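/- Let $V$ be a vector space of finite dimension $n$ over the finite field $\mathbb F_q$. Let $G\le GL(V)$ be a primitive linear group (i.e. $G$ is irreducible and does not permute the summands of any decomposition of $V$ into a direct sum of at least two nonzero subspaces) which is maximal coprime, i.e. $\gcd(|G|,|V|)=1$ and no subgroup $L\le GL(V)$ with $\gcd(|L|,|V|)=1$ strictly contains $G$. Then the following hold. 1. Among the abelian subgroups of $GL(V)$ normalised by $G$ there is a unique maximal one, $Z$. Moreover $Z\le G$. 2. $Z$ is cyclic, and $Z\cup\{0\}\subseteq \mathrm{End}_{\mathbb F_q}(V)$ is a field isomorphic to $\mathbb F_{q^k}$ for some $k\mid n$. 3. This makes $V$ a vector space $V_d(q^k)$ over $\mathbb F_{q^k}$ of dimension $d=n/k$ (extending the $\mathbb F_q$-structure), and $G\le \Gamma L(d,q^k)$. This structure is maximal and unique: if $L\ge\mathbb F_q$ is a field, and $V$ has an $L$-vector space structure extending the $\mathbb F_q$-structure for which all elements of $G$ are semilinear, then the $L$-structure is obtained by restriction along an $\mathbb F_q$-embedding $L\to\mathbb F_{q^k}$, which is an isomorphism if $|L|=q^k$. 4. Let $H=G\cap GL(d,q^k)$.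 Then $Z\le H=C_G(Z)\trianglelefteq G$, $Z=Z(GL(d,q^k))$ is the group of scalar transformations of $V_d(q^k)$, and the semilinear action of $G$ defines a homomorphism $G\to \mathrm{Gal}(\mathbb F_{q^k}/\mathbb F_q)$ with kernel $H$, so $G/H$ embeds into this Galois group. 5. Let $N=F^*(H)$ be the generalised Fitting subgroup of $H$. Then $Z\le N$, $N/Z$ is the socle of $H/Z$, and $V_d(q^k)$ is an absolutely irreducible $\mathbb F_{q^k}N$-module. 6. Let $N_1,\dots,N_t$ (without repetition) be all the minimal normal subgroups of $H$ above $Z$, i.e. the minimal ones among the normal subgroups of $H$ properly containing $Z$. Then there are finite dimensional $\mathbb F_{q^k}$-spaces $V_1,\dots,V_t$ and an identification $V\cong V_1\otimes_{\mathbb F_{q^k}}\dots\otimes_{\mathbb F_{q^k}}V_t$ such that each $N_i$ acts on the $i$-th factor only, and absolutely irreducibly there; so $N_i$ is identified with an absolutely irreducible subgroup of $GL(V_i)$. Furthermore there are subgroups $H_i\le GL(V_i)$ with $N_i\trianglelefteq H_i$, $N=N_1\otimes\dots\otimes N_t$ and $H=H_1\otimes\dots\otimes H_t$. (If $t=0$,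 the empty tensor product of spaces is $\mathbb F_{q^k}$ and the empty tensor product of groups is understood to be the scalar group $Z$.) For each $i$, $N_i/Z$ is either abelian or a direct product of finitely many isomorphic non-abelian simple groups. 7. If $N_i/Z$ is abelian, then there are a prime $r_i$, a natural number $l_i$ and an extraspecial $r_i$-group $R_i\le N_i$ of order $r_i^{2l_i+1}$ such that $N_i=ZR_i$. Furthermore $|N_i/Z|=r_i^{2l_i}$ and $\dim_{\mathbb F_{q^k}}(V_i)=r_i^{l_i}$. 8. If $N_i/Z$ is a direct product of $s$ isomorphic non-abelian simple groups, then there is a tensor product decomposition $V_i\cong W_1\otimes\dots\otimes W_s$ over $\mathbb F_{q^k}$ and there are quasisimple, absolutely irreducible groups $S_j\le GL(W_j)$, pairwise isomorphic as groups, such that $N_i=K_1\otimes\dots\otimes K_s$, where $K_j\le GL(W_j)$ is generated by $S_j$ and the scalar group of $W_j$. Moreover there is a transitive action of $H_i$ on $\{1,\dots,s\}$ by which $H_i$ permutes the factors $W_j$ and the groups $K_j$: if $h\in H_i$ acts as $\pi$, then $h$ sends $w_1\otimes\dots\otimes w_s$ to the pure tensor whose component at $\pi(j)$ is the image of $w_j$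 under a linear isomorphism $W_j\to W_{\pi(j)}$ depending only on $h$ and $j$, and $hK_jh^{-1}=K_{\pi(j)}$, where $K_j$ is regarded as a subgroup of $GL(V_i)$ acting on the $j$-th factor. -/

import Mathlib

open scoped TensorProduct

universe u v

section Groups

/-- Every element of `G` conjugates `A` into itself (so `G` normalises `A`, as `G` is a group). -/
def NormalisedBy {X : Type*} [Group X] (G A : Subgroup X) : Prop :=
  ∀ g ∈ G, ∀ a ∈ A, g * a * g⁻¹ ∈ A

/-- `A` is an abelian subgroup normalised by `G`. -/
def IsAbelianNormalisedBy {X : Type*} [Group X] (G A : Subgroup X) : Prop :=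
  (∀ a ∈ A, ∀ b ∈ A, a * b = b * a) ∧ NormalisedBy G A

/-- A group is quasisimple if it is perfect and its quotient by the centre is simple. -/
def IsQuasisimple (X : Type*) [Group X] : Prop :=
  Group.IsPerfect X ∧ IsSimpleGroup (X ⧸ Subgroup.center X)

/-- The Fitting subgroup: generated by the nilpotent normal subgroups. -/
def fittingSubgroup (X : Type*) [Group X] : Subgroup X :=
  sSup {M | M.Normal ∧ Group.IsNilpotent M}

/-- The layer: generated by the components, i.e. by the subnormal quasisimple subgroups. -/
def layer (X : Type*) [Group X] : Subgroup X :=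
  sSup {M | M.IsSubnormal ∧ IsQuasisimple M}

/-- The generalised Fitting subgroup `F*(X) = F(X) E(X)`. -/
def generalisedFitting (X : Type*) [Group X] : Subgroup X :=
  fittingSubgroup X ⊔ layer X

/-- The socle: generated by the minimal normal subgroups. -/
def socle (X : Type*) [Group X] : Subgroup X :=
  sSup {M | Minimal (fun L : Subgroup X => L.Normal ∧ L ≠ ⊥) M}

/-- `M` is a minimal normal subgroup of `H` above `Z`: it is minimal among the normal subgroups
of `H` which properly contain `Z`. -/
def IsMinimalNormalAbove {X : Type*} [Group X] (H Z M : Subgroup X) : Prop :=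
  Minimal (fun L : Subgroup X => Z < L ∧ L ≤ H ∧ NormalisedBy H L) M

/-- A finite `r`-group is extraspecial if its centre, its commutator subgroup and its Frattini
subgroup coincide and have order `r`. -/
def IsExtraspecial (r : ℕ) (X : Type*) [Group X] : Prop :=
  Finite X ∧ IsPGroup r X ∧ Nat.card (Subgroup.center X) = r ∧
    commutator X = Subgroup.center X ∧ frattini X = Subgroup.center X

end Groups

section LinearGroups

/-- The natural representation of a linear group. -/
def naturalRep {F : Type*} {V : Type*} [Field F] [AddCommGroup V] [Module F V]
    (G : Subgroup (LinearMap.GeneralLinearGroup F V)) : Representation F G V :=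
  (Units.coeHom (Module.End F V)).comp G.subtype

/-- The natural representation of a linear group over `K`, with scalars extended to `L`. -/
noncomputable def extendedRep {K : Type*} {V : Type*} [Field K] [AddCommGroup V] [Module K V]
    (G : Subgroup (LinearMap.GeneralLinearGroup K V)) (L : Type*) [Field L] [Algebra K L] :
    Representation L G (L ⊗[K] V) :=
  (Module.End.baseChangeHom K L V : Module.End K V →* Module.End L (L ⊗[K] V)).comp (naturalRep G)

/-- The linear group `G` is absolutely irreducible: it stays irreducible over every extension
field. -/
def IsAbsolutelyIrreducible {K : Type u} {V : Type v} [Field K] [AddCommGroup V] [Module K V]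
    (G : Subgroup (LinearMap.GeneralLinearGroup K V)) : Prop :=
  ∀ (L : Type u) [Field L] [Algebra K L], (extendedRep G L).IsIrreducible

/-- The linear group `G` on the finite space `V` is coprime: `(|G|, |V|) = 1`. -/
def IsCoprimeLinear {F : Type*} {V : Type*} [Field F] [AddCommGroup V] [Module F V]
    (G : Subgroup (LinearMap.GeneralLinearGroup F V)) : Prop :=
  (Nat.card G).Coprime (Nat.card V)

/-- The linear group `G` is primitive: it is irreducible, and it does not permute the summands of
a direct sum decomposition of `V` into at least two nonzero subspaces. -/
def IsPrimitiveLinear {F : Type*} {V : Type*} [Field F] [AddCommGroup V] [Module F V]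
    (G : Subgroup (LinearMap.GeneralLinearGroup F V)) : Prop :=
  (naturalRep G).IsIrreducible ∧
    ∀ (m : ℕ) (W : Fin m → Submodule F V), DirectSum.IsInternal W → (∀ i, W i ≠ ⊥) →
      (∀ g ∈ G, ∀ i, ∃ j, (W i).map (g : V →ₗ[F] V) = W j) → m ≤ 1

end LinearGroups

section ExtensionField

variable (F : Type*) (K : Type*) (V : Type*) [Field F] [Field K] [Algebra F K] [AddCommGroup V]
  [Module F V] [Module K V] [IsScalarTower F K V]

/-- The embedding `GL(V) → GL(V)` of the `K`-linear transformations into the `F`-linear ones. -/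
def restrictGL : LinearMap.GeneralLinearGroup K V →* LinearMap.GeneralLinearGroup F V :=
  Units.map
    { toFun := fun f : Module.End K V => (f.restrictScalars F : Module.End F V)
      map_one' := rfl
      map_mul' := fun _ _ => rfl }

/-- The group of `F`-linear transformations of `V` which are `K`-semilinear. -/
def semilinearGroup : Subgroup (LinearMap.GeneralLinearGroup F V) where
  carrier := {g | ∃ σ : K ≃+* K, ∀ (a : K) (v : V),
    (g : V →ₗ[F] V) (a • v) = σ a • (g : V →ₗ[F] V) v}
  one_mem' := ⟨RingEquiv.refl K, fun _ _ => rfl⟩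
  mul_mem' := by
    rintro g h ⟨σ, hσ⟩ ⟨τ, hτ⟩
    refine ⟨τ.trans σ, fun a v => ?_⟩
    simp [hσ, hτ]
  inv_mem' := by
    rintro g ⟨σ, hσ⟩
    refine ⟨σ.symm, fun a v => ?_⟩
    apply g.toLinearEquiv.injective
    have h : ∀ w : V, (g : V →ₗ[F] V) ((↑g⁻¹ : V →ₗ[F] V) w) = w := fun w => by
      rw [← Module.End.mul_apply, Units.mul_inv, Module.End.one_apply]
    simp only [LinearMap.GeneralLinearGroup.coe_toLinearEquiv, h, hσ, RingEquiv.apply_symm_apply]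

end ExtensionField

section Tensor

/-- An identification of `V` with a tensor product over `K` of finite dimensional spaces `W i`. -/
structure TensorDecomposition (K : Type*) (V : Type*) [Field K] [AddCommGroup V] [Module K V]
    (ι : Type) where
  /-- the tensor factors -/
  W : ι → Type
  [addCommGroup : ∀ i, AddCommGroup (W i)]
  [module : ∀ i, Module K (W i)]
  [finiteDimensional : ∀ i, FiniteDimensional K (W i)]
  /-- the identification -/
  equiv : V ≃ₗ[K] ⨂[K] i, W i

namespace TensorDecomposition

attribute [instance] addCommGroup module finiteDimensional

variable {K : Type*} {V : Type*} [Field K] [AddCommGroup V] [Module K V] {ι : Type}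
  (D : TensorDecomposition K V ι)

/-- The family `(hᵢ)` acts on `V` as the tensor product of the `hᵢ`. -/
noncomputable def act :
    (∀ i, LinearMap.GeneralLinearGroup K (D.W i)) →* LinearMap.GeneralLinearGroup K V :=
  (LinearMap.GeneralLinearGroup.congrLinearEquiv D.equiv.symm).toMonoidHom.comp
    ((Units.map PiTensorProduct.mapMonoidHom).comp MulEquiv.piUnits.symm.toMonoidHom)

/-- The group of all tensor products `⨂ hᵢ` with `hᵢ ∈ A i`. -/
noncomputable def tensor (A : ∀ i, Subgroup (LinearMap.GeneralLinearGroup K (D.W i))) :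
    Subgroup (LinearMap.GeneralLinearGroup K V) :=
  (Subgroup.pi Set.univ A).map D.act

/-- A linear group on the `i`-th tensor factor, acting on `V` as `1 ⊗ ⋯ ⊗ A ⊗ ⋯ ⊗ 1`. -/
noncomputable def factor [DecidableEq ι] (i : ι)
    (A : Subgroup (LinearMap.GeneralLinearGroup K (D.W i))) :
    Subgroup (LinearMap.GeneralLinearGroup K V) :=
  A.map (D.act.comp
    (MonoidHom.mulSingle (fun i => LinearMap.GeneralLinearGroup K (D.W i)) i))

/-- The transformation `h` permutes the tensor factors according to `π`, mapping the factor at `j`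
to the factor at `π j`: there are linear isomorphisms `f j : W (π⁻¹ j) → W j` such that `h` maps
`⨂ wⱼ` to the pure tensor with component `f j (w (π⁻¹ j))` at `j`. -/
def Permutes (π : Equiv.Perm ι) (h : LinearMap.GeneralLinearGroup K V) : Prop :=
  ∃ f : ∀ j, D.W (π⁻¹ j) ≃ₗ[K] D.W j, ∀ w : ∀ j, D.W j,
    D.equiv ((h : V →ₗ[K] V) (D.equiv.symm (PiTensorProduct.tprod K w))) =
      PiTensorProduct.tprod K fun j => f j (w (π⁻¹ j))

end TensorDecomposition

end Tensor

open Module (End)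
open LinearMap (BilinForm)
open Function (Injective Surjective)
local notation "GL" => LinearMap.GeneralLinearGroup

/-! ### Orders coprime to a given number -/

section CoprimeOrders

/-! Let `Ω ≤ End V` be a commutative algebra stable under conjugation by `G`. Irreducibility forces
`Ω` to be reduced. Primitivity forces it to have one maximal ideal, because the subspaces killed by
the maximal ideals decompose `V` and are permuted by `G`. So `Ω` is a field
(`isUnit_of_conjStable`), its unit group has order coprime to `q`, and maximality puts that unit
group into `G` (`le_of_coprime_of_normalisedBy`). Two such fields therefore normalise each other,
and a Cartan–Brauer–Hua computation shows that they commute. Hence there is a largest one, `K`, with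
`Z = Kˣ`, and `G` acts on `V` by `K`-semilinear maps. What is needed afterwards is collected in
`IsCoprimeSemilinear`: `G` is irreducible, every commutative stable `K`-algebra is scalar, `G` is
cyclic modulo `H`, and every stable coprime linear group is contained in `H`.

Two principles then drive the argument. By `le_linearPart`, a stable linear group whose exponent
modulo scalars is coprime to `|K|` lies in `H`; most of the groups constructed below are built to be
fed into this lemma or its symplectic counterpart `IsCoprimeSymplectic.maximal`. By
`charAbelianCentral`, all characteristic abelian subgroups of `H` are central. The second principle
is purely group theoretic in its consequences: `F*(H)/Z` is the socle of `H/Z`, and the centraliser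
of `N = F*(H)` in `H` is `Z`. The first one, with Skolem–Noether, gives `H` inside the algebra
spanned by `N`; that algebra is a matrix algebra over `K`, and a Galois descent argument using the
surjectivity of the norm and the irreducibility of `G` shows that it is all of `End V`
(`groupAlg_eq_top`). This is the absolute irreducibility of `N`.

The delicate point is that distinct minimal normal subgroups above `Z` commute
(`commutator_minimalNormal_eq_bot`). This is formal unless both are elementary abelian modulo `Z`
for the same prime `r`. In that case both lie in a stable group `P` of class two, and `P/Z` is a
symplectic space over the field with `r` elements, on which `G` acts by similitudes and `H` by
isometries. Suitable isometries lift to elements of `GL(V)` normalising `P` (`exists_hom`,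
`exists_unit_mul_eq`), so the maximality of `G` becomes a maximality property of the isometry group
(`isCoprimeSymplectic`). If two irreducible subspaces were not orthogonal, one could construct
either too many isometries or a nonzero isotropic stable subspace (`le_orthogonal`).

Commuting groups that together span `End V` generate commuting matrix algebras, and these give a
tensor decomposition of `V` (`exists_equiv_piTensorProduct`). By Skolem–Noether every element of `H`
is, up to a scalar, a tensor product of maps of the factors, and maximality shows that each
component alone belongs to `H`. If `N_i/Z` is abelian, coset representatives of `Z` form a basis of
`End V_i`, which gives the dimension, and a complement modulo the subgroup of order `r` of `Z` gives
the extraspecial group. If `N_i/Z` is a power of a nonabelian simple group, the preimages of the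
simple factors commute, so the same tensor theorem applies inside `V_i`, and conjugation permutes
them. -/

theorem NormalisedBy.le_normalizer {X : Type*} [Group X] {G A : Subgroup X} (h : NormalisedBy G A) :
    G ≤ Subgroup.normalizer (A : Set X) := by
  intro g hg; rw [Subgroup.mem_normalizer_iff]; intro a
  refine ⟨fun ha => h g hg a ha, fun ha => ?_⟩; have := h g⁻¹ (G.inv_mem hg) _ ha
  simpa [mul_assoc] using this

theorem card_sup_dvd_of_normalisedBy {X : Type*} [Group X] [Finite X] {G A : Subgroup X}
    (h : NormalisedBy G A) : Nat.card (G ⊔ A : Subgroup X) ∣ Nat.card G * Nat.card A := by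
  have hn := h.le_normalizer
  have hle : G ⊔ A ≤ Subgroup.normalizer (A : Set X) := sup_le hn Subgroup.le_normalizer
  have : (A.subgroupOf (G ⊔ A)).Normal := Subgroup.normal_subgroupOf_of_le_normalizer hle
  have : (A.subgroupOf G).Normal := Subgroup.normal_subgroupOf_of_le_normalizer hn
  have e := QuotientGroup.quotientInfEquivProdNormalizerQuotient G A hn
  rw [Subgroup.card_eq_card_quotient_mul_card_subgroup (A.subgroupOf (G ⊔ A)),
    ← Nat.card_congr e.toEquiv,
    Nat.card_congr (Subgroup.subgroupOfEquivOfLe (le_sup_right : A ≤ G ⊔ A)).toEquiv]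
  exact Nat.mul_dvd_mul_right (Subgroup.card_quotient_dvd_card _) _

theorem card_coprime_of_forall_pow_eq_one {X : Type*} [Group X] [Finite X] {m n : ℕ}
    (h : ∀ x : X, x ^ m = 1) (hmn : m.Coprime n) : (Nat.card X).Coprime n := by
  refine Nat.Coprime.symm (Nat.coprime_of_dvd fun q hq hqn hqX => ?_); have := Fact.mk hq
  obtain ⟨x, hx⟩ := exists_prime_orderOf_dvd_card' (G := X) q hqX
  have h1 : q ∣ m := hx ▸ orderOf_dvd_of_pow_eq_one (h x); have := Nat.dvd_gcd h1 hqn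
  rw [hmn] at this; exact hq.one_lt.ne' (Nat.dvd_one.mp this)

end CoprimeOrders

/-! ### Commutative algebras normalised by a primitive maximal coprime group -/

section MaximalCoprime

variable {F : Type u} {V : Type v} [Field F] [Finite F] [AddCommGroup V] [Module F V]
    [FiniteDimensional F V]

instance : Finite (End F V) :=
  have : Finite V := Module.finite_of_finite F
  DFunLike.finite _

instance : Finite (GL F V) := inferInstanceAs (Finite (End F V)ˣ)

variable {G : Subgroup (GL F V)}

/-- The order of `GX` divides `|G||X|`, so `GX` is coprime and equals `G` by maximality. -/
theorem le_of_coprime_of_normalisedBy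
    (hmax : Maximal (fun L : Subgroup (GL F V) => IsCoprimeLinear L) G) {X : Subgroup (GL F V)}
    (hX : IsCoprimeLinear X) (hn : NormalisedBy G X) : X ≤ G := by
  have h : IsCoprimeLinear (G ⊔ X) :=
    Nat.Coprime.coprime_dvd_left (card_sup_dvd_of_normalisedBy hn) (hmax.prop.mul_left hX)
  exact le_sup_right.trans (hmax.le_of_ge h le_sup_left)

theorem nontrivial_of_isPrimitiveLinear (hprim : IsPrimitiveLinear G) : Nontrivial V := by
  obtain ⟨h, -⟩ := hprim; by_contra hV; rw [not_nontrivial_iff_subsingleton] at hV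
  obtain ⟨a, b, hab⟩ := h.exists_pair_ne; apply hab
  have : a.toSubmodule = b.toSubmodule := Subsingleton.elim _ _
  exact Subrepresentation.toSubmodule_injective this

theorem eq_bot_or_top_of_isPrimitiveLinear (hprim : IsPrimitiveLinear G) (U : Submodule F V)
    (hU : ∀ g ∈ G, ∀ x ∈ U, (g : V →ₗ[F] V) x ∈ U) : U = ⊥ ∨ U = ⊤ := by
  obtain ⟨h, -⟩ := hprim
  let S : Subrepresentation (naturalRep G) := ⟨U, fun g x hx => hU g g.2 x hx⟩
  rcases h.eq_bot_or_eq_top S with h | h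
  · left; exact congrArg Subrepresentation.toSubmodule h
  · right; exact congrArg Subrepresentation.toSubmodule h

theorem GeneralLinearGroup.apply_inv_apply {R M : Type*} [CommRing R] [AddCommGroup M] [Module R M]
    (g : GL R M) (v : M) : (g : M →ₗ[R] M) ((↑g⁻¹ : M →ₗ[R] M) v) = v := by
  rw [← Module.End.mul_apply, Units.mul_inv, Module.End.one_apply]

theorem GeneralLinearGroup.inv_apply_apply {R M : Type*} [CommRing R] [AddCommGroup M] [Module R M]
    (g : GL R M) (v : M) : (↑g⁻¹ : M →ₗ[R] M) ((g : M →ₗ[R] M) v) = v := by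
  rw [← Module.End.mul_apply, Units.inv_mul, Module.End.one_apply]

/-- The endomorphism algebra `Ω` is stable under conjugation by `G`. -/
def ConjStable (G : Subgroup (GL F V)) (Ω : Subalgebra F (End F V)) : Prop :=
  ∀ g ∈ G, ∀ x ∈ Ω, (g : End F V) * x * (↑g⁻¹ : End F V) ∈ Ω

/-- The common kernel of all nilpotent elements of `Ω` is `G`-invariant. It is nonzero because the
nilradical is nilpotent, so by irreducibility it is all of `V`. -/
theorem isReduced_of_conjStable (hprim : IsPrimitiveLinear G) (Ω : Subalgebra F (End F V))
    (hc : ∀ x ∈ Ω, ∀ y ∈ Ω, x * y = y * x) (hs : ConjStable G Ω) : ∀ x ∈ Ω, IsNilpotent x → x = 0 :=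
    by
  let _ : CommRing Ω := { (inferInstance : Ring Ω) with
    mul_comm := fun a b => Subtype.ext (hc a a.2 b b.2) }
  have : IsArtinianRing Ω := inferInstance; let U : Submodule F V :=
    { carrier := {v | ∀ x ∈ Ω, IsNilpotent x → x v = 0}
      add_mem' := fun {a b} ha hb x hx hn => by rw [map_add, ha x hx hn, hb x hx hn, add_zero]
      zero_mem' := fun x _ _ => map_zero x
      smul_mem' := fun c v hv x hx hn => by rw [map_smul, hv x hx hn, smul_zero] }
  have hUinv : ∀ g ∈ G, ∀ v ∈ U, (g : V →ₗ[F] V) v ∈ U := by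
    intro g hg v hv x hx hn
    have h1 : (↑g⁻¹ : End F V) * x * (g : End F V) ∈ Ω := by simpa using hs g⁻¹ (G.inv_mem hg) x hx
    have h2 : IsNilpotent ((↑g⁻¹ : End F V) * x * (g : End F V)) := by
      obtain ⟨n, hn⟩ := hn; refine ⟨n, ?_⟩
      have : ∀ n : ℕ, ((↑g⁻¹ : End F V) * x * (g : End F V)) ^ n =
          (↑g⁻¹ : End F V) * x ^ n * (g : End F V) :=
        fun n => Units.conj_pow' g x n
      rw [this, hn]; simp
    have h3 := hv _ h1 h2; have h4 := congrArg (g : V →ₗ[F] V) h3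
    simpa [Module.End.mul_apply, GeneralLinearGroup.apply_inv_apply] using h4
  have hnil : IsNilpotent (nilradical Ω) := IsArtinianRing.isNilpotent_nilradical
  have := nontrivial_of_isPrimitiveLinear hprim
  have hUne : U ≠ ⊥ := by
    classical
    let n := Nat.find hnil
    have hn : nilradical Ω ^ n = 0 := Nat.find_spec hnil
    have hn0 : n ≠ 0 := by
      intro h0; rw [h0, pow_zero] at hn
      have : (1 : Ω) ∈ (0 : Ideal Ω) := hn ▸ (Ideal.one_eq_top (R := Ω) ▸ Submodule.mem_top)
      have h1 : (1 : Ω) = 0 := this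
      exact one_ne_zero (α := End F V) (congrArg Subtype.val h1)
    -- An element `y` of the last nonzero power of the nilradical is annihilated by every nilpotent
    -- element, so the image of `y` lies in `U`.
    have hm : nilradical Ω ^ (n - 1) ≠ 0 := Nat.find_min hnil (Nat.sub_lt (Nat.pos_of_ne_zero hn0) one_pos)
    obtain ⟨y, hy, hy0⟩ := Submodule.exists_mem_ne_zero_of_ne_bot hm
    have hy1 : (y : End F V) ≠ 0 := fun h => hy0 (Subtype.ext h)
    obtain ⟨v, hv⟩ : ∃ v, (y : End F V) v ≠ 0 := by
      by_contra hcon; push Not at hcon; exact hy1 (LinearMap.ext hcon)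
    intro hbot; apply hv
    have : (y : End F V) v ∈ U := by
      intro x hx hxn
      have hx' : (⟨x, hx⟩ : Ω) ∈ nilradical Ω := by
        obtain ⟨k, hk⟩ := hxn; exact ⟨k, Subtype.ext hk⟩
      have h1 : (⟨x, hx⟩ : Ω) * y ∈ nilradical Ω ^ n := by
        have : n = (n - 1) + 1 := by omega
        rw [this, pow_succ']; exact Ideal.mul_mem_mul hx' hy
      rw [hn] at h1; have h2 : (⟨x, hx⟩ : Ω) * y = 0 := h1
      have h3 := congrArg Subtype.val h2; exact LinearMap.congr_fun h3 v
    rw [hbot] at this; exact this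
  intro x hx hxn
  have hT := (eq_bot_or_top_of_isPrimitiveLinear hprim U hUinv).resolve_left hUne; ext v
  have : v ∈ U := hT ▸ Submodule.mem_top; exact this x hx hxn

/-- For a maximal ideal `m` let `W m` be the vectors killed by `m`. As `Ω` is reduced and Artinian,
`V` is the direct sum of the `W m`. Conjugation by `G` permutes the maximal ideals and hence these
summands, so primitivity leaves only one maximal ideal, which is then zero. -/
theorem isUnit_of_conjStable (hprim : IsPrimitiveLinear G) (Ω : Subalgebra F (End F V))
    (hc : ∀ x ∈ Ω, ∀ y ∈ Ω, x * y = y * x) (hs : ConjStable G Ω) : ∀ x ∈ Ω, x ≠ 0 → ∃ y ∈ Ω, x * y =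
    1 := by
  classical
  have hred := isReduced_of_conjStable hprim Ω hc hs
  let _ : CommRing Ω := { (inferInstance : Ring Ω) with
    mul_comm := fun a b => Subtype.ext (hc a a.2 b b.2) }
  have := nontrivial_of_isPrimitiveLinear hprim; have : IsArtinianRing Ω := inferInstance
  have : Nontrivial Ω := ⟨0, 1, fun h => zero_ne_one (α := End F V) (congrArg Subtype.val h)⟩
  have : Finite (MaximalSpectrum Ω) := inferInstance
  have : Fintype (MaximalSpectrum Ω) := Fintype.ofFinite _
  have hinf : ∀ x : Ω, (∀ m : MaximalSpectrum Ω, x ∈ m.asIdeal) → x = 0 := by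
    intro x hx
    have h1 : x ∈ nilradical Ω := by
      rw [nilradical_eq_sInf, Ideal.mem_sInf]; intro I hI; have : I.IsPrime := hI
      exact hx ⟨I, (IsArtinianRing.isPrime_iff_isMaximal I).1 hI⟩
    obtain ⟨k, hk⟩ := h1; exact Subtype.ext (hred x x.2 ⟨k, congrArg Subtype.val hk⟩)
  let W : MaximalSpectrum Ω → Submodule F V := fun m =>
    { carrier := {v | ∀ x : Ω, x ∈ m.asIdeal → (x : End F V) v = 0}
      add_mem' := fun {a b} ha hb x hx => by rw [map_add, ha x hx, hb x hx, add_zero]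
      zero_mem' := fun x _ => map_zero _
      smul_mem' := fun c v hv x hx => by rw [map_smul, hv x hx, smul_zero] }
  have hWne : ∀ m, W m ≠ ⊥ := by
    intro m
    -- If no such `y` existed, the product of the other maximal ideals would lie in `m`, and by
    -- primality one of them would equal `m`. The image of `y` lies in `W m` because the product of
    -- `y` with an element of `m` lies in every maximal ideal.
    have h1 : ∃ y : Ω, (∀ m', m' ≠ m → y ∈ m'.asIdeal) ∧ y ≠ 0 := by
      by_contra hcon
      push Not at hcon
      have h2 : (Finset.univ.erase m).prod (fun m' : MaximalSpectrum Ω => m'.asIdeal) ≤ m.asIdeal := by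
        intro y hy
        have := hcon y (fun m' hm' => (Ideal.prod_le_inf.trans (Finset.inf_le (Finset.mem_erase.2 ⟨hm', Finset.mem_univ _⟩))) hy)
        rw [this]; exact zero_mem _
      rw [(m.isMaximal.isPrime).prod_le] at h2; obtain ⟨m', hm', hle⟩ := h2
      exact (Finset.mem_erase.1 hm').1 (MaximalSpectrum.ext (m'.isMaximal.eq_of_le m.isMaximal.ne_top hle))
    obtain ⟨y, hy, hy0⟩ := h1
    obtain ⟨v, hv⟩ : ∃ v, (y : End F V) v ≠ 0 := by
      by_contra hcon; push Not at hcon; exact hy0 (Subtype.ext (LinearMap.ext hcon))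
    intro hbot; apply hv
    have : (y : End F V) v ∈ W m := by
      intro x hx
      have : x * y = 0 := hinf _ fun m' => by
        by_cases hm : m' = m
        · rw [hm]; exact Ideal.mul_mem_right _ _ hx
        · exact Ideal.mul_mem_left _ _ (hy m' hm)
      exact LinearMap.congr_fun (congrArg Subtype.val this) v
    rw [hbot] at this; exact this
  let e := Fintype.equivFin (MaximalSpectrum Ω)
  have hp : ((Finset.univ : Finset (Fin (Fintype.card (MaximalSpectrum Ω)))) : Set _).Pairwise
      fun i j => (e.symm i).asIdeal ⊔ (e.symm j).asIdeal = ⊤ := fun i _ j _ hij =>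
    (e.symm i).isMaximal.coprime_of_ne (e.symm j).isMaximal
        (fun h => hij (e.symm.injective (MaximalSpectrum.ext h)))
  -- Chinese remainder theorem: the maximal ideals are pairwise comaximal and their intersection is
  -- zero.
  have hint : DirectSum.IsInternal fun i => W (e.symm i) := by
    have h1 := Submodule.supIndep_torsionBySet_ideal (M := V) hp
    have h2 := Submodule.iSup_torsionBySet_ideal_eq_torsionBySet_iInf (M := V) hp
    have h3 : (⨅ i ∈ (Finset.univ : Finset (Fin (Fintype.card (MaximalSpectrum Ω)))),
        (e.symm i).asIdeal : Ideal Ω) = ⊥ := by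
      rw [eq_bot_iff]; intro x hx; refine hinf x fun m => ?_
      have := (Ideal.mem_iInf.1 ((Ideal.mem_iInf.1 hx) (e m))) (Finset.mem_univ _)
      simpa using this
    have h4 : DirectSum.IsInternal fun i => Submodule.torsionBySet Ω V (e.symm i).asIdeal := by
      refine DirectSum.isInternal_submodule_of_iSupIndep_of_iSup_eq_top ?_ ?_
      · rw [iSupIndep_iff_supIndep_univ]; exact h1
      · rw [h3] at h2; simp only [Finset.mem_univ, iSup_pos] at h2; rw [h2, eq_top_iff]
        intro v _; rw [Submodule.mem_torsionBySet_iff]; rintro ⟨x, hx⟩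
        have hx0 : x = 0 := hx; subst hx0; exact LinearMap.zero_apply v
    have h5 : DirectSum.IsInternal fun i =>
        (Submodule.torsionBySet Ω V (e.symm i).asIdeal).restrictScalars F := h4
    have h6 : (fun i => W (e.symm i)) = fun i =>
        (Submodule.torsionBySet Ω V (e.symm i).asIdeal).restrictScalars F := by
      funext i; refine Submodule.ext fun v => ?_
      rw [Submodule.restrictScalars_mem, Submodule.mem_torsionBySet_iff]
      exact ⟨fun h x => h x x.2, fun h x hx => h ⟨x, hx⟩⟩
    rw [h6]; exact h5
  have hperm : ∀ g ∈ G, ∀ m, ∃ m', (W m).map (g : V →ₗ[F] V) = W m' := by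
    intro g hg m; let c : Ω →+* Ω :=
      { toFun := fun x => ⟨(g : End F V) * x * (↑g⁻¹ : End F V), hs g hg x x.2⟩
        map_one' := Subtype.ext (by simp)
        map_zero' := Subtype.ext (by simp)
        map_mul' := fun x y => Subtype.ext (by simp [mul_assoc])
        map_add' := fun x y => Subtype.ext (by simp [mul_add, add_mul]) }
    have hcinj : Injective c := by
      intro x y hxy; have h1 := congrArg Subtype.val hxy
      have h2 : (g : End F V) * x * (↑g⁻¹ : End F V) = (g : End F V) * y * (↑g⁻¹ : End F V) := h1
      exact Subtype.ext (by simpa using h2)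
    have hcsurj : Surjective c := Finite.surjective_of_injective hcinj
    have hmax : (m.asIdeal.map c).IsMaximal := by
      have := m.isMaximal
      exact (Ideal.map_eq_top_or_isMaximal_of_surjective c hcsurj this).resolve_left (by
        intro htop; apply m.isMaximal.ne_top
        have h1 := Ideal.comap_map_of_surjective c hcsurj m.asIdeal
        rw [htop, Ideal.comap_top, ← RingHom.ker_eq_comap_bot,
          (RingHom.injective_iff_ker_eq_bot c).1 hcinj, sup_bot_eq] at h1
        exact h1.symm)
    refine ⟨⟨_, hmax⟩, ?_⟩; ext v; constructor
    · rintro ⟨w, hw, rfl⟩ y hy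
      obtain ⟨x, hx, rfl⟩ := (Ideal.mem_map_iff_of_surjective c hcsurj).1 hy
      have : ((c x : Ω) : End F V) ((g : V →ₗ[F] V) w) = (g : V →ₗ[F] V) ((x : End F V) w) := by
        change ((g : End F V) * x * (↑g⁻¹ : End F V)) ((g : V →ₗ[F] V) w) = _
        simp [Module.End.mul_apply, GeneralLinearGroup.inv_apply_apply]
      rw [this, hw x hx, map_zero]
    · intro hv
      refine ⟨(↑g⁻¹ : V →ₗ[F] V) v, fun x hx => ?_, GeneralLinearGroup.apply_inv_apply g v⟩
      have h1 := hv (c x) (Ideal.mem_map_of_mem c hx)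
      have h2 : (g : V →ₗ[F] V) ((x : End F V) ((↑g⁻¹ : V →ₗ[F] V) v)) = 0 := h1
      have h3 := congrArg (↑g⁻¹ : V →ₗ[F] V) h2
      rwa [GeneralLinearGroup.inv_apply_apply, map_zero] at h3
  have hcard := hprim.2 _ _ hint (fun i => hWne _) (fun g hg i => by
    obtain ⟨m', hm'⟩ := hperm g hg (e.symm i); exact ⟨e m', by simpa using hm'⟩)
  have hsub : Subsingleton (MaximalSpectrum Ω) := Fintype.card_le_one_iff_subsingleton.1 hcard
  obtain ⟨m⟩ : Nonempty (MaximalSpectrum Ω) := inferInstance; intro x hx hx0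
  by_cases hu : IsUnit (⟨x, hx⟩ : Ω)
  · obtain ⟨y, hy⟩ := hu.exists_right_inv; exact ⟨y, y.2, congrArg Subtype.val hy⟩
  · obtain ⟨m, hm, hxm⟩ := exists_max_ideal_of_mem_nonunits hu
    refine absurd (congrArg Subtype.val (hinf ⟨x, hx⟩ fun m' => ?_)) hx0
    rw [Subsingleton.elim m' ⟨m, hm⟩]; exact hxm

theorem conjStable_adjoin {A : Subgroup (GL F V)} (hA : NormalisedBy G A) : ConjStable G
    (Algebra.adjoin F ((fun z : GL F V => (z : End F V)) '' A)) := by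
  intro g hg x hx; induction hx using Algebra.adjoin_induction with
  | mem x hx =>
    obtain ⟨a, ha, rfl⟩ := hx
    refine Algebra.subset_adjoin ⟨g * a * g⁻¹, hA g hg a ha, ?_⟩; simp
  | algebraMap r =>
    rw [← Algebra.commutes, mul_assoc, Units.mul_inv, mul_one]
    exact Subalgebra.algebraMap_mem _ r
  | add x y _ _ hx hy => rw [mul_add, add_mul]; exact add_mem hx hy
  | mul x y _ _ hx hy =>
    have := mul_mem hx hy
    rwa [show (g : End F V) * x * (↑g⁻¹ : End F V) * ((g : End F V) * y * (↑g⁻¹ : End F V)) =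
      (g : End F V) * (x * y) * (↑g⁻¹ : End F V) by simp [mul_assoc]] at this

theorem commute_adjoin {A : Subgroup (GL F V)} (hA : ∀ a ∈ A, ∀ b ∈ A, a * b = b * a) : ∀ x ∈
    Algebra.adjoin F ((fun z : GL F V => (z : End F V)) '' A), ∀ y ∈ Algebra.adjoin F ((fun z : GL F
      V => (z : End F V)) '' A), x * y = y * x := by
  have hc : ∀ a ∈ ((fun z : GL F V => (z : End F V)) '' A),
      ∀ b ∈ ((fun z : GL F V => (z : End F V)) '' A),
      a * b = b * a := by
    rintro _ ⟨a, ha, rfl⟩ _ ⟨b, hb, rfl⟩; have := congrArg Units.val (hA a ha b hb)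
    simpa using this
  intro x hx y hy
  have := (Algebra.isMulCommutative_adjoin F hc).is_comm.comm ⟨x, hx⟩ ⟨y, hy⟩
  exact congrArg Subtype.val this

/-- The invertible elements of a finite commutative algebra of endomorphisms. -/
def unitsSubgroup (Ω : Subalgebra F (End F V)) : Subgroup (GL F V) where
  carrier := {g | (g : End F V) ∈ Ω}
  one_mem' := Ω.one_mem
  mul_mem' := fun {a b} ha hb => by
    simp only [Set.mem_setOf_eq, Units.val_mul] at *
    exact Ω.mul_mem ha hb
  inv_mem' := by
    intro g hg
    obtain ⟨n, hn⟩ : ∃ n : ℕ, g⁻¹ = g ^ n := by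
      have h : g⁻¹ ∈ Submonoid.powers g := by
        rw [mem_powers_iff_mem_zpowers]; exact inv_mem (Subgroup.mem_zpowers g)
      obtain ⟨n, hn⟩ := h; exact ⟨n, hn.symm⟩
    simp only [Set.mem_setOf_eq] at *
    rw [hn, Units.val_pow_eq_pow_val]; exact Ω.pow_mem hg n

theorem mem_unitsSubgroup {Ω : Subalgebra F (End F V)} {g : GL F V} : g ∈ unitsSubgroup Ω ↔
    (g : End F V) ∈ Ω := Iff.rfl

theorem isAbelianNormalisedBy_unitsSubgroup {Ω : Subalgebra F (End F V)}
    (hc : ∀ x ∈ Ω, ∀ y ∈ Ω, x * y = y * x) (hs : ConjStable G Ω) : IsAbelianNormalisedBy G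
    (unitsSubgroup Ω) := by
  refine ⟨fun a ha b hb => Units.ext (by simpa using hc a ha b hb), fun g hg a ha => ?_⟩
  rw [mem_unitsSubgroup] at ha ⊢; simpa using hs g hg a ha

theorem exists_unit_of_conjStable (hprim : IsPrimitiveLinear G) {Ω : Subalgebra F (End F V)}
    (hc : ∀ x ∈ Ω, ∀ y ∈ Ω, x * y = y * x) (hs : ConjStable G Ω) {x : End F V} (hx : x ∈ Ω)
    (hx0 : x ≠ 0) : ∃ g ∈ unitsSubgroup Ω, (g : End F V) = x := by
  obtain ⟨y, hy, hxy⟩ := isUnit_of_conjStable hprim Ω hc hs x hx hx0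
  exact ⟨⟨x, y, hxy, by rw [← hc x hx y hy, hxy]⟩, hx, rfl⟩

theorem isField_of_conjStable (hprim : IsPrimitiveLinear G) {Ω : Subalgebra F (End F V)}
    (hc : ∀ x ∈ Ω, ∀ y ∈ Ω, x * y = y * x) (hs : ConjStable G Ω) : IsField Ω := by
  have := nontrivial_of_isPrimitiveLinear hprim
  refine ⟨⟨0, 1, fun h => zero_ne_one (α := End F V) (congrArg Subtype.val h)⟩,
    fun x y => Subtype.ext (hc x x.2 y y.2), fun {x} hx => ?_⟩
  obtain ⟨y, hy, hxy⟩ := isUnit_of_conjStable hprim Ω hc hs x x.2 (fun h => hx (Subtype.ext h))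
  exact ⟨⟨y, hy⟩, Subtype.ext hxy⟩

/-- `Ω` is a finite field, so the exponent of its unit group divides `|Ω| - 1`, while `|Ω|` is a
nontrivial power of `|F|`. -/
theorem coprime_unitsSubgroup (hprim : IsPrimitiveLinear G) {Ω : Subalgebra F (End F V)}
    (hc : ∀ x ∈ Ω, ∀ y ∈ Ω, x * y = y * x) (hs : ConjStable G Ω) : IsCoprimeLinear (unitsSubgroup Ω)
    := by
  let _ : Field Ω := (isField_of_conjStable hprim hc hs).toField
  have := Fintype.ofFinite Ω
  refine card_coprime_of_forall_pow_eq_one (m := Fintype.card Ω - 1) ?_ ?_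
  · rintro ⟨x, hx⟩
    have h0 : (⟨x, hx⟩ : Ω) ≠ 0 := by
      have := nontrivial_of_isPrimitiveLinear hprim; intro h
      exact x.ne_zero (congrArg Subtype.val h)
    have := FiniteField.pow_card_sub_one_eq_one (⟨x, hx⟩ : Ω) h0
    refine Subtype.ext (Units.ext ?_); simpa using congrArg Subtype.val this
  · rw [Module.natCard_eq_pow_finrank (K := F) (V := V)]; apply Nat.Coprime.pow_right
    have h1 : Fintype.card Ω = Nat.card F ^ Module.finrank F Ω := by
      rw [← Nat.card_eq_fintype_card, Module.natCard_eq_pow_finrank (K := F)]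
    have h2 : Module.finrank F Ω ≠ 0 := by
      have : Nontrivial Ω := ⟨0, 1, zero_ne_one⟩; exact Module.finrank_pos.ne'
    have h3 : Nat.card F ∣ Fintype.card Ω := h1 ▸ dvd_pow_self _ h2
    have h4 : 0 < Fintype.card Ω := Fintype.card_pos
    have h5 : (Fintype.card Ω - 1).Coprime (Fintype.card Ω) := by
      have h6 := Nat.coprime_self_add_right (m := Fintype.card Ω - 1) (n := 1)
      rw [Nat.sub_add_cancel h4] at h6; exact h6.2 (Nat.coprime_one_right _)
    exact Nat.Coprime.coprime_dvd_right h3 h5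

/-- A maximal abelian normalised subgroup is the unit group of the field it spans, and it lies in
`G`; so any two of them normalise each other. Once they are known to commute, their product is again
abelian and normalised, and both are equal to it. -/
theorem exists_maximal_abelian (hprim : IsPrimitiveLinear G)
    (hmax : Maximal (fun L : Subgroup (GL F V) => IsCoprimeLinear L) G) : ∃ Ω : Subalgebra F
    (End F V), (∀ x ∈ Ω, ∀ y ∈ Ω, x * y = y * x) ∧ ConjStable G Ω ∧ Maximal
      (IsAbelianNormalisedBy G) (unitsSubgroup Ω) ∧
      (∀ Z', Maximal (IsAbelianNormalisedBy G) Z' → Z' = unitsSubgroup Ω) ∧ unitsSubgroup Ω ≤ G ∧ ∀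
      Ω' : Subalgebra F (End F V), (∀ x ∈ Ω', ∀ y ∈ Ω', x * y = y * x) → ConjStable G Ω' → Ω' ≤ Ω :=
        by
  have := nontrivial_of_isPrimitiveLinear hprim
  -- every maximal one is the unit group of a field
  have key : ∀ Z', Maximal (IsAbelianNormalisedBy G) Z' →
      ∃ Ω : Subalgebra F (End F V), (∀ x ∈ Ω, ∀ y ∈ Ω, x * y = y * x) ∧
        ConjStable G Ω ∧ Z' = unitsSubgroup Ω := by
    intro Z' hZ'; refine ⟨_, commute_adjoin hZ'.prop.1, conjStable_adjoin hZ'.prop.2, ?_⟩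
    refine hZ'.eq_of_le (isAbelianNormalisedBy_unitsSubgroup (commute_adjoin hZ'.prop.1)
      (conjStable_adjoin hZ'.prop.2)) fun z hz => ?_
    exact Algebra.subset_adjoin ⟨z, hz, rfl⟩
  have hle : ∀ Ω : Subalgebra F (End F V), (∀ x ∈ Ω, ∀ y ∈ Ω, x * y = y * x) →
      ConjStable G Ω → unitsSubgroup Ω ≤ G := fun Ω hc hs =>
    le_of_coprime_of_normalisedBy hmax (coprime_unitsSubgroup hprim hc hs)
      (isAbelianNormalisedBy_unitsSubgroup hc hs).2
  have hcomm : ∀ 𝓐 𝓑 : Subalgebra F (End F V), (∀ x ∈ 𝓐, ∀ y ∈ 𝓐, x * y = y * x) →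
      (∀ x ∈ 𝓑, ∀ y ∈ 𝓑, x * y = y * x) → ConjStable G 𝓐 → ConjStable G 𝓑 →
      ∀ a ∈ unitsSubgroup 𝓐, ∀ b ∈ unitsSubgroup 𝓑, a * b = b * a := by
    intro 𝓐 𝓑 hA hB hsA hsB a ha b hb; have haG := hle 𝓐 hA hsA ha
    have hcm : ∀ b ∈ unitsSubgroup 𝓑, a * b * a⁻¹ * b⁻¹ ∈ unitsSubgroup 𝓐 := by
      intro b hb; have hbG := hle 𝓑 hB hsB hb
      have h1 := (isAbelianNormalisedBy_unitsSubgroup hA hsA).2 b hbG a⁻¹ (inv_mem ha)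
      have h2 := mul_mem ha h1; simpa [mul_assoc] using h2
    by_cases hbA : (b : End F V) ∈ 𝓐
    · exact Units.ext (by simpa using hA a ha b hbA)
    -- Cartan–Brauer–Hua: with `d = 1 + b`, the commutators `c = [a, b]` and `e = [a, d]` both lie
    -- in `𝓐`. Conjugating `1 + b` by `a` in two ways gives `e - 1 = (c - e) b`. If `c ≠ e`, this
    -- would put `b` into `𝓐`; so `c = e`, and then `e = 1`.
    have hb1 : (1 + b : End F V) ≠ 0 := by
      intro h; apply hbA
      have : (b : End F V) = -1 := by rw [eq_neg_iff_add_eq_zero, add_comm]; exact h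
      rw [this]; exact neg_mem 𝓐.one_mem
    obtain ⟨d, hd, hd1⟩ := exists_unit_of_conjStable hprim hB hsB (add_mem 𝓑.one_mem hb) hb1
    have hc1 := hcm b hb; have hc2 := hcm d hd
    obtain ⟨c, hc⟩ : ∃ c, c = a * b * a⁻¹ * b⁻¹ := ⟨_, rfl⟩
    obtain ⟨e, he⟩ : ∃ e, e = a * d * a⁻¹ * d⁻¹ := ⟨_, rfl⟩; rw [← hc] at hc1
    rw [← he] at hc2
    have hc' : (a : End F V) * b * (↑a⁻¹ : End F V) = c * b := by rw [hc]; simp [mul_assoc]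
    have he' : (a : End F V) * d * (↑a⁻¹ : End F V) = e * d := by rw [he]; simp [mul_assoc]
    have h3 : (e : End F V) - 1 = (c - e : End F V) * b := by
      have : (a : End F V) * d * (↑a⁻¹ : End F V) = 1 + c * b := by
        rw [hd1, mul_add, add_mul, hc', mul_one, Units.mul_inv]
      rw [he', hd1, mul_add, mul_one] at this; rw [sub_mul]
      rw [sub_eq_sub_iff_add_eq_add, this, add_comm]
    have h4 : (c : End F V) - e = 0 := by
      by_contra hne
      obtain ⟨y, hy, hxy⟩ := isUnit_of_conjStable hprim 𝓐 hA hsA _ (sub_mem hc1 hc2) hne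
      apply hbA
      have : (b : End F V) = y * ((c - e : End F V) * b) := by
        rw [← mul_assoc, ← hA _ (sub_mem hc1 hc2) _ hy, hxy, one_mul]
      rw [this, ← h3]; exact mul_mem hy (sub_mem hc2 𝓐.one_mem)
    have h5 : c = e := Units.ext (sub_eq_zero.1 h4); rw [h4, zero_mul, sub_eq_zero] at h3
    have h6 : c = 1 := by rw [h5]; exact Units.ext h3
    rw [h6] at hc
    have h7 : a * b * a⁻¹ = b := by rw [eq_comm, mul_inv_eq_one] at hc; exact hc
    exact mul_inv_eq_iff_eq_mul.1 h7
  have hexists : ∀ A, IsAbelianNormalisedBy G A → ∃ B, A ≤ B ∧ Maximal (IsAbelianNormalisedBy G) B :=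
    fun A hA => Finite.exists_le_maximal hA
  obtain ⟨Z, -, hZ⟩ := hexists ⊥
    ⟨fun a ha b hb => by rw [Subgroup.mem_bot.1 ha, Subgroup.mem_bot.1 hb],
      fun g _ a ha => by rw [Subgroup.mem_bot.1 ha]; simp⟩
  obtain ⟨Ω, hc, hs, rfl⟩ := key Z hZ
  have huniq : ∀ Z', Maximal (IsAbelianNormalisedBy G) Z' → Z' = unitsSubgroup Ω := by
    intro Z' hZ'; obtain ⟨𝓑, hcB, hsB, rfl⟩ := key Z' hZ'
    have hsup : IsAbelianNormalisedBy G (unitsSubgroup 𝓑 ⊔ unitsSubgroup Ω) := by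
      constructor
      · have h1 : unitsSubgroup 𝓑 ⊔ unitsSubgroup Ω ≤
            Subgroup.centralizer (unitsSubgroup 𝓑 ⊔ unitsSubgroup Ω : Subgroup _) := by
          rw [Subgroup.le_centralizer_iff]
          refine sup_le ?_ ?_ <;> rw [Subgroup.le_centralizer_iff] <;> refine sup_le ?_ ?_ <;>
            intro x hx <;> rw [Subgroup.mem_centralizer_iff] <;> intro y hy
          · exact hcomm _ _ hcB hcB hsB hsB _ hy _ hx
          · exact hcomm _ _ hcB hc hsB hs _ hy _ hx
          · exact hcomm _ _ hc hcB hs hsB _ hy _ hx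
          · exact hcomm _ _ hc hc hs hs _ hy _ hx
        intro a ha b hb; exact (Subgroup.mem_centralizer_iff.1 (h1 ha) b hb).symm
      · intro g hg; have h1 : unitsSubgroup 𝓑 ⊔ unitsSubgroup Ω ≤
            (unitsSubgroup 𝓑 ⊔ unitsSubgroup Ω).comap (MulAut.conj g).toMonoidHom := by
          refine sup_le (fun x hx => ?_) (fun x hx => ?_)
          · exact Subgroup.mem_sup_left (hZ'.prop.2 g hg x hx)
          · exact Subgroup.mem_sup_right (hZ.prop.2 g hg x hx)
        exact fun a ha => h1 ha
    rw [hZ'.eq_of_le hsup le_sup_left]; conv_rhs => rw [hZ.eq_of_le hsup le_sup_right]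
  refine ⟨Ω, hc, hs, hZ, huniq, hle Ω hc hs, fun Ω' hc' hs' x hx => ?_⟩
  by_cases hx0 : x = 0
  · rw [hx0]; exact zero_mem _
  obtain ⟨g, hg, rfl⟩ := exists_unit_of_conjStable hprim hc' hs' hx hx0
  obtain ⟨B, hB, hBmax⟩ := hexists _ (isAbelianNormalisedBy_unitsSubgroup hc' hs')
  rw [huniq B hBmax] at hB; exact hB hg

end MaximalCoprime

/-! ### Semilinear automorphisms and their conjugation action -/

section SemilinearAutomorphisms

/-- The group of semilinear automorphisms of a vector space. -/
def semiAut (K : Type*) (V : Type*) [Field K] [AddCommGroup V] [Module K V] : Subgroup (V ≃ₗ[ℤ] V)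
    where
  carrier := {g | ∃ σ : K ≃+* K, ∀ (a : K) (v : V), g (a • v) = σ a • g v}
  one_mem' := ⟨RingEquiv.refl K, fun _ _ => rfl⟩
  mul_mem' := by
    rintro g h ⟨σ, hσ⟩ ⟨τ, hτ⟩; exact ⟨τ.trans σ, fun a v => by simp [hσ, hτ]⟩
  inv_mem' := by
    rintro g ⟨σ, hσ⟩; refine ⟨σ.symm, fun a v => ?_⟩; apply g.injective
    have h : ∀ w, g (g⁻¹ w) = w := g.apply_symm_apply
    rw [h, hσ, h, RingEquiv.apply_symm_apply]

variable {K : Type*} {V : Type*} [Field K] [AddCommGroup V] [Module K V]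

namespace semiAut

/-- Semilinear automorphisms act as functions. -/
instance : CoeFun (semiAut K V) fun _ => V → V := ⟨fun g => (g : V ≃ₗ[ℤ] V)⟩

@[simp] theorem mul_apply (g h : semiAut K V) (v : V) : (g * h) v = g (h v) := rfl

@[simp] theorem one_apply (v : V) : (1 : semiAut K V) v = v := rfl

@[simp] theorem apply_inv_apply (g : semiAut K V) (v : V) : g (g⁻¹ v) = v :=
  (g : V ≃ₗ[ℤ] V).apply_symm_apply v

@[simp] theorem inv_apply_apply (g : semiAut K V) (v : V) : g⁻¹ (g v) = v :=
  (g : V ≃ₗ[ℤ] V).symm_apply_apply v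

theorem map_add (g : semiAut K V) (v w : V) : g (v + w) = g v + g w :=
  _root_.map_add (g : V ≃ₗ[ℤ] V) v w

theorem map_sum (g : semiAut K V) {ι : Type*} (s : Finset ι) (f : ι → V) : g (∑ i ∈ s, f i) = ∑ i ∈
    s, g (f i) :=
  _root_.map_sum (g : V ≃ₗ[ℤ] V) f s

@[ext] theorem ext {g h : semiAut K V} (H : ∀ v, g v = h v) : g = h :=
  Subtype.ext (LinearEquiv.ext H)

theorem injective (g : semiAut K V) : Injective g := (g : V ≃ₗ[ℤ] V).injective

/-- The semilinear automorphism `g` acts on the linear endomorphisms by conjugation. -/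
def conjFun (g : semiAut K V) (f : End K V) : End K V where
  toFun v := g (f (g⁻¹ v))
  map_add' v w := by rw [map_add, _root_.map_add, map_add]
  map_smul' a v := by
    obtain ⟨σ, hσ⟩ := g.2
    have h : ∀ w, g⁻¹ (a • w) = σ.symm a • g⁻¹ w := by
      intro w; apply injective g
      rw [apply_inv_apply, hσ, apply_inv_apply, RingEquiv.apply_symm_apply]
    rw [h, map_smul, hσ, RingEquiv.apply_symm_apply, RingHom.id_apply]

theorem conjFun_apply (g : semiAut K V) (f : End K V) (v : V) : conjFun g f v = g (f (g⁻¹ v)) := rfl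

/-- The action of semilinear automorphisms on the endomorphism ring by conjugation. -/
def conjEnd : semiAut K V →* (End K V ≃+* End K V) where
  toFun g :=
    { toFun := conjFun g
      invFun := conjFun g⁻¹
      left_inv := fun f => by ext v; simp [conjFun_apply]
      right_inv := fun f => by ext v; simp [conjFun_apply]
      map_mul' := fun f f' => by ext v; simp [conjFun_apply]
      map_add' := fun f f' => by
        ext v; simp only [conjFun_apply, LinearMap.add_apply]; exact map_add g _ _ }
  map_one' := by ext f v; rfl
  map_mul' g h := by ext f v; rfl

@[simp] theorem conjEnd_apply (g : semiAut K V) (f : End K V) (v : V) :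
    conjEnd g f v = g (f (g⁻¹ v)) := rfl

/-- The action of semilinear automorphisms on the linear group by conjugation. -/
def conjGL : semiAut K V →* MulAut (GL K V) where
  toFun g := Units.mapEquiv (conjEnd g : End K V ≃* End K V)
  map_one' := by ext f v; rfl
  map_mul' g h := by ext f v; rfl

@[simp] theorem coe_conjGL (g : semiAut K V) (x : GL K V) :
    (conjGL g x : End K V) = conjEnd g x := rfl

/-- Linear automorphisms are semilinear. -/
def ofGL : GL K V →* semiAut K V where
  toFun x := ⟨x.toLinearEquiv.restrictScalars ℤ, RingEquiv.refl K, fun a v => by simp⟩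
  map_one' := rfl
  map_mul' _ _ := rfl

@[simp] theorem ofGL_apply (x : GL K V) (v : V) : ofGL x v = (x : End K V) v := rfl

theorem ofGL_injective : Injective (ofGL (K := K) (V := V)) := by
  intro x y h; ext v; exact congrArg (fun g : semiAut K V => g v) h

theorem conjGL_ofGL (x y : GL K V) : conjGL (ofGL x) y = x * y * x⁻¹ := by
  ext v; rfl

theorem ofGL_conjGL (g : semiAut K V) (x : GL K V) : ofGL (conjGL g x) = g * ofGL x * g⁻¹ := by
  ext v; rfl

end semiAut

/-- The properties of a maximal coprime primitive group `Λ`, which acts semilinearly over the field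
spanned by its maximal abelian normal subgroup. -/
structure IsCoprimeSemilinear (Λ : Subgroup (semiAut K V)) : Prop where
  coprime : (Nat.card Λ).Coprime (Nat.card K)
  irreducible : ∀ U : Submodule K V, (∀ g ∈ Λ, ∀ v ∈ U, g v ∈ U) → U = ⊥ ∨ U = ⊤
  maximal : ∀ X : Subgroup (GL K V),
    (Nat.card X).Coprime (Nat.card K) → (∀ g ∈ Λ, ∀ x ∈ X, semiAut.conjGL g x ∈ X) →
      ∀ x ∈ X, semiAut.ofGL x ∈ Λ
  scalar : ∀ Ω : Subalgebra K (End K V), (∀ x ∈ Ω, ∀ y ∈ Ω, x * y = y * x) →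
    (∀ g ∈ Λ, ∀ x ∈ Ω, semiAut.conjEnd g x ∈ Ω) → Ω = ⊥
  cyclic : ∃ g₀ ∈ Λ, ∀ g ∈ Λ, ∃ (i : ℕ) (x : GL K V),
    semiAut.ofGL x ∈ Λ ∧ g = g₀ ^ i * semiAut.ofGL x

end SemilinearAutomorphisms

/-! ### The field structure and the passage from `G` to a semilinear group -/

section FieldStructure

variable {F : Type u} {V : Type v} [Field F] [Finite F] [AddCommGroup V] [Module F V]
    [FiniteDimensional F V]

/-- This moves the finite field `Ω` from the universe of `End F V` to `Type`, by transporting its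
structure to a finite index type. The `ULift` keeps the new structure apart from the arithmetic
which `Fin n` already carries. -/
theorem exists_field_algEquiv (Ω : Subalgebra F (End F V)) (h : IsField Ω) : ∃ (K : Type)
    (_ : Field K) (_ : Algebra F K), Nonempty (K ≃ₐ[F] Ω) := by
  let _ : Field Ω := h.toField
  obtain ⟨n, ⟨e⟩⟩ := Finite.exists_equiv_fin Ω
  let e' : ULift.{0} (Fin n) ≃ Ω := Equiv.ulift.trans e.symm
  let _ : Field (ULift.{0} (Fin n)) := e'.field
  let _ : Algebra F (ULift.{0} (Fin n)) := e'.algebra F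
  exact ⟨ULift.{0} (Fin n), inferInstance, inferInstance, ⟨e'.algEquiv F⟩⟩

/-- If `v` and `z v` were independent, some functional `φ` would satisfy `φ v = 0` and `φ (z v) =
1`. The transvection `w ↦ w + φ w • v` fixes `v` but moves `z v`, so it does not commute with `z`.
Hence every vector is an eigenvector of `z`. -/
theorem GeneralLinearGroup.exists_smul_of_mem_center {K : Type*} {V : Type*} [Field K]
    [AddCommGroup V] [Module K V] {z : GL K V} (hz : z ∈ Subgroup.center (GL K V)) : ∃ a : Kˣ, ∀ v :
    V, (z : V →ₗ[K] V) v = (a : K) • v := by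
  rcases subsingleton_or_nontrivial V with hV | hV
  · exact ⟨1, fun v => Subsingleton.elim _ _⟩
  have h : ∀ v, ¬ LinearIndependent K ![v, (z : V →ₗ[K] V) v] := by
    intro v hv
    let φ₀ : Module.Dual K (Submodule.span K (Set.range ![v, (z : V →ₗ[K] V) v])) :=
      (Module.Basis.span hv).coord 1
    obtain ⟨φ, hφ⟩ := LinearMap.exists_extend φ₀
    have h1 : φ v = 0 := by
      have h2 := LinearMap.congr_fun hφ (Module.Basis.span hv 0)
      have h3 : φ (Module.Basis.span hv 0 : V) =
        (Module.Basis.span hv).coord 1 (Module.Basis.span hv 0) := h2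
      rw [Module.Basis.coord_apply, Module.Basis.repr_self, Module.Basis.span_apply] at h3
      simpa using h3
    have h2 : φ ((z : V →ₗ[K] V) v) = 1 := by
      have h2 := LinearMap.congr_fun hφ (Module.Basis.span hv 1)
      have h3 : φ (Module.Basis.span hv 1 : V) =
        (Module.Basis.span hv).coord 1 (Module.Basis.span hv 1) := h2
      rw [Module.Basis.coord_apply, Module.Basis.repr_self, Module.Basis.span_apply] at h3
      simpa using h3
    let τ : GL K V := .ofLinearEquiv (LinearEquiv.transvection h1)
    have h3 := LinearMap.congr_fun (congrArg Units.val (Subgroup.mem_center_iff.1 hz τ)) v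
    have h4 : ∀ w, (τ : V →ₗ[K] V) w = w + φ w • v := fun w => rfl
    simp only [Units.val_mul, Module.End.mul_apply, h4, h1, h2, one_smul, zero_smul, add_zero,
      add_eq_left] at h3
    exact hv.ne_zero 0 h3
  obtain ⟨a, ha⟩ := LinearMap.exists_eq_smul_id_of_forall_notLinearIndependent h
  have ha0 : a ≠ 0 := by
    rintro rfl; rw [zero_smul] at ha; exact z.ne_zero ha
  exact ⟨Units.mk0 a ha0, fun v => by rw [ha]; rfl⟩

theorem GeneralLinearGroup.mem_center_iff {K : Type*} {V : Type*} [Field K] [AddCommGroup V]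
    [Module K V] {z : GL K V} : z ∈ Subgroup.center (GL K V) ↔ ∃ a : Kˣ, ∀ v : V, (z : V →ₗ[K] V) v
      = (a : K) • v := by
  refine ⟨fun h => GeneralLinearGroup.exists_smul_of_mem_center h, ?_⟩; rintro ⟨a, ha⟩
  rw [Subgroup.mem_center_iff]; intro g; ext v; simp [ha]

variable {K : Type} [Field K] [Algebra F K] [Module K V] [IsScalarTower F K V]

theorem finite_of_isScalarTower (F : Type u) (K : Type) (V : Type v) [Field F] [Finite F]
    [AddCommGroup V] [Module F V] [FiniteDimensional F V] [Field K] [Algebra F K] [Module K V]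
    [IsScalarTower F K V] [Nontrivial V] : Finite K := by
  refine Finite.of_injective (fun a : K => (Algebra.lsmul F F V a : End F V)) fun a b hab => ?_
  obtain ⟨v, hv⟩ := exists_ne (0 : V); have h : a • v = b • v := LinearMap.congr_fun hab v
  exact smul_left_injective K hv h

/-- The semilinear automorphisms which are given by the elements of `G`. -/
def semilinearImage (F K : Type*) {V : Type*} [Field F] [Field K] [AddCommGroup V] [Module F V]
    [Module K V] (G : Subgroup (GL F V)) : Subgroup (semiAut K V) where
  carrier := {s | ∃ g ∈ G, ∀ v, s v = (g : V →ₗ[F] V) v}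
  one_mem' := ⟨1, G.one_mem, fun _ => rfl⟩
  mul_mem' := by
    rintro s t ⟨g, hg, hs⟩ ⟨h, hh, ht⟩
    exact ⟨g * h, G.mul_mem hg hh, fun v => by simp [hs, ht]⟩
  inv_mem' := by
    rintro s ⟨g, hg, hs⟩; refine ⟨g⁻¹, G.inv_mem hg, fun v => semiAut.injective s ?_⟩
    rw [hs, hs, GeneralLinearGroup.apply_inv_apply, ← hs, semiAut.apply_inv_apply]

theorem exists_semiAut {g : GL F V} (hg : g ∈ semilinearGroup F K V) : ∃ s : semiAut K V, ∀ v, s v =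
    (g : V →ₗ[F] V) v := by
  obtain ⟨σ, hσ⟩ := hg
  exact ⟨⟨g.toLinearEquiv.restrictScalars ℤ, σ, fun a v => by simp [hσ]⟩, fun v => by simp⟩

theorem restrictGL_apply (x : GL K V) (v : V) : (restrictGL F K V x : V →ₗ[F] V) v = (x : V →ₗ[K] V)
    v := rfl

theorem comap_semilinearImage (G : Subgroup (GL F V)) :
    (semilinearImage F K G).comap semiAut.ofGL = G.comap (restrictGL F K V) := by
  ext x; constructor
  · rintro ⟨g, hg, h⟩
    have : restrictGL F K V x = g := by
      ext v; exact h v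
    rw [Subgroup.mem_comap, this]; exact hg
  · intro h; exact ⟨_, h, fun v => rfl⟩

theorem exists_galoisHom [Nontrivial V] {G : Subgroup (GL F V)} (hG : G ≤ semilinearGroup F K V) : ∃
    σ : G →* (K ≃ₐ[F] K), ∀ (g : G) (a : K) (v : V), ((g : GL F V) : V →ₗ[F] V) (a • v) = σ g a •
        ((g : GL F V) : V →ₗ[F] V) v := by
  have huniq : ∀ (g : GL F V) (a b : K) (v : V), v ≠ 0 →
      a • (g : V →ₗ[F] V) v = b • (g : V →ₗ[F] V) v → a = b := by
    intro g a b v hv hab; refine smul_left_injective K (m := (g : V →ₗ[F] V) v) ?_ hab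
    intro h0; apply hv; rw [← GeneralLinearGroup.inv_apply_apply g v, h0, map_zero]
  obtain ⟨v₀, hv₀⟩ := exists_ne (0 : V)
  have hex : ∀ g : G, ∃ σ : K ≃ₐ[F] K, ∀ (a : K) (v : V), ((g : GL F V) : V →ₗ[F] V) (a • v) =
        σ a • ((g : GL F V) : V →ₗ[F] V) v := by
    intro g; obtain ⟨σ, hσ⟩ := hG g.2
    refine ⟨AlgEquiv.ofRingEquiv (f := σ) fun r => ?_, hσ⟩; refine huniq g _ _ v₀ hv₀ ?_
    rw [← hσ, algebraMap_smul, algebraMap_smul, map_smul]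
  choose σ hσ using hex
  refine ⟨⟨⟨σ, ?_⟩, ?_⟩, hσ⟩
  · ext a; refine huniq 1 _ _ v₀ hv₀ ?_; have := hσ 1 a v₀; simpa using this.symm
  · intro g h; ext a; refine huniq (g * h : G) _ _ v₀ hv₀ ?_; have h1 := hσ (g * h) a v₀
    have h2 : (((g * h : G) : GL F V) : V →ₗ[F] V) (a • v₀) =
      σ g (σ h a) • (((g * h : G) : GL F V) : V →ₗ[F] V) v₀ := by simp [hσ]
    rw [← h1, h2]; rfl

theorem mem_range_restrictGL_iff (g : GL F V) : g ∈ (restrictGL F K V).range ↔ ∀ (a : K)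
      (v : V), (g : V →ₗ[F] V) (a • v) = a • (g : V →ₗ[F] V) v := by
  constructor
  · rintro ⟨x, rfl⟩ a v; simp [restrictGL_apply]
  · intro h
    refine ⟨.ofLinearEquiv { g.toLinearEquiv with map_smul' := fun a v => h a v }, ?_⟩
    ext v; rfl

/-- The bridge from the primitive group over `F` to the semilinear setting. The hypothesis `hK` says
that `K` absorbs all commutative `G`-stable algebras over `F`; it yields the clause that stable
commutative `K`-algebras are scalar, which is what later arguments retain of primitivity besides
irreducibility. -/
theorem isCoprimeSemilinear_semilinearImage [Nontrivial V] {G : Subgroup (GL F V)}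
    (hprim : IsPrimitiveLinear G)
    (hmax : Maximal (fun L : Subgroup (GL F V) => IsCoprimeLinear L) G)
    (hG : G ≤ semilinearGroup F K V)
    (hK : ∀ Ω' : Subalgebra F (End F V), (∀ x ∈ Ω', ∀ y ∈ Ω', x * y = y * x) → ConjStable G Ω' → ∀ x
        ∈ Ω', ∃ a : K, ∀ v, x v = a • v) : IsCoprimeSemilinear (semilinearImage F K G) := by
  have : Finite K := finite_of_isScalarTower F K V
  have : FiniteDimensional K V := Module.Finite.of_restrictScalars_finite F K V
  have hlift : ∀ g ∈ G, ∃ s ∈ semilinearImage F K G, ∀ v, s v = (g : V →ₗ[F] V) v := fun g hg => by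
    obtain ⟨s, hs⟩ := exists_semiAut (hG hg); exact ⟨s, ⟨g, hg, hs⟩, hs⟩
  have hinv : ∀ (s : semiAut K V) (g : GL F V),
      (∀ v, s v = (g : V →ₗ[F] V) v) → ∀ v, s⁻¹ v = (↑g⁻¹ : V →ₗ[F] V) v := fun s g h v => by
    apply semiAut.injective s
    rw [h, h, GeneralLinearGroup.apply_inv_apply, ← h, semiAut.apply_inv_apply]
  have hcardV : Nat.card V = Nat.card K ^ Module.finrank K V := Module.natCard_eq_pow_finrank
  have hcop : ∀ m : ℕ, m.Coprime (Nat.card V) ↔ m.Coprime (Nat.card K) := fun m => by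
    rw [hcardV]; exact Nat.coprime_pow_right_iff Module.finrank_pos _ _
  refine ⟨?_, ?_, ?_, ?_, ?_⟩
  · rw [← hcop]
    let f : semilinearImage F K G → G := fun s => ⟨s.2.choose, s.2.choose_spec.1⟩
    have hf : Function.Bijective f := by
      constructor
      · intro s t hst; refine Subtype.ext (semiAut.ext fun v => ?_)
        rw [s.2.choose_spec.2, t.2.choose_spec.2]
        have : s.2.choose = t.2.choose := congrArg Subtype.val hst; rw [this]
      · rintro ⟨g, hg⟩; obtain ⟨s, hs, h⟩ := hlift g hg; refine ⟨⟨s, hs⟩, Subtype.ext ?_⟩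
        ext v; rw [← h]; exact ((⟨s, hs⟩ : semilinearImage F K G).2.choose_spec.2 v).symm
    rw [Nat.card_congr (Equiv.ofBijective f hf)]; exact hmax.prop
  · intro U hU
    have := eq_bot_or_top_of_isPrimitiveLinear hprim (U.restrictScalars F) fun g hg v hv => by
      obtain ⟨s, hs, h⟩ := hlift g hg; rw [← h]; exact hU s hs v hv
    simpa using this
  · intro X hX hn x hx
    have h1 : X.map (restrictGL F K V) ≤ G := by
      apply le_of_coprime_of_normalisedBy hmax
      · have : (Nat.card (X.map (restrictGL F K V))) ∣ Nat.card X := Subgroup.card_map_dvd _ _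
        exact Nat.Coprime.coprime_dvd_left this ((hcop _).2 hX)
      · rintro g hg _ ⟨x, hx, rfl⟩; obtain ⟨s, hs, h⟩ := hlift g hg
        refine ⟨_, hn s hs x hx, ?_⟩; ext v
        rw [restrictGL_apply, semiAut.coe_conjGL, semiAut.conjEnd_apply, h, hinv s g h]
        rfl
    exact ⟨_, h1 ⟨x, hx, rfl⟩, fun v => rfl⟩
  · intro Ω hc hs; let Ω' : Subalgebra F (End F V) :=
      { carrier := {x | ∃ y ∈ Ω, ∀ v, x v = y v}
        mul_mem' := by
          rintro x x' ⟨y, hy, h⟩ ⟨y', hy', h'⟩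
          exact ⟨y * y', mul_mem hy hy', fun v => by simp [h, h']⟩
        add_mem' := by
          rintro x x' ⟨y, hy, h⟩ ⟨y', hy', h'⟩
          exact ⟨y + y', add_mem hy hy', fun v => by simp [h, h']⟩
        algebraMap_mem' := fun r =>
          ⟨algebraMap K _ (algebraMap F K r), Ω.algebraMap_mem _, fun v => by simp⟩ }
    rw [eq_bot_iff]; intro y hy; obtain ⟨a, ha⟩ := hK Ω' (by
      rintro x ⟨y, hy, h⟩ x' ⟨y', hy', h'⟩; ext v
      have := LinearMap.congr_fun (hc y hy y' hy') v; simpa [h, h'] using this) (by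
      rintro g hg x ⟨y, hy, h⟩; obtain ⟨s, hs1, hs2⟩ := hlift g hg
      exact ⟨_, hs s hs1 y hy, fun v => by
        rw [semiAut.conjEnd_apply, hs2, hinv s g hs2, ← h]; rfl⟩) (y.restrictScalars F)
      ⟨y, hy, fun v => rfl⟩
    rw [Algebra.mem_bot]; exact ⟨a, LinearMap.ext fun v => (ha v).symm⟩
  -- The Galois group of a finite field is cyclic. An element `g₀` mapping to a generator of the
  -- image of `G` generates `G` modulo the kernel, which consists of the `K`-linear elements.
  · obtain ⟨σ, hσ⟩ := exists_galoisHom hG; have hcyc : IsCyclic σ.range := inferInstance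
    obtain ⟨⟨_, g₀, rfl⟩, hg₀⟩ := hcyc.exists_generator
    obtain ⟨s₀, hs₀, h₀⟩ := hlift g₀ g₀.2; refine ⟨s₀, hs₀, ?_⟩; rintro s ⟨g, hg, hs⟩
    obtain ⟨i, hi⟩ : ∃ i : ℕ, σ g₀ ^ i = σ ⟨g, hg⟩ := by
      have h1 := hg₀ ⟨_, ⟨g, hg⟩, rfl⟩; rw [← mem_powers_iff_mem_zpowers] at h1
      obtain ⟨i, hi⟩ := h1; exact ⟨i, congrArg Subtype.val hi⟩
    have hx : ((g₀ ^ i)⁻¹ * ⟨g, hg⟩ : G) ∈ σ.ker := by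
      rw [MonoidHom.mem_ker, map_mul, map_inv, map_pow, hi, inv_mul_cancel]
    have hx2 : (((g₀ ^ i)⁻¹ * ⟨g, hg⟩ : G) : GL F V) ∈ (restrictGL F K V).range := by
      rw [mem_range_restrictGL_iff]; intro a v; rw [hσ, MonoidHom.mem_ker.1 hx]; rfl
    obtain ⟨x, hx⟩ := hx2
    have hpow : ∀ (j : ℕ) (v : V), (s₀ ^ j) v = (((g₀ ^ j : G) : GL F V) : V →ₗ[F] V) v := by
      intro j; induction j with
      | zero => intro v; simp
      | succ j ih => intro v; rw [pow_succ, semiAut.mul_apply, ih, h₀, pow_succ]; rfl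
    refine ⟨i, x, ⟨_, ((g₀ ^ i)⁻¹ * ⟨g, hg⟩ : G).2, fun v => ?_⟩, ?_⟩
    · rw [← hx]; rfl
    · refine semiAut.ext fun v => ?_
      rw [hs, semiAut.mul_apply, hpow, semiAut.ofGL_apply, ← restrictGL_apply (F := F), hx]
      change (g : V →ₗ[F] V) v = (((g₀ ^ i : G) * ((g₀ ^ i)⁻¹ * ⟨g, hg⟩) : G) : GL F V).1 v
      rw [mul_inv_cancel_left]

end FieldStructure

/-! ### Enveloping algebras of linear groups -/

section GroupAlgebra

variable {K : Type*} {V : Type*} [Field K] [AddCommGroup V] [Module K V]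

/-- The algebra of endomorphisms generated by a linear group. -/
def groupAlg (X : Subgroup (GL K V)) : Subalgebra K (End K V) :=
  Algebra.adjoin K ((fun x : GL K V => (x : End K V)) '' X)

theorem coe_mem_groupAlg {X : Subgroup (GL K V)} {x : GL K V} (hx : x ∈ X) : (x : End K V) ∈
    groupAlg X :=
  Algebra.subset_adjoin ⟨x, hx, rfl⟩

theorem groupAlg_toSubmodule (X : Subgroup (GL K V)) : Subalgebra.toSubmodule (groupAlg X) =
    Submodule.span K ((fun x : GL K V => (x : End K V)) '' X) := by
  have h : ((X.toSubmonoid.map (Units.coeHom (End K V)) : Submonoid (End K V)) : Set (End K V)) =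
      (fun x : GL K V => (x : End K V)) '' X := by rfl
  rw [groupAlg, Algebra.adjoin_eq_span, ← h, Submonoid.closure_eq]

theorem groupAlg_induction {X : Subgroup (GL K V)} {p : End K V → Prop} (mem : ∀ x ∈ X, p x)
    (zero : p 0) (add : ∀ a b, p a → p b → p (a + b)) (smul : ∀ (c : K) a, p a → p (c • a))
    {a : End K V} (ha : a ∈ groupAlg X) : p a := by
  have ha' : a ∈ Submodule.span K
      ((fun x : GL K V => (x : End K V)) '' X) := by rw [← groupAlg_toSubmodule]; exact ha
  clear ha; induction ha' using Submodule.span_induction with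
  | mem x hx => obtain ⟨x, hx, rfl⟩ := hx; exact mem x hx
  | zero => exact zero
  | add a b h1 h2 ha hb =>
    exact add a b ha hb
  | smul c a h ha => exact smul c a ha

theorem commute_groupAlg {X : Subgroup (GL K V)} {b : End K V}
    (h : ∀ x ∈ X, (x : End K V) * b = b * x) {a : End K V} (ha : a ∈ groupAlg X) : a * b = b * a :=
    by
  refine groupAlg_induction (p := fun a => a * b = b * a) h ?_ ?_ ?_ ha
  · simp
  · intro a c ha hc; rw [add_mul, mul_add, ha, hc]
  · intro c a ha; rw [smul_mul_assoc, mul_smul_comm, ha]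

/-- An invariant subspace of `L ⊗ V` is stable under the base change of every endomorphism of `V`,
since the group spans `End V`. The rank one maps with image spanned by a basis vector then carry any
nonzero vector of it to multiples of all basis vectors. -/
theorem isAbsolutelyIrreducible_of_groupAlg_eq_top {K : Type u} {V : Type v} [Field K]
    [AddCommGroup V] [Module K V] [FiniteDimensional K V] [Nontrivial V] {X : Subgroup (GL K V)}
    (hX : groupAlg X = ⊤) : IsAbsolutelyIrreducible X := by
  intro L _ _; let b := Module.finBasis K V
  have hne : Nontrivial (L ⊗[K] V) := by
    have : 0 < Module.finrank L (L ⊗[K] V) := by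
      rw [Module.finrank_baseChange]; exact Module.finrank_pos
    exact Module.nontrivial_of_finrank_pos this
  have htop : ∀ U : Subrepresentation (extendedRep X L), U = ⊥ ∨ U = ⊤ := by
    intro U
    have hinv : ∀ f : End K V, ∀ u ∈ U.toSubmodule, f.baseChange L u ∈ U.toSubmodule := by
      intro f; have hf : f ∈ groupAlg X := by rw [hX]; trivial
      refine groupAlg_induction
        (p := fun f => ∀ u ∈ U.toSubmodule, f.baseChange L u ∈ U.toSubmodule) ?_ ?_ ?_ ?_ hf
      · exact fun x hx u hu => U.apply_mem_toSubmodule ⟨x, hx⟩ hu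
      · intro u _; rw [LinearMap.baseChange_zero]; exact U.toSubmodule.zero_mem
      · intro f g hf hg u hu; rw [LinearMap.baseChange_add]
        exact U.toSubmodule.add_mem (hf u hu) (hg u hu)
      · intro c f hf u hu
        rw [LinearMap.baseChange_smul, LinearMap.smul_apply, ← algebraMap_smul L c]
        exact U.toSubmodule.smul_mem _ (hf u hu)
    by_cases hU : U.toSubmodule = ⊥
    · left; exact Subrepresentation.toSubmodule_injective hU
    · right; apply Subrepresentation.toSubmodule_injective
      obtain ⟨u, hu, hu0⟩ := Submodule.exists_mem_ne_zero_of_ne_bot hU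
      let B := b.baseChange L
      obtain ⟨j, hj⟩ : ∃ j, B.repr u j ≠ 0 := by
        by_contra! h; exact hu0 (B.repr.map_eq_zero_iff.1 (Finsupp.ext h))
      have key : ∀ k, B k ∈ U.toSubmodule := by
        intro k; have h1 := hinv ((b.coord j).smulRight (b k)) u hu
        have h2 : ((b.coord j).smulRight (b k)).baseChange L u = B.repr u j • B k := by
          conv_lhs => rw [← B.sum_repr u, map_sum]
          rw [Finset.sum_eq_single j]
          · rw [map_smul]; simp [B, Module.Basis.baseChange_apply]
          · intro i _ hij; rw [map_smul]
            simp [B, Module.Basis.baseChange_apply, Finsupp.single_apply, hij]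
          · simp
        rw [h2] at h1; exact (Submodule.smul_mem_iff _ hj).1 h1
      change U.toSubmodule = ⊤; rw [eq_top_iff, ← B.span_eq, Submodule.span_le]
      rintro _ ⟨k, rfl⟩; exact key k
  have : Nontrivial (Subrepresentation (extendedRep X L)) := by
    refine ⟨⊥, ⊤, fun h => ?_⟩
    have h' : (⊥ : Submodule L (L ⊗[K] V)) = ⊤ := congrArg Subrepresentation.toSubmodule h
    exact bot_ne_top h'
  exact { eq_bot_or_eq_top := htop }

/-- A linear group of order coprime to the characteristic whose enveloping algebra has only
scalars in its centre generates a matrix algebra. -/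
theorem exists_algHom_of_center_groupAlg [Finite K] [FiniteDimensional K V] [Nontrivial V]
    {X : Subgroup (GL K V)} (hX : (Nat.card X).Coprime (Nat.card K))
    (hc : ∀ a ∈ groupAlg X, (∀ x ∈ X, (x : End K V) * a = a * x) → ∃ c : K, a = c • (1 : End K V)) :
    ∃ (n : ℕ) (θ : End K (Fin n → K) →ₐ[K] End K V), Injective θ ∧ θ.range = groupAlg X := by
  have hne : NeZero (Nat.card X : K) := by
    refine ⟨fun h => ?_⟩; obtain ⟨p, hp⟩ := CharP.exists K
    have hpp := CharP.char_is_prime K p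
    have h1 : p ∣ Nat.card X := (CharP.cast_eq_zero_iff K p _).1 h
    have : Fintype K := Fintype.ofFinite K
    have h2 : p ∣ Nat.card K := by
      rw [Nat.card_eq_fintype_card]
      exact (CharP.cast_eq_zero_iff K p _).1 (Nat.cast_card_eq_zero K)
    exact hpp.one_lt.ne' (Nat.eq_one_of_dvd_coprimes hX h1 h2)
  let ρ : MonoidAlgebra K X →ₐ[K] End K V := MonoidAlgebra.lift K _ X (naturalRep X)
  have hρ : ρ.range = groupAlg X := by
    apply le_antisymm
    · rintro _ ⟨a, rfl⟩; induction a using MonoidAlgebra.induction_on with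
      | of x => 
        have : ρ (MonoidAlgebra.of K X x) = (x : GL K V) := by simp [ρ, naturalRep]
        change ρ (MonoidAlgebra.of K X x) ∈ _; rw [this]; exact coe_mem_groupAlg x.2
      | add a b ha hb =>
        change ρ (a + b) ∈ _; rw [map_add]; exact add_mem ha hb
      | smul c a ha =>
        change ρ (c • a) ∈ _; rw [map_smul]; exact Subalgebra.smul_mem _ ha c
    · refine Algebra.adjoin_le ?_; rintro _ ⟨x, hx, rfl⟩
      exact ⟨MonoidAlgebra.of K X ⟨x, hx⟩, by simp [ρ, naturalRep]⟩
  -- Maschke: the enveloping algebra is a quotient of the group algebra of a group whose order is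
  -- invertible in `K`.
  have hss : IsSemisimpleRing (groupAlg X) := by
    rw [← hρ]
    exact RingHom.isSemisimpleRing_of_surjective (ρ.rangeRestrict : MonoidAlgebra K X →+* ρ.range)
      ρ.rangeRestrict_surjective
  obtain ⟨n, D, d, hD, hKD, hfin, hd, ⟨e⟩⟩ :=
    IsSemisimpleRing.exists_algEquiv_pi_matrix_divisionRing_finite K (groupAlg X)
  have hcen : ∀ y : (Π i, Matrix (Fin (d i)) (Fin (d i)) (D i)), (∀ w, w * y = y * w) →
      ∃ c : K, y = c • 1 := by
    intro y hy
    obtain ⟨c, hc⟩ := hc (e.symm y) (e.symm y).2 fun x hx => by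
      have := hy (e ⟨x, coe_mem_groupAlg hx⟩); have := congrArg e.symm this
      rw [map_mul, map_mul, e.symm_apply_apply] at this; exact congrArg Subtype.val this
    refine ⟨c, e.symm.injective ?_⟩; rw [map_smul, map_one]; exact Subtype.ext hc
  have hnt : Nontrivial (groupAlg X) := inferInstance
  -- A second Wedderburn block would make the identity of one block a central element that is not a
  -- scalar.
  have hn : ∃ i₀ : Fin n, ∀ i, i = i₀ := by
    have hn0 : Nonempty (Fin n) := by
      by_contra h; rw [not_nonempty_iff] at h
      exact one_ne_zero (e.injective (Subsingleton.elim (e 1) (e 0)))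
    obtain ⟨i₀⟩ := hn0; refine ⟨i₀, fun i => ?_⟩; by_contra hi
    obtain ⟨c, hc⟩ := hcen (Pi.single i₀ 1) fun w => by
      rw [← Pi.single_mul_left, ← Pi.single_mul_right]; simp
    have h1 := congrFun hc i₀; have h2 := congrFun hc i; have := hd i; have := hd i₀
    rw [Pi.single_eq_same, Pi.smul_apply, Pi.one_apply] at h1
    rw [Pi.single_eq_of_ne hi, Pi.smul_apply, Pi.one_apply] at h2
    have hc0 : c = 0 := by
      by_contra hc0; exact one_ne_zero ((smul_eq_zero.1 h2.symm).resolve_left hc0)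
    rw [hc0, zero_smul] at h1; exact one_ne_zero h1
  obtain ⟨i₀, hi₀⟩ := hn; have hev : Function.Bijective
      (Pi.evalAlgHom K (fun i => Matrix (Fin (d i)) (Fin (d i)) (D i)) i₀) := by
    constructor
    · intro a b hab; funext i
      cases hi₀ i
      exact hab
    · intro a; exact ⟨Pi.single i₀ a, by simp⟩
  have hDfin : Finite (D i₀) := Module.finite_of_finite K
  -- Wedderburn's little theorem. The scalar matrices over `D i₀` are then central, and the
  -- hypothesis on the centre forces `D i₀ = K`.
  have hcomm : ∀ x y : D i₀, x * y = y * x := (Finite.isDomain_to_isField (D i₀)).mul_comm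
  have := hd i₀
  have hbij : Function.Bijective (Algebra.ofId K (D i₀)) := by
    refine ⟨(algebraMap K (D i₀)).injective, fun δ => ?_⟩
    obtain ⟨c, hc⟩ := hcen (Pi.single i₀ (Matrix.scalar _ δ)) fun w => by
      funext i
      cases hi₀ i
      rw [Pi.mul_apply, Pi.mul_apply, Pi.single_eq_same]
      exact (Matrix.scalar_commute δ (fun r => hcomm _ _) (w _)).symm
    refine ⟨c, ?_⟩; have h1 := congrFun hc i₀
    rw [Pi.single_eq_same, Pi.smul_apply, Pi.one_apply] at h1
    have h2 := congrFun (congrFun h1 0) 0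
    simp only [Matrix.scalar_apply, Matrix.diagonal_apply_eq, Matrix.smul_apply,
      Matrix.one_apply_eq] at h2
    rw [h2, Algebra.ofId_apply, Algebra.algebraMap_eq_smul_one]
  let φ : groupAlg X ≃ₐ[K] End K (Fin (d i₀) → K) :=
    ((e.trans (AlgEquiv.ofBijective _ hev)).trans
      (AlgEquiv.ofBijective _ hbij).symm.mapMatrix).trans Matrix.toLinAlgEquiv'
  refine ⟨d i₀, (groupAlg X).val.comp φ.symm.toAlgHom,
    Subtype.val_injective.comp φ.symm.injective, ?_⟩
  apply le_antisymm
  · rintro _ ⟨a, rfl⟩; exact (φ.symm a).2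
  · intro a ha; exact ⟨φ ⟨a, ha⟩, by simp⟩

end GroupAlgebra

/-! ### Tensor decompositions from commuting matrix algebras -/

section CommutingProducts

theorem List.prod_ofFn_mul_of_commute {M : Type*} [Monoid M] {n : ℕ} (a b : Fin n → M)
    (h : ∀ i j, i ≠ j → Commute (a i) (b j)) :
    (List.ofFn fun i => a i * b i).prod = (List.ofFn a).prod * (List.ofFn b).prod := by
  induction n with
  | zero => simp
  | succ n ih =>
    have hc : Commute (b 0) (List.ofFn fun i : Fin n => a i.succ).prod := by
      apply Commute.list_prod_right; intro y hy; obtain ⟨i, rfl⟩ := List.mem_ofFn.1 hy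
      exact (h _ _ (Fin.succ_ne_zero i)).symm
    simp only [List.ofFn_succ, List.prod_cons]
    rw [ih (fun i => a i.succ) (fun i => b i.succ)
      fun i j hij => h _ _ fun h' => hij (Fin.succ_injective _ h')]
    simp only [mul_assoc]; rw [← mul_assoc (b 0), hc.eq, mul_assoc]

theorem List.prod_ofFn_mulSingle {M : Type*} [Monoid M] {n : ℕ} (i : Fin n) (x : M) :
    (List.ofFn (Pi.mulSingle (M := fun _ => M) i x)).prod = x := by
  induction n with
  | zero => exact i.elim0
  | succ n ih =>
    rw [List.ofFn_succ, List.prod_cons]; refine Fin.cases ?_ (fun j => ?_) i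
    · have : (fun k : Fin n => (Pi.mulSingle (M := fun _ => M) (0 : Fin (n + 1)) x) k.succ) =
          fun _ => 1 := by
        funext k; exact Pi.mulSingle_eq_of_ne (Fin.succ_ne_zero k) x
      rw [this]; simp
    · have : (fun k : Fin n => (Pi.mulSingle (M := fun _ => M) j.succ x) k.succ) =
          Pi.mulSingle (M := fun _ => M) j x := by
        funext k; by_cases hk : k = j
        · subst hk; simp
        · rw [Pi.mulSingle_eq_of_ne hk,
            Pi.mulSingle_eq_of_ne (fun h => hk (Fin.succ_injective _ h))]
      rw [this, ih, Pi.mulSingle_eq_of_ne (Fin.succ_ne_zero j).symm, one_mul]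

end CommutingProducts

section TensorFactorisation

variable {K : Type*} {V : Type*} [Field K] [AddCommGroup V] [Module K V]

/-- A rank one idempotent generates `End X` as an ideal: every rank one map factors through it, and
`1` is a sum of rank one maps. So an operator commuting with the image of `End X` and killed by one
such idempotent is killed by `1`. -/
theorem eq_zero_of_commute_of_mul_eq_zero {X : Type*} [AddCommGroup X] [Module K X]
    [FiniteDimensional K X] (θ : End K X →ₐ[K] End K V) {e : X} {φ : Module.Dual K X} (hφ : φ e = 1)
    {T : End K V} (hT : ∀ f, Commute (θ f) T) (h : θ (φ.smulRight e) * T = 0) : T = 0 := by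
  have h1 : ∀ (x : X) (ψ : Module.Dual K X), θ (ψ.smulRight x) * T = 0 := by
    intro x ψ
    have : (ψ.smulRight x : End K X) = φ.smulRight x * (φ.smulRight e * ψ.smulRight e) := by
      ext v; simp [hφ]
    rw [this, map_mul, map_mul, mul_assoc, mul_assoc, (hT _).eq, ← mul_assoc (θ (φ.smulRight e)), h]
    simp
  have h2 : (1 : End K X) = ∑ i, ((Module.finBasis K X).coord i).smulRight
      (Module.finBasis K X i) := by
    ext v; conv_lhs => rw [Module.End.one_apply, ← (Module.finBasis K X).sum_repr v]
    simp [LinearMap.sum_apply]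
  have h3 : θ 1 * T = 0 := by
    rw [h2, map_sum, Finset.sum_mul]; exact Finset.sum_eq_zero fun i _ => h1 _ _
  rwa [map_one, one_mul] at h3

variable {n : ℕ} {X : Fin n → Type*} [∀ i, AddCommGroup (X i)] [∀ i, Module K (X i)]
  (θ : ∀ i, End K (X i) →ₐ[K] End K V)

/-- The product of commuting images of endomorphisms of the tensor factors. -/
noncomputable def tensorOp (f : ∀ i, End K (X i)) : End K V :=
  (List.ofFn fun i => θ i (f i)).prod

variable {θ}

theorem tensorOp_mul (hcomm : ∀ i j, i ≠ j → ∀ f g, Commute (θ i f) (θ j g))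
    (f g : ∀ i, End K (X i)) : tensorOp θ (fun i => f i * g i) = tensorOp θ f * tensorOp θ g := by
  rw [tensorOp]; simp only [map_mul]
  exact List.prod_ofFn_mul_of_commute _ _ fun i j hij => hcomm i j hij _ _

theorem tensorOp_mulSingle (i : Fin n) (f : End K (X i)) : tensorOp θ (Pi.mulSingle i f) = θ i f :=
    by
  rw [tensorOp]; have : (fun j => θ j ((Pi.mulSingle i f : ∀ j, End K (X j)) j)) =
      Pi.mulSingle (M := fun _ => End K V) i (θ i f) := by
    funext j; by_cases h : j = i
    · subst h; simp
    · rw [Pi.mulSingle_eq_of_ne h, Pi.mulSingle_eq_of_ne h, map_one]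
  rw [this, List.prod_ofFn_mulSingle]

theorem commute_tensorOp (f : ∀ i, End K (X i)) {a : End K V}
    (h : ∀ i, Commute a (θ i (f i))) : Commute a (tensorOp θ f) := by
  apply Commute.list_prod_right; intro y hy; obtain ⟨i, rfl⟩ := List.mem_ofFn.1 hy
  exact h i

/-- The idempotents are multiplied in one at a time. The product obtained so far commutes with the
next matrix algebra, so `eq_zero_of_commute_of_mul_eq_zero` keeps it from vanishing. -/
theorem tensorOp_ne_zero [Nontrivial V] [∀ i, FiniteDimensional K (X i)]
    (hcomm : ∀ i j, i ≠ j → ∀ f g, Commute (θ i f) (θ j g)) {e : ∀ i, X i}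
    {φ : ∀ i, Module.Dual K (X i)} (hφ : ∀ i, φ i (e i) = 1) : tensorOp θ
    (fun i => (φ i).smulRight (e i)) ≠ 0 := by
  have key : ∀ s : Finset (Fin n),
      tensorOp θ (fun i => if i ∈ s then (φ i).smulRight (e i) else 1) ≠ 0 := by
    intro s; induction s using Finset.induction_on with
    | empty =>
      have : tensorOp θ (fun i => (1 : End K (X i))) = 1 := by simp [tensorOp]
      simp [this]
    | insert j s hj ih =>
      intro h0; have h1 : (fun i => if i ∈ insert j s then (φ i).smulRight (e i) else
          (1 : End K (X i))) = fun i => (Pi.mulSingle j ((φ j).smulRight (e j)) :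
            ∀ i, End K (X i)) i * (if i ∈ s then (φ i).smulRight (e i) else 1) := by
        funext i; by_cases h : i = j
        · subst h; simp [hj]
        · simp [h]
      rw [h1, tensorOp_mul hcomm, tensorOp_mulSingle] at h0
      refine ih (eq_zero_of_commute_of_mul_eq_zero (θ j) (hφ j) (fun f => ?_) h0)
      refine commute_tensorOp _ fun i => ?_; by_cases h : i = j
      · subst h; simp [hj]
      · exact hcomm _ _ (Ne.symm h) _ _
  simpa using key Finset.univ

/-- Commuting matrix algebras which generate `End V` give a tensor product decomposition of `V`. -/
theorem exists_equiv_piTensorProduct [Nontrivial V] [FiniteDimensional K V]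
    [∀ i, FiniteDimensional K (X i)] (hcomm : ∀ i j, i ≠ j → ∀ f g, Commute (θ i f) (θ j g))
    (hgen : Algebra.adjoin K (⋃ i, Set.range (θ i)) = ⊤) : ∃ Ψ : (⨂[K] i, X i)
    ≃ₗ[K] V, ∀ (f : ∀ i, End K (X i)) (t : ⨂[K] i, X i), Ψ (PiTensorProduct.map f t) = tensorOp θ f
      (Ψ t) := by
  have hX : ∀ i, Nontrivial (X i) := by
    intro i; by_contra h; rw [not_nontrivial_iff_subsingleton] at h
    have : (1 : End K V) = 0 := by
      rw [← map_one (θ i), ← map_zero (θ i)]; exact congrArg _ (Subsingleton.elim _ _)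
    exact one_ne_zero this
  have he : ∀ i, ∃ (e : X i) (φ : Module.Dual K (X i)), φ e = 1 := by
    intro i; obtain ⟨e, he⟩ := exists_ne (0 : X i)
    obtain ⟨φ, hφ⟩ := Module.Projective.exists_dual_eq_one K he; exact ⟨e, φ, hφ⟩
  choose e φ hφ using he
  obtain ⟨v₁, hv₁⟩ : ∃ v, tensorOp θ (fun i => (φ i).smulRight (e i)) v ≠ 0 := by
    by_contra! h; exact tensorOp_ne_zero hcomm hφ (LinearMap.ext h)
  set v₀ := tensorOp θ (fun i => (φ i).smulRight (e i)) v₁ with hv₀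
  -- The isomorphism sends `⊗ xᵢ` to the product of the operators `θ i (φ i ⊗ x i)` applied to `v₁`.
  -- Left multiplication on the rank one maps makes it equivariant, and `v₀` is the image of `⊗ eᵢ`,
  -- which is nonzero by the choice of `v₁`.
  let m : MultilinearMap K X V :=
    ((LinearMap.applyₗ v₁ : End K V →ₗ[K] V).compMultilinearMap
      (MultilinearMap.mkPiAlgebraFin K n (End K V))).compLinearMap
        (fun i => (θ i).toLinearMap ∘ₗ (LinearMap.smulRightₗ (φ i)))
  have hm : ∀ x, m x = tensorOp θ (fun i => (φ i).smulRight (x i)) v₁ := fun x => rfl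
  let Ψ := PiTensorProduct.lift m
  have hΨ : ∀ x, Ψ (PiTensorProduct.tprod K x) = tensorOp θ (fun i => (φ i).smulRight (x i)) v₁ :=
    fun x => by rw [← hm]; exact PiTensorProduct.lift.tprod x
  have heq : ∀ (f : ∀ i, End K (X i)) (t : ⨂[K] i, X i),
      Ψ (PiTensorProduct.map f t) = tensorOp θ f (Ψ t) := by
    intro f t; induction t using PiTensorProduct.induction_on with
    | smul_tprod r x =>
      rw [map_smul, map_smul, map_smul, map_smul, PiTensorProduct.map_tprod, hΨ, hΨ,
        ← Module.End.mul_apply, ← tensorOp_mul hcomm]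
      congr 3; funext i; ext v; simp
    | add a b ha hb => rw [map_add, map_add, ha, hb, map_add, map_add]
  have hinj : Injective Ψ := by
    rw [← LinearMap.ker_eq_bot, LinearMap.ker_eq_bot']; intro t ht
    let b := fun i => Module.finBasis K (X i)
    let B := Basis.piTensorProduct b
    apply B.repr.map_eq_zero_iff.1; ext p
    -- The tensor product of the rank one maps given by the coordinates at `p` extracts the
    -- coordinate of `s` at `p`, multiplied by `⊗ eᵢ`. By equivariance each coordinate of an element
    -- of the kernel vanishes.
    have h1 : ∀ s : ⨂[K] i, X i, PiTensorProduct.map (fun i => ((b i).coord (p i)).smulRight (e i)) s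
        = B.repr s p • PiTensorProduct.tprod K e := by
      intro s; induction s using PiTensorProduct.induction_on with
      | smul_tprod r x =>
        rw [map_smul, PiTensorProduct.map_tprod, map_smul, Finsupp.smul_apply,
          Basis.piTensorProduct_repr_tprod_apply, smul_assoc]
        congr 1
        exact (PiTensorProduct.tprod K).map_smul_univ (fun i => (b i).repr (x i) (p i)) e
      | add a b ha hb => rw [map_add, ha, hb, map_add, Finsupp.add_apply, add_smul]
    have h2 := heq (fun i => ((b i).coord (p i)).smulRight (e i)) t
    rw [h1, ht, map_zero, map_smul, hΨ, ← hv₀] at h2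
    exact (smul_eq_zero.1 h2).resolve_right hv₁
  have hsurj : Surjective Ψ := by
    rw [← LinearMap.range_eq_top]
    -- The range is stable under the algebra generated by the images of the `θ i`, hence under all
    -- of `End V`, and it contains the nonzero vector `v₀`.
    have hinv : ∀ a ∈ Algebra.adjoin K (⋃ i, Set.range (θ i)), ∀ v ∈ LinearMap.range Ψ,
        a v ∈ LinearMap.range Ψ := by
      intro a ha; induction ha using Algebra.adjoin_induction with
      | mem x hx =>
        obtain ⟨i, f, rfl⟩ := Set.mem_iUnion.1 hx; rintro _ ⟨t, rfl⟩
        refine ⟨PiTensorProduct.map (Pi.mulSingle (M := fun i => End K (X i)) i f) t, ?_⟩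
        rw [← tensorOp_mulSingle i f, ← heq]
      | algebraMap c => exact fun v hv => (LinearMap.range Ψ).smul_mem c hv
      | add a b _ _ ha hb => exact fun v hv => Submodule.add_mem _ (ha v hv) (hb v hv)
      | mul a b _ _ ha hb => exact fun v hv => ha _ (hb v hv)
    rw [eq_top_iff]; intro v _
    obtain ⟨ψ, hψ⟩ := Module.Projective.exists_dual_eq_one K hv₁
    have h1 := hinv (ψ.smulRight v) (by rw [hgen]; trivial) v₀ ⟨PiTensorProduct.tprod K e, hΨ e⟩
    rw [LinearMap.smulRight_apply, hψ, one_smul] at h1; exact h1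
  exact ⟨LinearEquiv.ofBijective Ψ ⟨hinj, hsurj⟩, heq⟩

theorem exists_tensorDecomposition {K : Type} {V : Type v} [Field K] [AddCommGroup V] [Module K V]
    [Nontrivial V] [FiniteDimensional K V] {n : ℕ} {X : Fin n → Type} [∀ i, AddCommGroup (X i)]
    [∀ i, Module K (X i)] [∀ i, FiniteDimensional K (X i)] (θ : ∀ i, End K (X i) →ₐ[K] End K V)
    (hcomm : ∀ i j, i ≠ j → ∀ f g, Commute (θ i f) (θ j g))
    (hgen : Algebra.adjoin K (⋃ i, Set.range (θ i)) = ⊤) : ∃ (D : TensorDecomposition K V (Fin n))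
    (η : ∀ i, End K (D.W i) →ₐ[K] End K V), (∀ i, (η i).range = (θ i).range) ∧
      (∀ i, Injective (θ i) → Injective (η i)) ∧ (∀ u : ∀ i, GL K (D.W i), (D.act u : End K V) =
        tensorOp η fun i => (u i : End K (D.W i))) := by
  obtain ⟨Ψ, hΨ⟩ := exists_equiv_piTensorProduct hcomm hgen
  refine ⟨{ W := X, equiv := Ψ.symm }, θ, fun i => rfl, fun i h => h, fun u => ?_⟩; ext v
  have h1 := hΨ (fun i => (u i : End K (X i))) (Ψ.symm v); rw [Ψ.apply_symm_apply] at h1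
  exact h1

end TensorFactorisation

section CommutingLinearGroups

theorem exists_smul_one_of_forall_commute {K : Type*} {V : Type*} [Field K] [AddCommGroup V]
    [Module K V] {a : End K V} (h : ∀ b : End K V, a * b = b * a) : ∃ c : K, a = c • (1 : End K V)
    := by
  have : a ∈ Subalgebra.center K (End K V) := Subalgebra.mem_center_iff.2 fun b => (h b).symm
  rw [Algebra.IsCentral.center_eq_bot] at this; obtain ⟨c, hc⟩ := Algebra.mem_bot.1 this
  exact ⟨c, by rw [← hc, Algebra.algebraMap_eq_smul_one]⟩

theorem exists_smul_one_of_commute_groupAlg {K : Type*} {V : Type*} [Field K] [AddCommGroup V]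
    [Module K V] {X : Subgroup (GL K V)} (hX : groupAlg X = ⊤) {a : End K V}
    (h : ∀ x ∈ X, (x : End K V) * a = a * x) : ∃ c : K, a = c • (1 : End K V) :=
  exists_smul_one_of_forall_commute fun b =>
    (commute_groupAlg h (by rw [hX]; trivial : b ∈ groupAlg X)).symm

theorem mem_center_of_commute_groupAlg {K : Type*} {V : Type*} [Field K] [AddCommGroup V]
    [Module K V] {X : Subgroup (GL K V)} (hX : groupAlg X = ⊤) {a : GL K V}
    (h : ∀ x ∈ X, x * a = a * x) : a ∈ Subgroup.center (GL K V) := by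
  rw [Subgroup.mem_center_iff]; intro b; apply Units.ext
  exact commute_groupAlg (X := X) (fun x hx => congrArg Units.val (h x hx))
    (by rw [hX]; trivial)

variable {K : Type} {V : Type v} [Field K] [Finite K] [AddCommGroup V] [Module K V]
  [FiniteDimensional K V] [Nontrivial V] {n : ℕ} {M : Fin n → Subgroup (GL K V)}

/-- Pairwise commuting linear groups of order coprime to the characteristic which together generate
`End V` act on the factors of a tensor product decomposition of `V`. -/
theorem exists_tensorDecomposition_of_commute (hM : ∀ i, (Nat.card (M i)).Coprime (Nat.card K))
    (hcomm : ∀ i j, i ≠ j → ∀ x ∈ M i, ∀ y ∈ M j, x * y = y * x) (htop : groupAlg (⨆ i, M i) = ⊤) :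
    ∃ (D : TensorDecomposition K V (Fin n)) (η : ∀ i, End K (D.W i) →ₐ[K] End K V),
      (∀ i, Nontrivial (D.W i)) ∧ (∀ i, Injective (η i)) ∧ (∀ i, (η i).range = groupAlg (M i)) ∧
      (∀ i j, i ≠ j → ∀ f g, Commute (η i f) (η j g)) ∧ (∀ u : ∀ i, GL K (D.W i),
        (D.act u : End K V) = tensorOp η fun i => (u i : End K (D.W i))) := by
  have hmat : ∀ i, ∃ (m : ℕ) (θ : End K (Fin m → K) →ₐ[K] End K V),
      Injective θ ∧ θ.range = groupAlg (M i) := by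
    -- A central element of the algebra of `M i` commutes with `M i`, and with every other `M j` as
    -- well; since these groups together span `End V`, it is a scalar.
    intro i; refine exists_algHom_of_center_groupAlg (hM i) fun a ha hac => ?_
    refine exists_smul_one_of_commute_groupAlg htop fun x hx => ?_
    induction hx using Subgroup.iSup_induction' with
    | hp j x hx =>
      by_cases hij : i = j
      · subst hij; exact hac x hx
      · exact (commute_groupAlg (fun y hy => congrArg Units.val (hcomm i j hij y hy x hx)) ha).symm
    | h1 => simp
    | hmul x y _ _ hx hy => rw [Units.val_mul, mul_assoc, hy, ← mul_assoc, hx, mul_assoc]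
  choose m θ hinj hrange using hmat
  have hc' : ∀ i j, i ≠ j → ∀ a ∈ groupAlg (M i), ∀ b ∈ groupAlg (M j), a * b = b * a := by
    intro i j hij a ha b hb; refine commute_groupAlg (fun x hx => ?_) ha
    refine (commute_groupAlg (fun y hy => ?_) hb).symm
    exact congrArg Units.val (hcomm i j hij x hx y hy).symm
  have hgen : Algebra.adjoin K (⋃ i, Set.range (θ i)) = ⊤ := by
    rw [eq_top_iff, ← htop]; refine Algebra.adjoin_le ?_; rintro _ ⟨x, hx, rfl⟩
    induction hx using Subgroup.iSup_induction' with
    | hp j x hx =>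
      refine Algebra.subset_adjoin (Set.mem_iUnion.2 ⟨j, ?_⟩); have := coe_mem_groupAlg hx
      rw [← hrange j] at this; exact this
    | h1 => exact one_mem _
    | hmul x y _ _ hx hy => exact mul_mem hx hy
  obtain ⟨D, η, hr, hηinj, hact⟩ := exists_tensorDecomposition θ
    (fun i j hij f g => hc' i j hij _ (hrange i ▸ ⟨f, rfl⟩) _ (hrange j ▸ ⟨g, rfl⟩)) hgen
  have hr' : ∀ i, (η i).range = groupAlg (M i) := fun i => (hr i).trans (hrange i)
  have hW : ∀ i, Nontrivial (D.W i) := by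
    intro i; by_contra h; rw [not_nontrivial_iff_subsingleton] at h
    have : (1 : End K V) = 0 := by
      rw [← map_one (η i), ← map_zero (η i)]; exact congrArg _ (Subsingleton.elim _ _)
    exact one_ne_zero this
  refine ⟨D, η, hW, fun i => hηinj i (hinj i), hr',
    fun i j hij f g => hc' i j hij _ (hr' i ▸ ⟨f, rfl⟩) _ (hr' j ▸ ⟨g, rfl⟩), hact⟩

end CommutingLinearGroups

/-! ### Hilbert 90 and norms for cyclic groups of field automorphisms -/

section CyclicNorm

/-- Dedekind's independence of the characters `σ ^ i`, applied after a functional which takes the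
value `1` at `w 0`. With vectors in place of field elements it also serves to produce fixed vectors
of semilinear maps. -/
theorem exists_sum_smul_ne_zero {K : Type*} {V : Type*} [Field K] [AddCommGroup V] [Module K V]
    (σ : K ≃+* K) (hσ : 0 < orderOf σ) (w : ℕ → V) (hw : w 0 ≠ 0) : ∃ c : K, ∑ i ∈ Finset.range
    (orderOf σ), (σ ^ i) c • w i ≠ 0 := by
  obtain ⟨φ, hφ⟩ := Module.Projective.exists_dual_eq_one K hw; by_contra! h
  let χ : Fin (orderOf σ) → (K →* K) := fun i => ((σ ^ (i : ℕ) : K ≃+* K) : K →* K)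
  have hχ : Injective χ := by
    intro i j hij
    have h1 : σ ^ (i : ℕ) = σ ^ (j : ℕ) := RingEquiv.ext fun x => DFunLike.congr_fun hij x
    exact Fin.ext (pow_injOn_Iio_orderOf i.2 j.2 h1)
  have hli := (linearIndependent_monoidHom K K).comp χ hχ
  have h0 := Fintype.linearIndependent_iff.1 hli (fun i => φ (w i)) (by
    funext c; have := congrArg φ (h c); rw [map_sum, map_zero] at this
    rw [Finset.sum_apply, Pi.zero_apply, ← this, Finset.sum_range]
    refine Finset.sum_congr rfl fun i _ => ?_; rw [map_smul, smul_eq_mul, mul_comm]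
    rfl) ⟨0, hσ⟩
  rw [show ((⟨0, hσ⟩ : Fin (orderOf σ)) : ℕ) = 0 from rfl, hφ] at h0; exact one_ne_zero h0

variable {K : Type*} [Field K]

/-- Additive Hilbert 90 for a cyclic group of automorphisms, in its multiplicative form. -/
theorem exists_mul_eq_of_prod_eq_one (σ : K ≃+* K) (hσ : 0 < orderOf σ) {u : K}
    (hu : ∏ i ∈ Finset.range (orderOf σ), (σ ^ i) u = 1) : ∃ b : K, b ≠ 0 ∧ u * σ b = b := by
  -- Lagrange resolvent: `w i` is the product of the first `i` conjugates of `u`, so `u * σ` shifts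
  -- the summands of `b = ∑ σ^i(c) w i`, cyclically because the norm of `u` is `1`.
  let w : ℕ → K := fun i => ∏ j ∈ Finset.range i, (σ ^ j) u
  obtain ⟨c, hc⟩ := exists_sum_smul_ne_zero σ hσ w (by simp [w])
  refine ⟨_, hc, ?_⟩
  have hw : ∀ i, u * σ (w i) = w (i + 1) := by
    intro i; simp only [w]; rw [Finset.prod_range_succ', map_prod, mul_comm]
    simp [pow_succ']
  simp only [smul_eq_mul]; rw [map_sum, Finset.mul_sum]
  have h1 : ∀ i, u * σ ((σ ^ i) c * w i) = (σ ^ (i + 1)) c * w (i + 1) := by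
    intro i; rw [map_mul, ← hw, pow_succ', RingAut.mul_apply]; ring
  rw [Finset.sum_congr rfl fun i _ => h1 i]
  have h2 := Finset.sum_range_succ (fun i => (σ ^ i) c * w i) (orderOf σ)
  rw [Finset.sum_range_succ' (fun i => (σ ^ i) c * w i) (orderOf σ)] at h2
  have h3 : w (orderOf σ) = w 0 := by simp only [w]; rw [hu]; simp
  rw [h3, pow_orderOf_eq_one, pow_zero] at h2; exact add_right_cancel h2

/-- The norm for a cyclic group of automorphisms of a finite field is surjective. -/
theorem exists_prod_eq_of_fixed [Finite K] (σ : K ≃+* K) {μ : K} (hμ : μ ≠ 0) (hσμ : σ μ = μ) : ∃ c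
    : K, ∏ i ∈ Finset.range (orderOf σ), (σ ^ i) c = μ := by
  have hfin : Finite (K ≃+* K) := Finite.of_injective (fun e => (e : K → K)) DFunLike.coe_injective
  have hσ : 0 < orderOf σ := orderOf_pos σ; let τ : Kˣ →* Kˣ := Units.map (σ : K →* K)
  let δ : Kˣ →* Kˣ := MonoidHom.id Kˣ / τ
  let N : Kˣ →* Kˣ := ∏ i ∈ Finset.range (orderOf σ), Units.map ((σ ^ i : K ≃+* K) : K →* K)
  have hN : ∀ c : Kˣ, ((N c : Kˣ) : K) = ∏ i ∈ Finset.range (orderOf σ), (σ ^ i) (c : K) := by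
    intro c; simp [N, MonoidHom.finsetProd_apply]
  have hδ : ∀ c : Kˣ, c ∈ δ.ker ↔ σ (c : K) = c := by
    intro c; rw [MonoidHom.mem_ker]; change c / τ c = 1 ↔ _
    rw [div_eq_one, eq_comm, Units.ext_iff]; rfl
  have h1 : N.ker ≤ δ.range := by
    intro u hu
    obtain ⟨b, hb, hub⟩ := exists_mul_eq_of_prod_eq_one σ hσ (u := (u : K)) (by
      rw [← hN, MonoidHom.mem_ker.1 hu]; rfl)
    refine ⟨Units.mk0 b hb, ?_⟩; change Units.mk0 b hb / τ (Units.mk0 b hb) = u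
    rw [div_eq_iff_eq_mul]; exact Units.ext hub.symm
  have h2 : N.range ≤ δ.ker := by
    rintro _ ⟨c, rfl⟩; rw [hδ, hN, map_prod]
    have h3 := Finset.prod_range_succ (fun i => (σ ^ i) (c : K)) (orderOf σ)
    rw [Finset.prod_range_succ' (fun i => (σ ^ i) (c : K)), pow_orderOf_eq_one, pow_zero] at h3
    have h4 := mul_right_cancel₀ (by simp : (1 : K ≃+* K) (c : K) ≠ 0) h3
    rw [← h4]; exact Finset.prod_congr rfl fun i _ => by rw [pow_succ', RingAut.mul_apply]
  have h3 : N.range = δ.ker := by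
    -- Counting: `|im N||ker N| = |im δ||ker δ|`, and Hilbert 90 gives `|ker N| ≤ |im δ|`. So the
    -- norms exhaust the nonzero fixed elements.
    apply Subgroup.eq_of_le_of_card_ge h2
    have hcN : Nat.card N.range * Nat.card N.ker = Nat.card Kˣ := by
      rw [← Subgroup.index_ker, mul_comm, Subgroup.card_mul_index]
    have hcδ : Nat.card δ.range * Nat.card δ.ker = Nat.card Kˣ := by
      rw [← Subgroup.index_ker, mul_comm, Subgroup.card_mul_index]
    have h4 : Nat.card N.ker ≤ Nat.card δ.range := Subgroup.card_le_of_le h1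
    have h5 : 0 < Nat.card N.ker := Nat.card_pos; by_contra! h6
    have : Nat.card N.range * Nat.card N.ker < Nat.card δ.ker * Nat.card δ.range :=
      lt_of_lt_of_le ((Nat.mul_lt_mul_right h5).2 h6) (Nat.mul_le_mul_left _ h4)
    rw [hcN, mul_comm, hcδ] at this; exact lt_irrefl _ this
  have h4 : Units.mk0 μ hμ ∈ N.range := by
    rw [h3, hδ]; exact hσμ
  obtain ⟨c, hc⟩ := h4; exact ⟨c, by rw [← hN, hc]; rfl⟩

end CyclicNorm

open Subgroup
open scoped commutatorElement

/-! ### Groups whose characteristic abelian subgroups are central -/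

section CentralCharacteristicAbelian

variable {Q : Type*} [Group Q]

/-- Every characteristic abelian subgroup of `Q` is central. -/
def CharAbelianCentral (Q : Type*) [Group Q] : Prop :=
  ∀ A : Subgroup Q, A.Characteristic → (∀ a ∈ A, ∀ b ∈ A, a * b = b * a) → A ≤ center Q

/-- `M` is minimal among the normal subgroups properly containing the centre. -/
def IsMinimalAboveCenter (M : Subgroup Q) : Prop :=
  Minimal (fun L : Subgroup Q => L.Normal ∧ center Q < L) M

/-- The subgroup generated by the centre and the minimal normal subgroups above it. -/
def socleAboveCenter (Q : Type*) [Group Q] : Subgroup Q :=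
  center Q ⊔ sSup {M | IsMinimalAboveCenter M}

theorem IsMinimalAboveCenter.map {M : Subgroup Q} (hM : IsMinimalAboveCenter M) (φ : Q ≃* Q) :
    IsMinimalAboveCenter (M.map φ.toMonoidHom) := by
  have hc : ∀ ψ : Q ≃* Q, (center Q).map ψ.toMonoidHom = center Q :=
    characteristic_iff_map_eq.1 inferInstance
  have hmap : ∀ (ψ : Q ≃* Q) (L : Subgroup Q), (L.Normal ∧ center Q < L) →
      ((L.map ψ.toMonoidHom).Normal ∧ center Q < L.map ψ.toMonoidHom) := by
    rintro ψ L ⟨h1, h2⟩; refine ⟨h1.map _ ψ.surjective, ?_⟩; rw [← hc ψ]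
    exact (map_lt_map_iff_of_injective ψ.injective).2 h2
  refine ⟨hmap φ M hM.1, fun L hL hLM => ?_⟩
  have h1 : L.map φ.symm.toMonoidHom ≤ M := by
    rintro _ ⟨x, hx, rfl⟩; obtain ⟨y, hy, hyx⟩ := hLM hx
    have : φ.symm x = y := by rw [← hyx]; exact φ.symm_apply_apply y
    change φ.symm x ∈ M; rwa [this]
  have h2 := hM.2 (hmap φ.symm L hL) h1; rintro _ ⟨y, hy, rfl⟩
  obtain ⟨x, hx, hxy⟩ := h2 hy
  have : φ y = x := by rw [← hxy]; exact φ.apply_symm_apply x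
  change φ y ∈ L; rwa [this]

theorem center_le_socleAboveCenter : center Q ≤ socleAboveCenter Q := le_sup_left

theorem IsMinimalAboveCenter.le_socleAboveCenter {M : Subgroup Q} (hM : IsMinimalAboveCenter M) : M
    ≤ socleAboveCenter Q :=
  le_sup_of_le_right (le_sSup hM)

instance socleAboveCenter_characteristic : (socleAboveCenter Q).Characteristic := by
  rw [characteristic_iff_map_le]; intro φ
  rw [socleAboveCenter, Subgroup.map_sup, sSup_eq_iSup', Subgroup.map_iSup]
  refine sup_le (le_sup_of_le_left ?_) (le_sup_of_le_right (iSup_le fun M => ?_))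
  · exact (characteristic_iff_map_le.1 inferInstance) φ
  · exact le_iSup_of_le (⟨_, M.2.map φ⟩ : {M : Subgroup Q | IsMinimalAboveCenter M}) le_rfl

theorem exists_isMinimalNormalAboveCenter_le [Finite Q] {L : Subgroup Q} (hn : L.Normal)
    (hL : center Q < L) : ∃ M, IsMinimalAboveCenter M ∧ M ≤ L := by
  obtain ⟨M, hML, hM⟩ := (Set.toFinite {L : Subgroup Q | L.Normal ∧ center Q < L}).exists_le_minimal
    (show L ∈ {L : Subgroup Q | L.Normal ∧ center Q < L} from ⟨hn, hL⟩)
  exact ⟨M, hM, hML⟩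

theorem socle_comap_eq_socleAboveCenter :
    (socle (Q ⧸ center Q)).comap (QuotientGroup.mk' (center Q)) = socleAboveCenter Q := by
  have hsurj := QuotientGroup.mk'_surjective (center Q)
  have hmin : ∀ M : Subgroup (Q ⧸ center Q),
      Minimal (fun L : Subgroup (Q ⧸ center Q) => L.Normal ∧ L ≠ ⊥) M ↔
        IsMinimalAboveCenter (M.comap (QuotientGroup.mk' (center Q))) := by
    have hlt : ∀ L : Subgroup (Q ⧸ center Q), L ≠ ⊥ ↔
        center Q < L.comap (QuotientGroup.mk' (center Q)) := by
      intro L; rw [← bot_lt_iff_ne_bot]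
      conv_rhs => lhs; rw [← QuotientGroup.ker_mk' (center Q), ← MonoidHom.comap_bot]
      exact (Subgroup.comap_lt_comap_of_surjective hsurj).symm
    have hnorm : ∀ L : Subgroup (Q ⧸ center Q), L.Normal ↔
        (L.comap (QuotientGroup.mk' (center Q))).Normal := by
      intro L; refine ⟨fun h => h.comap _, fun h => ?_⟩
      rw [← Subgroup.map_comap_eq_self_of_surjective hsurj L]; exact h.map _ hsurj
    intro M; constructor
    · rintro ⟨⟨h1, h2⟩, h3⟩; refine ⟨⟨(hnorm M).1 h1, (hlt M).1 h2⟩, ?_⟩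
      rintro L ⟨hL1, hL2⟩ hLM
      have hL : (L.map (QuotientGroup.mk' (center Q))).comap (QuotientGroup.mk' (center Q)) = L := by
        rw [QuotientGroup.comap_map_mk', sup_eq_right.2 hL2.le]
      rw [← hL] at hLM hL1 hL2 ⊢
      exact Subgroup.comap_mono (h3 ⟨(hnorm _).2 hL1, (hlt _).2 hL2⟩
        ((Subgroup.comap_le_comap_of_surjective hsurj).1 hLM))
    · rintro ⟨⟨h1, h2⟩, h3⟩; refine ⟨⟨(hnorm M).2 h1, (hlt M).2 h2⟩, ?_⟩
      rintro L ⟨hL1, hL2⟩ hLM; exact (Subgroup.comap_le_comap_of_surjective hsurj).1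
        (h3 ⟨(hnorm L).1 hL1, (hlt L).1 hL2⟩ (Subgroup.comap_mono hLM))
  apply le_antisymm
  · have h1 : socle (Q ⧸ center Q) ≤ (socleAboveCenter Q).map (QuotientGroup.mk' (center Q)) := by
      refine sSup_le fun M hM => ?_
      rw [← Subgroup.map_comap_eq_self_of_surjective hsurj M]
      exact Subgroup.map_mono ((hmin M).1 hM).le_socleAboveCenter
    refine (Subgroup.comap_mono h1).trans ?_
    rw [QuotientGroup.comap_map_mk', sup_eq_right.2 center_le_socleAboveCenter]
  · refine sup_le ?_ (sSup_le fun M hM => ?_)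
    · conv_lhs => rw [← QuotientGroup.ker_mk' (center Q), ← MonoidHom.comap_bot]
      exact Subgroup.comap_mono bot_le
    · have hL : (M.map (QuotientGroup.mk' (center Q))).comap (QuotientGroup.mk' (center Q)) = M := by
        rw [QuotientGroup.comap_map_mk', sup_eq_right.2 hM.1.2.le]
      have hM' : M ∈ {M : Subgroup Q | IsMinimalAboveCenter M} := hM; rw [← hL] at hM ⊢
      exact Subgroup.comap_mono (le_sSup ((hmin _).2 hM))

theorem commutatorElement_mul_right_of_mem_center {x y z : Q} (h : ⁅x, z⁆ ∈ center Q) : ⁅x, y * z⁆ =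
    ⁅x, y⁆ * ⁅x, z⁆ := by
  have h1 : ⁅x, y * z⁆ = ⁅x, y⁆ * (y * ⁅x, z⁆ * y⁻¹) := by simp only [commutatorElement_def]; group
  rw [h1, mem_center_iff.1 h y, mul_inv_cancel_right]

theorem commutatorElement_mul_left_of_mem_center {x y z : Q} (h : ⁅y, z⁆ ∈ center Q) : ⁅x * y, z⁆ =
    ⁅x, z⁆ * ⁅y, z⁆ := by
  have h1 : ⁅x * y, z⁆ = (x * ⁅y, z⁆ * x⁻¹) * ⁅x, z⁆ := by simp only [commutatorElement_def]; group
  rw [h1, mem_center_iff.1 h x, mul_inv_cancel_right, mem_center_iff.1 h]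

variable (hQ : CharAbelianCentral Q)

include hQ in
theorem inf_centralizer_le_center {A : Subgroup Q} (hA : A.Characteristic) : A ⊓ centralizer
    (A : Set Q) ≤ center Q := by
  refine hQ _ inferInstance ?_; rintro a ⟨ha, -⟩ b ⟨-, hb⟩
  exact mem_centralizer_iff.1 hb a ha

include hQ in
-- Were the centraliser larger than the centre, it would contain a minimal normal subgroup above the
-- centre. That subgroup would also lie in the socle, and the intersection of a characteristic
-- subgroup with its centraliser is characteristic and abelian, hence central.
theorem centralizer_socleAboveCenter [Finite Q] : centralizer (socleAboveCenter Q : Set Q) = center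
    Q := by
  apply le_antisymm _ (center_le_centralizer _); by_contra h
  have hlt : center Q < centralizer (socleAboveCenter Q : Set Q) :=
    lt_of_le_not_ge (center_le_centralizer _) h
  obtain ⟨M, hM, hle⟩ := exists_isMinimalNormalAboveCenter_le inferInstance hlt
  have h1 : M ≤ center Q :=
    (le_inf hM.le_socleAboveCenter hle).trans (inf_centralizer_le_center hQ inferInstance)
  exact absurd h1 (not_le_of_gt hM.1.2)

include hQ in
-- Consider the last noncentral term `γ` of the lower central series of `A`. If it lies in `[A, A]`,
-- then `[[γ, A], A] = 1`, and the three subgroups lemma gives `[[A, A], γ] = 1`. So `γ` is abelian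
-- and characteristic, hence central, a contradiction.
theorem commutator_le_center_of_isNilpotent {A : Subgroup Q} (hA : A.Characteristic)
    (hn : Group.IsNilpotent A) : ⁅A, A⁆ ≤ center Q := by
  classical
  obtain ⟨n, hn⟩ := (Subgroup.isNilpotent_iff_lowerCentralSeries A).1 hn
  have hex : ∃ n, A.lowerCentralSeries n ≤ center Q := ⟨n, hn ▸ bot_le⟩
  let m := Nat.find hex
  have hm : A.lowerCentralSeries m ≤ center Q := Nat.find_spec hex
  have hle : ∀ k, A.lowerCentralSeries (k + 1) ≤ ⁅A, A⁆ := by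
    have hA' : ∀ k, A.lowerCentralSeries k ≤ A := by
      intro k; induction k with
      | zero => exact le_rfl
      | succ k ih => exact (commutator_mono ih le_rfl).trans (commutator_le_left A A)
    exact fun k => commutator_mono (hA' k) le_rfl
  rcases hk : m with _ | _ | k
  · rw [hk] at hm; exact (commutator_le_left A A).trans hm
  · rw [hk] at hm; exact hm
  · rw [hk] at hm; exfalso
    refine Nat.find_min hex (m := k + 1) (by change k + 1 < m; omega) ?_
    refine hQ _ inferInstance ?_
    have h1 : ⁅⁅A.lowerCentralSeries (k + 1), A⁆, A⁆ = ⊥ := by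
      rw [commutator_eq_bot_iff_le_centralizer]; exact hm.trans (center_le_centralizer _)
    have h2 : ⁅⁅A, A⁆, A.lowerCentralSeries (k + 1)⁆ = ⊥ := by
      apply commutator_commutator_eq_bot_of_rotate
      · rw [commutator_comm A]; exact h1
      · exact h1
    rw [commutator_eq_bot_iff_le_centralizer] at h2; intro a ha b hb
    exact (mem_centralizer_iff.1 (h2 (hle k ha)) b hb).symm

include hQ in
-- Put `X = P ∩ Soc`. The centraliser of `X` in `P` is central, since otherwise its product with the
-- centre would contain a minimal normal subgroup above the centre, all of whose elements would be
-- central. Thus the commutator pairing embeds `P` modulo the centre into the dual of `X` modulo the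
-- centre, and comparing orders gives `P = X`.
theorem le_socleAboveCenter_of_commutator_le [Finite Q] (hZ : IsCyclic (center Q)) {P : Subgroup Q}
    (hP : P.Characteristic) (hPP : ⁅P, P⁆ ≤ center Q) : P ≤ socleAboveCenter Q := by
  set X := socleAboveCenter Q ⊓ P with hX
  have hXc : X.Characteristic := inferInstance
  set C := centralizer (X : Set Q) ⊓ P with hC
  have hCc : C.Characteristic := inferInstance
  have hCX : C ⊓ X ≤ center Q := fun x hx => inf_centralizer_le_center hQ hXc ⟨hx.2, hx.1.1⟩
  have hCZ : C ≤ center Q := by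
    by_contra h; have hlt : center Q < C ⊔ center Q :=
      lt_of_le_not_ge le_sup_right fun h' => h (le_sup_left.trans h')
    obtain ⟨M, hM, hle⟩ := exists_isMinimalNormalAboveCenter_le inferInstance hlt
    refine absurd (fun m hm => ?_) (not_le_of_gt hM.1.2)
    obtain ⟨c, hc, z, hz, rfl⟩ := mem_sup_of_normal_right.1 (hle hm)
    refine mul_mem (hCX ⟨hc, ?_, hc.2⟩) hz
    have := mul_mem (hM.le_socleAboveCenter hm) (inv_mem (center_le_socleAboveCenter hz))
    rwa [mul_inv_cancel_right] at this
  -- the commutator pairing embeds `P / Z` into the dual of `X / Z`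
  have hcen : ∀ x ∈ P, ∀ y ∈ P, ⁅x, y⁆ ∈ center Q := fun x hx y hy =>
    hPP (commutator_mem_commutator hx hy)
  -- The centre is cyclic, so it embeds in the complex roots of unity. This turns commutators into
  -- characters, and a finite abelian group has as many characters as elements.
  obtain ⟨ε, hε⟩ : ∃ f : center Q →* ℂˣ, Injective f := by
    obtain ⟨g, hg⟩ := hZ.exists_generator
    have hprim := Complex.isPrimitiveRoot_exp (Nat.card (center Q)) Nat.card_pos.ne'
    let ζ : ℂˣ := hprim.toRootsOfUnity.1
    have hζ : orderOf ζ = orderOf g := by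
      rw [orderOf_eq_card_of_forall_mem_zpowers hg]; rw [← orderOf_units]
      exact hprim.eq_orderOf.symm
    refine ⟨monoidHomOfForallMemZpowers hg (g' := ζ) (hζ ▸ dvd_rfl), ?_⟩
    rw [injective_iff_map_eq_one]; intro x hx; obtain ⟨k, rfl⟩ := hg x; simp only at hx
    rw [map_zpow, monoidHomOfForallMemZpowers_apply_gen, ← orderOf_dvd_iff_zpow_eq_one, hζ,
      orderOf_dvd_iff_zpow_eq_one] at hx
    exact hx
  let χ : P → (X →* ℂˣ) := fun x =>
    MonoidHom.mk' (fun y : X => ε ⟨⁅(x : Q), (y : Q)⁆, hcen x x.2 y y.2.2⟩) fun y z => by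
      rw [← map_mul]; exact congrArg ε (Subtype.ext
        (commutatorElement_mul_right_of_mem_center (hcen x x.2 z z.2.2)))
  have hχ : ∀ (x : P) (y : X), χ x y = 1 ↔ ⁅(x : Q), (y : Q)⁆ = 1 := by
    intro x y; change ε _ = 1 ↔ _; rw [map_eq_one_iff ε hε, Subtype.ext_iff]; rfl
  have hXn : ((center Q).subgroupOf X).Normal := inferInstance
  let cg : CommGroup (X ⧸ (center Q).subgroupOf X) :=
    { (inferInstance : Group (X ⧸ (center Q).subgroupOf X)) with
      mul_comm := by
        intro a b; induction a using QuotientGroup.induction_on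
        induction b using QuotientGroup.induction_on
        rename_i a b
        rw [← QuotientGroup.mk_mul, ← QuotientGroup.mk_mul, QuotientGroup.eq, mem_subgroupOf]
        have := hcen _ (inv_mem b.2.2) _ (inv_mem a.2.2)
        simpa [commutatorElement_def, mul_assoc] using this }
  have hker : ∀ x : P, (center Q).subgroupOf X ≤ (χ x).ker := by
    intro x y hy; rw [MonoidHom.mem_ker, hχ, commutatorElement_eq_one_iff_mul_comm]
    exact mem_center_iff.1 (mem_subgroupOf.1 hy) x
  let Φ : P →* ((X ⧸ (center Q).subgroupOf X) →* ℂˣ) :=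
    { toFun := fun x => QuotientGroup.lift _ (χ x) (hker x)
      map_one' := by
        apply QuotientGroup.monoidHom_ext; ext1 z
        exact (hχ 1 z).2 (commutatorElement_one_left _)
      map_mul' := fun x y => by
        apply QuotientGroup.monoidHom_ext; ext1 z; change ε _ = ε _ * ε _; rw [← map_mul]
        exact congrArg ε (Subtype.ext
          (commutatorElement_mul_left_of_mem_center (hcen y y.2 z z.2.2))) }
  have hΦ : Φ.ker ≤ (center Q).subgroupOf P := by
    intro x hx; refine hCZ ⟨?_, x.2⟩; change (x : Q) ∈ centralizer (X : Set Q)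
    rw [mem_centralizer_iff]; intro y hy; have h1 : χ x ⟨y, hy⟩ = 1 :=
      DFunLike.congr_fun (MonoidHom.mem_ker.1 hx) ((⟨y, hy⟩ : X) : X ⧸ (center Q).subgroupOf X)
    rw [hχ, commutatorElement_eq_one_iff_mul_comm] at h1; exact h1.symm
  have hcard1 : Nat.card P ≤ Nat.card ((center Q).subgroupOf P) *
      Nat.card (X ⧸ (center Q).subgroupOf X) := by
    rw [← Subgroup.card_mul_index Φ.ker, Subgroup.index_ker]
    refine Nat.mul_le_mul (Subgroup.card_le_of_le hΦ) ?_
    have : HasEnoughRootsOfUnity ℂ (Monoid.exponent (X ⧸ (center Q).subgroupOf X)) := by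
      have : NeZero (Monoid.exponent (X ⧸ (center Q).subgroupOf X)) :=
        ⟨Monoid.exponent_ne_zero_of_finite⟩
      infer_instance
    have hc := CommGroup.card_monoidHom_of_hasEnoughRootsOfUnity (X ⧸ (center Q).subgroupOf X) ℂ
    rw [← hc]
    have : Finite ((X ⧸ (center Q).subgroupOf X) →* ℂˣ) := Nat.finite_of_card_ne_zero (by
      rw [hc]; exact Nat.card_pos.ne')
    exact Subgroup.card_le_card_group _
  have hcard2 : Nat.card ((center Q).subgroupOf P) = Nat.card ((center Q).subgroupOf X) := by
    have h1 : (((center Q).subgroupOf P).map P.subtype : Subgroup Q) =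
        ((center Q).subgroupOf X).map X.subtype := by
      rw [subgroupOf_map_subtype, subgroupOf_map_subtype, hX, ← inf_assoc,
        inf_eq_left.2 center_le_socleAboveCenter]
    have h2 := congrArg (fun L : Subgroup Q => Nat.card L) h1
    rwa [Subgroup.card_map_of_injective P.subtype_injective,
      Subgroup.card_map_of_injective X.subtype_injective] at h2
  rw [hcard2, ← Subgroup.index_eq_card, Subgroup.card_mul_index] at hcard1
  have hXP : X = P := Subgroup.eq_of_le_of_card_ge inf_le_right hcard1; rw [← hXP]
  exact inf_le_left

end CentralCharacteristicAbelian

/-! ### The generalised Fitting subgroup lies in the socle above the centre -/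

section FittingSubgroup

variable {Q : Type*} [Group Q]

/-- The intersection of the Sylow subgroups. -/
def sylowCore (p : ℕ) (Q : Type*) [Group Q] : Subgroup Q := ⨅ P : Sylow p Q, (P : Subgroup Q)

instance sylowCore_characteristic (p : ℕ) : (sylowCore p Q).Characteristic := by
  rw [characteristic_iff_le_comap]; intro φ x hx; rw [sylowCore, mem_iInf] at hx
  change φ x ∈ sylowCore p Q; rw [sylowCore, mem_iInf]; intro P
  have hker : (φ.toMonoidHom.ker) = ⊥ := (MonoidHom.ker_eq_bot_iff _).2 φ.injective
  have h := hx (P.comapOfInjective φ.toMonoidHom φ.injective (by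
    rw [MonoidHom.range_eq_top.2 φ.surjective]; exact le_top))
  exact h

theorem isPGroup_sylowCore (p : ℕ) : IsPGroup p (sylowCore p Q) :=
  (default : Sylow p Q).isPGroup'.to_le (iInf_le _ _)

theorem le_sylowCore [Finite Q] {p : ℕ} [Fact p.Prime] {A : Subgroup Q} (hn : A.Normal)
    (hA : IsPGroup p A) : A ≤ sylowCore p Q := by
  obtain ⟨P, hP⟩ := hA.exists_le_sylow; refine le_iInf fun P' => ?_
  obtain ⟨g, rfl⟩ := MulAction.exists_smul_eq Q P P'; intro a ha
  have h1 : g⁻¹ * a * g ∈ A := by simpa using hn.conj_mem a ha g⁻¹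
  rw [Sylow.coe_subgroup_smul, Subgroup.mem_pointwise_smul_iff_inv_smul_mem]
  have h2 := hP h1; simpa [MulAut.smul_def] using h2

/-- No prime divides the index of `M ∩ N` in `M`. -/
theorem le_of_forall_sylow_le [Finite Q] {M N : Subgroup Q}
    (h : ∀ (p : ℕ) (_ : Fact p.Prime), ∃ P : Sylow p M, (P : Subgroup M).map M.subtype ≤ N) : M ≤ N
    := by
  rw [← subgroupOf_eq_top, ← Subgroup.index_eq_one]; by_contra hne
  obtain ⟨p, hp, hdvd⟩ := Nat.exists_prime_and_dvd hne; have : Fact p.Prime := ⟨hp⟩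
  obtain ⟨P, hP⟩ := h p this
  refine P.not_dvd_index (hdvd.trans (Subgroup.index_dvd_of_le ?_)); intro x hx
  exact hP ⟨x, hx, rfl⟩

/-- A Sylow subgroup of a nilpotent normal subgroup is a normal `p`-subgroup, so it lies in the
intersection of all Sylow `p`-subgroups. The latter is characteristic and nilpotent, hence has
central commutator subgroup. -/
theorem fittingSubgroup_le_socleAboveCenter [Finite Q] (hQ : CharAbelianCentral Q)
    (hZ : IsCyclic (center Q)) : fittingSubgroup Q ≤ socleAboveCenter Q := by
  refine sSup_le ?_; rintro M ⟨hMn, hMnil⟩; refine le_of_forall_sylow_le fun p hp => ?_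
  have hsyl := (Group.isNilpotent_of_finite_tfae (G := M)).out 0 3
  let P : Sylow p M := default
  refine ⟨P, ?_⟩; have hPn : (P : Subgroup M).Normal := hsyl.1 hMnil p hp P
  have hPc : (P : Subgroup M).Characteristic := P.characteristic_of_normal hPn
  have h1 : (P : Subgroup M).map M.subtype ≤ sylowCore p Q := by
    refine le_sylowCore inferInstance ?_; exact P.isPGroup'.map _
  refine h1.trans (le_socleAboveCenter_of_commutator_le hQ hZ inferInstance ?_)
  exact commutator_le_center_of_isNilpotent hQ inferInstance (isPGroup_sylowCore p).isNilpotent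

/-- The image of `N ∩ X` in the simple group `X/Z(X)` is trivial or everything. In the second case
`X = (N ∩ X) Z(X)`, central factors drop out of commutators, and so `X = [X, X] ≤ N`. -/
theorem IsQuasisimple.le_or_commutator_eq_bot_of_normal {X N : Subgroup Q} (hX : IsQuasisimple X)
    (hN : (N.subgroupOf X).Normal) : X ≤ N ∨ ⁅X, N ⊓ X⁆ = ⊥ := by
  obtain ⟨hperf, hsimple⟩ := hX; have hsurj := QuotientGroup.mk'_surjective (center X)
  rcases (hN.map (QuotientGroup.mk' (center X)) hsurj).eq_bot_or_eq_top with h | h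
  · right; rw [Subgroup.map_eq_bot_iff, QuotientGroup.ker_mk'] at h
    rw [commutator_comm, commutator_eq_bot_iff_le_centralizer]; rintro x ⟨hxN, hxX⟩
    rw [mem_centralizer_iff]; intro y hy
    have := mem_center_iff.1 (h (show (⟨x, hxX⟩ : X) ∈ N.subgroupOf X from hxN)) ⟨y, hy⟩
    exact congrArg Subtype.val this
  · left
    have h1 : N.subgroupOf X ⊔ center X = ⊤ := by
      have h2 := congrArg (Subgroup.comap (QuotientGroup.mk' (center X))) h
      rw [QuotientGroup.comap_map_mk', Subgroup.comap_top, sup_comm] at h2; exact h2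
    have h3 : (⊤ : Subgroup X) ≤ N.subgroupOf X := by
      rw [← hperf.commutator_eq_top, commutator_def, ← h1, commutator_le]; intro a ha b hb
      obtain ⟨n, hn, z, hz, rfl⟩ := mem_sup_of_normal_left.1 ha
      obtain ⟨m, hm, w, hw, rfl⟩ := mem_sup_of_normal_left.1 hb
      have e1 : ⁅n * z, m * w⁆ = ⁅n, m⁆ := by
        have hz' := mem_center_iff.1 hz; have hw' := mem_center_iff.1 hw
        have hzi := mem_center_iff.1 (inv_mem hz)
        have hwi := mem_center_iff.1 (inv_mem hw)
        simp only [commutatorElement_def, mul_inv_rev]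
        calc n * z * (m * w) * (z⁻¹ * n⁻¹) * (w⁻¹ * m⁻¹)
            = n * (z * m) * w * z⁻¹ * n⁻¹ * (w⁻¹ * m⁻¹) := by simp only [mul_assoc]
          _ = n * m * (z * (w * z⁻¹)) * (n⁻¹ * w⁻¹) * m⁻¹ := by rw [← hz' m]; simp only [mul_assoc]
          _ = n * m * (w * (w⁻¹ * n⁻¹)) * m⁻¹ := by
            rw [hzi w, ← mul_assoc z, mul_inv_cancel, one_mul, hwi n⁻¹]; simp only [mul_assoc]
          _ = _ := by simp only [mul_assoc, mul_inv_cancel_left]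
      rw [e1, commutatorElement_def]
      exact mul_mem (mul_mem (mul_mem hn hm) (inv_mem hn)) (inv_mem hm)
    exact subgroupOf_eq_top.1 (top_le_iff.1 h3)

/-- The three subgroups lemma gives `[[X, X], N] = 1`, and `[X, X] = X`. -/
theorem commutator_eq_bot_of_perfect {X N : Subgroup Q} (hX : ⁅X, X⁆ = X) (h : ⁅⁅X, N⁆, X⁆ = ⊥) :
    ⁅X, N⁆ = ⊥ := by
  have h1 : ⁅⁅X, X⁆, N⁆ = ⊥ := by
    apply commutator_commutator_eq_bot_of_rotate h; rw [commutator_comm N]; exact h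
  rwa [hX] at h1

/-- A subnormal quasisimple subgroup is contained in, or centralises, each normal subgroup. -/
theorem IsQuasisimple.le_or_commutator_eq_bot {X N : Subgroup Q} (hX : IsQuasisimple X)
    (hs : X.IsSubnormal) (hN : N.Normal) : X ≤ N ∨ ⁅X, N⁆ = ⊥ := by
  have hperf : ⁅X, X⁆ = X := Subgroup.isPerfect_iff.1 hX.1
  -- Induction up a subnormal chain from `X` to the whole group. At a step `L ⊴ K`, `[X, N ∩ K]`
  -- lies in `N ∩ L`, which already commutes with `X`; perfectness of `X` then gives `[X, N ∩ K] =
  -- 1`.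
  have key : ∀ K : Subgroup Q, K.IsSubnormal → X ≤ K → (X ≤ N ∨ ⁅X, N ⊓ K⁆ = ⊥) →
      X ≤ N ∨ ⁅X, N⁆ = ⊥ := by
    intro K hK; induction hK with
    | top => intro _ h; rwa [inf_top_eq] at h
    | step L K hLK _ hLn ih =>
      intro hXL h; refine ih (hXL.trans hLK) ?_; rcases h with h | h
      · exact Or.inl h
      · right; apply commutator_eq_bot_of_perfect hperf
        have h1 : ⁅X, N ⊓ K⁆ ≤ N ⊓ L := by
          refine le_inf ?_ ?_
          · exact (commutator_mono le_rfl inf_le_left).trans (commutator_le_right X N)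
          · rw [commutator_le]; rintro x hx y ⟨-, hy⟩
            have hc := hLn.conj_mem ⟨x⁻¹, hLK (inv_mem (hXL hx))⟩ (inv_mem (hXL hx)) ⟨y, hy⟩
            have hc' : y * x⁻¹ * y⁻¹ ∈ L := hc
            rw [commutatorElement_def, mul_assoc, mul_assoc, ← mul_assoc y]
            exact mul_mem (hXL hx) hc'
        rw [← le_bot_iff, ← h, commutator_comm]; exact commutator_mono le_rfl h1
  refine key X hs le_rfl ?_; exact hX.le_or_commutator_eq_bot_of_normal inferInstance

/-- A component that is not contained in the socle would centralise it, and the centraliser of the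
socle is the centre. -/
theorem layer_le_socleAboveCenter [Finite Q] (hQ : CharAbelianCentral Q) : layer Q ≤
    socleAboveCenter Q := by
  refine sSup_le ?_; rintro X ⟨hs, hX⟩
  rcases hX.le_or_commutator_eq_bot hs (inferInstance : (socleAboveCenter Q).Normal) with h | h
  · exact h
  · rw [commutator_eq_bot_iff_le_centralizer, centralizer_socleAboveCenter hQ] at h
    exact h.trans center_le_socleAboveCenter

end FittingSubgroup

/-! ### Characteristically simple groups -/

section CharacteristicallySimple

theorem exists_type_zero_mulEquiv (T : Type*) [Group T] [Finite T] : ∃ (T' : Type)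
    (_ : Group T'), Nonempty (T ≃* T') := by
  exact ⟨Shrink.{0} T, inferInstance, ⟨(Shrink.mulEquiv).symm⟩⟩

/-- A nonabelian finite group without proper nontrivial characteristic subgroups is a direct power
of a nonabelian simple group. -/
theorem exists_mulEquiv_pi_of_characteristicallySimple {Q : Type*} [Group Q] [Finite Q]
    (h : ∀ A : Subgroup Q, A.Characteristic → A = ⊥ ∨ A = ⊤) (hna : ¬ ∀ x y : Q, x * y = y * x) : ∃
    (s : ℕ) (T : Type) (_ : Group T), IsSimpleGroup T ∧ (¬ ∀ x y : T, x * y = y * x) ∧ Nonempty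
      (Q ≃* (Fin s → T)) := by
  classical
  have hcen : center Q = ⊥ := by
    refine (h (center Q) inferInstance).resolve_right fun htop => hna fun x y => ?_
    exact (mem_center_iff.1 (htop ▸ mem_top x : x ∈ center Q) y).symm
  have hnt : Nontrivial Q := by
    by_contra hs; rw [not_nontrivial_iff_subsingleton] at hs
    exact hna fun x y => Subsingleton.elim _ _
  obtain ⟨T₀, -, hT₀⟩ := (Set.toFinite {L : Subgroup Q | L.Normal ∧ L ≠ ⊥}).exists_le_minimal
    (show (⊤ : Subgroup Q) ∈ {L : Subgroup Q | L.Normal ∧ L ≠ ⊥} from ⟨inferInstance, top_ne_bot⟩)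
  -- The orbit of a minimal normal subgroup `T₀` under automorphisms. Its join is characteristic,
  -- hence everything, and distinct members intersect trivially and therefore commute.
  let ι := {T : Subgroup Q // ∃ φ : Q ≃* Q, T = T₀.map φ.toMonoidHom}
  have hn : ∀ i : ι, (i : Subgroup Q).Normal := by
    rintro ⟨_, φ, rfl⟩; exact hT₀.1.1.map _ φ.surjective
  have hmin : ∀ (i : ι) (L : Subgroup Q), L.Normal → L ≤ i → L = ⊥ ∨ L = i := by
    rintro ⟨_, φ, rfl⟩ L hL hLi; by_cases hb : L = ⊥
    · exact Or.inl hb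
    · right; refine le_antisymm hLi ?_
      have h1 : T₀ ≤ L.map φ.symm.toMonoidHom := by
        refine hT₀.2 ⟨hL.map _ φ.symm.surjective, ?_⟩ ?_
        · rwa [Ne, Subgroup.map_eq_bot_iff_of_injective _ φ.symm.injective]
        · rintro _ ⟨x, hx, rfl⟩; obtain ⟨y, hy, hyx⟩ := hLi hx
          have : φ.symm x = y := by rw [← hyx]; exact φ.symm_apply_apply y
          change φ.symm x ∈ T₀; rwa [this]
      rintro _ ⟨y, hy, rfl⟩; obtain ⟨x, hx, hxy⟩ := h1 hy
      have : φ y = x := by rw [← hxy]; exact φ.apply_symm_apply x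
      change φ y ∈ L; rwa [this]
  have htop : ⨆ i : ι, (i : Subgroup Q) = ⊤ := by
    refine (h _ ?_).resolve_left fun hb => hT₀.1.2 ?_
    · rw [characteristic_iff_map_le]; intro φ; rw [Subgroup.map_iSup]
      refine iSup_le fun i => ?_; obtain ⟨_, ψ, rfl⟩ := i
      refine le_iSup_of_le (⟨_, ψ.trans φ, rfl⟩ : ι) ?_; rw [Subgroup.map_map]
      exact le_rfl
    · rw [← le_bot_iff, ← hb]
      exact le_iSup_of_le (⟨T₀, MulEquiv.refl Q, (Subgroup.map_id T₀).symm⟩ : ι) le_rfl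
  have hcomm : Pairwise fun i j : ι => ∀ x y : Q, x ∈ (i : Subgroup Q) → y ∈ (j : Subgroup Q) →
      Commute x y := by
    intro i j hij; refine Subgroup.commute_of_normal_of_disjoint _ _ (hn i) (hn j) ?_
    rw [disjoint_iff]; have := hn i; have := hn j
    refine (hmin i (i ⊓ j : Subgroup Q) inferInstance inf_le_left).resolve_right fun h1 => ?_
    rcases hmin j (i : Subgroup Q) (hn i) (inf_eq_left.1 h1) with h2 | h2
    · have h3 := hmin i ⊥; obtain ⟨_, φ, rfl⟩ := i
      rw [Subgroup.map_eq_bot_iff_of_injective _ φ.injective] at h2; exact hT₀.1.2 h2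
    · exact hij (Subtype.ext h2)
  have hcentral : ∀ x : Q, (∀ i : ι, ∀ y ∈ (i : Subgroup Q), x * y = y * x) → x = 1 := by
    intro x hx
    have : ⨆ i : ι, (i : Subgroup Q) ≤ centralizer {x} := by
      refine iSup_le fun i y hy => ?_; rw [mem_centralizer_singleton_iff]
      exact (hx i y hy).symm
    rw [htop] at this; rw [← Subgroup.mem_bot, ← hcen, mem_center_iff]; intro y
    exact mem_centralizer_singleton_iff.1 (this (mem_top y))
  -- An element of one member that also lies in the join of the others commutes with every member,
  -- hence with the whole group, whose centre is trivial.
  have hind : iSupIndep fun i : ι => (i : Subgroup Q) := by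
    intro i; rw [disjoint_iff, eq_bot_iff]; rintro x ⟨hx, hx'⟩; rw [Subgroup.mem_bot]
    refine hcentral x fun j y hy => ?_; by_cases hij : i = j
    · subst hij
      have : (⨆ (j : ι) (_ : j ≠ i), (j : Subgroup Q)) ≤ centralizer {y} := by
        refine iSup₂_le fun j hj z hz => ?_; rw [mem_centralizer_singleton_iff]
        exact hcomm hj z y hz hy
      exact mem_centralizer_singleton_iff.1 (this hx')
    · exact hcomm hij x y hx hy
  have : Fintype ι := Fintype.ofFinite ι
  let E : (∀ i : ι, (i : Subgroup Q)) ≃* Q := MulEquiv.ofBijective (Subgroup.noncommPiCoprod hcomm)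
    ⟨Subgroup.injective_noncommPiCoprod_of_iSupIndep hind, by
      rw [← MonoidHom.range_eq_top, Subgroup.noncommPiCoprod_range, htop]⟩
  have hiso : ∀ i : ι, Nonempty ((i : Subgroup Q) ≃* T₀) := by
    rintro ⟨_, φ, rfl⟩; exact ⟨(T₀.equivMapOfInjective φ.toMonoidHom φ.injective).symm⟩
  let i₀ : ι := ⟨T₀, MulEquiv.refl Q, (Subgroup.map_id T₀).symm⟩
  have hT₀na : ¬ ∀ x y : T₀, x * y = y * x := by
    intro hab
    refine hT₀.1.2 ((Subgroup.eq_bot_iff_forall _).2 fun x hx => hcentral x fun j y hy => ?_)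
    by_cases hij : i₀ = j
    · subst hij; exact congrArg Subtype.val (hab ⟨x, hx⟩ ⟨y, hy⟩)
    · exact hcomm hij x y hx hy
  have hT₀nt : Nontrivial T₀ := by rw [Subgroup.nontrivial_iff_ne_bot]; exact hT₀.1.2
  -- A normal subgroup of `T₀` is centralised by the other members of the orbit, so it is normal in
  -- the whole group.
  have hT₀s : IsSimpleGroup T₀ := by
    refine ⟨fun L hL => ?_⟩
    have hLn : (L.map T₀.subtype).Normal := by
      rw [← normalizer_eq_top_iff, eq_top_iff, ← htop]; refine iSup_le fun j y hy => ?_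
      have hnorm : ∀ z ∈ (j : Subgroup Q), ∀ x ∈ L.map T₀.subtype,
          z * x * z⁻¹ ∈ L.map T₀.subtype := by
        rintro z hz _ ⟨x, hx, rfl⟩; by_cases hij : i₀ = j
        · subst hij; exact ⟨_, hL.conj_mem x hx ⟨z, hz⟩, rfl⟩
        · have hc := hcomm hij x z x.2 hz; refine ⟨x, hx, ?_⟩
          change (x : Q) = z * x * z⁻¹; rw [← hc.eq, mul_inv_cancel_right]
      rw [mem_normalizer_iff]; intro x; refine ⟨hnorm y hy x, fun hx => ?_⟩
      have := hnorm y⁻¹ (inv_mem hy) _ hx; simpa [mul_assoc] using this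
    rcases hmin i₀ _ hLn (map_subtype_le L) with h1 | h1
    · left; exact (Subgroup.map_eq_bot_iff_of_injective _ T₀.subtype_injective).1 h1
    · right; rw [eq_top_iff]; intro x _
      obtain ⟨y, hy, hyx⟩ := (h1.ge x.2 : (x : Q) ∈ L.map T₀.subtype)
      rwa [← Subtype.ext hyx]
  obtain ⟨T, hTg, ⟨τ⟩⟩ := exists_type_zero_mulEquiv T₀; let e := Finite.equivFin ι
  refine ⟨Nat.card ι, T, hTg, τ.symm.isSimpleGroup,
    fun hab => hT₀na fun x y => τ.injective (by rw [map_mul, map_mul, hab]), ⟨?_⟩⟩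
  exact (E.symm.trans (MulEquiv.piCongrRight fun i => (hiso i).some.trans τ)).trans
    (MulEquiv.arrowCongr e (MulEquiv.refl T))

end CharacteristicallySimple

/-! ### Quasisimple groups as derived groups of central extensions -/

section Quasisimple

theorem IsQuasisimple.of_mulEquiv {X Y : Type*} [Group X] [Group Y] (e : X ≃* Y)
    (h : IsQuasisimple X) : IsQuasisimple Y := by
  obtain ⟨h1, h2⟩ := h
  refine ⟨Group.IsPerfect.ofSurjective (f := e.toMonoidHom) e.surjective, ?_⟩
  have hc : (center X).map e.toMonoidHom = center Y := by
    ext y; simp only [Subgroup.mem_map, mem_center_iff]; constructor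
    · rintro ⟨x, hx, rfl⟩ z; have := congrArg e (hx (e.symm z)); simpa using this
    · intro hy; refine ⟨e.symm y, fun z => e.injective ?_, e.apply_symm_apply y⟩
      simpa using hy (e z)
  exact (QuotientGroup.congr (center X) (center Y) e hc).symm.isSimpleGroup

section CentralExtension

variable {X : Type*} [Group X] {T : Type*} [Group T] [IsSimpleGroup T] {f : X →* T}

theorem center_eq_bot_of_isSimpleGroup (hT : ¬ ∀ x y : T, x * y = y * x) : center T = ⊥ := by
  rcases (inferInstance : (center T).Normal).eq_bot_or_eq_top with h | h
  · exact h
  · exact absurd (fun x y => (mem_center_iff.1 (h ▸ mem_top x : x ∈ center T) y).symm) hT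

theorem ker_eq_center_of_surjective (hf : Surjective f) (hker : f.ker ≤ center X)
    (hT : ¬ ∀ x y : T, x * y = y * x) : f.ker = center X := by
  refine le_antisymm hker fun x hx => ?_
  rw [MonoidHom.mem_ker, ← Subgroup.mem_bot, ← center_eq_bot_of_isSimpleGroup hT, mem_center_iff]
  intro y; obtain ⟨z, rfl⟩ := hf y; rw [← map_mul, ← map_mul, mem_center_iff.1 hx]

theorem map_commutator_eq_top (hf : Surjective f) (hT : ¬ ∀ x y : T, x * y = y * x) :
    (commutator X).map f = ⊤ := by
  have h1 : (commutator X).map f = commutator T := by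
    rw [commutator_def, map_commutator, ← MonoidHom.range_eq_map, MonoidHom.range_eq_top.2 hf]
    rfl
  rw [h1]
  refine ((inferInstance : (commutator T).Normal).eq_bot_or_eq_top).resolve_left fun h => hT ?_
  intro x y; rw [← commutatorElement_eq_one_iff_mul_comm, ← Subgroup.mem_bot, ← h]
  exact commutator_mem_commutator (mem_top x) (mem_top y)

/-- The derived group already maps onto `T`, and the kernel is central. -/
theorem center_sup_commutator (hf : Surjective f) (hker : f.ker ≤ center X)
    (hT : ¬ ∀ x y : T, x * y = y * x) : center X ⊔ commutator X = ⊤ := by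
  rw [eq_top_iff]; intro x _
  obtain ⟨y, hy, hyx⟩ := (map_commutator_eq_top hf hT).ge (mem_top (f x))
  have h1 : x * y⁻¹ ∈ f.ker := by rw [MonoidHom.mem_ker, map_mul, map_inv, hyx, mul_inv_cancel]
  have := mul_mem_sup (hker h1) hy; rwa [inv_mul_cancel_right] at this

/-- The derived group of a central extension of a nonabelian simple group is quasisimple. -/
theorem isQuasisimple_commutator (hf : Surjective f) (hker : f.ker ≤ center X)
    (hT : ¬ ∀ x y : T, x * y = y * x) : IsQuasisimple (commutator X) := by
  have htop := center_sup_commutator hf hker hT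
  have hperf : ⁅commutator X, commutator X⁆ = commutator X := by
    apply le_antisymm (commutator_le_left _ _); have h0 : commutator X =
        ⁅center X ⊔ commutator X, center X ⊔ commutator X⁆ := by rw [htop, commutator_def]
    refine h0.le.trans (commutator_le.2 ?_); intro a ha b hb
    obtain ⟨z, hz, n, hn, rfl⟩ := mem_sup_of_normal_left.1 ha
    obtain ⟨w, hw, m, hm, rfl⟩ := mem_sup_of_normal_left.1 hb
    have e1 : ⁅z * n, w * m⁆ = ⁅n, m⁆ := by
      have hz0 : ∀ y : X, ⁅z, y⁆ = 1 := fun y =>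
        commutatorElement_eq_one_iff_mul_comm.2 (mem_center_iff.1 hz y).symm
      have hw0 : ∀ y : X, ⁅y, w⁆ = 1 := fun y =>
        commutatorElement_eq_one_iff_mul_comm.2 (mem_center_iff.1 hw y)
      have h1 : ⁅n, w * m⁆ = ⁅n, m⁆ := by
        have : ⁅n, w * m⁆ = ⁅n, w⁆ * (w * ⁅n, m⁆ * w⁻¹) := by
          simp only [commutatorElement_def]; group
        rw [this, hw0, one_mul, ← mem_center_iff.1 hw, mul_inv_cancel_right]
      have : ⁅z * n, w * m⁆ = (z * ⁅n, w * m⁆ * z⁻¹) * ⁅z, w * m⁆ := by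
        simp only [commutatorElement_def]; group
      rw [this, hz0, mul_one, ← mem_center_iff.1 hz, mul_inv_cancel_right, h1]
    rw [e1]; exact commutator_mem_commutator hn hm
  refine ⟨Subgroup.isPerfect_iff.2 hperf, ?_⟩
  let g : commutator X →* T := f.comp (commutator X).subtype
  have hg : Surjective g := by
    intro t; obtain ⟨y, hy, hyt⟩ := (map_commutator_eq_top hf hT).ge (mem_top t)
    exact ⟨⟨y, hy⟩, hyt⟩
  have hgker : g.ker = center (commutator X) := by
    refine ker_eq_center_of_surjective hg (fun x hx => ?_) hT; rw [mem_center_iff]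
    intro y; exact Subtype.ext (mem_center_iff.1 (hker hx) y)
  exact ((QuotientGroup.quotientMulEquivOfEq hgker).symm.trans
    (QuotientGroup.quotientKerEquivOfSurjective g hg)).isSimpleGroup

end CentralExtension

end Quasisimple

/-! ### Central extensions of direct powers of a simple group -/

section FactorSubgroups

variable {X : Type*} [Group X] {s : ℕ} {T : Type*} [Group T] (f : X →* (Fin s → T))

/-- The preimage of the `j`-th factor under a homomorphism to a direct power. -/
def factorSubgroup (j : Fin s) : Subgroup X where
  carrier := {x | ∀ i, i ≠ j → f x i = 1}
  one_mem' := fun i _ => by rw [map_one]; rfl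
  mul_mem' := fun {a b} ha hb i hi => by rw [map_mul, Pi.mul_apply, ha i hi, hb i hi, mul_one]
  inv_mem' := fun {a} ha i hi => by rw [map_inv, Pi.inv_apply, ha i hi, inv_one]

variable {f}

instance factorSubgroup_normal (j : Fin s) : (factorSubgroup f j).Normal := by
  refine ⟨fun x hx g i hi => ?_⟩
  rw [map_mul, map_mul, Pi.mul_apply, Pi.mul_apply, hx i hi, mul_one, map_inv, Pi.inv_apply,
    mul_inv_cancel]

theorem ker_le_factorSubgroup (j : Fin s) : f.ker ≤ factorSubgroup f j := by
  intro x hx i _; rw [MonoidHom.mem_ker.1 hx]; rfl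

variable (f) in
/-- The `j`-th coordinate on the `j`-th factor subgroup. -/
def factorHom (j : Fin s) : factorSubgroup f j →* T :=
  ((Pi.evalMonoidHom (fun _ => T) j).comp f).comp (factorSubgroup f j).subtype

theorem factorHom_apply (j : Fin s) (x : factorSubgroup f j) : factorHom f j x = f x j := rfl

theorem factorHom_eq_one_iff (j : Fin s) (x : factorSubgroup f j) : factorHom f j x = 1 ↔ (x : X) ∈
    f.ker := by
  rw [factorHom_apply, MonoidHom.mem_ker]; constructor
  · intro h; funext i; by_cases hi : i = j
    · subst hi; exact h
    · exact x.2 i hi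
  · intro h; rw [h]; rfl

theorem exists_mem_factorSubgroup (hf : Surjective f) (j : Fin s) (t : T) : ∃ x ∈ factorSubgroup f
    j, f x j = t := by
  obtain ⟨x, hx⟩ := hf (Pi.mulSingle j t); refine ⟨x, fun i hi => ?_, ?_⟩
  · rw [hx, Pi.mulSingle_eq_of_ne hi]
  · rw [hx, Pi.mulSingle_eq_same]

theorem factorHom_surjective (hf : Surjective f) (j : Fin s) : Surjective (factorHom f j) := by
  intro t; obtain ⟨x, hx, h⟩ := exists_mem_factorSubgroup hf j t; exact ⟨⟨x, hx⟩, h⟩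

theorem ker_factorHom_le_center (hker : f.ker ≤ center X) (j : Fin s) :
    (factorHom f j).ker ≤ center (factorSubgroup f j) := by
  intro x hx; rw [mem_center_iff]; intro y
  exact Subtype.ext (mem_center_iff.1 (hker ((factorHom_eq_one_iff j x).1 hx)) y)

theorem ker_sup_iSup_factorSubgroup (hf : Surjective f) : f.ker ⊔ ⨆ j, factorSubgroup f j = ⊤ := by
  rw [eq_top_iff]; have key : ∀ (S : Finset (Fin s)) (x : X), (∀ i, i ∉ S → f x i = 1) →
      x ∈ f.ker ⊔ ⨆ j, factorSubgroup f j := by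
    intro S; induction S using Finset.induction_on with
    | empty =>
      intro x hx
      exact mem_sup_left (MonoidHom.mem_ker.2 (funext fun i => hx i (Finset.notMem_empty i)))
    | insert j S hj ih =>
      intro x hx; obtain ⟨y, hy, hyx⟩ := exists_mem_factorSubgroup hf j (f x j)
      have h1 : x * y⁻¹ ∈ f.ker ⊔ ⨆ j, factorSubgroup f j := by
        refine ih _ fun i hi => ?_; rw [map_mul, map_inv, Pi.mul_apply, Pi.inv_apply]
        by_cases hij : i = j
        · subst hij; rw [hyx, mul_inv_cancel]
        · rw [hy i hij, hx i (by simp [hi, hij])]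
          simp
      have h2 : y ∈ f.ker ⊔ ⨆ j, factorSubgroup f j := mem_sup_right (mem_iSup_of_mem j hy)
      have := mul_mem h1 h2; rwa [inv_mul_cancel_right] at this
  exact fun x _ => key Finset.univ x fun i hi => absurd (Finset.mem_univ i) hi

theorem commutator_factorSubgroup_le_ker {i j : Fin s} (hij : i ≠ j) : ⁅factorSubgroup f i,
    factorSubgroup f j⁆ ≤ f.ker := by
  rw [commutator_le]; intro x hx y hy; rw [MonoidHom.mem_ker, map_commutatorElement]
  funext k
  rw [commutatorElement_def, Pi.mul_apply, Pi.mul_apply, Pi.mul_apply, Pi.inv_apply, Pi.inv_apply,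
    Pi.one_apply]
  by_cases hk : k = i
  · rw [hy k (hk ▸ hij)]; simp
  · rw [hx k hk]; simp

variable [IsSimpleGroup T]

/-- Write `K_i`, `K_j` for the two factor subgroups. Then `[K_i, K_j]` is central, so the three
subgroups lemma gives `[[K_i, K_i], K_j] = 1`. Moreover `K_i` is its derived group times elements
centralising `K_i`; these map into the trivial centre of `T`, so they lie in the kernel and are
central in `X`. -/
theorem commutator_factorSubgroup_eq_bot (hf : Surjective f) (hker : f.ker ≤ center X)
    (hT : ¬ ∀ x y : T, x * y = y * x) {i j : Fin s} (hij : i ≠ j) : ⁅factorSubgroup f i,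
    factorSubgroup f j⁆ = ⊥ := by
  have hle : ∀ {i j : Fin s}, i ≠ j → ⁅factorSubgroup f i, factorSubgroup f j⁆ ≤ center X :=
    fun h => (commutator_factorSubgroup_le_ker h).trans hker
  have htop := center_sup_commutator (factorHom_surjective hf i) (ker_factorHom_le_center hker i) hT
  have h1 : factorSubgroup f i ≤ centralizer (factorSubgroup f i : Set X) ⊔
      ⁅factorSubgroup f i, factorSubgroup f i⁆ := by
    have h2 := congrArg (Subgroup.map (factorSubgroup f i).subtype) htop
    rw [Subgroup.map_sup, commutator_def, map_commutator, ← MonoidHom.range_eq_map,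
      range_subtype] at h2
    conv_lhs => rw [← h2]
    refine sup_le_sup_right ?_ _; rintro _ ⟨z, hz, rfl⟩; rw [mem_centralizer_iff]
    intro y hy; exact congrArg Subtype.val (mem_center_iff.1 hz ⟨y, hy⟩)
  have h3 : ⁅⁅factorSubgroup f i, factorSubgroup f i⁆, factorSubgroup f j⁆ = ⊥ := by
    apply commutator_commutator_eq_bot_of_rotate
    · rw [commutator_eq_bot_iff_le_centralizer]
      exact (hle hij).trans (center_le_centralizer _)
    · rw [commutator_eq_bot_iff_le_centralizer]
      exact (hle hij.symm).trans (center_le_centralizer _)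
  have hcen : ∀ z ∈ factorSubgroup f i, (∀ x ∈ factorSubgroup f i, x * z = z * x) →
      z ∈ center X := by
    intro z hz hzc; apply hker; refine (factorHom_eq_one_iff i ⟨z, hz⟩).1 ?_
    rw [← Subgroup.mem_bot, ← center_eq_bot_of_isSimpleGroup hT, mem_center_iff]; intro t
    obtain ⟨x, rfl⟩ := factorHom_surjective hf i t; rw [← map_mul, ← map_mul]
    exact congrArg _ (Subtype.ext (hzc x x.2))
  have h5 : factorSubgroup f i ≤ center X ⊔ ⁅factorSubgroup f i, factorSubgroup f i⁆ := by
    intro x hx; obtain ⟨z, hz, d, hd, rfl⟩ := mem_sup_of_normal_right.1 (h1 hx)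
    have hdi := commutator_le_left (factorSubgroup f i) (factorSubgroup f i) hd
    have hzi : z ∈ factorSubgroup f i := by
      have := mul_mem hx (inv_mem hdi); rwa [mul_inv_cancel_right] at this
    exact mul_mem_sup (hcen z hzi (mem_centralizer_iff.1 hz)) hd
  rw [commutator_eq_bot_iff_le_centralizer] at h3 ⊢
  exact h5.trans (sup_le (center_le_centralizer _) h3)

/-- Take an element of `L` with a nontrivial `i`-th coordinate. Its commutator with a suitable
element of the `i`-th factor subgroup is an element of `L` in that factor with nontrivial image in
`T`. By simplicity `L` covers `T`, and `L` contains the kernel. -/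
theorem exists_factorSubgroup_le (hf : Surjective f) (hT : ¬ ∀ x y : T, x * y = y * x)
    {L : Subgroup X} (hL : L.Normal) (hker : f.ker < L) : ∃ i, factorSubgroup f i ≤ L := by
  obtain ⟨x, hx, hxk⟩ := Set.exists_of_ssubset hker
  obtain ⟨i, hi⟩ : ∃ i, f x i ≠ 1 := by
    by_contra! h; exact hxk (MonoidHom.mem_ker.2 (funext h))
  refine ⟨i, ?_⟩
  obtain ⟨t, ht⟩ : ∃ t, t * f x i ≠ f x i * t := by
    by_contra! h
    exact hi (by rw [← Subgroup.mem_bot, ← center_eq_bot_of_isSimpleGroup hT, mem_center_iff]; exact h)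
  obtain ⟨m, hm, hmt⟩ := exists_mem_factorSubgroup hf i t
  have hc : ⁅m, x⁆ ∈ L ⊓ factorSubgroup f i := by
    constructor
    · exact L.mul_mem (hL.conj_mem x hx m) (L.inv_mem hx)
    · rw [commutatorElement_def, mul_assoc, mul_assoc, ← mul_assoc x]
      exact mul_mem hm ((factorSubgroup_normal i).conj_mem _ (inv_mem hm) x)
  let N : Subgroup T := (L.subgroupOf (factorSubgroup f i)).map (factorHom f i)
  have hN : N.Normal := Subgroup.Normal.map inferInstance _ (factorHom_surjective hf i)
  have hNtop : N = ⊤ := by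
    refine hN.eq_bot_or_eq_top.resolve_left fun h => ht ?_
    have h1 : factorHom f i ⟨_, hc.2⟩ ∈ N := ⟨⟨_, hc.2⟩, hc.1, rfl⟩
    rw [h, Subgroup.mem_bot, factorHom_apply, map_commutatorElement] at h1; rw [← hmt]
    exact commutatorElement_eq_one_iff_mul_comm.1 h1
  intro y hy; obtain ⟨z, hz, hzy⟩ := hNtop.ge (mem_top (factorHom f i ⟨y, hy⟩))
  have h1 : (⟨y, hy⟩ * z⁻¹ : factorSubgroup f i) ∈ (factorHom f i).ker := by
    rw [MonoidHom.mem_ker, map_mul, map_inv, hzy, mul_inv_cancel]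
  have h2 : y * (z : X)⁻¹ ∈ L := hker.le ((factorHom_eq_one_iff i _).1 h1)
  have := mul_mem h2 (show (z : X) ∈ L from hz); rwa [inv_mul_cancel_right] at this

theorem eq_of_factorSubgroup_le (hf : Surjective f) {i j : Fin s}
    (h : factorSubgroup f i ≤ factorSubgroup f j) : i = j := by
  by_contra hij; obtain ⟨t, ht⟩ := exists_ne (1 : T)
  obtain ⟨x, hx, hxt⟩ := exists_mem_factorSubgroup hf i t; exact ht (hxt ▸ h hx i hij)

theorem ker_lt_factorSubgroup (hf : Surjective f) (j : Fin s) : f.ker < factorSubgroup f j := by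
  refine lt_of_le_of_ne (ker_le_factorSubgroup j) fun h => ?_
  obtain ⟨t, ht⟩ := exists_ne (1 : T)
  obtain ⟨x, hx, hxt⟩ := exists_mem_factorSubgroup hf j t
  rw [← h, MonoidHom.mem_ker] at hx; exact ht (by rw [← hxt, hx]; rfl)

/-- Automorphisms preserving the kernel permute the factor subgroups. -/
theorem exists_map_factorSubgroup_eq (hf : Surjective f) (hT : ¬ ∀ x y : T, x * y = y * x)
    (φ : X ≃* X) (hφ : f.ker.map φ.toMonoidHom = f.ker) (j : Fin s) : ∃ i,
    (factorSubgroup f j).map φ.toMonoidHom = factorSubgroup f i := by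
  have hφ' : f.ker.map φ.symm.toMonoidHom = f.ker := by
    conv_lhs => rw [← hφ]
    rw [Subgroup.map_map]; convert Subgroup.map_id _
    ext x; exact φ.symm_apply_apply x
  have key : ∀ (ψ : X ≃* X), f.ker.map ψ.toMonoidHom = f.ker → ∀ j,
      ∃ i, factorSubgroup f i ≤ (factorSubgroup f j).map ψ.toMonoidHom := by
    intro ψ hψ j
    refine exists_factorSubgroup_le hf hT ((factorSubgroup_normal j).map _ ψ.surjective) ?_
    conv_lhs => rw [← hψ]
    exact (map_lt_map_iff_of_injective ψ.injective).2 (ker_lt_factorSubgroup hf j)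
  obtain ⟨i, hi⟩ := key φ hφ j; obtain ⟨k, hk⟩ := key φ.symm hφ' i
  have h1 : (factorSubgroup f i).map φ.symm.toMonoidHom ≤ factorSubgroup f j := by
    rintro _ ⟨x, hx, rfl⟩; obtain ⟨y, hy, hyx⟩ := hi hx
    have : φ.symm x = y := by rw [← hyx]; exact φ.symm_apply_apply y
    change φ.symm x ∈ factorSubgroup f j; rwa [this]
  obtain rfl := eq_of_factorSubgroup_le hf (hk.trans h1); refine ⟨i, le_antisymm ?_ hi⟩
  rintro _ ⟨y, hy, rfl⟩; obtain ⟨x, hx, hxy⟩ := hk hy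
  have : φ y = x := by rw [← hxy]; exact φ.apply_symm_apply x
  change φ y ∈ factorSubgroup f i; rwa [this]

end FactorSubgroups

/-! ### Minimal normal subgroups above the centre, and `F*` -/

section MinimalNormal

variable {Q : Type*} [Group Q]

/-- Characteristic subgroups of the section of a minimal normal subgroup are trivial. -/
theorem IsMinimalAboveCenter.eq_bot_or_eq_top {M : Subgroup Q} (hM : IsMinimalAboveCenter M)
    (A : Subgroup (M ⧸ (center Q).subgroupOf M)) (hA : A.Characteristic) : A = ⊥ ∨ A = ⊤ := by
  have hMn : M.Normal := hM.1.1; set Z := (center Q).subgroupOf M with hZ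
  have hsurj := QuotientGroup.mk'_surjective Z
  let B : Subgroup Q := (A.comap (QuotientGroup.mk' Z)).map M.subtype
  have hmemB : ∀ (m : Q) (hm : m ∈ M), m ∈ B ↔ ((⟨m, hm⟩ : M) : M ⧸ Z) ∈ A := by
    intro m hm; constructor
    · rintro ⟨x, hx, hxm⟩; have : x = ⟨m, hm⟩ := Subtype.ext hxm; rw [← this]; exact hx
    · intro h; exact ⟨⟨m, hm⟩, h, rfl⟩
  have hBM : B ≤ M := map_subtype_le _
  have hBn : B.Normal := by
    refine ⟨fun b hb q => ?_⟩; let φ : M ≃* M := MulAut.conjNormal q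
    have hφ : Z.map φ.toMonoidHom = Z := by
      ext x; constructor
      · rintro ⟨y, hy, rfl⟩; have hy' : (y : Q) ∈ center Q := hy
        have : (φ y : Q) = y := by
          rw [MulAut.conjNormal_apply, mem_center_iff.1 hy' q, mul_inv_cancel_right]
        change (φ y : Q) ∈ center Q; rwa [this]
      · intro hx; have hx' : (x : Q) ∈ center Q := hx; refine ⟨x, hx, Subtype.ext ?_⟩
        change (φ x : Q) = x
        rw [MulAut.conjNormal_apply, mem_center_iff.1 hx' q, mul_inv_cancel_right]
    have hbM := hBM hb; have hqM := hMn.conj_mem b hbM q; rw [hmemB _ hqM]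
    have h1 := (characteristic_iff_le_comap.1 hA (QuotientGroup.congr Z Z φ hφ))
      ((hmemB b hbM).1 hb)
    have h2 : (⟨q * b * q⁻¹, hqM⟩ : M) = φ ⟨b, hbM⟩ := Subtype.ext (by rw [MulAut.conjNormal_apply])
    rw [h2]; exact h1
  have hZB : center Q ≤ B := by
    intro z hz; rw [hmemB z (hM.1.2.le hz)]
    have : ((⟨z, hM.1.2.le hz⟩ : M) : M ⧸ Z) = 1 := (QuotientGroup.eq_one_iff _).2 hz
    rw [this]; exact one_mem A
  by_cases hlt : center Q = B
  · left; rw [eq_bot_iff]; intro a ha; obtain ⟨m, rfl⟩ := hsurj a; rw [Subgroup.mem_bot]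
    refine (QuotientGroup.eq_one_iff _).2 ?_; change (m : Q) ∈ center Q
    rw [hlt, hmemB _ m.2]; exact ha
  · right; rw [eq_top_iff]; intro a _; obtain ⟨m, rfl⟩ := hsurj a
    exact (hmemB m m.2).1 (hM.2 ⟨hBn, lt_of_le_of_ne hZB hlt⟩ hBM m.2)

theorem IsMinimalAboveCenter.comm_or_pi [Finite Q] {M : Subgroup Q} (hM : IsMinimalAboveCenter M) :
    (∀ x y : M ⧸ (center Q).subgroupOf M, x * y = y * x) ∨ ∃ (s : ℕ) (T : Type)
      (_ : Group T), IsSimpleGroup T ∧ (¬ ∀ x y : T, x * y = y * x) ∧ Nonempty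
        ((M ⧸ (center Q).subgroupOf M) ≃* (Fin s → T)) := by
  by_cases h : ∀ x y : M ⧸ (center Q).subgroupOf M, x * y = y * x
  · exact Or.inl h
  · exact Or.inr (exists_mulEquiv_pi_of_characteristicallySimple hM.eq_bot_or_eq_top h)

theorem quotient_comm_iff {M Z : Subgroup Q} [(Z.subgroupOf M).Normal] :
    (∀ x y : M ⧸ Z.subgroupOf M, x * y = y * x) ↔ ⁅M, M⁆ ≤ Z := by
  rw [commutator_le]; constructor
  · intro h x hx y hy; have := h (⟨y, hy⟩ : M)⁻¹ (⟨x, hx⟩ : M)⁻¹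
    rw [← QuotientGroup.mk_inv, ← QuotientGroup.mk_inv, ← QuotientGroup.mk_mul,
      ← QuotientGroup.mk_mul, QuotientGroup.eq, mem_subgroupOf] at this
    simpa [commutatorElement_def, mul_assoc] using this
  · intro h x y; induction x using QuotientGroup.induction_on with | H x => ?_
    induction y using QuotientGroup.induction_on with | H y => ?_
    rw [← QuotientGroup.mk_mul, ← QuotientGroup.mk_mul, QuotientGroup.eq, mem_subgroupOf]
    have h1 := h _ (inv_mem y.2) _ (inv_mem x.2)
    simpa [commutatorElement_def, mul_assoc] using h1

/-- A minimal normal subgroup above the centre with abelian quotient has a prime exponent modulo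
the centre. -/
theorem IsMinimalAboveCenter.exists_prime [Finite Q] {M : Subgroup Q} (hM : IsMinimalAboveCenter M)
    (h : ∀ x y : M ⧸ (center Q).subgroupOf M, x * y = y * x) : ∃ r : ℕ, r.Prime ∧ ∀ x ∈ M, x ^ r ∈
    center Q := by
  set Z := (center Q).subgroupOf M with hZ
  have hne : Nat.card (M ⧸ Z) ≠ 1 := by
    intro h1
    rw [← Subgroup.index_eq_card, Subgroup.index_eq_one, subgroupOf_eq_top] at h1
    exact absurd h1 (not_le_of_gt hM.1.2)
  obtain ⟨r, hr, hdvd⟩ := Nat.exists_prime_and_dvd hne; have : Fact r.Prime := ⟨hr⟩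
  refine ⟨r, hr, ?_⟩; obtain ⟨x, hx⟩ := exists_prime_orderOf_dvd_card' r hdvd
  let A : Subgroup (M ⧸ Z) :=
    { carrier := {x | x ^ r = 1}
      one_mem' := one_pow r
      mul_mem' := fun {a b} ha hb => by
        change (a * b) ^ r = 1; rw [Commute.mul_pow (h a b), ha, hb, one_mul]
      inv_mem' := fun {a} ha => by
        change a⁻¹ ^ r = 1; rw [inv_pow, ha, inv_one] }
  have hA : A.Characteristic := by
    rw [characteristic_iff_le_comap]; intro φ a ha; change φ a ^ r = 1
    rw [← map_pow, show a ^ r = 1 from ha, map_one]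
  have htop : A = ⊤ := by
    refine (hM.eq_bot_or_eq_top A hA).resolve_left fun hb => ?_
    have : x ∈ A := by
      change x ^ r = 1; rw [← hx, pow_orderOf_eq_one]
    rw [hb, Subgroup.mem_bot] at this; rw [this, orderOf_one] at hx; exact hr.one_lt.ne hx
  intro m hm; have h1 : (((⟨m, hm⟩ : M) : M ⧸ Z)) ^ r = 1 := htop.ge (mem_top _)
  rw [← QuotientGroup.mk_pow] at h1
  exact (QuotientGroup.eq_one_iff ((⟨m, hm⟩ : M) ^ r)).1 h1

theorem IsMinimalAboveCenter.le_fittingSubgroup {M : Subgroup Q} (hM : IsMinimalAboveCenter M)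
    (h : ∀ x y : M ⧸ (center Q).subgroupOf M, x * y = y * x) : M ≤ fittingSubgroup Q := by
  refine le_sSup ⟨hM.1.1, ?_⟩
  refine Subgroup.isNilpotent_of_lowerCentralSeries_eq_bot (n := 2) ?_
  change ⁅⁅M, M⁆, M⁆ = ⊥; rw [commutator_eq_bot_iff_le_centralizer]
  exact (quotient_comm_iff.1 h).trans (center_le_centralizer _)

theorem center_le_fittingSubgroup : center Q ≤ fittingSubgroup Q :=
  le_sSup ⟨inferInstance, Subgroup.isNilpotent_of_lowerCentralSeries_eq_bot (n := 1) (by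
    change ⁅center Q, center Q⁆ = ⊥; rw [commutator_eq_bot_iff_le_centralizer]
    exact center_le_centralizer _)⟩

/-- `M` is generated by the kernel and the preimages of the simple factors. Each preimage is its
centre, which is central in `Q`, times its derived group, which is quasisimple and subnormal. -/
theorem IsMinimalAboveCenter.le_layer {M : Subgroup Q} (hM : IsMinimalAboveCenter M) {s : ℕ}
    {T : Type*} [Group T] [IsSimpleGroup T] (hT : ¬ ∀ x y : T, x * y = y * x)
    (e : (M ⧸ (center Q).subgroupOf M) ≃* (Fin s → T)) : M ≤ center Q ⊔ layer Q := by
  have hMn := hM.1.1; let f : M →* (Fin s → T) := e.toMonoidHom.comp (QuotientGroup.mk' _)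
  have hf : Surjective f := e.surjective.comp (QuotientGroup.mk'_surjective _)
  have hfker : f.ker = (center Q).subgroupOf M := by
    have : f.ker = (QuotientGroup.mk' ((center Q).subgroupOf M)).ker := by
      ext x; simp [f, MonoidHom.mem_ker]
    rw [this, QuotientGroup.ker_mk']
  have hker : f.ker ≤ center M := by
    rw [hfker]; intro z hz; rw [mem_center_iff]; intro y
    exact Subtype.ext (mem_center_iff.1 (mem_subgroupOf.1 hz) y)
  have hkerQ : f.ker.map M.subtype ≤ center Q := by
    rw [hfker, subgroupOf_map_subtype]; exact inf_le_left
  have htop := congrArg (Subgroup.map M.subtype) (ker_sup_iSup_factorSubgroup hf)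
  rw [Subgroup.map_sup, Subgroup.map_iSup, ← MonoidHom.range_eq_map, range_subtype] at htop
  conv_lhs => rw [← htop]
  refine sup_le (hkerQ.trans le_sup_left) (iSup_le fun j => ?_)
  let K := factorSubgroup f j
  have hKf := factorHom_surjective hf j; have hKker := ker_factorHom_le_center hker j
  have hKtop := congrArg (Subgroup.map (M.subtype.comp K.subtype))
    (center_sup_commutator hKf hKker hT)
  have hker' := ker_eq_center_of_surjective hKf hKker hT
  rw [Subgroup.map_sup, ← MonoidHom.range_eq_map, MonoidHom.range_comp, range_subtype] at hKtop
  change K.map M.subtype ≤ _; rw [← hKtop]; refine sup_le ?_ ?_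
  · refine le_trans ?_ le_sup_left; rintro _ ⟨z, hz, rfl⟩; rw [← hker'] at hz
    exact hkerQ ⟨z, (factorHom_eq_one_iff j z).1 hz, rfl⟩
  · refine le_trans ?_ le_sup_right; refine le_sSup ⟨?_, ?_⟩
    · have h1 : ((commutator K).map K.subtype).IsSubnormal := (Subgroup.Normal.isSubnormal
        (inferInstance : ((commutator K).map K.subtype).Normal))
      have h2 : ((((commutator K).map K.subtype).map M.subtype)).IsSubnormal :=
        Subgroup.IsSubnormal.trans' h1 (Subgroup.Normal.isSubnormal hMn)
      rwa [Subgroup.map_map] at h2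
    · exact (isQuasisimple_commutator hKf hKker hT).of_mulEquiv
        ((commutator K).equivMapOfInjective _ (M.subtype_injective.comp K.subtype_injective))

/-- For the second inclusion, a minimal normal subgroup is either nilpotent of class at most two or
generated by components modulo the centre. -/
theorem generalisedFitting_eq_socleAboveCenter [Finite Q] (hQ : CharAbelianCentral Q)
    (hZ : IsCyclic (center Q)) : generalisedFitting Q = socleAboveCenter Q := by
  apply le_antisymm
  · exact sup_le (fittingSubgroup_le_socleAboveCenter hQ hZ) (layer_le_socleAboveCenter hQ)
  · refine sup_le (center_le_fittingSubgroup.trans le_sup_left) (sSup_le fun M hM => ?_)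
    have hM' : IsMinimalAboveCenter M := hM
    rcases hM'.comm_or_pi with h | ⟨s, T, hTg, hTs, hT, ⟨e⟩⟩
    · exact (hM'.le_fittingSubgroup h).trans le_sup_left
    · exact (hM'.le_layer hT e).trans (sup_le_sup_right center_le_fittingSubgroup _)

end MinimalNormal

/-! ### The linear part `H` of a semilinear group -/

section LinearPart

variable {K : Type*} {V : Type*} [Field K] [AddCommGroup V] [Module K V]

/-- The group of linear transformations in a group of semilinear transformations. -/
def linearPart (Λ : Subgroup (semiAut K V)) : Subgroup (GL K V) :=
  Λ.comap semiAut.ofGL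

theorem mem_linearPart {Λ : Subgroup (semiAut K V)} {x : GL K V} : x ∈ linearPart Λ ↔ semiAut.ofGL x
    ∈ Λ := Iff.rfl

theorem conjGL_mem_linearPart {Λ : Subgroup (semiAut K V)} {g : semiAut K V} (hg : g ∈ Λ)
    {x : GL K V} (hx : x ∈ linearPart Λ) : semiAut.conjGL g x ∈ linearPart Λ := by
  rw [mem_linearPart, semiAut.ofGL_conjGL]; exact mul_mem (mul_mem hg hx) (inv_mem hg)

theorem semiAut.conjEnd_smul {g : semiAut K V} {σ : K ≃+* K}
    (hσ : ∀ (a : K) (v : V), g (a • v) = σ a • g v) (c : K) (a : End K V) : conjEnd g (c • a) = σ c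
    • conjEnd g a := by
  ext v; simp [hσ]

/-- A set of linear transformations is stable under conjugation by `Λ`. -/
def StableUnder (Λ : Subgroup (semiAut K V)) (X : Subgroup (GL K V)) : Prop :=
  ∀ g ∈ Λ, ∀ x ∈ X, semiAut.conjGL g x ∈ X

theorem StableUnder.conjEnd_mem_groupAlg {Λ : Subgroup (semiAut K V)} {X : Subgroup (GL K V)}
    (hX : StableUnder Λ X) {g : semiAut K V} (hg : g ∈ Λ) {a : End K V} (ha : a ∈ groupAlg X) :
    semiAut.conjEnd g a ∈ groupAlg X := by
  obtain ⟨σ, hσ⟩ := g.2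
  refine groupAlg_induction (p := fun a => semiAut.conjEnd g a ∈ groupAlg X) ?_ ?_ ?_ ?_ ha
  · intro x hx; rw [← semiAut.coe_conjGL]; exact coe_mem_groupAlg (hX g hg x hx)
  · rw [map_zero]; exact zero_mem _
  · intro a b ha hb; rw [map_add]; exact add_mem ha hb
  · intro c a ha; rw [semiAut.conjEnd_smul hσ]; exact Subalgebra.smul_mem _ ha _

theorem StableUnder.commute {Λ : Subgroup (semiAut K V)} {X : Subgroup (GL K V)}
    (hX : StableUnder Λ X) {g : semiAut K V} (hg : g ∈ Λ) {a : End K V}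
    (ha : ∀ x ∈ X, (x : End K V) * a = a * x) : ∀ x ∈ X, (x : End K V) * semiAut.conjEnd g a =
    semiAut.conjEnd g a * x := by
  intro x hx; have h1 := ha _ (hX g⁻¹ (inv_mem hg) x hx)
  have h2 := congrArg (semiAut.conjEnd g) h1
  have h3 : semiAut.conjEnd g (semiAut.conjGL g⁻¹ x : End K V) = x := by
    rw [semiAut.coe_conjGL]; ext v
    simp only [semiAut.conjEnd_apply, semiAut.apply_inv_apply, inv_inv]
  rwa [map_mul, map_mul, h3] at h2

end LinearPart

namespace IsCoprimeSemilinear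

variable {K : Type*} {V : Type*} [Field K] [Finite K] [AddCommGroup V] [Module K V]
  [FiniteDimensional K V] {Λ : Subgroup (semiAut K V)} (hΛ : IsCoprimeSemilinear Λ)

include hΛ

theorem coprime_linearPart : (Nat.card (linearPart Λ)).Coprime (Nat.card K) :=
  Nat.Coprime.coprime_dvd_left (Subgroup.card_comap_dvd_of_injective _ _ semiAut.ofGL_injective)
    hΛ.coprime

omit hΛ [FiniteDimensional K V] in
theorem coprime_card_units : (Nat.card Kˣ).Coprime (Nat.card K) := by
  rw [Nat.card_units]; have h : 1 ≤ Nat.card K := Nat.card_pos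
  have := Nat.coprime_self_sub_left h (n := Nat.card K); simp [this]

omit hΛ [FiniteDimensional K V] in
theorem pow_card_units_of_mem_center {z : GL K V} (hz : z ∈ center (GL K V)) : z ^ Nat.card Kˣ = 1
    := by
  obtain ⟨a, ha⟩ := GeneralLinearGroup.mem_center_iff.1 hz
  have hpow : ∀ (n : ℕ) (v : V), ((z ^ n : GL K V) : V →ₗ[K] V) v = ((a ^ n : Kˣ) : K) • v := by
    intro n; induction n with
    | zero => intro v; simp
    | succ n ih =>
      intro v; rw [pow_succ, Units.val_mul, Module.End.mul_apply, ih]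
      have : (z : End K V) v = (a : K) • v := ha v
      rw [this, pow_succ, Units.val_mul, mul_smul]
  ext v; rw [hpow, pow_card_eq_one']; simp

/-- A stable linear group of exponent prime to the characteristic modulo scalars is contained in
the linear part. -/
theorem le_linearPart {X : Subgroup (GL K V)} (hX : StableUnder Λ X) {m : ℕ}
    (hm : m.Coprime (Nat.card K)) (hpow : ∀ x ∈ X, x ^ m ∈ center (GL K V)) : X ≤ linearPart Λ := by
  refine hΛ.maximal X ?_ hX
  refine card_coprime_of_forall_pow_eq_one (m := m * Nat.card Kˣ) (fun x => ?_)
    (Nat.Coprime.mul_left hm coprime_card_units)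
  apply Subtype.ext; rw [SubmonoidClass.coe_pow, pow_mul]
  exact pow_card_units_of_mem_center (hpow x x.2)

theorem center_le_linearPart : center (GL K V) ≤ linearPart Λ := by
  refine hΛ.le_linearPart (m := 1) (fun g _ x hx => ?_) (Nat.coprime_one_left _) fun x hx => ?_
  · exact (characteristic_iff_le_comap.1 inferInstance (semiAut.conjGL g)) hx
  · rwa [pow_one]

/-- The centre of the enveloping algebra of a stable group is a commutative stable algebra, hence
scalar. -/
theorem exists_smul_one_of_center {X : Subgroup (GL K V)} (hX : StableUnder Λ X) {a : End K V}
    (ha : a ∈ groupAlg X) (hc : ∀ x ∈ X, (x : End K V) * a = a * x) : ∃ c : K, a = c • (1 : End K V)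
    := by
  let Ω : Subalgebra K (End K V) :=
    groupAlg X ⊓ Subalgebra.centralizer K ((fun x : GL K V => (x : End K V)) '' X)
  have hmem : ∀ b, b ∈ Ω ↔ b ∈ groupAlg X ∧ ∀ x ∈ X, (x : End K V) * b = b * x := by
    intro b; rw [Algebra.mem_inf, Subalgebra.mem_centralizer_iff, Set.forall_mem_image]
    rfl
  have h := hΛ.scalar Ω (fun x hx y hy => commute_groupAlg ((hmem y).1 hy).2 ((hmem x).1 hx).1)
    fun g hg x hx => (hmem _).2 ⟨hX.conjEnd_mem_groupAlg hg ((hmem x).1 hx).1, hX.commute hg ((hmem x).1 hx).2⟩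
  obtain ⟨c, hc⟩ := Algebra.mem_bot.1 (h ▸ (hmem a).2 ⟨ha, hc⟩ : a ∈ (⊥ : Subalgebra K _))
  exact ⟨c, by rw [← hc, Algebra.algebraMap_eq_smul_one]⟩

omit hΛ [Finite K] [FiniteDimensional K V] in
theorem mem_center_of_eq_smul_one {x : GL K V} {c : K} (h : (x : End K V) = c • (1 : End K V)) : x ∈
    center (GL K V) := by
  rw [mem_center_iff]; intro y; apply Units.ext; rw [Units.val_mul, Units.val_mul, h]
  simp

theorem mem_center_of_abelian {A : Subgroup (GL K V)} (hA : StableUnder Λ A)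
    (hc : ∀ a ∈ A, ∀ b ∈ A, a * b = b * a) : A ≤ center (GL K V) := by
  intro a ha; obtain ⟨c, hc⟩ := hΛ.exists_smul_one_of_center hA (coe_mem_groupAlg ha)
    fun x hx => congrArg Units.val (hc x hx a ha)
  exact mem_center_of_eq_smul_one hc

omit hΛ [Finite K] [FiniteDimensional K V] in
/-- Characteristic subgroups of stable subgroups are stable. -/
theorem _root_.StableUnder.map_subtype {X : Subgroup (GL K V)} (hX : StableUnder Λ X)
    {A : Subgroup X} (hA : A.Characteristic) : StableUnder Λ (A.map X.subtype) := by
  rintro g hg _ ⟨x, hx, rfl⟩; let φ : X ≃* X :=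
    { toFun := fun y => ⟨semiAut.conjGL g y, hX g hg y y.2⟩
      invFun := fun y => ⟨semiAut.conjGL g⁻¹ y, hX g⁻¹ (inv_mem hg) y y.2⟩
      left_inv := fun y => Subtype.ext (by simp)
      right_inv := fun y => Subtype.ext (by simp)
      map_mul' := fun y z => Subtype.ext (by simp) }
  exact ⟨φ x, characteristic_iff_le_comap.1 hA φ hx, rfl⟩

omit [Finite K] [FiniteDimensional K V] hΛ in
theorem stableUnder_linearPart : StableUnder Λ (linearPart Λ) :=
  fun _ hg _ hx => conjGL_mem_linearPart hg hx

/-- A characteristic subgroup of a stable group is stable, and a stable abelian group is scalar. -/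
theorem charAbelianCentral {X : Subgroup (GL K V)} (hX : StableUnder Λ X) : CharAbelianCentral X :=
    by
  intro A hA hab a ha; have h1 := hΛ.mem_center_of_abelian (hX.map_subtype hA) (by
    rintro _ ⟨x, hx, rfl⟩ _ ⟨y, hy, rfl⟩; exact congrArg Subtype.val (hab x hx y hy))
  have h2 := h1 ⟨a, ha, rfl⟩; rw [mem_center_iff]; intro y
  exact Subtype.ext (mem_center_iff.1 h2 y)

theorem center_eq {X : Subgroup (GL K V)} (hX : StableUnder Λ X) : center X =
    (center (GL K V)).subgroupOf X := by
  ext x; rw [mem_subgroupOf]; constructor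
  · intro hx
    exact hΛ.mem_center_of_abelian (hX.map_subtype (inferInstance : (center X).Characteristic)) (by
        rintro _ ⟨x, hx, rfl⟩ _ ⟨y, hy, rfl⟩
        exact congrArg Subtype.val (mem_center_iff.1 hx y).symm) ⟨x, hx, rfl⟩
  · intro hx; rw [mem_center_iff]; intro y; exact Subtype.ext (mem_center_iff.1 hx y)

omit hΛ [FiniteDimensional K V] in
theorem isCyclic_center : IsCyclic (center (GL K V)) := by
  rcases subsingleton_or_nontrivial V with hV | hV
  · have : Subsingleton (GL K V) :=
      ⟨fun a b => Units.ext (LinearMap.ext fun v => Subsingleton.elim _ _)⟩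
    infer_instance
  have h : ∀ z : center (GL K V), ∃ a : Kˣ, ∀ v : V, ((z : GL K V) : V →ₗ[K] V) v = (a : K) • v :=
    fun z => GeneralLinearGroup.mem_center_iff.1 z.2
  choose f hf using h
  obtain ⟨v₀, hv₀⟩ := exists_ne (0 : V)
  let F : center (GL K V) →* Kˣ := MonoidHom.mk' f fun y z => by
    apply Units.ext; refine smul_left_injective K hv₀ ?_; simp only
    rw [← hf, Units.val_mul, mul_smul, ← hf z, ← hf y]; rfl
  refine isCyclic_of_injective F fun y z hyz => ?_; ext v; have h1 := hf y v
  rw [show f y = f z from hyz, ← hf z v] at h1; exact h1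

omit hΛ in
theorem isCyclic_center_of_eq {X : Subgroup (GL K V)}
    (hX : center X = (center (GL K V)).subgroupOf X) : IsCyclic (center X) := by
  have hc := isCyclic_center (K := K) (V := V); let F : center X →* center (GL K V) :=
    { toFun := fun x => ⟨x, hX.le x.2⟩
      map_one' := rfl
      map_mul' := fun _ _ => rfl }
  refine isCyclic_of_injective F fun y z hyz => ?_
  exact Subtype.ext (Subtype.ext (congrArg (fun x : center (GL K V) => (x : GL K V)) hyz))

theorem isCyclic_center_subgroup {X : Subgroup (GL K V)} (hX : StableUnder Λ X) : IsCyclic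
    (center X) := isCyclic_center_of_eq (hΛ.center_eq hX)

end IsCoprimeSemilinear

/-! ### Skolem–Noether, descent, and spanning the full matrix algebra -/

section SkolemNoether

/-- Skolem–Noether for two matrix subalgebras of an algebra which are conjugate by a
homomorphism. -/
theorem exists_linearEquiv_of_range_eq {K : Type*} [Field K] {X₁ X₂ : Type*} [AddCommGroup X₁]
    [Module K X₁] [AddCommGroup X₂] [Module K X₂] {E : Type*} [Ring E] [Algebra K E]
    (θ₁ : End K X₁ →ₐ[K] E) (θ₂ : End K X₂ →ₐ[K] E) (h₁ : Injective θ₁) (h₂ : Injective θ₂)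
    (h : θ₁.range = θ₂.range) : ∃ T : X₁ ≃ₗ[K] X₂, ∀ F, θ₁ F = θ₂ (T.conjAlgEquiv K F) := by
  let α : End K X₁ ≃ₐ[K] End K X₂ :=
    ((AlgEquiv.ofInjective θ₁ h₁).trans (Subalgebra.equivOfEq _ _ h)).trans
      (AlgEquiv.ofInjective θ₂ h₂).symm
  obtain ⟨T, hT⟩ := AlgEquiv.eq_linearEquivConjAlgEquiv α; refine ⟨T, fun F => ?_⟩
  rw [← hT]; have : (AlgEquiv.ofInjective θ₂ h₂) (α F) = Subalgebra.equivOfEq _ _ h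
      (AlgEquiv.ofInjective θ₁ h₁ F) := by simp [α]
  exact (congrArg Subtype.val this).symm

end SkolemNoether

namespace semiAut

variable {K : Type*} {V : Type*} [Field K] [AddCommGroup V] [Module K V]

/-- The coordinatewise action of a field automorphism. -/
def coord (σ : K ≃+* K) (ι : Type*) : semiAut K (ι → K) :=
  ⟨{ toFun := fun v i => σ (v i)
     invFun := fun v i => σ.symm (v i)
     left_inv := fun v => by ext i; simp
     right_inv := fun v => by ext i; simp
     map_add' := fun v w => by ext i; simp
     map_smul' := fun n v => by ext i; simp }, σ, fun a v => by
      funext i; exact map_mul σ a (v i)⟩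

theorem coord_apply (σ : K ≃+* K) {ι : Type*} (v : ι → K) (i : ι) : coord σ ι v i = σ (v i) := rfl

theorem coord_inv_apply (σ : K ≃+* K) {ι : Type*} (v : ι → K) (i : ι) :
    (coord σ ι)⁻¹ v i = σ.symm (v i) := rfl

theorem coord_pow_orderOf (σ : K ≃+* K) (ι : Type*) : coord σ ι ^ orderOf σ = 1 := by
  have h : ∀ (n : ℕ) (v : ι → K) (i : ι), (coord σ ι ^ n) v i = (σ ^ n) (v i) := by
    intro n; induction n with
    | zero => intro v i; rfl
    | succ n ih => intro v i; rw [pow_succ', mul_apply, coord_apply, ih, pow_succ']; rfl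
  ext v i; rw [h, pow_orderOf_eq_one]; rfl

theorem pow_smul {g : semiAut K V} {σ : K ≃+* K} (hσ : ∀ (a : K) (v : V), g (a • v) = σ a • g v)
    (n : ℕ) (a : K) (v : V) : (g ^ n) (a • v) = (σ ^ n) a • (g ^ n) v := by
  induction n with
  | zero => simp
  | succ n ih => rw [pow_succ', mul_apply, ih, hσ, pow_succ', ← mul_apply]; rfl

theorem exists_ofGL_eq {g : semiAut K V} (h : ∀ (a : K) (v : V), g (a • v) = a • g v) : ∃ x : GL K
    V, ofGL x = g := by
  refine ⟨.ofLinearEquiv { (g : V ≃ₗ[ℤ] V) with map_smul' := h }, ?_⟩; ext v; rfl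

theorem conjEnd_ofGL (x : GL K V) (f : End K V) : conjEnd (ofGL x) f = x * f * (x⁻¹ : GL K V) := by
  ext v; simp [← _root_.map_inv]

theorem ofGL_smul_mul_pow {b : semiAut K V} {σ : K ≃+* K}
    (hσ : ∀ (a : K) (v : V), b (a • v) = σ a • b v) {b' : semiAut K V} {c : K}
    (hc : ∀ v, b' v = c • b v) (n : ℕ) (v : V) : (b' ^ n) v = (∏ i ∈ Finset.range n, (σ ^ i) c) •
    (b ^ n) v := by
  induction n with
  | zero => simp
  | succ n ih =>
    rw [pow_succ', mul_apply, ih, hc, hσ, map_prod, smul_smul, pow_succ' b, mul_apply,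
      Finset.prod_range_succ']
    congr 1; rw [mul_comm]; congr 1; refine Finset.prod_congr rfl fun i _ => ?_
    rw [pow_succ']; rfl

end semiAut

namespace IsCoprimeSemilinear

variable {K : Type*} {V : Type*} [Field K] [Finite K] [AddCommGroup V] [Module K V]
  [FiniteDimensional K V] [Nontrivial V] {Λ : Subgroup (semiAut K V)} (hΛ : IsCoprimeSemilinear Λ)

include hΛ

theorem coprime_of_le {X : Subgroup (GL K V)} (hX : X ≤ linearPart Λ) :
    (Nat.card X).Coprime (Nat.card K) :=
  Nat.Coprime.coprime_dvd_left (Subgroup.card_dvd_of_le hX) hΛ.coprime_linearPart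

theorem exists_algHom {X : Subgroup (GL K V)} (hX : StableUnder Λ X) (hle : X ≤ linearPart Λ) : ∃
    (n : ℕ) (θ : End K (Fin n → K) →ₐ[K] End K V), Injective θ ∧ θ.range = groupAlg X :=
  exists_algHom_of_center_groupAlg (hΛ.coprime_of_le hle)
    fun _ ha hc => hΛ.exists_smul_one_of_center hX ha hc

omit hΛ [Nontrivial V] in
theorem _root_.StableUnder.conjGL_mem_unitsSubgroup {X : Subgroup (GL K V)} (hX : StableUnder Λ X)
    {g : semiAut K V} (hg : g ∈ Λ) {a : GL K V} (ha : a ∈ unitsSubgroup (groupAlg X)) :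
    semiAut.conjGL g a ∈ unitsSubgroup (groupAlg X) := by
  rw [mem_unitsSubgroup, semiAut.coe_conjGL]
  exact hX.conjEnd_mem_groupAlg hg (mem_unitsSubgroup.1 ha)

omit hΛ [Nontrivial V] in
theorem _root_.conj_mem_unitsSubgroup {X : Subgroup (GL K V)} (hX : StableUnder Λ X) {h : GL K V}
    (hh : h ∈ linearPart Λ) {a : GL K V} (ha : a ∈ unitsSubgroup (groupAlg X)) : h * a * h⁻¹ ∈
    unitsSubgroup (groupAlg X) := by
  rw [← semiAut.conjGL_ofGL]; exact hX.conjGL_mem_unitsSubgroup hh ha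

/-- Let `𝓐` be the matrix algebra spanned by `N`. The elements of `𝓐ˣ H` that centralise `N` form a
stable group, which maximality places in `H`, so they are scalars by `hC`. By Skolem–Noether
conjugation by `h` agrees on `𝓐` with conjugation by a unit `a` of `𝓐`, so `h⁻¹ a` is such a scalar
and `h ∈ 𝓐`. -/
theorem coe_mem_groupAlg_of_mem_linearPart {N : Subgroup (GL K V)} (hN : StableUnder Λ N)
    (hle : N ≤ linearPart Λ) (hC : ∀ x ∈ linearPart Λ, (∀ n ∈ N, n * x = x * n) → x ∈ center
      (GL K V)) {h : GL K V} (hh : h ∈ linearPart Λ) : (h : End K V) ∈ groupAlg N := by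
  obtain ⟨n, θ, hθ, hr⟩ := hΛ.exists_algHom hN hle
  -- the elements of `𝓐 H` which centralise `𝓐`
  let X : Subgroup (GL K V) :=
    { carrier := {x | (∀ n ∈ N, n * x = x * n) ∧
        ∃ a ∈ unitsSubgroup (groupAlg N), ∃ h ∈ linearPart Λ, x = a * h}
      one_mem' := ⟨fun n _ => by simp, 1, one_mem _, 1, one_mem _, by simp⟩
      mul_mem' := by
        rintro _ _ ⟨hc, a, ha, h, hh, rfl⟩ ⟨hc', a', ha', h', hh', rfl⟩
        refine ⟨fun n hn => ?_, a * (h * a' * h⁻¹),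
          mul_mem ha (conj_mem_unitsSubgroup hN hh ha'), h * h', mul_mem hh hh', by group⟩
        rw [← mul_assoc, hc n hn, mul_assoc, hc' n hn, ← mul_assoc]
      inv_mem' := by
        rintro _ ⟨hc, a, ha, h, hh, rfl⟩; refine ⟨fun n hn => ?_, h⁻¹ * a⁻¹ * h⁻¹⁻¹,
          conj_mem_unitsSubgroup hN (inv_mem hh) (inv_mem ha), h⁻¹, inv_mem hh, by group⟩
        exact (Commute.inv_right (hc n hn)).eq }
  have hXs : StableUnder Λ X := by
    rintro g hg _ ⟨hc, a, ha, h, hh, rfl⟩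
    refine ⟨fun n hn => ?_, _, hN.conjGL_mem_unitsSubgroup hg ha, _, conjGL_mem_linearPart hg hh,
      map_mul _ _ _⟩
    have h1 := congrArg (semiAut.conjGL g) (hc _ (hN g⁻¹ (inv_mem hg) n hn))
    rw [_root_.map_mul, _root_.map_mul _ (a * h), _root_.map_inv, MulAut.apply_inv_self] at h1
    exact h1
  have hX : X ≤ linearPart Λ := by
    refine hΛ.le_linearPart hXs hΛ.coprime_linearPart ?_; rintro x ⟨hc, a, ha, h, hh, rfl⟩
    -- As `h` normalises `𝓐ˣ`, the power of `a h` with exponent `|H|` lies in `𝓐ˣ`. It also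
    -- centralises `N`, so it lies in the centre of `𝓐` and is a scalar.
    have hpow : ∀ j : ℕ, ∃ a' ∈ unitsSubgroup (groupAlg N), (a * h) ^ j = a' * h ^ j := by
      intro j; induction j with
      | zero => exact ⟨1, one_mem _, by simp⟩
      | succ j ih =>
        obtain ⟨a', ha', e⟩ := ih
        refine ⟨a * (h * a' * h⁻¹), mul_mem ha (conj_mem_unitsSubgroup hN hh ha'), ?_⟩
        rw [pow_succ', e, pow_succ']; group
    obtain ⟨a', ha', e⟩ := hpow (Nat.card (linearPart Λ))
    have h1 : h ^ Nat.card (linearPart Λ) = 1 := congrArg Subtype.val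
      (pow_card_eq_one' (x := (⟨h, hh⟩ : linearPart Λ)))
    rw [h1, mul_one] at e; rw [e]
    obtain ⟨c, hc⟩ := hΛ.exists_smul_one_of_center hN (mem_unitsSubgroup.1 ha') fun x hx => by
      rw [← Units.val_mul, ← Units.val_mul, ← e]
      exact congrArg Units.val (Commute.pow_right (hc x hx) _).eq
    exact mem_center_of_eq_smul_one hc
  -- conjugation by `h` is inner on `𝓐`
  let β : End K (Fin n → K) →ₐ[K] End K V :=
    AlgHom.ofLinearMap
      { toFun := fun F => h * θ F * (h⁻¹ : GL K V)
        map_add' := fun F F' => by simp [mul_add, add_mul]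
        map_smul' := fun c F => by simp }
      (by simp) (fun F F' => by simp [mul_assoc])
  have hβ : ∀ F, β F = h * θ F * (h⁻¹ : GL K V) := fun F => rfl
  have hmem : ∀ y ∈ linearPart Λ, ∀ a ∈ groupAlg N,
      (y : End K V) * a * (y⁻¹ : GL K V) ∈ groupAlg N := by
    intro y hy a ha; rw [← semiAut.conjEnd_ofGL]; exact hN.conjEnd_mem_groupAlg hy ha
  have hβi : Injective β := fun F F' e => hθ (by
    rw [hβ, hβ] at e; exact (Units.mul_right_inj _).1 ((Units.mul_left_inj _).1 e))
  have hβr : β.range = θ.range := by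
    apply le_antisymm
    · rintro _ ⟨F, rfl⟩; rw [hr]; exact hmem h hh _ (hr ▸ ⟨F, rfl⟩)
    · rintro a ha; rw [hr] at ha
      obtain ⟨F, hF⟩ : ∃ F, θ F = _ := hr.ge (hmem h⁻¹ (inv_mem hh) a ha); refine ⟨F, ?_⟩
      change β F = a; rw [hβ, hF, inv_inv]; simp [mul_assoc]
  obtain ⟨T, hT⟩ := exists_linearEquiv_of_range_eq β θ hβi hθ hβr; let a : GL K V :=
    Units.map (θ : End K (Fin n → K) →* End K V) (LinearMap.GeneralLinearGroup.ofLinearEquiv T)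
  have ha : a ∈ unitsSubgroup (groupAlg N) := by
    rw [mem_unitsSubgroup]; exact hr.le ⟨_, rfl⟩
  have haF : ∀ F, (a : End K V) * θ F = h * θ F * (h⁻¹ : GL K V) * a := by
    intro F; rw [← hβ, hT]; change θ _ * θ F = θ _ * θ _; rw [← map_mul, ← map_mul]
    congr 1; ext v; simp
  have hx : h⁻¹ * a ∈ X := by
    refine ⟨fun n hn => ?_, h⁻¹ * a * h⁻¹⁻¹, conj_mem_unitsSubgroup hN (inv_mem hh) ha, h⁻¹,
      inv_mem hh, by group⟩
    obtain ⟨F, hF⟩ : ∃ F, θ F = (n : End K V) := hr.ge (coe_mem_groupAlg hn)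
    have h1 := haF F; rw [hF] at h1; have h2 : a * n = h * n * h⁻¹ * a := Units.ext h1
    rw [mul_assoc h⁻¹, h2]; group
  have hz := hC _ (hX hx) hx.1; obtain ⟨c, hc⟩ := GeneralLinearGroup.mem_center_iff.1 hz
  have h3 : h = a * (h⁻¹ * a)⁻¹ := by group
  obtain ⟨c, hc⟩ := GeneralLinearGroup.mem_center_iff.1 (inv_mem hz)
  rw [h3, Units.val_mul]; refine mul_mem (mem_unitsSubgroup.1 ha) ?_
  have : ((h⁻¹ * a)⁻¹ : GL K V).1 = (c : K) • (1 : End K V) := by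
    ext v; exact hc v
  rw [this]; exact Subalgebra.smul_mem _ (one_mem _) _

/-- A stable subgroup of the linear part with scalar centraliser spans the matrix algebra. -/
theorem groupAlg_eq_top {N : Subgroup (GL K V)} (hN : StableUnder Λ N) (hle : N ≤ linearPart Λ)
    (hC : ∀ x ∈ linearPart Λ, (∀ n ∈ N, n * x = x * n) → x ∈ center (GL K V)) : groupAlg N = ⊤ := by
  obtain ⟨n, θ, hθ, hr⟩ := hΛ.exists_algHom hN hle
  have hH : ∀ h ∈ linearPart Λ, (h : End K V) ∈ groupAlg N :=
    fun h hh => hΛ.coe_mem_groupAlg_of_mem_linearPart hN hle hC hh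
  obtain ⟨g₀, hg₀, hgen⟩ := hΛ.cyclic; obtain ⟨σ, hσ⟩ := g₀.2
  replace hσ : ∀ (a : K) (v : V), g₀ (a • v) = σ a • g₀ v := hσ
  let s := semiAut.coord σ (Fin n)
  have hs : ∀ (a : K) (v : Fin n → K), s (a • v) = σ a • s v := fun a v => by
    ext i; simp [s, semiAut.coord_apply]
  have hs' : ∀ (a : K) (v : Fin n → K), s⁻¹ (a • v) = σ.symm a • s⁻¹ v := fun a v => by
    ext i; exact map_mul σ.symm a (v i)
  have hmem : ∀ a ∈ groupAlg N, semiAut.conjEnd g₀ a ∈ groupAlg N :=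
    fun a ha => hN.conjEnd_mem_groupAlg hg₀ ha
  -- `g₀` acts on the matrix algebra as `s` up to an inner automorphism
  let β : End K (Fin n → K) →ₐ[K] End K V :=
    AlgHom.ofLinearMap
      { toFun := fun F => semiAut.conjEnd g₀ (θ (semiAut.conjEnd s⁻¹ F))
        map_add' := fun F F' => by simp only [map_add]
        map_smul' := fun c F => by
          rw [semiAut.conjEnd_smul hs', _root_.map_smul, semiAut.conjEnd_smul hσ]; simp }
      (by simp only [LinearMap.coe_mk, AddHom.coe_mk, map_one])
      (fun F F' => by simp only [LinearMap.coe_mk, AddHom.coe_mk, map_mul])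
  have hβ : ∀ F, β F = semiAut.conjEnd g₀ (θ (semiAut.conjEnd s⁻¹ F)) := fun F => rfl
  have hcc : ∀ (x : semiAut K (Fin n → K)) F, semiAut.conjEnd x⁻¹ (semiAut.conjEnd x F) = F := by
    intro x F; ext v; simp
  have hβi : Injective β := by
    intro F F' e; rw [hβ, hβ] at e
    exact (semiAut.conjEnd s⁻¹).injective (hθ ((semiAut.conjEnd g₀).injective e))
  have hβr : β.range = θ.range := by
    apply le_antisymm
    · rintro _ ⟨F, rfl⟩; rw [hr]; exact hmem _ (hr ▸ ⟨_, rfl⟩)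
    · rintro a ha; rw [hr] at ha
      obtain ⟨F, hF⟩ : ∃ F, θ F = _ := hr.ge (hN.conjEnd_mem_groupAlg (inv_mem hg₀) ha)
      refine ⟨semiAut.conjEnd s F, ?_⟩; change β _ = a; rw [hβ, hcc, hF]; ext v; simp
  obtain ⟨T, hT⟩ := exists_linearEquiv_of_range_eq β θ hβi hθ hβr; let a : GL K V :=
    Units.map (θ : End K (Fin n → K) →* End K V) (LinearMap.GeneralLinearGroup.ofLinearEquiv T)
  have ha : a ∈ unitsSubgroup (groupAlg N) := by
    rw [mem_unitsSubgroup]; exact hr.le ⟨_, rfl⟩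
  have hainv : ((a⁻¹ : GL K V) : End K V) = θ (T.symm : (Fin n → K) →ₗ[K] (Fin n → K)) := rfl
  have haval : (a : End K V) = θ (T : (Fin n → K) →ₗ[K] (Fin n → K)) := rfl
  -- After removing the inner part, `b` acts on `𝓐` exactly as the coordinatewise automorphism `s`
  -- acts on matrices.
  let b : semiAut K V := semiAut.ofGL a⁻¹ * g₀
  have hbσ : ∀ (c : K) (v : V), b (c • v) = σ c • b v := fun c v => by
    simp only [b, semiAut.mul_apply, hσ, semiAut.ofGL_apply, map_smul]
  have hbθ : ∀ F, semiAut.conjEnd b (θ F) = θ (semiAut.conjEnd s F) := by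
    intro F
    have h1 : semiAut.conjEnd g₀ (θ F) = θ (T.conjAlgEquiv K (semiAut.conjEnd s F)) := by
      rw [← hT, hβ, hcc]
    rw [map_mul, RingAut.mul_apply, h1, semiAut.conjEnd_ofGL, inv_inv, hainv, haval, ← map_mul,
      ← map_mul]
    congr 1; ext v; simp
  have hbpowθ : ∀ (j : ℕ) F, semiAut.conjEnd (b ^ j) (θ F) = θ (semiAut.conjEnd (s ^ j) F) := by
    intro j; induction j with
    | zero => intro F; simp
    | succ j ih =>
      intro F
      rw [pow_succ, map_mul, RingAut.mul_apply, hbθ, ih, pow_succ, map_mul, RingAut.mul_apply]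
  have hbpow : ∀ j : ℕ, ∃ a' ∈ unitsSubgroup (groupAlg N), b ^ j = semiAut.ofGL a' * g₀ ^ j := by
    intro j; induction j with
    | zero => exact ⟨1, one_mem _, by simp⟩
    | succ j ih =>
      obtain ⟨a', ha', e⟩ := ih; refine ⟨a⁻¹ * semiAut.conjGL g₀ a', mul_mem (inv_mem ha)
        (hN.conjGL_mem_unitsSubgroup hg₀ ha'), ?_⟩
      rw [pow_succ', e, _root_.map_mul, semiAut.ofGL_conjGL, pow_succ']; simp only [b]
      group
  have hfin : 0 < orderOf σ := by
    have : Finite (K ≃+* K) := DFunLike.finite _; exact orderOf_pos σ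
  -- the power of `b` which is linear is a scalar fixed by `σ`
  obtain ⟨a', ha', e⟩ := hbpow (orderOf σ)
  obtain ⟨x, hx⟩ : ∃ x : GL K V, semiAut.ofGL x = g₀ ^ orderOf σ := by
    apply semiAut.exists_ofGL_eq; intro c v; rw [semiAut.pow_smul hσ, pow_orderOf_eq_one]
    rfl
  have hxH : x ∈ linearPart Λ := by
    rw [mem_linearPart, hx]; exact pow_mem hg₀ _
  rw [← hx, ← _root_.map_mul] at e
  obtain ⟨c₀, hc₀⟩ : ∃ c : K, ((a' * x : GL K V) : End K V) = c • (1 : End K V) := by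
    refine hΛ.exists_smul_one_of_center hN ?_ ?_
    · rw [Units.val_mul]; exact mul_mem (mem_unitsSubgroup.1 ha') (hH x hxH)
    · intro y hy; obtain ⟨F, hF⟩ : ∃ F, θ F = (y : End K V) := hr.ge (coe_mem_groupAlg hy)
      have h1 := hbpowθ (orderOf σ) F
      rw [semiAut.coord_pow_orderOf, map_one, RingAut.one_apply, e, semiAut.conjEnd_ofGL, hF] at h1
      nth_rewrite 1 [← h1]; simp [mul_assoc]
  have hbc : ∀ v, (b ^ orderOf σ) v = c₀ • v := by
    intro v; rw [e, semiAut.ofGL_apply, hc₀]; rfl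
  obtain ⟨v₁, hv₁⟩ := exists_ne (0 : V)
  have hc₀0 : c₀ ≠ 0 := by
    rintro rfl; apply hv₁; apply semiAut.injective (b ^ orderOf σ)
    rw [hbc, hbc, zero_smul, zero_smul]
  have hc₀σ : σ c₀ = c₀ := by
    have h1 : b ((b ^ orderOf σ) v₁) = (b ^ orderOf σ) (b v₁) := by
      rw [← semiAut.mul_apply, ← semiAut.mul_apply, ← pow_succ, ← pow_succ']
    rw [hbc, hbc, hbσ] at h1; refine smul_left_injective K (m := b v₁) ?_ h1; intro h0
    apply hv₁; rw [← semiAut.inv_apply_apply b v₁, h0, ← zero_smul K (0 : V)]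
    simpa using (b⁻¹).map_sum (∅ : Finset ℕ) (fun _ => (0 : V))
  -- Scaling `b` by an element `c` of norm `c₀⁻¹` makes its power with exponent `orderOf σ` trivial.
  -- This is the descent datum needed below.
  obtain ⟨c, hc⟩ := exists_prod_eq_of_fixed σ (inv_ne_zero hc₀0) (by rw [map_inv₀, hc₀σ])
  have hc0 : c ≠ 0 := by
    rintro rfl
    have : (0 : K) = c₀⁻¹ := by
      rw [← hc]; refine (Finset.prod_eq_zero (Finset.mem_range.2 hfin) ?_).symm; simp
    exact inv_ne_zero hc₀0 this.symm
  let z : GL K V := .ofLinearEquiv (LinearEquiv.smulOfNeZero K V c hc0)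
  have hz : ∀ v, (z : End K V) v = c • v := fun v => rfl
  have hzc : ∀ f : End K V, (z : End K V) * f = f * z := fun f => by
    ext v; simp [hz]
  let d : semiAut K V := semiAut.ofGL z * b
  have hdb : ∀ v, d v = c • b v := fun v => rfl
  have hdσ : ∀ (c : K) (v : V), d (c • v) = σ c • d v := fun c' v => by
    rw [hdb, hbσ, hdb, smul_comm]
  have hdθ : ∀ F, semiAut.conjEnd d (θ F) = θ (semiAut.conjEnd s F) := by
    intro F; rw [map_mul, RingAut.mul_apply, hbθ, semiAut.conjEnd_ofGL, hzc]
    simp [mul_assoc]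
  have hd1 : d ^ orderOf σ = 1 := by
    ext v
    rw [semiAut.ofGL_smul_mul_pow hbσ hdb, hc, hbc, smul_smul, inv_mul_cancel₀ hc₀0]; simp
  have hn : 0 < n := by
    rcases Nat.eq_zero_or_pos n with rfl | h
    · exfalso; apply one_ne_zero (α := End K V); rw [← map_one θ, ← map_zero θ]; congr 1
      exact Subsingleton.elim _ _
    · exact h
  -- a primitive idempotent of the matrix algebra
  let i₀ : Fin n := ⟨0, hn⟩
  let ε : (Fin n → K) →ₗ[K] End K (Fin n → K) :=
    { toFun := fun w => (LinearMap.proj i₀ : (Fin n → K) →ₗ[K] K).smulRight w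
      map_add' := fun w w' => by ext; simp
      map_smul' := fun c w => by ext; simp [mul_left_comm] }
  have hε : ∀ w v, ε w v = v i₀ • w := fun w v => rfl; let E := ε (Pi.single i₀ 1)
  have hEs : semiAut.conjEnd s E = E := by
    refine LinearMap.ext fun j => funext fun i => ?_
    rw [semiAut.conjEnd_apply, hε, hε, semiAut.coord_inv_apply, hs]
    rw [Pi.smul_apply, Pi.smul_apply, semiAut.coord_apply, RingEquiv.apply_symm_apply]
    congr 1; rcases eq_or_ne i i₀ with rfl | h
    · simp
    · simp [h]
  have hEE : ∀ F : End K (Fin n → K), F * E = ε (F (Pi.single i₀ 1)) := by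
    intro F; apply LinearMap.ext; intro v; rw [Module.End.mul_apply, hε, hε, map_smul]
  have hEid : E * E = E := by
    rw [hEE]; congr 1; rw [hε]; simp
  have hde : ∀ v, d (θ E v) = θ E (d v) := by
    intro v; have h1 := LinearMap.congr_fun (hdθ E) (d v)
    rwa [hEs, semiAut.conjEnd_apply, semiAut.inv_apply_apply] at h1
  have hE0 : θ E ≠ 0 := by
    rw [← map_zero θ]; refine hθ.ne fun h0 => ?_
    have h1 := congrFun (LinearMap.congr_fun h0 (Pi.single i₀ 1)) i₀; rw [hε] at h1
    simp at h1
  obtain ⟨v₂, hv₂⟩ : ∃ v, θ E v ≠ 0 := by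
    by_contra! h; exact hE0 (LinearMap.ext h)
  have hdpe : ∀ (j : ℕ) v, (d ^ j) (θ E v) = θ E ((d ^ j) v) := by
    intro j; induction j with
    | zero => intro v; simp
    | succ j ih => intro v; rw [pow_succ', semiAut.mul_apply, ih, hde, ← semiAut.mul_apply]
  -- Galois descent: a twisted trace over the powers of `d` produces a nonzero `d`-fixed vector `u`
  -- in the image of `θ E`.
  obtain ⟨y, hy⟩ := exists_sum_smul_ne_zero σ hfin (fun i => (d ^ i) (θ E v₂)) (by simpa using hv₂)
  set u := ∑ i ∈ Finset.range (orderOf σ), (σ ^ i) y • (d ^ i) (θ E v₂) with hu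
  have hdu : d u = u := by
    rw [hu, semiAut.map_sum]; have h1 : ∀ i, d ((σ ^ i) y • (d ^ i) (θ E v₂)) =
        (σ ^ (i + 1)) y • (d ^ (i + 1)) (θ E v₂) := fun i => by
      rw [hdσ, pow_succ' σ, pow_succ' d]; rfl
    rw [Finset.sum_congr rfl fun i _ => h1 i]
    obtain ⟨k, hk⟩ := Nat.exists_eq_succ_of_ne_zero hfin.ne'
    have h2 : (σ ^ (k + 1)) y • (d ^ (k + 1)) (θ E v₂) = (σ ^ 0) y • (d ^ 0) (θ E v₂) := by
      rw [← Nat.succ_eq_add_one, ← hk, pow_orderOf_eq_one, hd1, pow_zero, pow_zero]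
    rw [hk, Finset.sum_range_succ, Finset.sum_range_succ', h2]
  have heu : θ E u = u := by
    rw [hu, _root_.map_sum]; refine Finset.sum_congr rfl fun i _ => ?_
    rw [map_smul, hdpe, ← Module.End.mul_apply, ← map_mul, hEid]
  -- `U = 𝓐 u` is stable under `𝓐` and under `d`. Since `g₀ = a c⁻¹ d` and the linear part lies in
  -- `𝓐`, it is stable under `Λ`, and irreducibility gives `U = V`.
  let U : Submodule K V := (LinearMap.applyₗ u ∘ₗ θ.toLinearMap : End K (Fin n → K) →ₗ[K] V).range
  have hU : ∀ v, v ∈ U ↔ ∃ F, θ F u = v := fun v => Iff.rfl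
  have hUa : ∀ f ∈ groupAlg N, ∀ v ∈ U, f v ∈ U := by
    rintro f hf _ ⟨F, rfl⟩; obtain ⟨F', rfl⟩ : ∃ F', θ F' = f := hr.ge hf
    exact ⟨F' * F, by simp⟩
  have hUd : ∀ v ∈ U, d v ∈ U := by
    rintro _ ⟨F, rfl⟩; refine ⟨semiAut.conjEnd s F, ?_⟩; change θ _ u = d (θ F u)
    rw [← hdθ, semiAut.conjEnd_apply]; nth_rewrite 1 [← hdu]; rw [semiAut.inv_apply_apply]
  have hUg : ∀ v ∈ U, g₀ v ∈ U := by
    intro v hv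
    have h1 : g₀ v = (a : End K V) (c⁻¹ • d v) := by
      rw [hdb, smul_smul, inv_mul_cancel₀ hc0, one_smul]
      simp only [b, semiAut.mul_apply, semiAut.ofGL_apply]
      rw [GeneralLinearGroup.apply_inv_apply]
    rw [h1]; exact hUa _ (mem_unitsSubgroup.1 ha) _ (U.smul_mem _ (hUd v hv))
  have hUtop : U = ⊤ := by
    refine (hΛ.irreducible U ?_).resolve_left ?_
    · intro g hg v hv; obtain ⟨i, x, hx, rfl⟩ := hgen g hg
      rw [semiAut.mul_apply, semiAut.ofGL_apply]; have h1 := hUa _ (hH x hx) v hv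
      generalize (x : End K V) v = w at h1; induction i with
      | zero => simpa using h1
      | succ i ih =>
        rw [pow_succ', semiAut.mul_apply]; exact hUg _ (ih (by
          have h2 := mul_mem (inv_mem hg₀) hg
          rwa [pow_succ', mul_assoc, inv_mul_cancel_left] at h2))
    · intro h0; have h1 : u ∈ U := ⟨1, by simp⟩
      rw [h0, Submodule.mem_bot] at h1; exact hy h1
  have hsurj : Surjective (LinearMap.applyₗ u ∘ₗ θ.toLinearMap ∘ₗ ε : (Fin n → K) →ₗ[K] V) := by
    intro v; obtain ⟨F, hF⟩ := (hU v).1 (hUtop ▸ Submodule.mem_top)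
    refine ⟨F (Pi.single i₀ 1), ?_⟩; change θ (ε _) u = v
    rw [← hEE, map_mul, Module.End.mul_apply, heu, hF]
  -- As `θ E u = u`, the space `𝓐 u` is an image of the first column `𝓐 E`, of dimension `n`.
  -- Together with the embedding of `n × n` matrices into `End V` this makes `θ` bijective.
  have hdim1 : Module.finrank K V ≤ n := by
    simpa using LinearMap.finrank_le_finrank_of_surjective hsurj
  have hdim2 : n * n ≤ Module.finrank K V * Module.finrank K V := by
    have := LinearMap.finrank_le_finrank_of_injective (f := θ.toLinearMap) hθ
    simpa [Module.finrank_linearMap] using this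
  have hdim : Module.finrank K (End K (Fin n → K)) = Module.finrank K (End K V) := by
    simp only [Module.finrank_linearMap, Module.finrank_fin_fun]
    exact le_antisymm hdim2 (Nat.mul_le_mul hdim1 hdim1)
  have hs := (LinearMap.injective_iff_surjective_of_finrank_eq_finrank hdim (f := θ.toLinearMap)).1 hθ
  rw [eq_top_iff, ← hr]; intro f _; exact hs f

end IsCoprimeSemilinear

section Finite

/-- A submonoid of a finite group is closed under inversion. -/
theorem inv_mem_of_forall_mul_mem {G : Type*} [Group G] [Finite G] (S : Set G) (h1 : 1 ∈ S)
    (hmul : ∀ x ∈ S, ∀ y ∈ S, x * y ∈ S) {x : G} (hx : x ∈ S) : x⁻¹ ∈ S := by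
  have hpow : ∀ n : ℕ, x ^ n ∈ S := by
    intro n; induction n with
    | zero => simpa using h1
    | succ n ih => rw [pow_succ]; exact hmul _ ih _ hx
  have : x⁻¹ = x ^ (orderOf x - 1) := by
    rw [inv_eq_iff_mul_eq_one, ← pow_succ', Nat.sub_add_cancel (orderOf_pos x), pow_orderOf_eq_one]
  rw [this]; exact hpow _

end Finite

/-! ### Scaling an invariant form in characteristic two -/

section SkewScaling

variable {r : ℕ} [hr : Fact r.Prime] {M : Type*} [AddCommGroup M] [Module (ZMod r) M] [Finite M]

/-- Let `c` be a nonzero self-adjoint endomorphism of an irreducible symplectic module in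
characteristic two. The form `β (c x) y` is equivalent to `- β x y`. -/
theorem exists_forall_apply_eq_neg {G : Type*} [Group G] (ρ : G →* End (ZMod r) M)
    (hirr : ∀ U : Submodule (ZMod r) M, (∀ g, ∀ u ∈ U, ρ g u ∈ U) → U = ⊥ ∨ U = ⊤)
    (β : M →ₗ[ZMod r] M →ₗ[ZMod r] ZMod r) (hβ : ∀ g m m', β (ρ g m) (ρ g m') = β m m')
    (halt : ∀ m, β m m = 0) (hnd : ∀ m, (∀ m', β m m' = 0) → m = 0) [Nontrivial M] (h2 : r = 2)
    (c : End (ZMod r) M) (hc0 : c ≠ 0) (hc : ∀ g, c * ρ g = ρ g * c)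
    (hcself : ∀ m m', β (c m) m' = β m (c m')) : ∃ a : End (ZMod r) M, (∀ g, a * ρ g = ρ g * a) ∧ ∀
      m m', β (c (a m)) (a m') = - β m m' := by
  have hneg : ∀ x y, β x y = - β y x := fun x y => by
    have h1 := halt (x + y)
    simp only [map_add, LinearMap.add_apply, halt, zero_add, add_zero] at h1
    exact eq_neg_of_add_eq_zero_right h1
  have hfd : FiniteDimensional (ZMod r) M := Module.Finite.of_finite
  have hβn : BilinForm.Nondegenerate β := ⟨hnd, fun m h => hnd m fun m' => by
    rw [hneg, h, neg_zero]⟩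
  -- The commutant is a finite division ring by Schur's lemma, hence a field, and taking adjoints is
  -- an automorphism of it whose square is the identity.
  let E : Subalgebra (ZMod r) (End (ZMod r) M) := Subalgebra.centralizer (ZMod r) (Set.range ρ)
  have hE : ∀ a : End (ZMod r) M, a ∈ E ↔ ∀ g, a * ρ g = ρ g * a := by
    intro a; rw [Subalgebra.mem_centralizer_iff]; simp only [Set.forall_mem_range]
    exact forall_congr' fun g => eq_comm
  have : Finite (End (ZMod r) M) := DFunLike.finite _
  have hinj : ∀ a ∈ E, a ≠ 0 → Injective a := by
    intro a ha ha0; rw [← LinearMap.ker_eq_bot]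
    refine (hirr (LinearMap.ker a) ?_).resolve_right fun h => ha0 (LinearMap.ker_eq_top.1 h)
    intro g u hu; have := LinearMap.congr_fun ((hE a).1 ha g) u
    rw [LinearMap.mem_ker] at hu ⊢; change a (ρ g u) = ρ g (a u) at this
    rw [this, hu, map_zero]
  have hnz : NoZeroDivisors E := by
    refine ⟨fun {a b} hab => ?_⟩; by_contra! h
    have ha := hinj a a.2 fun h0 => h.1 (Subtype.ext h0)
    refine h.2 (Subtype.ext (LinearMap.ext fun x => ha ?_))
    have := LinearMap.congr_fun (congrArg Subtype.val hab) x
    change (a : End (ZMod r) M) ((b : End (ZMod r) M) x) = 0 at this; rw [this]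
    exact (map_zero _).symm
  have hdom : IsDomain E := NoZeroDivisors.to_isDomain E
  letI : Field E := (Finite.isDomain_to_isField E).toField
  -- the adjoint
  let adj : End (ZMod r) M → End (ZMod r) M := fun a => BilinForm.leftAdjointOfNondegenerate β hβn a
  have hadj : ∀ a m m', β (adj a m) m' = β m (a m') := fun a m m' =>
    BilinForm.isAdjointPairLeftAdjointOfNondegenerate β hβn a m m'
  have huniq : ∀ a b : End (ZMod r) M, (∀ m m', β (a m) m' = β (b m) m') → a = b :=
    fun a b h => LinearMap.ext fun m => sub_eq_zero.1 (hnd _ fun m' => by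
      rw [map_sub, LinearMap.sub_apply, h, sub_self])
  have hadj' : ∀ a m m', β (a m) m' = β m (adj a m') := fun a m m' => by rw [hneg, ← hadj, hneg m]
  have hρinv : ∀ g m m', β (ρ g m) m' = β m (ρ g⁻¹ m') := fun g m m' => by
    rw [← hβ g m, ← Module.End.mul_apply, ← map_mul, mul_inv_cancel, map_one, Module.End.one_apply]
  have hadjE : ∀ a ∈ E, adj a ∈ E := by
    intro a ha; rw [hE] at ha ⊢; refine fun g => huniq _ _ fun m m' => ?_
    rw [Module.End.mul_apply, Module.End.mul_apply, hadj, hρinv, hρinv, hadj,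
      ← Module.End.mul_apply, ← Module.End.mul_apply, ha]
  let σ₀ : E →+* E :=
    { toFun := fun a => ⟨adj a, hadjE a a.2⟩
      map_one' := Subtype.ext (huniq _ _ fun m m' => by rw [hadj]; rfl)
      map_zero' := Subtype.ext (huniq _ _ fun m m' => by
        rw [hadj]; change β m 0 = β 0 m'; simp)
      map_mul' := fun a b => by
        rw [mul_comm]; refine Subtype.ext (huniq _ _ fun m m' => ?_); rw [hadj]
        change β m ((b : End (ZMod r) M) ((a : End (ZMod r) M) m')) = β (adj a (adj b m)) m'
        rw [hadj, hadj]
      map_add' := fun a b => Subtype.ext (huniq _ _ fun m m' => by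
        rw [hadj]
        change β m ((a : End (ZMod r) M) m' + (b : End (ZMod r) M) m') = β (adj a m + adj b m) m'
        rw [map_add, map_add, LinearMap.add_apply, hadj, hadj]) }
  have hσσ : ∀ a, σ₀ (σ₀ a) = a := fun a => Subtype.ext (huniq _ _ fun m m' => by
    change β (adj (adj a) m) m' = _; rw [hadj, ← hadj'])
  let σ : E ≃+* E := RingEquiv.ofRingHom σ₀ σ₀ (RingHom.ext hσσ) (RingHom.ext hσσ)
  have hσval : ∀ a m m', β ((σ a : End (ZMod r) M) m) m' =
      β m ((a : End (ZMod r) M) m') := fun a => hadj a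
  let cE : E := ⟨c, (hE c).2 hc⟩
  have hcE0 : cE ≠ 0 := fun h => hc0 (congrArg Subtype.val h)
  have hcσ : σ cE = cE := Subtype.ext (huniq _ _ fun m m' => by rw [hσval, ← hcself])
  -- Moving `a` to the left argument turns it into `σ a`, so the required identity says `σ a * c * a
  -- = -1`.
  suffices h : ∃ a : E, a * σ a = - cE⁻¹ by
    obtain ⟨a, ha⟩ := h; refine ⟨a, (hE a).1 a.2, fun m m' => ?_⟩
    have h1 : σ a * (cE * a) = -1 := by rw [mul_comm, mul_assoc, ha, mul_neg, mul_inv_cancel₀ hcE0]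
    rw [← hσval]; have h2 := LinearMap.congr_fun (congrArg Subtype.val h1) m
    change (σ a : End (ZMod r) M) (c ((a : End (ZMod r) M) m)) = - m at h2
    rw [h2, map_neg, LinearMap.neg_apply]
  -- Either every element is a square, in characteristic two, or `σ` has order two and the norm
  -- reaches the fixed element `-c⁻¹`.
  by_cases hσ1 : σ = 1
  · have hchar : ringChar E = 2 := by
      have : CharP E r := charP_of_injective_algebraMap (algebraMap (ZMod r) E).injective r
      rw [← h2]; exact ringChar.eq E r
    obtain ⟨a, ha⟩ := FiniteField.isSquare_of_char_two hchar (-cE⁻¹)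
    exact ⟨a, by rw [hσ1, RingAut.one_apply, ha]⟩
  · have ho : orderOf σ = 2 := orderOf_eq_prime (RingEquiv.ext fun a => hσσ a) hσ1
    obtain ⟨a, ha⟩ := exists_prod_eq_of_fixed σ (μ := - cE⁻¹)
      (neg_ne_zero.2 (inv_ne_zero hcE0)) (by rw [map_neg, map_inv₀, hcσ])
    rw [ho, Finset.prod_range_succ, Finset.prod_range_succ, Finset.prod_range_zero, one_mul,
      pow_zero, pow_one] at ha
    exact ⟨a, ha⟩

end SkewScaling

/-! ### A dihedral group with an automorphism swapping two reflections -/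

section Dihedral

/-- In a finite dihedral group, a subgroup of order prime to the odd prime `p` which is stable
under an automorphism swapping two generating reflections. -/
theorem exists_subgroup_of_dihedral {Γ : Type*} [Group Γ] [Finite Γ] {s z : Γ} (hs : s * s = 1)
    (hsz : s * z * s = z⁻¹) {p : ℕ} (hp : p.Prime) (hp2 : p ≠ 2) : ∃ (Y : Subgroup Γ) (j : ℤ)
    (m : ℕ), m.Coprime p ∧ s * z ^ (2 * j) ∈ Y ∧ (∀ y ∈ Y, y ^ m = 1) ∧
      (∀ y ∈ Y, ∃ n : ℤ, y = z ^ n ∨ y = s * z ^ n) ∧ ∀ φ : Γ →* Γ, φ s = s * z → φ z = z⁻¹ → ∀ y ∈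
      Y, φ y ∈ Y := by
  obtain ⟨c, k, hk, hck⟩ := Nat.exists_eq_pow_mul_and_not_dvd (orderOf_pos z).ne' p hp.ne_one
  have hs' : s⁻¹ = s := inv_eq_of_mul_eq_one_left hs
  have hzs : ∀ a : ℤ, s * z ^ a * s = z ^ (-a) := by
    intro a; have h1 : z⁻¹ = s * z * s⁻¹ := by rw [hs', hsz]
    rw [zpow_neg, ← inv_zpow, h1, conj_zpow, hs']
  have hzs' : ∀ a : ℤ, z ^ a * s = s * z ^ (-a) := by
    intro a; rw [← hzs, ← mul_assoc, ← mul_assoc, hs, one_mul]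
  have hss : ∀ a b : ℤ, s * z ^ a * (s * z ^ b) = z ^ (b - a) := by
    intro a b; rw [← mul_assoc, hzs, ← zpow_add]; congr 1; ring
  -- With `orderOf z = p ^ c * k`, the integer `j` inverts `4` modulo `p ^ c`, which is possible
  -- because `p` is odd. Modulo `z ^ (p ^ c)` the reflection `s z ^ (2 j)` is then fixed by `φ`,
  -- since `φ` sends it to `s z ^ (1 - 2 j)`.
  obtain ⟨j, e, hje⟩ : ∃ j e : ℤ, 1 - 4 * j = (p : ℤ) ^ c * e := by
    have h4 : IsCoprime ((4 : ℕ) : ℤ) ((p ^ c : ℕ) : ℤ) := by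
      rw [Nat.isCoprime_iff_coprime]; refine Nat.Coprime.pow_right _ ?_
      have : Nat.Coprime 2 p := (Nat.coprime_primes Nat.prime_two hp).2 (Ne.symm hp2)
      exact Nat.Coprime.pow_left 2 this
    obtain ⟨u, v, huv⟩ := h4; refine ⟨u, v, ?_⟩; push_cast at huv
    linear_combination -huv
  obtain ⟨q, hq⟩ : ∃ q : ℤ, q = (p : ℤ) ^ c := ⟨_, rfl⟩; rw [← hq] at hje
  -- The dihedral group generated by `z ^ (p ^ c)` and `s z ^ (2 j)`: its rotations have order
  -- dividing `k` and its reflections order two, whence the exponent `2 k`.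
  refine ⟨{ carrier := {x | ∃ n : ℤ, x = z ^ (q * n) ∨ x = s * z ^ (2 * j + q * n)}
            one_mem' := ⟨0, Or.inl (by simp)⟩
            mul_mem' := ?_
            inv_mem' := ?_ }, j, 2 * k, ?_, ⟨0, Or.inr (by simp)⟩, ?_, ?_, ?_⟩
  · rintro _ _ ⟨n, rfl | rfl⟩ ⟨m, rfl | rfl⟩
    · exact ⟨n + m, Or.inl (by rw [mul_add, zpow_add])⟩
    · refine ⟨m - n, Or.inr ?_⟩; rw [← mul_assoc, hzs', mul_assoc, ← zpow_add]; congr 2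
      ring
    · refine ⟨n + m, Or.inr ?_⟩; rw [mul_assoc, ← zpow_add]; congr 2; ring
    · refine ⟨m - n, Or.inl ?_⟩; rw [hss]; congr 1; ring
  · rintro _ ⟨n, rfl | rfl⟩
    · exact ⟨-n, Or.inl (by rw [mul_neg, zpow_neg])⟩
    · refine ⟨n, Or.inr ?_⟩; rw [inv_eq_iff_mul_eq_one, hss, sub_self, zpow_zero]
  · refine Nat.Coprime.mul_left ((Nat.coprime_primes Nat.prime_two hp).2 (Ne.symm hp2)) ?_
    exact (Nat.Coprime.symm ((Nat.Prime.coprime_iff_not_dvd hp).2 hk))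
  · rintro _ ⟨n, rfl | rfl⟩
    · rw [← zpow_natCast, ← zpow_mul, show q * n * ((2 * k : ℕ) : ℤ) = (orderOf z : ℤ) * (n * 2) by
        rw [hck, hq]; push_cast
        ring, zpow_mul, zpow_natCast, pow_orderOf_eq_one, one_zpow]
    · rw [pow_mul, sq, hss, sub_self, zpow_zero, one_pow]
  · rintro _ ⟨n, rfl | rfl⟩
    · exact ⟨_, Or.inl rfl⟩
    · exact ⟨_, Or.inr rfl⟩
  · rintro φ hφs hφz _ ⟨n, rfl | rfl⟩
    · refine ⟨-n, Or.inl ?_⟩; rw [map_zpow, hφz, inv_zpow, ← zpow_neg, mul_neg]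
    · refine ⟨e - n, Or.inr ?_⟩
      rw [map_mul, map_zpow, hφs, hφz, inv_zpow, ← zpow_neg, mul_assoc]; congr 1
      rw [← zpow_one_add]; congr 1
      linear_combination hje

end Dihedral

/-! ### Symplectic spaces with a maximal coprime isometry group -/

section Symplectic

variable {r : ℕ} {W : Type*} [AddCommGroup W] [Module (ZMod r) W]

/-- `g` multiplies the form `ω` by `μ`. -/
def HasMultiplier (ω : BilinForm (ZMod r) W) (g : W ≃ₗ[ZMod r] W) (μ : (ZMod r)ˣ) : Prop :=
  ∀ x y, ω (g x) (g y) = (μ : ZMod r) * ω x y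

/-- The submodule `U` is stable under the group `B`. -/
def IsStable (B : Subgroup (W ≃ₗ[ZMod r] W)) (U : Submodule (ZMod r) W) : Prop :=
  ∀ b ∈ B, ∀ u ∈ U, b u ∈ U

/-- The submodule `U` is irreducible for the group `B`. -/
structure IsIrreducibleFor (B : Subgroup (W ≃ₗ[ZMod r] W)) (U : Submodule (ZMod r) W) : Prop where
  ne_bot : U ≠ ⊥
  stable : IsStable B U
  eq_bot_or_eq : ∀ U' ≤ U, IsStable B U' → U' = ⊥ ∨ U' = U

/-- Symplectic similitude groups `B ≤ A` of order prime to `p` for which `B` is as large as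
possible. -/
structure IsCoprimeSymplectic (ω : BilinForm (ZMod r) W)
    (A B : Subgroup (W ≃ₗ[ZMod r] W)) (p : ℕ) : Prop where
  prime : p.Prime
  alt : ∀ x, ω x x = 0
  nondegenerate : ∀ x, (∀ y, ω x y = 0) → x = 0
  le : B ≤ A
  normal : ∀ a ∈ A, ∀ b ∈ B, a * b * a⁻¹ ∈ B
  isometry : ∀ b ∈ B, HasMultiplier ω b 1
  similitude : ∀ a ∈ A, ∃ μ, HasMultiplier ω a μ
  coprime : (Nat.card A).Coprime p
  eq_bot_of_isotropic : ∀ U, IsStable A U → (∀ x ∈ U, ∀ y ∈ U, ω x y = 0) → U = ⊥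
  maximal : r ≠ 2 → ∀ Y : Subgroup (W ≃ₗ[ZMod r] W), (∀ y ∈ Y, HasMultiplier ω y 1) →
    (Nat.card Y).Coprime p → (∀ a ∈ A, ∀ y ∈ Y, a * y * a⁻¹ ∈ Y) → Y ≤ B
  eq_of_two : r = 2 → A ≤ B

theorem HasMultiplier.mul {ω : BilinForm (ZMod r) W} {g h : W ≃ₗ[ZMod r] W} {μ ν : (ZMod r)ˣ}
    (hg : HasMultiplier ω g μ) (hh : HasMultiplier ω h ν) : HasMultiplier ω (g * h) (μ * ν) := fun x
    y => by rw [LinearEquiv.mul_apply, LinearEquiv.mul_apply, hg, hh, Units.val_mul, mul_assoc]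

theorem HasMultiplier.one (ω : BilinForm (ZMod r) W) : HasMultiplier ω (1 : W ≃ₗ[ZMod r] W) 1 := fun
    x y => by simp

theorem HasMultiplier.inv {ω : BilinForm (ZMod r) W} {g : W ≃ₗ[ZMod r] W} {μ : (ZMod r)ˣ}
    (hg : HasMultiplier ω g μ) : HasMultiplier ω g⁻¹ μ⁻¹ := fun x y => by
  have h := hg (g⁻¹ x) (g⁻¹ y)
  rw [← LinearEquiv.mul_apply, ← LinearEquiv.mul_apply, mul_inv_cancel] at h
  change ω x y = _ at h
  rw [h, ← mul_assoc, ← Units.val_mul, inv_mul_cancel, Units.val_one, one_mul]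

theorem HasMultiplier.pow {ω : BilinForm (ZMod r) W} {g : W ≃ₗ[ZMod r] W} {μ : (ZMod r)ˣ}
    (hg : HasMultiplier ω g μ) (n : ℕ) : HasMultiplier ω (g ^ n) (μ ^ n) := by
  induction n with
  | zero => simpa using HasMultiplier.one ω
  | succ n ih => rw [pow_succ, pow_succ]; exact ih.mul hg

variable (r W) in
/-- The scalar transformations. -/
def scalarAut : (ZMod r)ˣ →* (W ≃ₗ[ZMod r] W) := DistribMulAction.toModuleAut (ZMod r) W

theorem scalarAut_apply (ν : (ZMod r)ˣ) (w : W) : scalarAut r W ν w = (ν : ZMod r) • w := rfl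

theorem scalarAut_comm (ν : (ZMod r)ˣ) (g : W ≃ₗ[ZMod r] W) : Commute (scalarAut r W ν) g := by
  ext w; simp [LinearEquiv.mul_apply, scalarAut_apply]

theorem HasMultiplier.scalarAut (ω : BilinForm (ZMod r) W) (ν : (ZMod r)ˣ) : HasMultiplier ω
    (scalarAut r W ν) (ν ^ 2) := fun x y => by
  simp only [scalarAut_apply, map_smul, LinearMap.smul_apply, smul_eq_mul, sq, Units.val_mul,
    mul_assoc]

theorem IsStable.map {B : Subgroup (W ≃ₗ[ZMod r] W)} {U : Submodule (ZMod r) W} (hU : IsStable B U)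
    {a : W ≃ₗ[ZMod r] W} (ha : ∀ b ∈ B, a⁻¹ * b * a ∈ B) : IsStable B (U.map (a : W →ₗ[ZMod r] W))
    := by
  rintro b hb _ ⟨u, hu, rfl⟩; refine ⟨(a⁻¹ * b * a) u, hU _ (ha b hb) u hu, ?_⟩
  have : a * (a⁻¹ * b * a) = b * a := by group
  exact LinearEquiv.congr_fun this u

theorem IsIrreducibleFor.eq_of_le {B : Subgroup (W ≃ₗ[ZMod r] W)} {M M' : Submodule (ZMod r) W}
    (hM : IsIrreducibleFor B M) (hM' : IsIrreducibleFor B M') (h : M ≤ M') : M = M' :=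
  (hM'.eq_bot_or_eq M h hM.stable).resolve_left hM.ne_bot

theorem IsStable.inf {B : Subgroup (W ≃ₗ[ZMod r] W)} {U U' : Submodule (ZMod r) W}
    (hU : IsStable B U) (hU' : IsStable B U') : IsStable B (U ⊓ U') :=
  fun b hb u hu => ⟨hU b hb u hu.1, hU' b hb u hu.2⟩

theorem IsIrreducibleFor.map {B : Subgroup (W ≃ₗ[ZMod r] W)} {U : Submodule (ZMod r) W}
    (hU : IsIrreducibleFor B U) {a : W ≃ₗ[ZMod r] W} (ha : ∀ b ∈ B, a⁻¹ * b * a ∈ B)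
    (ha' : ∀ b ∈ B, a * b * a⁻¹ ∈ B) : IsIrreducibleFor B (U.map (a : W →ₗ[ZMod r] W)) := by
  refine ⟨fun h => hU.ne_bot ?_, hU.stable.map ha, fun U' hU' hs => ?_⟩
  · exact (Submodule.map_eq_bot_iff (e := a) (p := U)).1 h
  · have h1 : IsStable B (U'.map ((a⁻¹ : W ≃ₗ[ZMod r] W) : W →ₗ[ZMod r] W)) :=
      hs.map fun b hb => by rw [inv_inv]; exact ha' b hb
    have hmm : (U'.map ((a⁻¹ : W ≃ₗ[ZMod r] W) : W →ₗ[ZMod r] W)).map (a : W →ₗ[ZMod r] W)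
        = U' := by
      rw [← Submodule.map_comp]; convert Submodule.map_id U'
      exact LinearMap.ext fun x => LinearEquiv.congr_fun (mul_inv_cancel a) x
    have h2 : U'.map ((a⁻¹ : W ≃ₗ[ZMod r] W) : W →ₗ[ZMod r] W) ≤ U := by
      rintro _ ⟨x, hx, rfl⟩; obtain ⟨u, hu, rfl⟩ := hU' hx
      have : (a⁻¹ : W ≃ₗ[ZMod r] W) (a u) = u := LinearEquiv.congr_fun (inv_mul_cancel a) u
      change (a⁻¹ : W ≃ₗ[ZMod r] W) (a u) ∈ U; rwa [this]
    rcases hU.eq_bot_or_eq _ h2 h1 with h3 | h3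
    · left; rw [← hmm, h3, Submodule.map_bot]
    · right; rw [← hmm, h3]

namespace IsCoprimeSymplectic

variable [hr : Fact r.Prime] [Finite W] {ω : BilinForm (ZMod r) W} {A B : Subgroup (W ≃ₗ[ZMod r] W)}
  {p : ℕ} (h : IsCoprimeSymplectic ω A B p)

include h

theorem neg (x y : W) : ω x y = - ω y x := by
  have h1 := h.alt (x + y)
  simp only [map_add, LinearMap.add_apply, h.alt, zero_add, add_zero] at h1
  exact eq_neg_of_add_eq_zero_right h1

theorem injective_of_hasMultiplier {f : W →ₗ[ZMod r] W} (hf : ∀ x y, ω (f x) (f y) = ω x y) :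
    Injective f := by
  refine (injective_iff_map_eq_zero f).2 fun x hx => h.nondegenerate x fun y => ?_
  rw [← hf, hx, map_zero, LinearMap.zero_apply]

theorem le_of_forall_pow_eq_one (hr2 : r ≠ 2) {Y : Subgroup (W ≃ₗ[ZMod r] W)}
    (hY : ∀ y ∈ Y, HasMultiplier ω y 1) {m : ℕ} (hm : m.Coprime p) (hpow : ∀ y ∈ Y, y ^ m = 1)
    (hA : ∀ a ∈ A, ∀ y ∈ Y, a * y * a⁻¹ ∈ Y) : Y ≤ B := by
  have : Finite (W ≃ₗ[ZMod r] W) := DFunLike.finite _; exact h.maximal hr2 Y hY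
    (card_coprime_of_forall_pow_eq_one (fun y => Subtype.ext (hpow y y.2)) hm) hA

theorem hasMultiplier_unique [Nontrivial W] {g : W ≃ₗ[ZMod r] W} {μ ν : (ZMod r)ˣ}
    (hμ : HasMultiplier ω g μ) (hν : HasMultiplier ω g ν) : μ = ν := by
  obtain ⟨x, hx⟩ := exists_ne (0 : W)
  obtain ⟨y, hy⟩ : ∃ y, ω x y ≠ 0 := by
    by_contra! h1; exact hx (h.nondegenerate x h1)
  have h1 := (hμ x y).symm.trans (hν x y); exact Units.ext (mul_right_cancel₀ hy h1)

theorem pow_card_eq_one_of_multiplier [Nontrivial W] {a : W ≃ₗ[ZMod r] W} (ha : a ∈ A)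
    {μ : (ZMod r)ˣ} (hμ : HasMultiplier ω a μ) : μ ^ Nat.card A = 1 := by
  have h1 : a ^ Nat.card A = 1 := congrArg Subtype.val (pow_card_eq_one' (x := (⟨a, ha⟩ : A)))
  have h2 := hμ.pow (Nat.card A); rw [h1] at h2
  exact h.hasMultiplier_unique h2 (HasMultiplier.one ω)

/-- Similitudes in `A` with multiplier the square of a multiplier are scalar multiples of elements
of `B`. -/
theorem scalarAut_inv_mul_mem [Nontrivial W] (hr2 : r ≠ 2) {a : W ≃ₗ[ZMod r] W} (ha : a ∈ A)
    {a' : W ≃ₗ[ZMod r] W} (ha' : a' ∈ A) {ν : (ZMod r)ˣ} (hν : HasMultiplier ω a' ν)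
    (hμ : HasMultiplier ω a (ν ^ 2)) : scalarAut r W ν⁻¹ * a ∈ B := by
  -- The isometries that are a product of an element of `A` and a scalar which is itself a
  -- multiplier of some element of `A`. Multipliers have order dividing `|A|`, so `Y` has exponent
  -- dividing `|A|` and is contained in `B` by maximality.
  let Y : Subgroup (W ≃ₗ[ZMod r] W) :=
    { carrier := {y | HasMultiplier ω y 1 ∧ ∃ a ∈ A, ∃ a' ∈ A, ∃ ν, HasMultiplier ω a' ν ∧
        y = scalarAut r W ν * a}
      one_mem' := ⟨HasMultiplier.one ω, 1, one_mem _, 1, one_mem _, 1, HasMultiplier.one ω, by simp⟩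
      mul_mem' := by
        rintro _ _ ⟨h1, a, ha, a', ha', ν, hν, rfl⟩ ⟨h2, b, hb, b', hb', κ, hκ, rfl⟩
        refine ⟨by simpa using h1.mul h2, a * b, mul_mem ha hb, a' * b', mul_mem ha' hb', ν * κ,
          hν.mul hκ, ?_⟩
        rw [map_mul, mul_assoc, ← mul_assoc a, ← (scalarAut_comm κ a).eq]
        simp only [mul_assoc]
      inv_mem' := by
        rintro _ ⟨h1, a, ha, a', ha', ν, hν, rfl⟩
        refine ⟨by simpa using h1.inv, a⁻¹, inv_mem ha, a'⁻¹, inv_mem ha', ν⁻¹, hν.inv, ?_⟩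
        rw [mul_inv_rev, map_inv]; exact ((scalarAut_comm ν a).inv_inv).eq.symm }
  refine h.le_of_forall_pow_eq_one hr2 (Y := Y) (fun y hy => hy.1) h.coprime ?_ ?_ ?_
  · rintro _ ⟨h1, a, ha, a', ha', ν, hν, rfl⟩
    rw [(scalarAut_comm ν a).mul_pow, ← map_pow, h.pow_card_eq_one_of_multiplier ha' hν, map_one,
      one_mul]
    exact congrArg Subtype.val (pow_card_eq_one' (x := (⟨a, ha⟩ : A)))
  · rintro c hc _ ⟨h1, a, ha, a', ha', ν, hν, rfl⟩; obtain ⟨κ, hκ⟩ := h.similitude c hc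
    refine ⟨by simpa using (hκ.mul h1).mul hκ.inv, c * a * c⁻¹,
      mul_mem (mul_mem hc ha) (inv_mem hc), a', ha', ν, hν, ?_⟩
    rw [← mul_assoc, ← (scalarAut_comm ν c).eq]; simp only [mul_assoc]
  · refine ⟨?_, a, ha, a'⁻¹, inv_mem ha', ν⁻¹, hν.inv, rfl⟩
    have := (HasMultiplier.scalarAut ω ν⁻¹).mul hμ; simpa using this

/-- Up to scalars, `A` is generated by `B` and one more element. -/
theorem exists_generator [Nontrivial W] (hr2 : r ≠ 2) : ∃ a₀ ∈ A, ∃ d₀, HasMultiplier ω a₀ d₀ ∧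
    (∃ b ∈ B, a₀ * a₀ = scalarAut r W d₀ * b) ∧ ∀ a ∈ A, ∃ ν, ∃ b ∈ B, a = scalarAut r W ν * b ∨ a =
      scalarAut r W ν * (a₀ * b) := by
  let D : Subgroup (ZMod r)ˣ :=
    { carrier := {μ | ∃ a ∈ A, HasMultiplier ω a μ}
      one_mem' := ⟨1, one_mem _, HasMultiplier.one ω⟩
      mul_mem' := by
        rintro _ _ ⟨a, ha, hμ⟩ ⟨b, hb, hν⟩; exact ⟨a * b, mul_mem ha hb, hμ.mul hν⟩
      inv_mem' := by
        rintro _ ⟨a, ha, hμ⟩; exact ⟨a⁻¹, inv_mem ha, hμ.inv⟩ }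
  have hcyc : IsCyclic D := inferInstance
  obtain ⟨⟨d₀, a₀, ha₀, hd₀⟩, hgen⟩ := hcyc.exists_generator
  refine ⟨a₀, ha₀, d₀, hd₀, ?_, ?_⟩
  · refine ⟨_, h.scalarAut_inv_mul_mem hr2 (mul_mem ha₀ ha₀) ha₀ hd₀ (by rw [sq]; exact hd₀.mul hd₀),
      ?_⟩
    rw [← mul_assoc, ← map_mul, mul_inv_cancel, map_one, one_mul]
  · intro a ha; obtain ⟨μ, hμ⟩ := h.similitude a ha; have h1 := hgen ⟨μ, a, ha, hμ⟩
    rw [← mem_powers_iff_mem_zpowers] at h1; obtain ⟨i, hi⟩ := h1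
    have hi' : d₀ ^ i = μ := congrArg Subtype.val hi
    -- The multipliers form a cyclic group generated by `d₀`. An even power is the square of a
    -- multiplier, and so is removed by a scalar; an odd power needs one extra factor `a₀`.
    rcases Nat.even_or_odd' i with ⟨j, rfl | rfl⟩
    · refine ⟨d₀ ^ j, _, h.scalarAut_inv_mul_mem hr2 ha (pow_mem ha₀ j) (hd₀.pow j) ?_, Or.inl ?_⟩
      · rwa [← pow_mul, mul_comm, hi']
      · rw [← mul_assoc, ← map_mul, mul_inv_cancel, map_one, one_mul]
    · refine ⟨d₀ ^ j, _, h.scalarAut_inv_mul_mem hr2 (mul_mem (inv_mem ha₀) ha) (pow_mem ha₀ j)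
        (hd₀.pow j) ?_, Or.inr ?_⟩
      · have h2 := hd₀.inv.mul hμ
        rwa [← hi', pow_succ', inv_mul_cancel_left, mul_comm, pow_mul] at h2
      · rw [← mul_assoc a₀, ← (scalarAut_comm _ a₀).eq, map_inv]; group

/-- If `p = 2` or `r = 2` then `A` and `B` have the same stable subspaces. -/
theorem isStable_of_two [Nontrivial W] (h2 : p = 2 ∨ r = 2) {U : Submodule (ZMod r) W}
    (hU : IsStable B U) : IsStable A U := by
  by_cases hr2 : r = 2
  · exact fun a ha => hU a (h.eq_of_two hr2 ha)
  have hp := h2.resolve_right hr2; intro a ha u hu; obtain ⟨μ, hμ⟩ := h.similitude a ha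
  -- For `p = 2` the order of `A` is odd, say `2 m + 1`, so each multiplier is the square of its
  -- power with exponent `m + 1`.
  have hodd : Odd (Nat.card A) := by
    have := h.coprime; rw [hp] at this; exact Nat.coprime_two_right.1 this
  obtain ⟨m, hm⟩ := hodd
  have h1 : μ = (μ ^ (m + 1)) ^ 2 := by
    rw [← pow_mul, show (m + 1) * 2 = Nat.card A + 1 by omega, pow_succ,
      h.pow_card_eq_one_of_multiplier ha hμ, one_mul]
  have h3 := h.scalarAut_inv_mul_mem hr2 ha (pow_mem ha (m + 1)) (hμ.pow (m + 1)) (h1 ▸ hμ)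
  have h4 := U.smul_mem (μ ^ (m + 1) : (ZMod r)ˣ).1 (hU _ h3 u hu)
  rw [← scalarAut_apply, ← LinearEquiv.mul_apply, ← mul_assoc, ← map_mul, mul_inv_cancel, map_one,
    one_mul] at h4
  exact h4

theorem isStable_orthogonal {U : Submodule (ZMod r) W} (hU : IsStable B U) : IsStable B
    (ω.orthogonal U) := by
  intro b hb w hw u hu; have h1 : ω (b⁻¹ u) w = 0 := hw (b⁻¹ u) (hU _ (inv_mem hb) u hu)
  have h2 := h.isometry b hb (b⁻¹ u) w; change ω u (b w) = 0
  rw [h1, mul_zero, ← LinearEquiv.mul_apply, mul_inv_cancel] at h2; exact h2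

theorem isRefl : ω.IsRefl := fun x y hxy => by rw [h.neg, hxy, neg_zero]

theorem inv_mul_mul_mem {a b : W ≃ₗ[ZMod r] W} (ha : a ∈ A) (hb : b ∈ B) : a⁻¹ * b * a ∈ B := by
  simpa using h.normal a⁻¹ (inv_mem ha) b hb

/-- An element of `A` either fixes the pair `M`, `a₀ M` or swaps it. -/
theorem fixes_or_swaps {M N : Submodule (ZMod r) W} (hM : IsStable B M) {a₀ : W ≃ₗ[ZMod r] W}
    {d₀ : (ZMod r)ˣ} (ha₀ : a₀ ∈ A) (hN : N = M.map (a₀ : W →ₗ[ZMod r] W))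
    (hsq : ∃ b ∈ B, a₀ * a₀ = scalarAut r W d₀ * b)
    (hgen : ∀ a ∈ A, ∃ ν, ∃ b ∈ B, a = scalarAut r W ν * b ∨ a = scalarAut r W ν * (a₀ * b))
    {a : W ≃ₗ[ZMod r] W} (ha : a ∈ A) : ((∀ x ∈ M, a x ∈ M) ∧ ∀ x ∈ N, a x ∈ N) ∨
    ((∀ x ∈ M, a x ∈ N) ∧ ∀ x ∈ N, a x ∈ M) := by
  have hNs : IsStable B N := hN ▸ hM.map fun b hb => h.inv_mul_mul_mem ha₀ hb
  have hMN : ∀ x ∈ M, a₀ x ∈ N := fun x hx => hN ▸ ⟨x, hx, rfl⟩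
  have hNM : ∀ x ∈ N, a₀ x ∈ M := by
    intro x hx; rw [hN] at hx; obtain ⟨m, hm, rfl⟩ := hx; obtain ⟨b, hb, hbe⟩ := hsq
    have h1 : a₀ (a₀ m) = (d₀ : ZMod r) • b m := LinearEquiv.congr_fun hbe m
    change a₀ (a₀ m) ∈ M; rw [h1]; exact M.smul_mem _ (hM b hb m hm)
  obtain ⟨ν, b, hb, rfl | rfl⟩ := hgen a ha
  · exact Or.inl ⟨fun x hx => M.smul_mem _ (hM b hb x hx), fun x hx => N.smul_mem _ (hNs b hb x hx)⟩
  · exact Or.inr ⟨fun x hx => N.smul_mem _ (hMN _ (hM b hb x hx)),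
      fun x hx => M.smul_mem _ (hNM _ (hNs b hb x hx))⟩

/-- An irreducible `B`-submodule is nondegenerate. -/
theorem disjoint_orthogonal {M : Submodule (ZMod r) W} (hM : IsIrreducibleFor B M) : Disjoint M
    (ω.orthogonal M) := by
  rw [disjoint_iff]; by_contra hne
  have hnt : Nontrivial W := by
    obtain ⟨x, -, hx⟩ := (Submodule.ne_bot_iff _).1 hM.ne_bot; exact ⟨x, 0, hx⟩
  have hfin : Finite (W ≃ₗ[ZMod r] W) := DFunLike.finite _
  have hst := hM.stable.inf (h.isStable_orthogonal hM.stable); by_cases hr2 : r = 2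
  · exact hne (h.eq_bot_of_isotropic _ (h.isStable_of_two (Or.inr hr2) hst)
      fun x hx y hy => hy.2 x hx.1)
  have hMO := (hM.eq_bot_or_eq _ inf_le_left hst).resolve_left hne
  have hMiso : ∀ x ∈ M, ∀ y ∈ M, ω x y = 0 := fun x hx y hy => (hMO.symm ▸ hy : y ∈ M ⊓ ω.orthogonal M).2 x hx
  obtain ⟨a₀, ha₀, d₀, hd₀, hsq, hgen⟩ := h.exists_generator hr2
  -- If `M` is degenerate, it is isotropic, and so is `N = a₀ M`. The sum `M + N` is stable under
  -- `A`, hence not isotropic, so the form pairs `M` with `N` perfectly. The aim is an isometry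
  -- which belongs to `B` by maximality but swaps `M` and `N`.
  obtain ⟨N, hN⟩ : ∃ N, N = M.map (a₀ : W →ₗ[ZMod r] W) := ⟨_, rfl⟩
  have hfs := fun a ha => h.fixes_or_swaps hM.stable ha₀ hN hsq hgen (a := a) ha
  have hNirr : IsIrreducibleFor B N := hN ▸ hM.map (fun b hb => h.inv_mul_mul_mem ha₀ hb)
    fun b hb => h.normal a₀ ha₀ b hb
  have hNiso : ∀ x ∈ N, ∀ y ∈ N, ω x y = 0 := by
    rw [hN]; rintro _ ⟨x, hx, rfl⟩ _ ⟨y, hy, rfl⟩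
    exact (hd₀ x y).trans (by rw [hMiso x hx y hy, mul_zero])
  have hXA : IsStable A (M ⊔ N) := by
    intro a ha x hx; obtain ⟨m, hm, n, hn, rfl⟩ := Submodule.mem_sup.1 hx; rw [map_add]
    rcases hfs a ha with h1 | h1
    · exact Submodule.add_mem_sup (h1.1 m hm) (h1.2 n hn)
    · rw [add_comm]; exact Submodule.add_mem_sup (h1.2 n hn) (h1.1 m hm)
  have hfst : M ⊓ ω.orthogonal N = ⊥ := by
    refine (hM.eq_bot_or_eq _ inf_le_left (hM.stable.inf
      (h.isStable_orthogonal hNirr.stable))).resolve_right fun h1 => hM.ne_bot ?_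
    have hMN : ∀ x ∈ M, ∀ y ∈ N, ω x y = 0 := fun x hx y hy => by
      rw [h.neg, neg_eq_zero]; exact (h1.symm ▸ hx : x ∈ M ⊓ ω.orthogonal N).2 y hy
    have h2 := h.eq_bot_of_isotropic _ hXA (by
      intro x hx y hy; obtain ⟨m, hm, n, hn, rfl⟩ := Submodule.mem_sup.1 hx
      obtain ⟨m', hm', n', hn', rfl⟩ := Submodule.mem_sup.1 hy
      simp only [map_add, LinearMap.add_apply, hMiso m hm m' hm', hNiso n hn n' hn',
        hMN m hm n' hn', h.neg n m', hMN m' hm' n hn, neg_zero, add_zero])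
    exact le_bot_iff.1 (h2 ▸ le_sup_left)
  have hsnd : N ⊓ ω.orthogonal M = ⊥ := by
    refine (hNirr.eq_bot_or_eq _ inf_le_left (hNirr.stable.inf
      (h.isStable_orthogonal hM.stable))).resolve_right fun h1 => hM.ne_bot ?_
    rw [← hfst, eq_comm, inf_eq_left]; intro x hx y hy; change ω y x = 0
    rw [h.neg, neg_eq_zero]; exact (h1.symm ▸ hy : y ∈ N ⊓ ω.orthogonal M).2 x hx
  have hMN : Disjoint M N := by
    rw [disjoint_iff, eq_bot_iff, ← hfst]
    exact le_inf inf_le_left fun x hx y hy => hNiso y hy x hx.2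
  obtain ⟨O, hO⟩ : ∃ O, O = ω.orthogonal (M ⊔ N) := ⟨_, rfl⟩
  have hOM : ∀ x ∈ O, ∀ m ∈ M, ω m x = 0 := fun x hx m hm =>
    (hO ▸ hx : x ∈ ω.orthogonal (M ⊔ N)) m (le_sup_left (a := M) hm)
  have hON : ∀ x ∈ O, ∀ n ∈ N, ω n x = 0 := fun x hx n hn =>
    (hO ▸ hx : x ∈ ω.orthogonal (M ⊔ N)) n (le_sup_right (a := M) hn)
  have hdisj : Disjoint (M ⊔ N) O := by
    rw [disjoint_iff, Submodule.eq_bot_iff]; rintro x ⟨hx, hxO⟩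
    obtain ⟨m, hm, n, hn, rfl⟩ := Submodule.mem_sup.1 hx
    have hm0 : m ∈ M ⊓ ω.orthogonal N := ⟨hm, fun y hy => by
      have h1 := hON _ hxO y hy; rwa [map_add, hNiso y hy n hn, add_zero] at h1⟩
    have hn0 : n ∈ N ⊓ ω.orthogonal M := ⟨hn, fun y hy => by
      have h1 := hOM _ hxO y hy; rwa [map_add, hMiso y hy m hm, zero_add] at h1⟩
    rw [hfst] at hm0; rw [hsnd] at hn0
    rw [(Submodule.mem_bot _).1 hm0, (Submodule.mem_bot _).1 hn0, add_zero]
  have hcompl : IsCompl (M ⊔ N) O := hO ▸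
    (BilinForm.isCompl_orthogonal_iff_disjoint h.isRefl).2 (hO ▸ hdisj)
  have hOA : ∀ a ∈ A, ∀ x ∈ O, a x ∈ O := by
    intro a ha x hx; rw [hO]; intro y hy; obtain ⟨μ, hμ⟩ := h.similitude a ha
    have h1 := hμ (a⁻¹ y) x
    have h2 : a (a⁻¹ y) = y := LinearEquiv.congr_fun (mul_inv_cancel a) y
    have h3 : ω (a⁻¹ y) x = 0 := (hO ▸ hx : x ∈ ω.orthogonal (M ⊔ N)) _ (hXA _ (inv_mem ha) y hy)
    rw [h2, h3, mul_zero] at h1; exact h1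
  have hdecomp : ∀ w, ∃ m ∈ M, ∃ n ∈ N, ∃ o ∈ O, w = m + n + o := by
    intro w
    have : w ∈ (M ⊔ N) ⊔ O := by
      rw [hcompl.sup_eq_top]; exact Submodule.mem_top
    obtain ⟨x, hx, o, ho, rfl⟩ := Submodule.mem_sup.1 this
    obtain ⟨m, hm, n, hn, rfl⟩ := Submodule.mem_sup.1 hx; exact ⟨m, hm, n, hn, o, ho, rfl⟩
  -- the elements which act on `M` and `a₀ M` as multiples of elements of `A`
  let P : (W ≃ₗ[ZMod r] W) → (W ≃ₗ[ZMod r] W) → Prop := fun y a =>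
    HasMultiplier ω y 1 ∧ (∀ x ∈ O, y x = x) ∧ ∃ s t : (ZMod r)ˣ, s ^ Nat.card A = 1 ∧
      t ^ Nat.card A = 1 ∧ (∀ x ∈ M, y x = (s : ZMod r) • a x) ∧
      ∀ x ∈ N, y x = (t : ZMod r) • a x
  have hP1 : P 1 1 := ⟨HasMultiplier.one ω, fun x _ => rfl, 1, 1, by simp, by simp,
    fun x _ => by simp, fun x _ => by simp⟩
  have hPmul : ∀ y a y' a', a' ∈ A → P y a → P y' a' → P (y * y') (a * a') := by
    rintro y a y' a' ha' ⟨h1, h2, s, t, hs, ht, hsM, htN⟩ ⟨h1', h2', s', t', hs', ht', hsM', htN'⟩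
    refine ⟨by simpa using h1.mul h1', fun x hx => by
      rw [LinearEquiv.mul_apply, h2' x hx, h2 x hx], ?_⟩
    rcases hfs a' ha' with h3 | h3
    · refine ⟨s' * s, t' * t, by rw [mul_pow, hs, hs', one_mul], by rw [mul_pow, ht, ht', one_mul],
        fun x hx => ?_, fun x hx => ?_⟩
      · rw [LinearEquiv.mul_apply, hsM' x hx, map_smul, hsM _ (h3.1 x hx), Units.val_mul, mul_smul]
        rfl
      · rw [LinearEquiv.mul_apply, htN' x hx, map_smul, htN _ (h3.2 x hx), Units.val_mul, mul_smul]
        rfl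
    · refine ⟨s' * t, t' * s, by rw [mul_pow, ht, hs', one_mul], by rw [mul_pow, hs, ht', one_mul],
        fun x hx => ?_, fun x hx => ?_⟩
      · rw [LinearEquiv.mul_apply, hsM' x hx, map_smul, htN _ (h3.1 x hx), Units.val_mul, mul_smul]
        rfl
      · rw [LinearEquiv.mul_apply, htN' x hx, map_smul, hsM _ (h3.2 x hx), Units.val_mul, mul_smul]
        rfl
  have hPpow : ∀ y a, a ∈ A → P y a → ∀ n : ℕ, P (y ^ n) (a ^ n) := by
    intro y a ha hy n; induction n with
    | zero => simpa using hP1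
    | succ n ih => rw [pow_succ, pow_succ]; exact hPmul _ _ _ _ ha ih hy
  let S : Set (W ≃ₗ[ZMod r] W) := {y | ∃ a ∈ A, P y a}
  have hS1 : 1 ∈ S := ⟨1, one_mem _, hP1⟩
  have hSmul : ∀ x ∈ S, ∀ y ∈ S, x * y ∈ S := by
    rintro y ⟨a, ha, hy⟩ y' ⟨a', ha', hy'⟩
    exact ⟨a * a', mul_mem ha ha', hPmul _ _ _ _ ha' hy hy'⟩
  let Y : Subgroup (W ≃ₗ[ZMod r] W) :=
    { carrier := S
      one_mem' := hS1
      mul_mem' := fun hx hy => hSmul _ hx _ hy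
      inv_mem' := fun hx => inv_mem_of_forall_mul_mem S hS1 hSmul hx }
  have hYB : Y ≤ B := by
    refine h.le_of_forall_pow_eq_one hr2 (Y := Y) (m := Nat.card A * Nat.card A) ?_
      (Nat.Coprime.mul_left h.coprime h.coprime) ?_ ?_
    · rintro y ⟨a, ha, hy⟩; exact hy.1
    -- After `|A|` steps the factor from `A` is trivial and only scalars on `M` and `N` remain;
    -- another `|A|` steps remove these.
    · rintro y ⟨a, ha, hy⟩; have h1 := hPpow y a ha hy (Nat.card A)
      have h2 : a ^ Nat.card A = 1 := congrArg Subtype.val (pow_card_eq_one' (x := (⟨a, ha⟩ : A)))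
      rw [h2] at h1; obtain ⟨h3, h4, s, t, hs, ht, hsM, htN⟩ := h1; rw [pow_mul]
      have hpowM : ∀ n : ℕ, ∀ x ∈ M, ((y ^ Nat.card A) ^ n) x = ((s ^ n : (ZMod r)ˣ) : ZMod r) • x := by
        intro n x hx; induction n with
        | zero => simp
        | succ n ih =>
          rw [pow_succ, LinearEquiv.mul_apply, hsM x hx]
          change ((y ^ Nat.card A) ^ n) ((s : ZMod r) • x) = _
          rw [map_smul, ih, smul_smul, pow_succ, Units.val_mul, mul_comm]
      have hpowN : ∀ n : ℕ, ∀ x ∈ N, ((y ^ Nat.card A) ^ n) x = ((t ^ n : (ZMod r)ˣ) : ZMod r) • x := by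
        intro n x hx; induction n with
        | zero => simp
        | succ n ih =>
          rw [pow_succ, LinearEquiv.mul_apply, htN x hx]
          change ((y ^ Nat.card A) ^ n) ((t : ZMod r) • x) = _
          rw [map_smul, ih, smul_smul, pow_succ, Units.val_mul, mul_comm]
      have hpowO : ∀ n : ℕ, ∀ x ∈ O, ((y ^ Nat.card A) ^ n) x = x := by
        intro n x hx; induction n with
        | zero => simp
        | succ n ih => rw [pow_succ, LinearEquiv.mul_apply, h4 x hx, ih]
      refine LinearEquiv.ext fun w => ?_; obtain ⟨m, hm, n, hn, o, ho, rfl⟩ := hdecomp w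
      rw [map_add, map_add, hpowM _ m hm, hpowN _ n hn, hpowO _ o ho, hs, ht, Units.val_one,
        one_smul, one_smul]
      rfl
    · rintro c hc y ⟨a, ha, h1, h2, s, t, hs, ht, hsM, htN⟩
      obtain ⟨κ, hκ⟩ := h.similitude c hc
      have hcc : ∀ x, c (c⁻¹ x) = x := fun x => LinearEquiv.congr_fun (mul_inv_cancel c) x
      refine ⟨c * a * c⁻¹, mul_mem (mul_mem hc ha) (inv_mem hc),
        by simpa using (hκ.mul h1).mul hκ.inv, fun x hx => ?_, ?_⟩
      · change c (y (c⁻¹ x)) = x; rw [h2 _ (hOA _ (inv_mem hc) x hx), hcc]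
      · rcases hfs c⁻¹ (inv_mem hc) with h3 | h3
        · refine ⟨s, t, hs, ht, fun x hx => ?_, fun x hx => ?_⟩
          · change c (y (c⁻¹ x)) = _; rw [hsM _ (h3.1 x hx), map_smul]; rfl
          · change c (y (c⁻¹ x)) = _; rw [htN _ (h3.2 x hx), map_smul]; rfl
        · refine ⟨t, s, ht, hs, fun x hx => ?_, fun x hx => ?_⟩
          · change c (y (c⁻¹ x)) = _; rw [htN _ (h3.1 x hx), map_smul]; rfl
          · change c (y (c⁻¹ x)) = _; rw [hsM _ (h3.2 x hx), map_smul]; rfl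
  -- an element which swaps `M` and `a₀ M`
  have hcM : IsCompl M (N ⊔ O) := by
    refine ⟨hMN.disjoint_sup_right_of_disjoint_sup_left hdisj, codisjoint_iff.2 ?_⟩
    rw [← sup_assoc, hcompl.sup_eq_top]
  have hcN : IsCompl N (M ⊔ O) := by
    refine ⟨hMN.symm.disjoint_sup_right_of_disjoint_sup_left (sup_comm M N ▸ hdisj),
      codisjoint_iff.2 ?_⟩
    rw [← sup_assoc, sup_comm N M, hcompl.sup_eq_top]
  -- The map acts as `d₀⁻¹ a₀` on `M`, as `a₀` on `N`, and trivially on `O`. Since `M` and `N` are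
  -- isotropic, only the pairing between them has to be preserved, and the single factor `d₀⁻¹`
  -- cancels the multiplier `d₀` of `a₀`.
  let f : W →ₗ[ZMod r] W :=
    ((d₀⁻¹ : (ZMod r)ˣ) : ZMod r) • ((a₀ : W →ₗ[ZMod r] W) ∘ₗ M.projection _ hcM) +
      (a₀ : W →ₗ[ZMod r] W) ∘ₗ N.projection _ hcN +
      (LinearMap.id - M.projection _ hcM - N.projection _ hcN)
  have hf : ∀ m ∈ M, ∀ n ∈ N, ∀ o ∈ O,
      f (m + n + o) = ((d₀⁻¹ : (ZMod r)ˣ) : ZMod r) • a₀ m + a₀ n + o := by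
    intro m hm n hn o ho
    have e1 : M.projection _ hcM (m + n + o) = m := by
      rw [map_add, map_add, Submodule.projection_apply_of_mem_left hcM hm,
        Submodule.projection_apply_of_mem_right hcM (le_sup_left (a := N) hn),
        Submodule.projection_apply_of_mem_right hcM (le_sup_right (a := N) ho), add_zero, add_zero]
    have e2 : N.projection _ hcN (m + n + o) = n := by
      rw [map_add, map_add, Submodule.projection_apply_of_mem_left hcN hn,
        Submodule.projection_apply_of_mem_right hcN (le_sup_left (a := M) hm),
        Submodule.projection_apply_of_mem_right hcN (le_sup_right (a := M) ho), zero_add, add_zero]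
    simp only [f, LinearMap.add_apply, LinearMap.sub_apply, LinearMap.smul_apply,
      LinearMap.comp_apply, e1, e2, LinearMap.id_apply]
    rw [show m + n + o - m - n = o by abel]
    rfl
  have hswap := (hfs a₀ ha₀).resolve_left fun h1 => by
    obtain ⟨x, hx, hx0⟩ := (Submodule.ne_bot_iff _).1 hM.ne_bot
    have h2 : a₀ x ∈ N := hN ▸ ⟨x, hx, rfl⟩
    have h3 : a₀ x = 0 := Submodule.disjoint_def.1 hMN _ (h1.1 x hx) h2
    exact hx0 (a₀.map_eq_zero_iff.1 h3)
  have hfiso : ∀ x y, ω (f x) (f y) = ω x y := by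
    intro x y; obtain ⟨m, hm, n, hn, o, ho, rfl⟩ := hdecomp x
    obtain ⟨m', hm', n', hn', o', ho', rfl⟩ := hdecomp y
    have d1 : ((d₀⁻¹ : (ZMod r)ˣ) : ZMod r) * ((d₀ : ZMod r) * ω m n') = ω m n' := by
      rw [← mul_assoc, ← Units.val_mul, inv_mul_cancel, Units.val_one, one_mul]
    have d2 : ((d₀⁻¹ : (ZMod r)ˣ) : ZMod r) * ((d₀ : ZMod r) * ω n m') = ω n m' := by
      rw [← mul_assoc, ← Units.val_mul, inv_mul_cancel, Units.val_one, one_mul]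
    rw [hf m hm n hn o ho, hf m' hm' n' hn' o' ho']
    simp only [map_add, LinearMap.add_apply, map_smul, LinearMap.smul_apply, smul_eq_mul,
      hd₀ m n', hd₀ n m', d1, d2, hMiso m hm m' hm', hNiso n hn n' hn',
      hNiso _ (hswap.1 m hm) _ (hswap.1 m' hm'), hMiso _ (hswap.2 n hn) _ (hswap.2 n' hn'),
      hOM o' ho' m hm, hON o' ho' n hn, h.neg o m', h.neg o n', hOM o ho m' hm', hON o ho n' hn',
      h.neg o (a₀ m'), h.neg o (a₀ n'), hON _ ho _ (hswap.1 m' hm'), hOM _ ho _ (hswap.2 n' hn'),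
      hON _ ho' _ (hswap.1 m hm), hOM _ ho' _ (hswap.2 n hn)]
    linear_combination d2
  let y : W ≃ₗ[ZMod r] W := LinearEquiv.ofBijective f
    (Finite.injective_iff_bijective.1 (h.injective_of_hasMultiplier hfiso))
  have hyM : ∀ m ∈ M, y m = ((d₀⁻¹ : (ZMod r)ˣ) : ZMod r) • a₀ m := fun m hm => by
    have := hf m hm 0 (zero_mem _) 0 (zero_mem _)
    rwa [map_zero, add_zero, add_zero, add_zero, add_zero] at this
  have hyN : ∀ n ∈ N, y n = a₀ n := fun n hn => by
    have := hf 0 (zero_mem _) n hn 0 (zero_mem _)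
    rwa [map_zero, smul_zero, zero_add, zero_add, add_zero, add_zero] at this
  have hyO : ∀ o ∈ O, y o = o := fun o ho => by
    have := hf 0 (zero_mem _) 0 (zero_mem _) o ho
    rwa [map_zero, smul_zero, zero_add, zero_add] at this
  have hyY : y ∈ Y := by
    refine ⟨a₀, ha₀, fun x x' => ?_, hyO, d₀⁻¹, 1, ?_, one_pow _, hyM, fun n hn => ?_⟩
    · rw [Units.val_one, one_mul]; exact hfiso x x'
    · rw [inv_pow, h.pow_card_eq_one_of_multiplier ha₀ hd₀, inv_one]
    · rw [Units.val_one, one_smul, hyN n hn]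
  obtain ⟨x, hx, hx0⟩ := (Submodule.ne_bot_iff _).1 hM.ne_bot
  have h1 := hM.stable y (hYB hyY) x hx
  have h2 : y x ∈ N := by
    rw [hyM x hx]; exact N.smul_mem _ (hswap.1 x hx)
  exact hx0 (y.map_eq_zero_iff.1 (Submodule.disjoint_def.1 hMN _ h1 h2))

theorem isCompl_orthogonal {M : Submodule (ZMod r) W} (hM : IsIrreducibleFor B M) : IsCompl M
    (ω.orthogonal M) :=
  (BilinForm.isCompl_orthogonal_iff_disjoint h.isRefl).2 (h.disjoint_orthogonal hM)

theorem exists_projection {M : Submodule (ZMod r) W} (hM : IsIrreducibleFor B M) : ∃ π, π =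
    M.projection _ (h.isCompl_orthogonal hM) ∧ (∀ w, π w ∈ M) ∧ (∀ m ∈ M, π m = m) ∧
      (∀ w, π w = 0 ↔ w ∈ ω.orthogonal M) ∧ (∀ w, w - π w ∈ ω.orthogonal M) ∧ ∀ b : W
      ≃ₗ[ZMod r] W, (∀ m ∈ M, b m ∈ M) → (∀ w ∈ ω.orthogonal M, b w ∈ ω.orthogonal M) → ∀ w, π (b w)
        = b (π w) := by
  have hc := h.isCompl_orthogonal hM; have hM' := Submodule.projection_apply_mem hc
  have hid : ∀ m ∈ M, M.projection _ hc m = m := fun m hm =>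
    Submodule.projection_apply_of_mem_left hc hm
  have hO := fun w => Submodule.projection_apply_eq_zero_iff hc (x := w)
  have hsub : ∀ w, w - M.projection _ hc w ∈ ω.orthogonal M := fun w => by
    rw [← hO, map_sub, hid _ (hM' w), sub_self]
  refine ⟨_, rfl, hM', hid, hO, hsub, fun b hb hb' w => ?_⟩
  have h1 : b w = b (M.projection _ hc w) + b (w - M.projection _ hc w) := by
    rw [← map_add, add_sub_cancel]
  rw [h1, map_add, hid _ (hb _ (hM' w)), (hO _).2 (hb' _ (hsub w)), add_zero]

/-- If `p` and `r` are odd, the reflection in an irreducible `B`-submodule belongs to `B`. -/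
theorem exists_reflection_mem (hr2 : r ≠ 2) (hp2 : p ≠ 2) {M : Submodule (ZMod r) W}
    (hM : IsIrreducibleFor B M) : ∃ s ∈ B, ∀ w, s w = w - (2 : ℕ) • M.projection _
    (h.isCompl_orthogonal hM) w := by
  have hnt : Nontrivial W := by
    obtain ⟨x, -, hx⟩ := (Submodule.ne_bot_iff _).1 hM.ne_bot; exact ⟨x, 0, hx⟩
  have hfin : Finite (W ≃ₗ[ZMod r] W) := DFunLike.finite _
  obtain ⟨π, hπ, hπM, hπid, -, hsub, hπB⟩ := h.exists_projection hM
  have hst := h.isStable_orthogonal hM.stable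
  -- The reflection which is `-1` on `M` and `1` on its orthogonal complement; it commutes with `B`.
  let f : W →ₗ[ZMod r] W := LinearMap.id - (2 : ℕ) • π
  have hf : ∀ w, f w = w - (2 : ℕ) • π w := fun w => rfl
  have hff : Function.Involutive f := fun w => by
    rw [hf (f w), hf, map_sub, map_nsmul, hπid _ (hπM w)]; abel
  let s : W ≃ₗ[ZMod r] W := LinearEquiv.ofInvolutive f hff
  have hs : s * s = 1 := LinearEquiv.ext hff
  have hsB : ∀ b ∈ B, s * b = b * s := by
    intro b hb; refine LinearEquiv.ext fun w => ?_; change f (b w) = b (f w)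
    rw [hf, hf, map_sub, map_nsmul, hπB b (hM.stable b hb) (hst b hb)]
  have hsiso : HasMultiplier ω s 1 := by
    intro x y; rw [Units.val_one, one_mul]; change ω (f x) (f y) = _
    have h1 : ∀ m ∈ M, ∀ w, ω m (w - π w) = 0 := fun m hm w => hsub w m hm
    have h2 : ∀ w, f w = (w - π w) - π w := fun w => by rw [hf, two_nsmul]; abel
    have h3 : ω x y = ω ((x - π x) + π x) ((y - π y) + π y) := by simp
    rw [h3, h2, h2]; simp only [map_sub ω (x - π x), map_sub (ω (x - π x)) (y - π y),
      map_sub (ω (π x)) (y - π y), map_add ω (x - π x), map_add (ω (x - π x)) (y - π y),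
      map_add (ω (π x)) (y - π y), LinearMap.sub_apply (ω (x - π x)),
      LinearMap.add_apply (ω (x - π x)),
      h1 _ (hπM x), h.neg (x - π x) (π y), h1 _ (hπM y)]
    ring
  obtain ⟨a₀, ha₀, d₀, hd₀, ⟨b₀, hb₀, hsq⟩, hgen⟩ := h.exists_generator hr2
  obtain ⟨t, ht⟩ : ∃ t, t = a₀ * s * a₀⁻¹ := ⟨_, rfl⟩
  have htB : ∀ b ∈ B, t * b = b * t := by
    intro b hb; have h1 := hsB _ (h.inv_mul_mul_mem ha₀ hb); rw [ht]
    calc a₀ * s * a₀⁻¹ * b = a₀ * (s * (a₀⁻¹ * b * a₀)) * a₀⁻¹ := by group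
      _ = b * (a₀ * s * a₀⁻¹) := by rw [h1]; group
  have htt : t * t = 1 := by
    rw [ht]
    calc a₀ * s * a₀⁻¹ * (a₀ * s * a₀⁻¹) = a₀ * (s * s) * a₀⁻¹ := by group
      _ = 1 := by rw [hs]; group
  have hat : a₀ * t * a₀⁻¹ = s := by
    rw [ht]
    calc a₀ * (a₀ * s * a₀⁻¹) * a₀⁻¹ = (a₀ * a₀) * s * (a₀ * a₀)⁻¹ := by group
      _ = s := by
        rw [hsq, mul_assoc _ b₀, ← hsB _ hb₀, ← mul_assoc, (scalarAut_comm d₀ s).eq]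
        group
  -- Conjugation by `a₀` swaps `s` and `t`, because `a₀ ^ 2` is a scalar times an element of `B`.
  -- Hence the subgroup supplied by `exists_subgroup_of_dihedral` for `s` and `z = s t` is
  -- normalised by `A` and has exponent prime to `p`.
  obtain ⟨z, hz⟩ : ∃ z, z = s * t := ⟨_, rfl⟩
  have hst : s * z = t := by rw [hz, ← mul_assoc, hs, one_mul]
  have hzinv : z⁻¹ = t * s := by
    rw [hz, mul_inv_rev, inv_eq_of_mul_eq_one_left hs, inv_eq_of_mul_eq_one_left htt]
  have hszs : s * z * s = z⁻¹ := by rw [hst, hzinv]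
  have hzB : ∀ b ∈ B, Commute z b := fun b hb => by
    rw [hz]; exact Commute.mul_left (hsB b hb) (htB b hb)
  have htiso : HasMultiplier ω t 1 := by
    rw [ht]; simpa using (hd₀.mul hsiso).mul hd₀.inv
  have hziso : ∀ n : ℤ, HasMultiplier ω (z ^ n) 1 := by
    have h1 : HasMultiplier ω z 1 := by
      rw [hz]; simpa using hsiso.mul htiso
    intro n; obtain ⟨n, rfl | rfl⟩ := n.eq_nat_or_neg
    · simpa using h1.pow n
    · simpa using (h1.pow n).inv
  obtain ⟨Y, j, m, hm, hjY, hYm, hY, hYφ⟩ := exists_subgroup_of_dihedral hs hszs h.prime hp2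
  have hYB : Y ≤ B := by
    refine h.le_of_forall_pow_eq_one hr2 (fun y hy => ?_) hm hYm fun a ha y hy => ?_
    · obtain ⟨n, rfl | rfl⟩ := hY y hy
      · exact hziso n
      · simpa using hsiso.mul (hziso n)
    · have hcomm : ∀ b ∈ B, Commute b y := by
        intro b hb; obtain ⟨n, rfl | rfl⟩ := hY y hy
        · exact ((hzB b hb).zpow_left n).symm
        · exact (Commute.mul_left (hsB b hb) ((hzB b hb).zpow_left n)).symm
      obtain ⟨ν, b, hb, rfl | rfl⟩ := hgen a ha
      · have h1 : Commute (scalarAut r W ν * b) y := (scalarAut_comm ν y).mul_left (hcomm b hb)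
        rwa [h1.eq, mul_inv_cancel_right]
      · have h2 : scalarAut r W ν * (a₀ * b) * y * (scalarAut r W ν * (a₀ * b))⁻¹ =
            a₀ * y * a₀⁻¹ := by
          calc scalarAut r W ν * (a₀ * b) * y * (scalarAut r W ν * (a₀ * b))⁻¹
              = scalarAut r W ν * (a₀ * (b * y) * b⁻¹ * a₀⁻¹) * (scalarAut r W ν)⁻¹ := by group
            _ = _ := by
              rw [(scalarAut_comm ν _).eq, mul_inv_cancel_right, (hcomm b hb).eq]; group
        rw [h2]; refine hYφ (MulAut.conj a₀).toMonoidHom ?_ ?_ y hy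
        · exact (ht.symm.trans hst.symm)
        · change a₀ * z * a₀⁻¹ = z⁻¹; rw [hzinv, hz]
          calc a₀ * (s * t) * a₀⁻¹ = (a₀ * s * a₀⁻¹) * (a₀ * t * a₀⁻¹) := by group
            _ = _ := by rw [← ht, hat]
  -- The element `s z ^ (2 j)` of `B` commutes with `z`, so `z` commutes with `s` as well as being
  -- inverted by it. Thus `z ^ 2 = 1`, and `s z ^ (2 j)` is just `s`.
  have hz2 : z ^ 2 = 1 := by
    have h1 := (hzB _ (hYB hjY)).eq
    have h2 : z * s = s * z := by
      rw [← mul_assoc, mul_assoc s, (Commute.zpow_self z (2 * j)).eq, ← mul_assoc] at h1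
      exact mul_right_cancel h1
    rw [← h2, mul_assoc, hs, mul_one] at hszs; rw [sq]; nth_rewrite 2 [hszs]
    exact mul_inv_cancel z
  refine ⟨s, ?_, fun w => ?_⟩
  · have h1 := hYB hjY; rwa [zpow_mul, zpow_ofNat, hz2, one_zpow, mul_one] at h1
  · rw [← hπ]; exact hf w

/-- Distinct irreducible `B`-submodules are orthogonal. -/
theorem le_orthogonal {M M' : Submodule (ZMod r) W} (hM : IsIrreducibleFor B M)
    (hM' : IsIrreducibleFor B M') (hne : M ≠ M') : M' ≤ ω.orthogonal M := by
  have hnt : Nontrivial W := by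
    obtain ⟨x, -, hx⟩ := (Submodule.ne_bot_iff _).1 hM.ne_bot; exact ⟨x, 0, hx⟩
  obtain ⟨π, hπ, hπM, hπid, hπ0, hsub, hπb⟩ := h.exists_projection hM
  have hst := h.isStable_orthogonal hM.stable
  have hπB := fun b hb => hπb b (hM.stable b hb) (hst b hb)
  have hinf : M' ⊓ M = ⊥ := by
    refine (hM'.eq_bot_or_eq _ inf_le_left (hM'.stable.inf hM.stable)).resolve_right fun h1 => ?_
    exact hne (hM'.eq_of_le hM (inf_eq_left.1 h1)).symm
  -- For `r = 2` every `B`-stable subspace is `A`-stable, so there is no nonzero isotropic one. If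
  -- `M'` is not orthogonal to `M`, projection identifies it with `M`, so `M'` is the graph of an
  -- equivariant map `κ` from `M` to its orthogonal complement. Adjusting `κ` by an element of the
  -- commutant makes its graph isotropic, a contradiction.
  by_cases h2 : r = 2
  · by_contra hno
    have hker : M' ⊓ ω.orthogonal M = ⊥ := by
      refine (hM'.eq_bot_or_eq _ inf_le_left (hM'.stable.inf hst)).resolve_right fun h1 => ?_
      exact hno (inf_eq_left.1 h1)
    let π' : M' →ₗ[ZMod r] M := (π.codRestrict M hπM).comp M'.subtype
    have hπ' : ∀ x : M', (π' x : W) = π x := fun x => rfl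
    have hπ'inj : Injective π' := by
      rw [← LinearMap.ker_eq_bot, LinearMap.ker_eq_bot']; intro x hx
      have h1 : (x : W) ∈ M' ⊓ ω.orthogonal M := ⟨x.2, (hπ0 _).1 (congrArg Subtype.val hx)⟩
      rw [hker] at h1; exact Subtype.ext h1
    have hπ'surj : Surjective π' := by
      have h1 : IsStable B ((LinearMap.range π').map M.subtype) := by
        rintro b hb _ ⟨_, ⟨x, rfl⟩, rfl⟩
        refine ⟨_, ⟨⟨b x, hM'.stable b hb x x.2⟩, rfl⟩, ?_⟩; exact hπB b hb x
      rcases hM.eq_bot_or_eq _ (Submodule.map_subtype_le _ _) h1 with h3 | h3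
      · exfalso; obtain ⟨x, hx, hx0⟩ := (Submodule.ne_bot_iff _).1 hM'.ne_bot
        have h4 : (π' ⟨x, hx⟩ : W) ∈ (LinearMap.range π').map M.subtype := ⟨_, ⟨_, rfl⟩, rfl⟩
        rw [h3, Submodule.mem_bot] at h4
        have h5 : (⟨x, hx⟩ : M') = 0 := hπ'inj (by rw [map_zero]; exact Subtype.ext h4)
        exact hx0 (congrArg Subtype.val h5)
      · intro y; have h4 : (y : W) ∈ (LinearMap.range π').map M.subtype := h3.symm ▸ y.2
        obtain ⟨_, ⟨x, rfl⟩, hx⟩ := h4; exact ⟨x, Subtype.ext hx⟩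
    let e : M' ≃ₗ[ZMod r] M := LinearEquiv.ofBijective π' ⟨hπ'inj, hπ'surj⟩
    have he : ∀ m : M, π (e.symm m) = m := fun m => congrArg Subtype.val (e.apply_symm_apply m)
    -- `M'` is the graph of `κ`
    let κ : M →ₗ[ZMod r] W := M'.subtype.comp e.symm.toLinearMap - M.subtype
    have hκ : ∀ m : M, κ m = (e.symm m : W) - m := fun m => rfl
    have hκO : ∀ m : M, κ m ∈ ω.orthogonal M := fun m => by
      refine (hπ0 _).1 ?_; rw [hκ, map_sub, he, hπid _ m.2, sub_self]
    let ρ : B →* End (ZMod r) M :=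
      { toFun := fun b => ((b : W ≃ₗ[ZMod r] W) : W →ₗ[ZMod r] W).restrict
          (fun x hx => hM.stable b b.2 x hx)
        map_one' := rfl
        map_mul' := fun _ _ => rfl }
    have hρ : ∀ (b : B) (m : M), (ρ b m : W) = (b : W ≃ₗ[ZMod r] W) m := fun _ _ => rfl
    have hκB : ∀ (b : B) (m : M), κ (ρ b m) = (b : W ≃ₗ[ZMod r] W) (κ m) := by
      intro b m; have h1 : e.symm (ρ b m) =
          ⟨(b : W ≃ₗ[ZMod r] W) (e.symm m), hM'.stable b b.2 _ (e.symm m).2⟩ := by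
        rw [LinearEquiv.symm_apply_eq]; refine Subtype.ext ?_
        change _ = π ((b : W ≃ₗ[ZMod r] W) (e.symm m)); rw [hπB _ b.2, he, hρ]
      rw [hκ, hκ, h1, hρ, map_sub]
    let β : BilinForm (ZMod r) M := ω.restrict M
    have hβ : ∀ m m' : M, β m m' = ω m m' := fun _ _ => rfl
    have hMnd : ∀ m : M, (∀ m', β m m' = 0) → m = 0 := by
      intro m hm
      have h1 : (m : W) ∈ M ⊓ ω.orthogonal M := ⟨m.2, fun x hx => by
        change ω x m = 0; rw [h.neg, neg_eq_zero]; exact hm ⟨x, hx⟩⟩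
      rw [(h.disjoint_orthogonal hM).eq_bot] at h1; exact Subtype.ext h1
    have hMfd : FiniteDimensional (ZMod r) M := Module.Finite.of_finite
    have hβn : β.Nondegenerate := ⟨hMnd, fun m hm => hMnd m fun m' => by
      rw [hβ, h.neg, neg_eq_zero]; exact hm m'⟩
    have hex : ∀ φ : Module.Dual (ZMod r) M, ∃ m, ∀ m', β m m' = φ m' := fun φ =>
      ⟨(BilinForm.toDual β hβn).symm φ, fun m' => BilinForm.apply_toDual_symm_apply ..⟩
    -- The form pulled back along `κ` is expressed through the form on `M` by an endomorphism `c`,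
    -- which commutes with `B` and is self-adjoint.
    choose c₀ hc₀ using fun m : M => hex ((ω (κ m)).comp κ)
    have hc₀' : ∀ m m' : M, β (c₀ m) m' = ω (κ m) (κ m') := fun m m' => hc₀ m m'
    have huniq : ∀ x y : M, (∀ m', β x m' = β y m') → x = y := fun x y h1 =>
      sub_eq_zero.1 (hMnd _ fun m' => by rw [map_sub, LinearMap.sub_apply, h1, sub_self])
    let c : End (ZMod r) M :=
      { toFun := c₀
        map_add' := fun x y => huniq _ _ fun m' => by
          rw [map_add, LinearMap.add_apply, hc₀', hc₀', hc₀', map_add, map_add, LinearMap.add_apply]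
        map_smul' := fun k x => huniq _ _ fun m' => by
          rw [RingHom.id_apply, map_smul, LinearMap.smul_apply, hc₀', hc₀', map_smul, map_smul,
            LinearMap.smul_apply] }
    have hcβ : ∀ m m' : M, β (c m) m' = ω (κ m) (κ m') := hc₀'
    have hne0 : ∀ f : M →ₗ[ZMod r] W, (∀ (b : B) (m : M), f (ρ b m) = (b : W ≃ₗ[ZMod r] W) (f m)) →
        (∀ m m', ω (f m) (f m') = 0) → f = 0 := by
      intro f hfB hf; rw [← LinearMap.range_eq_bot]
      refine h.eq_bot_of_isotropic _ (h.isStable_of_two (Or.inr h2) ?_) ?_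
      · rintro b hb _ ⟨m, rfl⟩; exact ⟨ρ ⟨b, hb⟩ m, hfB ⟨b, hb⟩ m⟩
      · rintro _ ⟨x, rfl⟩ _ ⟨y, rfl⟩; exact hf x y
    have hMnt : Nontrivial M := Submodule.nontrivial_iff_ne_bot.2 hM.ne_bot
    have hc0 : c ≠ 0 := by
      intro h1; have h3 : κ = 0 := hne0 κ hκB fun m m' => by rw [← hcβ, h1]; simp
      obtain ⟨m, hm⟩ := exists_ne (0 : M)
      have h4 : (e.symm m : W) = m := sub_eq_zero.1 (by rw [← hκ, h3]; rfl)
      have h5 : (m : W) ∈ M' ⊓ M := ⟨h4 ▸ (e.symm m).2, m.2⟩; rw [hinf] at h5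
      exact hm (Subtype.ext h5)
    have hcneg : ∀ m m' : M, β (c m) m' = β m (c m') := fun m m' => by
      rw [hcβ, hβ, h.neg m, ← hβ, hcβ, h.neg]
    have hβB : ∀ (b : B) (m m' : M), β (ρ b m) (ρ b m') = β m m' := fun b m m' => by
      have := h.isometry b b.2 m m'; rwa [Units.val_one, one_mul] at this
    have hρsurj : ∀ (b : B) (m : M), ∃ m', ρ b m' = m := fun b m =>
      ⟨ρ b⁻¹ m, by rw [← Module.End.mul_apply, ← map_mul, mul_inv_cancel, map_one]; rfl⟩
    have hcB : ∀ b, c * ρ b = ρ b * c := by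
      intro b; refine LinearMap.ext fun m => huniq _ _ fun m' => ?_
      obtain ⟨m', rfl⟩ := hρsurj b m'
      change β (c (ρ b m)) (ρ b m') = β (ρ b (c m)) (ρ b m'); rw [hβB, hcβ, hcβ, hκB, hκB]
      have := h.isometry b b.2 (κ m) (κ m'); rwa [Units.val_one, one_mul] at this
    have hirr : ∀ U : Submodule (ZMod r) M, (∀ b, ∀ u ∈ U, ρ b u ∈ U) → U = ⊥ ∨ U = ⊤ := by
      intro U hU
      have h1 : IsStable B (U.map M.subtype) := by
        rintro b hb _ ⟨u, hu, rfl⟩; exact ⟨_, hU ⟨b, hb⟩ u hu, rfl⟩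
      rcases hM.eq_bot_or_eq _ (Submodule.map_subtype_le _ _) h1 with h3 | h3
      · left; exact (Submodule.map_injective_of_injective (Submodule.subtype_injective M))
            (h3.trans (Submodule.map_bot _).symm)
      · right; refine eq_top_iff.2 fun x _ => ?_
        have h4 : (x : W) ∈ U.map M.subtype := h3.symm ▸ x.2; obtain ⟨u, hu, hux⟩ := h4
        rwa [Subtype.ext hux] at hu
    obtain ⟨a, ha, hab⟩ := exists_forall_apply_eq_neg ρ hirr β hβB (fun m => h.alt m) hMnd h2 c
      hc0 hcB hcneg
    -- The choice of `a` makes the form pulled back along `κ ∘ a` the negative of the form on `M`,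
    -- so the graph of `κ ∘ a` is isotropic and stable, hence zero.
    have h3 : M.subtype + κ.comp a = 0 := by
      refine hne0 _ (fun b m => ?_) fun m m' => ?_
      · change (ρ b m : W) + κ ((a * ρ b) m) = (b : W ≃ₗ[ZMod r] W) (m + κ (a m))
        rw [ha, Module.End.mul_apply, hκB, hρ, map_add]
      · change ω ((m : W) + κ (a m)) (m' + κ (a m')) = 0
        have h4 : ω m (κ (a m')) = 0 := hκO _ m m.2
        have h5 : ω (κ (a m)) m' = 0 := by
          rw [h.neg, neg_eq_zero]; exact hκO _ m' m'.2
        have h6 := hab m m'; rw [hcβ, hβ] at h6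
        simp only [map_add, LinearMap.add_apply, h4, h5, h6]; ring
    obtain ⟨m, hm⟩ := exists_ne (0 : M)
    have h4 : (m : W) + κ (a m) = 0 := LinearMap.congr_fun h3 m
    have h5 : (m : W) ∈ M ⊓ ω.orthogonal M :=
      ⟨m.2, by rw [eq_neg_of_add_eq_zero_left h4]; exact neg_mem (hκO _)⟩
    rw [(h.disjoint_orthogonal hM).eq_bot] at h5; exact hm (Subtype.ext h5)
  by_cases hp2 : p = 2
  · -- the elements which act on `M` as elements of `B` and centralise its complement
    have hMA := h.isStable_of_two (Or.inl hp2) hM.stable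
    have hOA := fun a ha => hπb a (hMA a ha) (h.isStable_of_two (Or.inl hp2) hst a ha)
    let Y : Subgroup (W ≃ₗ[ZMod r] W) :=
      { carrier := {y | ∃ b ∈ B, ∀ w, y w = b (π w) + (w - π w)}
        one_mem' := ⟨1, one_mem _, fun w => (add_sub_cancel (π w) w).symm⟩
        mul_mem' := by
          rintro y y' ⟨b, hb, hy⟩ ⟨b', hb', hy'⟩
          refine ⟨b * b', mul_mem hb hb', fun w => ?_⟩
          have h1 := hM.stable b' hb' _ (hπM w)
          rw [LinearEquiv.mul_apply, hy', hy, map_add, hπid _ h1, (hπ0 _).2 (hsub w), add_zero,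
            add_sub_cancel_left]
          rfl
        inv_mem' := by
          rintro y ⟨b, hb, hy⟩; refine ⟨b⁻¹, inv_mem hb, fun w => y.injective ?_⟩
          have h1 := hM.stable _ (inv_mem hb) _ (hπM w); change (y * y⁻¹) w = _
          rw [mul_inv_cancel, hy, map_add, hπid _ h1, (hπ0 _).2 (hsub w), add_zero,
            add_sub_cancel_left]
          change w = (b * b⁻¹) (π w) + _; rw [mul_inv_cancel]
          exact (add_sub_cancel (π w) w).symm }
    have horth : ∀ x ∈ M, ∀ w, ω x (w - π w) = 0 := fun x hx w => hsub w x hx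
    have hiso : ∀ b ∈ B, ∀ x y, ω (b (π x) + (x - π x)) (b (π y) + (y - π y)) = ω x y := by
      intro b hb x y; have h1 := h.isometry b hb (π x) (π y); have h3 := hM.stable b hb
      conv_rhs => rw [← add_sub_cancel (π x) x, ← add_sub_cancel (π y) y]
      simp only [map_add ω, map_add (ω _), LinearMap.add_apply, horth _ (h3 _ (hπM x)),
        horth _ (hπM x), h.neg (x - π x) (b _), horth _ (h3 _ (hπM y)), h.neg (x - π x) (π y),
        horth _ (hπM y), h1, Units.val_one, one_mul]
    have hYB : Y ≤ B := by
      refine h.le_of_forall_pow_eq_one h2 (m := Nat.card B) ?_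
        (h.coprime.coprime_dvd_left (Subgroup.card_dvd_of_le h.le)) ?_ ?_
      · rintro y ⟨b, hb, hy⟩ w w'; rw [hy, hy, hiso b hb, Units.val_one, one_mul]
      · rintro y ⟨b, hb, hy⟩
        have h1 : ∀ n : ℕ, ∀ w, (y ^ n) w = (b ^ n) (π w) + (w - π w) := by
          intro n; induction n with
          | zero => exact fun w => (add_sub_cancel (π w) w).symm
          | succ n ih =>
            intro w; have h1 := hM.stable b hb _ (hπM w)
            rw [pow_succ, LinearEquiv.mul_apply, ih, hy, map_add, hπid _ h1, (hπ0 _).2 (hsub w),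
              add_zero, add_sub_cancel_left, pow_succ]
            rfl
        refine LinearEquiv.ext fun w => ?_
        have h3 : b ^ Nat.card B = 1 := congrArg Subtype.val (pow_card_eq_one' (x := (⟨b, hb⟩ : B)))
        rw [h1, h3]; exact add_sub_cancel (π w) w
      · rintro a ha y ⟨b, hb, hy⟩; refine ⟨a * b * a⁻¹, h.normal a ha b hb, fun w => ?_⟩
        have h1 : a (a⁻¹ w) = w := LinearEquiv.congr_fun (mul_inv_cancel a) w
        change a (y (a⁻¹ w)) = a (b (a⁻¹ (π w))) + _
        rw [hy, map_add, map_sub, h1, ← hOA a ha, h1, hOA _ (inv_mem ha)]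
    -- The isometry which is `b` on `M` and trivial on the complement lies in `B`. It moves `x ∈ M'`
    -- by `b (π x) - π x`, which lies in both `M` and `M'`, so it vanishes.
    have hfix : ∀ b ∈ B, ∀ x ∈ M', b (π x) = π x := by
      intro b hb x hx
      let f : W →ₗ[ZMod r] W := (b : W →ₗ[ZMod r] W) ∘ₗ π + (LinearMap.id - π)
      let y : W ≃ₗ[ZMod r] W := LinearEquiv.ofBijective f
        (Finite.injective_iff_bijective.1 (h.injective_of_hasMultiplier (hiso b hb)))
      have hy : y x = b (π x) + (x - π x) := rfl
      have h1 : y ∈ B := hYB ⟨b, hb, fun w => rfl⟩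
      have h3 : b (π x) - π x ∈ M' ⊓ M := by
        refine ⟨?_, sub_mem (hM.stable b hb _ (hπM x)) (hπM x)⟩
        have h4 := sub_mem (hM'.stable y h1 x hx) hx
        rwa [hy, show b (π x) + (x - π x) - x = b (π x) - π x by abel] at h4
      rw [hinf, Submodule.mem_bot] at h3; exact sub_eq_zero.1 h3
    -- A nonzero vector fixed by `B` spans the irreducible `M`, which would be one-dimensional and
    -- therefore isotropic.
    intro x hx; refine (hπ0 x).1 ?_; by_contra hne0
    have h1 : Submodule.span (ZMod r) {π x} = M := by
      refine (hM.eq_bot_or_eq _ (by simpa using hπM x) fun b hb u hu => ?_).resolve_left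
        (by rwa [Submodule.span_singleton_eq_bot])
      obtain ⟨k, rfl⟩ := Submodule.mem_span_singleton.1 hu; rwa [map_smul, hfix b hb x hx]
    have h3 : π x ∈ M ⊓ ω.orthogonal M := by
      refine ⟨hπM x, fun u hu => ?_⟩; rw [← h1] at hu
      obtain ⟨k, rfl⟩ := Submodule.mem_span_singleton.1 hu; change ω (k • π x) (π x) = 0
      rw [map_smul, LinearMap.smul_apply, h.alt, smul_zero]
    rw [(h.disjoint_orthogonal hM).eq_bot] at h3; exact hne0 h3
  -- With `p` and `r` odd the reflection in `M` lies in `B`, so `x - s x = 2 π x` lies in `M' ∩ M =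
  -- 0`, and `2` is invertible.
  · obtain ⟨s, hsB, hs⟩ := h.exists_reflection_mem h2 hp2 hM; intro x hx
    refine (hπ0 x).1 ?_
    have h1 : (2 : ℕ) • π x ∈ M' := by
      have h3 := sub_mem hx (hM'.stable s hsB x hx); rwa [hs, sub_sub_cancel, ← hπ] at h3
    have h3 : (2 : ℕ) • π x ∈ M' ⊓ M := ⟨h1, nsmul_mem (hπM x) 2⟩
    rw [hinf, Submodule.mem_bot] at h3
    have h4 : ((2 : ℕ) : ZMod r) ≠ 0 := by
      intro h5; rw [ZMod.natCast_eq_zero_iff] at h5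
      exact h2 ((Nat.prime_dvd_prime_iff_eq hr.out Nat.prime_two).1 h5)
    rw [← Nat.cast_smul_eq_nsmul (ZMod r)] at h3
    exact (smul_eq_zero.1 h3).resolve_left h4

end IsCoprimeSymplectic

end Symplectic

/-! ### Complements modulo a subgroup -/

section Complement

/-- A complement modulo `Δ` of a subgroup `Y`, in a group which is abelian modulo `Δ` and generated
modulo `Y` by elements of order `r` modulo `Δ`. -/
theorem exists_complement_modulo {E : Type*} [Group E] [Finite E] {r : ℕ} (hr : r.Prime)
    {Δ Y : Subgroup E} (hΔ : Δ ≤ Y) (hcomm : ∀ x y : E, ⁅x, y⁆ ∈ Δ)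
    (hpow : ∀ x : E, ∃ y ∈ Y, (x * y) ^ r ∈ Δ) : ∃ F : Subgroup E, Δ ≤ F ∧ F ⊓ Y = Δ ∧ F ⊔ Y = ⊤ :=
    by
  -- The complement is a maximal subgroup with `F ∩ Y ≤ Δ`. Commutators lie in `Δ`, so every
  -- subgroup containing `Δ` is normal.
  obtain ⟨F, -, hF⟩ := (Set.toFinite {F : Subgroup E | Δ ≤ F ∧ F ⊓ Y ≤ Δ}).exists_le_maximal
    (show Δ ∈ {F : Subgroup E | Δ ≤ F ∧ F ⊓ Y ≤ Δ} from ⟨le_rfl, inf_le_left⟩)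
  refine ⟨F, hF.prop.1, le_antisymm hF.prop.2 (le_inf hF.prop.1 hΔ), ?_⟩
  have hn : ∀ L : Subgroup E, Δ ≤ L → L.Normal := fun L hL => ⟨fun x hx g => by
    have h1 := L.mul_mem (hL (hcomm g x)) hx
    rwa [commutatorElement_def, inv_mul_cancel_right] at h1⟩
  have hFn := hn F hF.prop.1; rw [eq_top_iff]; intro e₀ _; obtain ⟨y, hy, he⟩ := hpow e₀
  obtain ⟨e, rfl⟩ : ∃ e, e₀ = e * y⁻¹ := ⟨e₀ * y, by group⟩
  rw [inv_mul_cancel_right] at he; refine mul_mem ?_ (inv_mem (mem_sup_right hy))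
  by_contra hne
  -- Since `e ^ r ∈ Δ`, a power `e ^ k` with `k` prime to `r` would bring back `e` itself.
  -- Consequently adjoining `e` to `F` creates no new intersection with `Y`.
  have hsup : ∀ k : ℕ, ¬ r ∣ k → e ^ k ∉ F ⊔ Y := by
    intro k hk hek
    have hcop : Nat.Coprime k r := (Nat.Coprime.symm ((Nat.Prime.coprime_iff_not_dvd hr).2 hk))
    obtain ⟨u, v, huv⟩ := Nat.isCoprime_iff_coprime.2 hcop; refine hne ?_
    rw [← zpow_one e, ← huv, zpow_add, mul_comm u, mul_comm v, zpow_mul, zpow_mul, zpow_natCast,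
      zpow_natCast]
    exact mul_mem (zpow_mem hek u) (zpow_mem (mem_sup_left (hF.prop.1 he)) v)
  have hF' : F ⊔ zpowers e ≤ F := by
    refine hF.le_of_ge ⟨hF.prop.1.trans le_sup_left, ?_⟩ le_sup_left; rintro x ⟨hx, hxY⟩
    obtain ⟨f, hf, x', hx', rfl⟩ := mem_sup_of_normal_left.1 hx
    rw [← mem_powers_iff_mem_zpowers] at hx'; obtain ⟨k, rfl⟩ := hx'
    change f * e ^ k ∈ Y at hxY; change f * e ^ k ∈ Δ
    have hk : r ∣ k := by
      by_contra hk; refine hsup k hk ?_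
      have := mul_mem (inv_mem (mem_sup_left (T := Y) hf)) (mem_sup_right (S := F) hxY)
      rwa [inv_mul_cancel_left] at this
    obtain ⟨m, rfl⟩ := hk
    have h1 : e ^ (r * m) ∈ Δ := by
      rw [pow_mul]; exact pow_mem he m
    refine mul_mem (hF.prop.2 ⟨hf, ?_⟩) h1; have := mul_mem hxY (inv_mem (hΔ h1))
    rwa [mul_inv_cancel_right] at this
  exact hne (mem_sup_left (hF' (mem_sup_right (mem_zpowers e))))

end Complement

/-! ### Linear independence and intertwiners in groups of class two -/

section Independence

variable {K : Type*} {V : Type*} [Field K] [Finite K] [AddCommGroup V] [Module K V]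
  [FiniteDimensional K V] [Nontrivial V]

theorem GeneralLinearGroup.exists_smul_one {z : GL K V} (hz : z ∈ center (GL K V)) : ∃ a : Kˣ,
    (z : End K V) = (a : K) • (1 : End K V) := by
  obtain ⟨a, ha⟩ := GeneralLinearGroup.mem_center_iff.1 hz; exact ⟨a, LinearMap.ext ha⟩

/-- In a group of class two with scalar centre, elements which are distinct modulo the scalars are
linearly independent. -/
theorem linearIndependent_of_class_two {X : Subgroup (GL K V)}
    (hX : (Nat.card X).Coprime (Nat.card K)) (hcomm : ∀ x ∈ X, ∀ y ∈ X, ⁅x, y⁆ ∈ center (GL K V))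
    (hC : ∀ x ∈ X, (∀ y ∈ X, y * x = x * y) → x ∈ center (GL K V)) {ι : Type*} [Finite ι]
    {s : ι → GL K V} (hs : ∀ i, s i ∈ X) (hne : ∀ i j, (s i)⁻¹ * s j ∈ center (GL K V) → i = j) :
    LinearIndependent K fun i => (s i : End K V) := by
  classical
  have hfin : Fintype X := Fintype.ofFinite X
  have hfinι : Fintype ι := Fintype.ofFinite ι
  -- the averaging operator
  let E : End K V →ₗ[K] End K V :=
    ∑ y : X, (LinearMap.mulLeft K ((y : GL K V) : End K V)) ∘ₗ
      (LinearMap.mulRight K (((y⁻¹ : X) : GL K V) : End K V))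
  have hE : ∀ f, E f = ∑ y : X, ((y : GL K V) : End K V) *
      (f * (((y⁻¹ : X) : GL K V) : End K V)) := fun f => by
    simp only [E, LinearMap.sum_apply, LinearMap.comp_apply, LinearMap.mulLeft_apply,
      LinearMap.mulRight_apply]
  have hE1 : ∀ x ∈ X, x ∉ center (GL K V) → E x = 0 := by
    intro x hx hxc
    obtain ⟨y, hy, hyx⟩ : ∃ y ∈ X, y * x ≠ x * y := by
      by_contra! h; exact hxc (hC x hx h)
    obtain ⟨a, ha⟩ := GeneralLinearGroup.exists_smul_one (hcomm y hy x hx)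
    -- Some `y` conjugates `x` to `a x` with a scalar `a ≠ 1`. The average is invariant under
    -- conjugation, so it is multiplied by `a` and must vanish.
    have h1 : ((y * x * y⁻¹ : GL K V) : End K V) = (a : K) • (x : End K V) := by
      have h2 : y * x * y⁻¹ = ⁅y, x⁆ * x := by rw [commutatorElement_def, inv_mul_cancel_right]
      rw [h2, Units.val_mul, ha, smul_mul_assoc, one_mul]
    have h2 : E ((y * x * y⁻¹ : GL K V) : End K V) = E x := by
      rw [hE, hE]; conv_rhs => rw [← Equiv.sum_comp (Equiv.mulRight (⟨y, hy⟩ : X))]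
      refine Finset.sum_congr rfl fun w _ => ?_
      rw [← Units.val_mul, ← Units.val_mul, ← Units.val_mul, ← Units.val_mul]; congr 1
    rw [h1, map_smul] at h2
    have h3 : ((a : K) - 1) • E x = 0 := by rw [sub_smul, one_smul, h2, sub_self]
    refine (smul_eq_zero.1 h3).resolve_left fun h4 => hyx ?_
    rw [← commutatorElement_eq_one_iff_mul_comm]; refine Units.ext ?_
    rw [ha, sub_eq_zero.1 h4, one_smul, Units.val_one]
  have hE2 : E 1 = (Nat.card X : K) • (1 : End K V) := by
    rw [hE]; have h1 : ∀ y ∈ (Finset.univ : Finset X), ((y : GL K V) : End K V) *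
          (1 * (((y⁻¹ : X) : GL K V) : End K V)) = 1 := by
      intro y _; rw [one_mul, ← Units.val_mul, ← coe_mul, mul_inv_cancel]; rfl
    rw [Finset.sum_congr rfl h1, Finset.sum_const, Finset.card_univ, Nat.card_eq_fintype_card,
      Nat.cast_smul_eq_nsmul]
  have hcard : (Nat.card X : K) ≠ 0 := by
    have hp : (ringChar K).Prime := CharP.char_is_prime K _; intro h
    rw [ringChar.spec] at h
    have hdvd : ringChar K ∣ Nat.card K := by
      have : Fintype K := Fintype.ofFinite K
      rw [← ringChar.spec, Nat.card_eq_fintype_card]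
      exact FiniteField.cast_card_eq_zero K
    exact hp.one_lt.ne' (Nat.dvd_one.1 (hX ▸ Nat.dvd_gcd h hdvd))
  -- Multiplying a relation by the inverse of `s i` and averaging leaves only the `i`-th coefficient
  -- times `|X|`, which is nonzero in `K`.
  rw [Fintype.linearIndependent_iff]; intro c hc i
  have h1 : ∑ j, c j • E (((s i)⁻¹ * s j : GL K V) : End K V) = 0 := by
    have h2 := congrArg (fun f => E (((s i)⁻¹ : GL K V) * f)) hc
    simp only [Finset.mul_sum, map_sum, mul_zero, map_zero, mul_smul_comm, map_smul] at h2
    exact h2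
  rw [Finset.sum_eq_single i] at h1
  · rw [inv_mul_cancel, Units.val_one, hE2, smul_smul] at h1
    have h2 := (smul_eq_zero.1 h1).resolve_right one_ne_zero
    exact (mul_eq_zero.1 h2).resolve_right hcard
  · intro j _ hj
    rw [hE1 _ (mul_mem (inv_mem (hs i)) (hs j)) fun h => hj (hne i j h).symm, smul_zero]
  · simp

/-- An endomorphism of a group of class two which fixes the scalars is induced by an invertible
element of the group algebra. -/
theorem exists_unit_mul_eq {X : Subgroup (GL K V)} (hX : (Nat.card X).Coprime (Nat.card K))
    (hcomm : ∀ x ∈ X, ∀ y ∈ X, ⁅x, y⁆ ∈ center (GL K V))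
    (hC : ∀ x ∈ X, (∀ y ∈ X, y * x = x * y) → x ∈ center (GL K V)) {n : ℕ}
    {θ : End K (Fin n → K) →ₐ[K] End K V} (hθ : Injective θ) (hr : θ.range = groupAlg X)
    {φ : X →* X} (hφ : ∀ x : X, (x : GL K V) ∈ center (GL K V) → φ x = x)
    (hφ' : ∀ x : X, (φ x : GL K V) ∈ center (GL K V) → (x : GL K V) ∈ center (GL K V)) : ∃ u : GL K
    V, (u : End K V) ∈ groupAlg X ∧ ∀ x : X, u * x = φ x * u := by
  classical
  let Z : Subgroup X := (center (GL K V)).subgroupOf X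
  have hZn : Z.Normal := inferInstance; have hfin : Fintype (X ⧸ Z) := Fintype.ofFinite _
  have hex : ∀ x : X, ∃ a, θ a = ((x : GL K V) : End K V) :=
    fun x => by
      have h1 := coe_mem_groupAlg x.2; rw [← hr] at h1; exact h1
  choose τ hτ using hex
  have hτ1 : τ 1 = 1 := hθ (by rw [hτ, map_one]; rfl)
  have hτm : ∀ x y, τ (x * y) = τ x * τ y := fun x y => hθ (by rw [hτ, map_mul, hτ, hτ]; rfl)
  have hτz : ∀ z ∈ Z, ∃ a : K, τ z = a • 1 := by
    intro z hz; obtain ⟨a, ha⟩ := GeneralLinearGroup.exists_smul_one hz; exact ⟨a, hθ (by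
      rw [hτ, map_smul, map_one]; exact ha)⟩
  -- The candidate intertwiner is the sum of `φ(x) f x⁻¹` over cosets of the scalar subgroup. The
  -- summand depends only on the coset because `φ` fixes scalars.
  let F : End K (Fin n → K) → X → End K (Fin n → K) := fun f x => τ (φ x) * f * τ x⁻¹
  have hFz : ∀ f x z, z ∈ Z → F f (x * z) = F f x := by
    intro f x z hz; obtain ⟨a, ha⟩ := hτz z hz; obtain ⟨b, hb⟩ := hτz z⁻¹ (inv_mem hz)
    have h1 : (a * b) • (1 : End K (Fin n → K)) = 1 := by
      have h2 : τ (z * z⁻¹) = 1 := by rw [mul_inv_cancel, hτ1]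
      rwa [hτm, ha, hb, smul_mul_smul_comm, mul_one] at h2
    simp only [F]; rw [map_mul, hφ z hz, hτm, mul_inv_rev, hτm, ha, hb]
    simp only [mul_smul_comm, smul_mul_assoc, one_mul, mul_one, smul_smul]
    rw [← one_mul (τ (φ x) * f * τ x⁻¹), ← smul_mul_assoc]
    first
    | rw [h1]
    | rw [mul_comm b a, h1]
  let s : X ⧸ Z → X := Quotient.out
  have hs : ∀ w : X ⧸ Z, (s w : X ⧸ Z) = w := Quotient.out_eq'
  have hFs : ∀ f (x : X), F f (s (x : X ⧸ Z)) = F f x := by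
    intro f x; have h1 : x⁻¹ * s (x : X ⧸ Z) ∈ Z := by rw [← QuotientGroup.eq, hs]
    have h2 := hFz f x _ h1; rwa [mul_inv_cancel_left] at h2
  let U : End K (Fin n → K) → End K (Fin n → K) := fun f => ∑ w, F f (s w)
  have hU : ∀ f x, U f * τ x = τ (φ x) * U f := by
    intro f x; simp only [U, Finset.mul_sum, Finset.sum_mul]
    rw [← Equiv.sum_comp (Equiv.mulLeft (x : X ⧸ Z))]
    refine Finset.sum_congr rfl fun w _ => ?_
    have h1 : F f (s ((x : X ⧸ Z) * w)) = F f (x * s w) := by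
      rw [← hFs f (x * s w), QuotientGroup.mk_mul, hs]
    rw [Equiv.coe_mulLeft, h1]; simp only [F]
    rw [map_mul, hτm (φ x), mul_inv_rev, hτm (s w)⁻¹, mul_assoc, mul_assoc (τ (s w)⁻¹),
      ← hτm x⁻¹ x, inv_mul_cancel, hτ1, mul_one]
    simp only [mul_assoc]
  -- If all these sums vanished, rank one choices of `f` would give a linear relation among the
  -- images of the coset representatives under `φ`. These are independent, being distinct modulo
  -- scalars by `hφ'`.
  obtain ⟨f, hf⟩ : ∃ f, U f ≠ 0 := by
    by_contra! h0; have hli := linearIndependent_of_class_two hX hcomm hC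
      (s := fun w : X ⧸ Z => (φ (s w) : GL K V))
      (fun w => (φ (s w)).2) fun w w' h1 => by
        have h2 : (s w)⁻¹ * s w' ∈ Z := mem_subgroupOf.2 (hφ' ((s w)⁻¹ * s w') (by
          rw [map_mul, map_inv]; exact h1))
        rw [← QuotientGroup.eq, hs, hs] at h2; exact h2
    rw [Fintype.linearIndependent_iff] at hli
    have h1 : ∀ (ξ : Module.Dual K (Fin n → K)) (t : Fin n → K), ξ (τ (s 1)⁻¹ t) = 0 := by
      intro ξ t; refine hli (fun w => ξ (τ (s w)⁻¹ t)) ?_ 1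
      have h2 : ∑ w, ξ (τ (s w)⁻¹ t) • τ (φ (s w)) = 0 := by
        refine LinearMap.ext fun v => ?_
        have h3 := LinearMap.congr_fun (h0 (LinearMap.smulRight ξ v)) t
        simp only [U, F, LinearMap.sum_apply, Module.End.mul_apply, LinearMap.smulRight_apply,
          map_smul, LinearMap.zero_apply] at h3
        simpa only [LinearMap.sum_apply, LinearMap.smul_apply, LinearMap.zero_apply] using h3
      have h4 := congrArg θ h2; simp only [map_sum, map_smul, hτ, map_zero] at h4
      exact h4
    have h2 : τ (s 1)⁻¹ = 0 := LinearMap.ext fun t => by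
      funext i; exact h1 (LinearMap.proj i) t
    have h3 := hτ (s 1)⁻¹; rw [h2, map_zero] at h3; exact Units.ne_zero _ h3.symm
  -- The kernel is stable under the full matrix algebra, so it is zero as soon as `U f ≠ 0`.
  have hker : LinearMap.ker (U f) = ⊥ := by
    have hst : ∀ b ∈ groupAlg X, ∃ a, θ a = b ∧ ∀ v, U f v = 0 → U f (a v) = 0 := by
      intro b hb
      refine groupAlg_induction (p := fun b => ∃ a, θ a = b ∧ ∀ v, U f v = 0 → U f (a v) = 0)
        ?_ ?_ ?_ ?_ hb
      · intro x hx; refine ⟨τ ⟨x, hx⟩, hτ _, fun v hv => ?_⟩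
        have := LinearMap.congr_fun (hU f ⟨x, hx⟩) v
        rw [Module.End.mul_apply, Module.End.mul_apply, hv, map_zero] at this; exact this
      · exact ⟨0, map_zero _, fun v _ => by rw [LinearMap.zero_apply, map_zero]⟩
      · rintro _ _ ⟨a, rfl, ha⟩ ⟨b, rfl, hb⟩
        exact ⟨a + b, map_add _ _ _, fun v hv => by
          rw [LinearMap.add_apply, map_add, ha v hv, hb v hv, add_zero]⟩
      · rintro c _ ⟨a, rfl, ha⟩
        exact ⟨c • a, map_smul _ _ _, fun v hv => by
          rw [LinearMap.smul_apply, map_smul, ha v hv, smul_zero]⟩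
    rw [LinearMap.ker_eq_bot']; intro v hv; by_contra hv0
    refine hf (LinearMap.ext fun w => ?_)
    obtain ⟨ξ, hξ⟩ := Module.Projective.exists_dual_eq_one K hv0
    obtain ⟨a, ha, hav⟩ := hst (θ (LinearMap.smulRight ξ w)) (hr ▸ ⟨_, rfl⟩)
    have h1 := hav v hv; rwa [hθ ha, LinearMap.smulRight_apply, hξ, one_smul] at h1
  have hunit : IsUnit (U f) := (LinearMap.isUnit_iff_ker_eq_bot _).2 hker
  obtain ⟨w, hw⟩ := hunit
  refine ⟨Units.map (θ : End K (Fin n → K) →* End K V) w, ?_, fun x => Units.ext ?_⟩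
  · rw [← hr]; exact ⟨w, rfl⟩
  · rw [Units.val_mul, Units.val_mul, ← hτ, ← hτ]
    change θ (w : End K (Fin n → K)) * _ = _ * θ (w : End K (Fin n → K))
    rw [hw, ← map_mul, ← map_mul, hU]

end Independence

/-! ### The symplectic space attached to a group of class two -/

section SymplecticQuotient

variable {Q : Type*} [Group Q]

/-- The central quotient of a group of class two, as a symplectic space. -/
structure IsSymplecticQuotient {r : ℕ} {W : Type*} [AddCommGroup W] [Module (ZMod r) W]
    (q : Q → W) (ζ : Q) (ω : BilinForm (ZMod r) W) : Prop where
  map_mul : ∀ x y, q (x * y) = q x + q y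
  surjective : Surjective q
  eq_zero_iff : ∀ x, q x = 0 ↔ x ∈ center Q
  mem_center : ζ ∈ center Q
  orderOf_eq : orderOf ζ = r
  commutator : ∀ x y, ⁅x, y⁆ = ζ ^ (ω (q x) (q y)).val

theorem commutatorElement_mul_left {x y z : Q} (h : ⁅y, z⁆ ∈ center Q) : ⁅x * y, z⁆ = ⁅x, z⁆ * ⁅y,
    z⁆ := by
  have h1 : ⁅x * y, z⁆ = (x * ⁅y, z⁆) * x⁻¹ * ⁅x, z⁆ := by
    simp only [commutatorElement_def]; group
  rw [h1, mem_center_iff.1 h x, mul_inv_cancel_right, ← mem_center_iff.1 h]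

theorem commutatorElement_mul_right {x y z : Q} (h : ⁅x, z⁆ ∈ center Q) : ⁅x, y * z⁆ = ⁅x, y⁆ * ⁅x,
    z⁆ := by
  have h1 : ⁅x, y * z⁆ = ⁅x, y⁆ * (y * ⁅x, z⁆) * y⁻¹ := by
    simp only [commutatorElement_def]; group
  rw [h1, mem_center_iff.1 h y]; group

theorem commutatorElement_pow_right {x y : Q} (h : ⁅x, y⁆ ∈ center Q) (n : ℕ) : ⁅x, y ^ n⁆ = ⁅x, y⁆
    ^ n := by
  induction n with
  | zero => simp
  | succ n ih => rw [pow_succ, commutatorElement_mul_right h, ih, pow_succ]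

theorem commutatorElement_pow_left {x y : Q} (h : ⁅x, y⁆ ∈ center Q) (n : ℕ) : ⁅x ^ n, y⁆ = ⁅x, y⁆ ^
    n := by
  induction n with
  | zero => simp
  | succ n ih => rw [pow_succ, commutatorElement_mul_left h, ih, pow_succ]

/-- The power map in a group of class two. -/
theorem mul_pow_eq_of_commutator_mem_center {x y : Q} (h : ⁅y, x⁆ ∈ center Q) (n : ℕ) : (x * y) ^ n
    = x ^ n * y ^ n * ⁅y, x⁆ ^ (n.choose 2) := by
  induction n with
  | zero => simp
  | succ n ih =>
    have h1 : y ^ n * x = x * y ^ n * ⁅y, x⁆ ^ n := by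
      have h2 := commutatorElement_pow_left h n
      rw [← h2, (mem_center_iff.1 (h2 ▸ pow_mem h n : ⁅y ^ n, x⁆ ∈ center Q) (x * y ^ n))]
      simp only [commutatorElement_def]; group
    rw [pow_succ, ih]; have hz := mem_center_iff.1 (pow_mem h (n.choose 2))
    calc x ^ n * y ^ n * ⁅y, x⁆ ^ n.choose 2 * (x * y)
        = x ^ n * (y ^ n * (⁅y, x⁆ ^ n.choose 2 * x) * y) := by simp only [mul_assoc]
      _ = x ^ n * (y ^ n * x * (⁅y, x⁆ ^ n.choose 2 * y)) := by
        rw [← hz x]; simp only [mul_assoc]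
      _ = x ^ n * (x * y ^ n * (⁅y, x⁆ ^ n * (⁅y, x⁆ ^ n.choose 2 * y))) := by
        rw [h1]; simp only [mul_assoc]
      _ = x ^ n * (x * y ^ n * (y * (⁅y, x⁆ ^ n * ⁅y, x⁆ ^ n.choose 2))) := by
        rw [← mul_assoc (⁅y, x⁆ ^ n), ← pow_add, mem_center_iff.1 (pow_mem h _) y]
      _ = x ^ (n + 1) * y ^ (n + 1) * ⁅y, x⁆ ^ (n + 1).choose 2 := by
        rw [← pow_add, Nat.choose_succ_succ' n 1, Nat.choose_one_right, pow_succ x, pow_succ y]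
        simp only [mul_assoc]

/-- If the centre is cyclic, then the central elements of exponent `r` are powers of any central
element of order `r`. -/
theorem mem_zpowers_of_pow_eq_one [Finite Q] (hcyc : IsCyclic (center Q)) {r : ℕ} (hr : 0 < r)
    {ζ c : Q} (hζc : ζ ∈ center Q) (hζ : orderOf ζ = r) (hc : c ∈ center Q) (hcr : c ^ r = 1) : c ∈
    zpowers ζ := by
  letI : CommGroup (center Q) := IsCyclic.commGroup
  have ho : orderOf (⟨ζ, hζc⟩ : center Q) = r := by rw [← hζ, ← Subgroup.orderOf_coe]
  have h1 : zpowers (⟨ζ, hζc⟩ : center Q) = MonoidHom.ker (powMonoidHom (α := center Q) r) := by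
    refine Subgroup.eq_of_le_of_card_ge ?_ ?_
    · rw [zpowers_le, MonoidHom.mem_ker, powMonoidHom_apply, ← ho, pow_orderOf_eq_one]
    · rw [IsCyclic.card_powMonoidHom_ker, Nat.card_zpowers, ho]
      exact Nat.gcd_le_right _ hr
  have h2 : (⟨c, hc⟩ : center Q) ∈ zpowers (⟨ζ, hζc⟩ : center Q) := by
    rw [h1]; exact Subtype.ext hcr
  obtain ⟨k, hk⟩ := h2; exact ⟨k, congrArg Subtype.val hk⟩

/-- The central quotient of a group of class two and exponent `r` modulo the centre. -/
theorem exists_quotient_module {Q : Type u} [Group Q] {r : ℕ} (hcomm : ∀ x y : Q, ⁅x, y⁆ ∈ center Q)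
    (hpow : ∀ x : Q, x ^ r ∈ center Q) : ∃ (W : Type u) (_ : AddCommGroup W) (_ : Module (ZMod r) W)
    (q : Q → W), (∀ x y, q (x * y) = q x + q y) ∧ Surjective q ∧ ∀ x, q x = 0 ↔ x ∈ center Q := by
  letI : CommGroup (Q ⧸ center Q) :=
    { (inferInstance : Group (Q ⧸ center Q)) with
      mul_comm := by
        intro a b; obtain ⟨x, rfl⟩ := QuotientGroup.mk_surjective a
        obtain ⟨y, rfl⟩ := QuotientGroup.mk_surjective b
        rw [← QuotientGroup.mk_mul, ← QuotientGroup.mk_mul, QuotientGroup.eq]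
        have h1 := hcomm y⁻¹ x⁻¹; rw [commutatorElement_def] at h1
        rwa [show (x * y)⁻¹ * (y * x) = y⁻¹ * x⁻¹ * y⁻¹⁻¹ * x⁻¹⁻¹ by group] }
  letI : Module (ZMod r) (Additive (Q ⧸ center Q)) := AddCommGroup.zmodModule (by
    intro a; obtain ⟨x, hx⟩ := QuotientGroup.mk_surjective a.toMul
    have h1 : a.toMul ^ r = 1 := by
      rw [← hx, ← QuotientGroup.mk_pow, QuotientGroup.eq_one_iff]; exact hpow x
    exact h1)
  refine ⟨Additive (Q ⧸ center Q), inferInstance, inferInstance,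
    fun x => Additive.ofMul (x : Q ⧸ center Q), fun x y => rfl, QuotientGroup.mk_surjective,
    fun x => QuotientGroup.eq_one_iff x⟩

/-- As `x ^ r` is central, every commutator has exponent `r`. A cyclic centre has only one subgroup
of order `r`, so all commutators are powers of a single nontrivial one, and the exponent is a
bilinear form on the quotient. -/
theorem exists_isSymplecticQuotient {Q : Type u} [Group Q] [Finite Q] {r : ℕ} (hr : r.Prime)
    (hcomm : ∀ x y : Q, ⁅x, y⁆ ∈ center Q) (hpow : ∀ x : Q, x ^ r ∈ center Q)
    (hcyc : IsCyclic (center Q)) (hna : ∃ x y : Q, ⁅x, y⁆ ≠ 1) : ∃ (W : Type u) (_ : AddCommGroup W)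
    (_ : Module (ZMod r) W) (q : Q → W) (ζ : Q)
      (ω : BilinForm (ZMod r) W), IsSymplecticQuotient q ζ ω := by
  have : Fact r.Prime := ⟨hr⟩
  obtain ⟨W, _, _, q, hmul, hsurj, hker⟩ := exists_quotient_module hcomm hpow
  have hpow1 : ∀ x y : Q, ⁅x, y⁆ ^ r = 1 := fun x y => by
    rw [← commutatorElement_pow_right (hcomm x y), commutatorElement_eq_one_iff_mul_comm]
    exact mem_center_iff.1 (hpow y) x
  obtain ⟨x₀, y₀, hne⟩ := hna; obtain ⟨ζ, hζ⟩ : ∃ ζ, ζ = ⁅x₀, y₀⁆ := ⟨_, rfl⟩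
  have hζo : orderOf ζ = r := hζ ▸ orderOf_eq_prime (hpow1 x₀ y₀) hne
  have hζc : ζ ∈ center Q := hζ ▸ hcomm x₀ y₀
  letI : CommGroup (center Q) := IsCyclic.commGroup
  have hmod : ∀ n, ζ ^ (n % r) = ζ ^ n := fun n => by
    have h := pow_mod_orderOf ζ n; rwa [hζo] at h
  have hex : ∀ c ∈ center Q, c ^ r = 1 → ∃ k : ZMod r, ζ ^ k.val = c := by
    intro c hc hcr; have h2 := mem_zpowers_of_pow_eq_one hcyc hr.pos hζc hζo hc hcr
    rw [← mem_powers_iff_mem_zpowers] at h2; obtain ⟨k, hk⟩ := h2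
    refine ⟨(k : ZMod r), ?_⟩; rw [ZMod.val_natCast, hmod]; exact hk
  have hadd : ∀ a b : ZMod r, ζ ^ (a + b).val = ζ ^ a.val * ζ ^ b.val := fun a b => by
    rw [ZMod.val_add, ← pow_add, hmod]
  have hinj : ∀ a b : ZMod r, ζ ^ a.val = ζ ^ b.val → a = b := fun a b hab => by
    rw [pow_inj_mod, hζo, Nat.mod_eq_of_lt (ZMod.val_lt a), Nat.mod_eq_of_lt (ZMod.val_lt b)] at hab
    exact ZMod.val_injective r hab
  choose k hk using fun x y : Q => hex _ (hcomm x y) (hpow1 x y)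
  have hkl : ∀ x x' y, k (x * x') y = k x y + k x' y := fun x x' y => hinj _ _ (by
    rw [hadd, hk, hk, hk, commutatorElement_mul_left (hcomm _ _)])
  have hkr : ∀ x y y', k x (y * y') = k x y + k x y' := fun x y y' => hinj _ _ (by
    rw [hadd, hk, hk, hk, commutatorElement_mul_right (hcomm _ _)])
  have hk1 : ∀ z ∈ center Q, ∀ x, k z x = 0 := fun z hz x => hinj _ _ (by
    rw [hk, ZMod.val_zero, pow_zero, commutatorElement_eq_one_iff_mul_comm, mem_center_iff.1 hz x])
  have hk2 : ∀ z ∈ center Q, ∀ x, k x z = 0 := fun z hz x => hinj _ _ (by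
    rw [hk, ZMod.val_zero, pow_zero, commutatorElement_eq_one_iff_mul_comm, mem_center_iff.1 hz x])
  have hq1 : q 1 = 0 := (hker 1).2 (one_mem _)
  have hqinv : ∀ x, q x⁻¹ = - q x := fun x => by
    rw [← add_eq_zero_iff_eq_neg, ← hmul, inv_mul_cancel, hq1]
  have hqeq : ∀ x x', q x = q x' → ∃ z ∈ center Q, x = x' * z := fun x x' h =>
    ⟨x'⁻¹ * x, (hker _).1 (by rw [hmul, hqinv, h, neg_add_cancel]), by group⟩
  have hwd : ∀ x x' y y', q x = q x' → q y = q y' → k x y = k x' y' := by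
    intro x x' y y' hx hy; obtain ⟨z, hz, rfl⟩ := hqeq _ _ hx
    obtain ⟨z', hz', rfl⟩ := hqeq _ _ hy
    rw [hkl, hkr, hk1 z hz, hk2 z' hz', add_zero, add_zero]
  let s := Function.surjInv hsurj
  have hs : ∀ w, q (s w) = w := Function.surjInv_eq hsurj; let F : W →+ W →+ ZMod r :=
    AddMonoidHom.mk' (fun w => AddMonoidHom.mk' (fun w' => k (s w) (s w')) fun a b => by
      rw [← hkr]
      exact hwd _ _ _ _ rfl (by rw [hs, hmul, hs, hs])) fun a b => by
      refine AddMonoidHom.ext fun w => ?_; change k _ _ = k _ _ + k _ _; rw [← hkl]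
      exact hwd _ _ _ _ (by rw [hs, hmul, hs, hs]) rfl
  refine ⟨W, inferInstance, inferInstance, q, ζ, LinearMap.mk₂ (ZMod r) (fun w w' => F w w')
    (fun a b w => by rw [map_add, AddMonoidHom.add_apply])
    (fun c a w => ?_) (fun a b w => map_add _ _ _) (fun c a w => ZMod.map_smul _ _ _),
    hmul, hsurj, hker, hζc, hζo, fun x y => ?_⟩
  · exact ZMod.map_smul ((AddMonoidHom.eval w).comp F) c a
  · rw [← hk]; congr 2; exact hwd _ _ _ _ (hs _).symm (hs _).symm

namespace IsSymplecticQuotient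

variable {r : ℕ} {W : Type*} [AddCommGroup W] [Module (ZMod r) W] {q : Q → W} {ζ : Q}
  {ω : BilinForm (ZMod r) W} (hS : IsSymplecticQuotient q ζ ω)

include hS

theorem map_one : q 1 = 0 := (hS.eq_zero_iff 1).2 (one_mem _)

theorem map_inv (x : Q) : q x⁻¹ = - q x := by
  rw [← add_eq_zero_iff_eq_neg, ← hS.map_mul, inv_mul_cancel, hS.map_one]

theorem map_pow (x : Q) (n : ℕ) : q (x ^ n) = n • q x := by
  induction n with
  | zero => rw [pow_zero, hS.map_one, zero_smul]
  | succ n ih => rw [pow_succ, hS.map_mul, ih, succ_nsmul]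

theorem eq_iff {x y : Q} : q x = q y ↔ x⁻¹ * y ∈ center Q := by
  rw [← hS.eq_zero_iff, hS.map_mul, hS.map_inv, neg_add_eq_zero]

theorem pow_mem_center (x : Q) : x ^ r ∈ center Q := by
  rw [← hS.eq_zero_iff, hS.map_pow, ← Nat.cast_smul_eq_nsmul (ZMod r), CharP.cast_eq_zero, zero_smul]

theorem commutator_mem_center (x y : Q) : ⁅x, y⁆ ∈ center Q := by
  rw [hS.commutator]; exact pow_mem hS.mem_center _

theorem commutator_pow (x y : Q) : ⁅x, y⁆ ^ r = 1 := by
  rw [hS.commutator, ← pow_mul, mul_comm, pow_mul]; have h := pow_orderOf_eq_one ζ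
  rw [hS.orderOf_eq] at h; rw [h, one_pow]

/-- An automorphism of the group acts on the symplectic space. -/
theorem exists_linearEquiv (φ : Q ≃* Q) : ∃ a : W ≃ₗ[ZMod r] W, ∀ x, a (q x) = q (φ x) := by
  have hφ : ∀ (φ : Q ≃* Q) x y, q x = q y → q (φ x) = q (φ y) := by
    intro φ x y h; rw [hS.eq_iff] at h ⊢; rw [← _root_.map_inv, ← _root_.map_mul]
    exact characteristic_iff_le_comap.1 (inferInstance : (center Q).Characteristic) φ h
  let s := Function.surjInv hS.surjective
  have hs : ∀ w, q (s w) = w := Function.surjInv_eq hS.surjective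
  let F : (Q ≃* Q) → W →+ W := fun φ => AddMonoidHom.mk' (fun w => q (φ (s w))) fun a b => by
    rw [← hS.map_mul, ← _root_.map_mul]; exact hφ φ _ _ (by rw [hS.map_mul, hs, hs, hs])
  have hF : ∀ φ x, F φ (q x) = q (φ x) := fun φ x => hφ φ _ _ (hs _)
  refine ⟨LinearEquiv.ofLinear ((F φ).toZModLinearMap r) ((F φ.symm).toZModLinearMap r) ?_ ?_, hF φ⟩
  · refine LinearMap.ext fun w => ?_; obtain ⟨x, rfl⟩ := hS.surjective w
    change F φ (F φ.symm (q x)) = q x; rw [hF, hF, MulEquiv.apply_symm_apply]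
  · refine LinearMap.ext fun w => ?_; obtain ⟨x, rfl⟩ := hS.surjective w
    change F φ.symm (F φ (q x)) = q x; rw [hF, hF, MulEquiv.symm_apply_apply]

theorem linearEquiv_ext {a b : W ≃ₗ[ZMod r] W} (h : ∀ x, a (q x) = b (q x)) : a = b :=
  LinearEquiv.ext fun w => by
    obtain ⟨x, rfl⟩ := hS.surjective w; exact h x

variable [Fact r.Prime]

theorem pow_injective {a b : ZMod r} (h : ζ ^ a.val = ζ ^ b.val) : a = b := by
  rw [pow_inj_mod, hS.orderOf_eq, Nat.mod_eq_of_lt (ZMod.val_lt a),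
    Nat.mod_eq_of_lt (ZMod.val_lt b)] at h
  exact ZMod.val_injective r h

theorem eq_zero_iff_commute {x y : Q} : ω (q x) (q y) = 0 ↔ x * y = y * x := by
  rw [← commutatorElement_eq_one_iff_mul_comm, hS.commutator]; constructor
  · intro h; rw [h, ZMod.val_zero, pow_zero]
  · intro h; exact hS.pow_injective (by rw [h, ZMod.val_zero, pow_zero])

theorem alternating (w : W) : ω w w = 0 := by
  obtain ⟨x, rfl⟩ := hS.surjective w; exact hS.eq_zero_iff_commute.2 rfl

theorem eq_zero_of_forall (w : W) (h : ∀ w', ω w w' = 0) : w = 0 := by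
  obtain ⟨x, rfl⟩ := hS.surjective w; rw [hS.eq_zero_iff, mem_center_iff]
  exact fun y => (hS.eq_zero_iff_commute.1 (h (q y))).symm

theorem nondegenerate : ω.Nondegenerate := by
  refine ⟨hS.eq_zero_of_forall, fun w h => ?_⟩; obtain ⟨x, rfl⟩ := hS.surjective w
  rw [hS.eq_zero_iff, mem_center_iff]; exact fun y => (hS.eq_zero_iff_commute.1 (h (q y)))

/-- An isometry of the symplectic space which is compatible with the power map is induced by an
endomorphism of the group. -/
theorem exists_hom [Finite Q] {y : W →ₗ[ZMod r] W} (hy : ∀ a b, ω (y a) (y b) = ω a b)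
    (hpow : ∀ x x', q x' = y (q x) → ∃ z ∈ center Q, x' ^ r * z ^ r = x ^ r) : ∃ φ : Q →* Q,
    (∀ z ∈ center Q, φ z = z) ∧ ∀ x, q (φ x) = y (q x) := by
  -- `E` consists of all pairs lifting `y`. The graph of the wanted endomorphism is a complement in
  -- `E` to the pairs `Y` with central first entry, modulo the diagonal `Δ` of the centre.
  let E : Subgroup (Q × Q) :=
    { carrier := {p | q p.2 = y (q p.1)}
      one_mem' := by
        change q 1 = y (q 1); rw [hS.map_one, map_zero]
      mul_mem' := by
        rintro a b (ha : _ = _) (hb : _ = _); change q (a.2 * b.2) = y (q (a.1 * b.1))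
        rw [hS.map_mul, hS.map_mul, ha, hb, map_add]
      inv_mem' := by
        rintro a (ha : _ = _); change q (a.2⁻¹) = y (q (a.1⁻¹))
        rw [hS.map_inv, hS.map_inv, ha, map_neg] }
  have hE : ∀ e : E, q (e : Q × Q).2 = y (q (e : Q × Q).1) := fun e => e.2
  let Y : Subgroup E := (center Q).comap ((MonoidHom.fst Q Q).comp E.subtype)
  let Δ : Subgroup E := Y ⊓ (MonoidHom.eqLocus (MonoidHom.fst Q Q) (MonoidHom.snd Q Q)).comap
    E.subtype
  have hY : ∀ e : E, e ∈ Y ↔ (e : Q × Q).1 ∈ center Q := fun _ => Iff.rfl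
  have hΔ : ∀ e : E, e ∈ Δ ↔ (e : Q × Q).1 ∈ center Q ∧ (e : Q × Q).1 = (e : Q × Q).2 :=
    fun _ => Iff.rfl
  have hc : ∀ e f : E, ⁅e, f⁆ ∈ Δ := by
    intro e f; rw [hΔ]
    have h1 : ((⁅e, f⁆ : E) : Q × Q).1 = ⁅(e : Q × Q).1, (f : Q × Q).1⁆ := rfl
    have h2 : ((⁅e, f⁆ : E) : Q × Q).2 = ⁅(e : Q × Q).2, (f : Q × Q).2⁆ := rfl
    rw [h1, h2, hS.commutator (e : Q × Q).2, hE, hE, hy, ← hS.commutator]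
    exact ⟨hS.commutator_mem_center _ _, rfl⟩
  -- The hypothesis on powers is exactly what makes the `r`-th power of a suitably corrected pair
  -- diagonal.
  have hp : ∀ e : E, ∃ y ∈ Y, (e * y) ^ r ∈ Δ := by
    intro e; obtain ⟨z, hz, hzr⟩ := hpow _ _ (hE e)
    have h1 : ((1 : Q), z) ∈ E := by
      change q z = y (q 1); rw [(hS.eq_zero_iff _).2 hz, hS.map_one, map_zero]
    refine ⟨⟨_, h1⟩, one_mem (center Q), (hΔ _).2 ?_⟩
    have h2 : ((((e : E) * ⟨_, h1⟩ : E) ^ r : E) : Q × Q).1 = ((e : Q × Q).1 * 1) ^ r := rfl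
    have h3 : ((((e : E) * ⟨_, h1⟩ : E) ^ r : E) : Q × Q).2 = ((e : Q × Q).2 * z) ^ r := rfl
    have h4 : Commute (e : Q × Q).2 z := mem_center_iff.1 hz _
    rw [h2, h3, mul_one, h4.mul_pow, hzr]; exact ⟨hS.pow_mem_center _, rfl⟩
  obtain ⟨F, hΔF, hFY, hF⟩ := exists_complement_modulo (Fact.out : r.Prime)
    (inf_le_left : Δ ≤ Y) hc hp
  have hn : Y.Normal := inferInstance
  have h1 : ∀ x, ∃ x', ∃ h : (x, x') ∈ E, (⟨(x, x'), h⟩ : E) ∈ F := by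
    intro x; obtain ⟨x₁, hx₁⟩ := hS.surjective (y (q x))
    have h2 : (⟨(x, x₁), hx₁⟩ : E) ∈ F ⊔ Y := hF ▸ mem_top _
    obtain ⟨f, hf, e, he, hfe⟩ := mem_sup_of_normal_right.1 h2
    have h3 : (f : Q × Q).1 * (e : Q × Q).1 = x := congrArg (fun e : E => (e : Q × Q).1) hfe
    have h4 : (((e : Q × Q).1, (e : Q × Q).1) : Q × Q) ∈ E := by
      change q _ = y (q _); rw [(hS.eq_zero_iff _).2 ((hY e).1 he), map_zero]
    have h5 : (⟨_, h4⟩ : E) ∈ F := hΔF ((hΔ _).2 ⟨(hY e).1 he, rfl⟩)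
    have h6 := mul_mem hf h5; refine ⟨(f : Q × Q).2 * (e : Q × Q).1, ?_, ?_⟩
    · have := (f * ⟨_, h4⟩ : E).2; rw [← h3]; exact this
    · convert h6 using 1
      exact Subtype.ext (Prod.ext h3.symm rfl)
  choose φ hφE hφ using h1
  have huniq : ∀ x x₁ x₂ (h₁ : (x, x₁) ∈ E) (h₂ : (x, x₂) ∈ E), (⟨_, h₁⟩ : E) ∈ F →
      (⟨_, h₂⟩ : E) ∈ F → x₁ = x₂ := by
    intro x x₁ x₂ h₁ h₂ hf₁ hf₂; have h3 := mul_mem (inv_mem hf₁) hf₂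
    have h4 : (⟨_, h₁⟩ : E)⁻¹ * ⟨_, h₂⟩ ∈ F ⊓ Y := by
      refine ⟨h3, (hY _).2 ?_⟩; change x⁻¹ * x ∈ center Q; rw [inv_mul_cancel]
      exact one_mem _
    rw [hFY] at h4; have h5 : x⁻¹ * x = x₁⁻¹ * x₂ := ((hΔ _).1 h4).2
    rw [inv_mul_cancel] at h5; exact (inv_mul_eq_one.1 h5.symm)
  refine ⟨MonoidHom.mk' φ fun a b => huniq (a * b) _ _ _ (mul_mem (hφE a) (hφE b))
    (hφ (a * b)) (mul_mem (hφ a) (hφ b)), fun z hz => ?_, fun x => hφE x⟩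
  have h4 : (z, z) ∈ E := by
    change q z = y (q z); rw [(hS.eq_zero_iff _).2 hz, map_zero]
  exact huniq z _ _ (hφE z) h4 (hφ z) (hΔF ((hΔ _).2 ⟨hz, rfl⟩))

/-- If all characteristic abelian subgroups are central, then the `r`-th powers lie in every
characteristic central subgroup modulo which the power map is a homomorphism. -/
theorem pow_mem [Finite W] (hQ : CharAbelianCentral Q) (hcyc : IsCyclic (center Q)) {T : Subgroup Q}
    (hT : T.Characteristic) (hTc : T ≤ center Q) (hcT : ∀ z ∈ center Q, z ^ r ∈ T)
    (hmul : ∀ x y, ∃ t ∈ T, (x * y) ^ r = x ^ r * y ^ r * t) (x : Q) : x ^ r ∈ T := by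
  -- The elements whose `r`-th power lies in `T` form a characteristic subgroup `L`. If `L` were
  -- proper, its centraliser would be abelian, hence central, whereas the nondegenerate form
  -- supplies a noncentral element commuting with `L`.
  have hr : r.Prime := Fact.out; let L : Subgroup Q :=
    { carrier := {x | x ^ r ∈ T}
      one_mem' := by
        change (1 : Q) ^ r ∈ T; rw [one_pow]; exact one_mem _
      mul_mem' := by
        rintro a b (ha : _ ∈ T) (hb : _ ∈ T); obtain ⟨t, ht, h⟩ := hmul a b; change _ ∈ T
        rw [h]; exact mul_mem (mul_mem ha hb) ht
      inv_mem' := by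
        rintro a (ha : _ ∈ T); change _ ∈ T; rw [inv_pow]; exact inv_mem ha }
  have hL : ∀ x, x ∈ L ↔ x ^ r ∈ T := fun _ => Iff.rfl
  have hLc : L.Characteristic := by
    rw [characteristic_iff_le_comap]; intro φ x hx; rw [mem_comap, hL]; change φ x ^ r ∈ T
    rw [← _root_.map_pow]; exact characteristic_iff_le_comap.1 hT φ hx
  by_contra hx₀
  -- Here `L` has at most `r` cosets, represented by powers of `x`: with `x ^ r = g ^ a` and `y ^ r
  -- = g ^ b` for a generator `g` of the centre, `a` is prime to `r` and `k` is `-b / a` modulo `r`.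
  have hgen : ∀ y, ∃ k : ℕ, y * x ^ k ∈ L := by
    obtain ⟨g, hg⟩ := hcyc.exists_generator
    have hg' : ∀ c ∈ center Q, ∃ k : ℤ, (g : Q) ^ k = c := fun c hc => by
      obtain ⟨k, hk⟩ := hg ⟨c, hc⟩; exact ⟨k, congrArg Subtype.val hk⟩
    have hgT : ∀ k : ℤ, (r : ℤ) ∣ k → (g : Q) ^ k ∈ T := by
      rintro _ ⟨k, rfl⟩; rw [mul_comm, zpow_mul, zpow_natCast]
      exact hcT _ (zpow_mem g.2 k)
    intro y; obtain ⟨a, ha⟩ := hg' _ (hS.pow_mem_center x)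
    obtain ⟨b, hb⟩ := hg' _ (hS.pow_mem_center y)
    have ha0 : (a : ZMod r) ≠ 0 := by
      rw [Ne, ZMod.intCast_zmod_eq_zero_iff_dvd]; exact fun h => hx₀ (ha ▸ hgT a h)
    refine ⟨(-(b : ZMod r) / (a : ZMod r)).val, ?_⟩
    obtain ⟨t, ht, h⟩ := hmul y (x ^ (-(b : ZMod r) / (a : ZMod r)).val); rw [hL, h]
    refine mul_mem ?_ ht
    rw [← pow_mul, mul_comm _ r, pow_mul, ← ha, ← hb, ← zpow_natCast, ← zpow_mul, ← zpow_add]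
    refine hgT _ ?_; rw [← ZMod.intCast_zmod_eq_zero_iff_dvd]; push_cast
    rw [ZMod.natCast_zmod_val, mul_div_cancel₀ _ ha0, add_neg_cancel]
  let C : Subgroup Q := centralizer (L : Set Q)
  have hCc : C ≤ center Q := by
    refine hQ C inferInstance fun u hu v hv => ?_
    have huL : ∀ l ∈ L, l * u = u * l := mem_centralizer_iff.1 hu
    have hvL : ∀ l ∈ L, l * v = v * l := mem_centralizer_iff.1 hv
    obtain ⟨k, hk⟩ := hgen u
    have h1 : ⁅u, x⁆ ^ k = 1 := by
      rw [← commutatorElement_pow_right (hS.commutator_mem_center u x),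
        commutatorElement_eq_one_iff_mul_comm]
      have h2 := huL _ hk; rw [mul_assoc] at h2; exact (mul_left_cancel h2).symm
    -- If `r ∣ k`, then `u` itself lies in `L` and commutes with `v`. Otherwise `u` commutes with
    -- `x`, since `[u, x]` has order dividing both `k` and `r`; and `v` differs from an element of
    -- `L` by a power of `x`.
    by_cases hrk : r ∣ k
    · refine hvL u ?_
      have h3 : x ^ k ∈ L := by
        obtain ⟨m, rfl⟩ := hrk; rw [pow_mul, hL]
        exact hcT _ (_root_.pow_mem (hS.pow_mem_center x) m)
      have := mul_mem hk (inv_mem h3); rwa [mul_inv_cancel_right] at this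
    · have h4 : ⁅u, x⁆ = 1 := by
        have hcop : Nat.Coprime k r := (Nat.Coprime.symm ((Nat.Prime.coprime_iff_not_dvd hr).2 hrk))
        have h5 := Nat.dvd_gcd (orderOf_dvd_of_pow_eq_one h1)
          (orderOf_dvd_of_pow_eq_one (hS.commutator_pow u x))
        rw [hcop] at h5; exact orderOf_eq_one_iff.1 (Nat.dvd_one.1 h5)
      rw [commutatorElement_eq_one_iff_mul_comm] at h4; obtain ⟨k', hk'⟩ := hgen v
      have h6 := huL _ hk'
      have h7 : u * x ^ k' = x ^ k' * u := (Commute.pow_right h4 k').eq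
      rw [mul_assoc, ← h7, ← mul_assoc, ← mul_assoc] at h6
      exact (mul_right_cancel h6).symm
  let U : AddSubgroup W :=
    { carrier := q '' L
      zero_mem' := ⟨1, one_mem _, hS.map_one⟩
      add_mem' := by
        rintro _ _ ⟨a, ha, rfl⟩ ⟨b, hb, rfl⟩; exact ⟨a * b, mul_mem ha hb, hS.map_mul _ _⟩
      neg_mem' := by
        rintro _ ⟨a, ha, rfl⟩; exact ⟨a⁻¹, inv_mem ha, hS.map_inv _⟩ }
  have hUx : q x ∉ AddSubgroup.toZModSubmodule r U := by
    rintro ⟨y, hy, hyx⟩; refine hx₀ ?_; have h1 := hS.eq_iff.1 hyx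
    have h2 : x = y * (y⁻¹ * x) := by group
    have h3 : y⁻¹ * x ∈ L := hcT _ h1; rw [h2]; exact mul_mem hy h3
  obtain ⟨f, hf0, hf⟩ := Submodule.exists_le_ker_of_lt_top (AddSubgroup.toZModSubmodule r U)
    (lt_top_iff_ne_top.2 fun h => hUx (h ▸ Submodule.mem_top))
  have hfd : FiniteDimensional (ZMod r) W := Module.Finite.of_finite
  obtain ⟨w, hw⟩ : ∃ w, w = (BilinForm.toDual ω hS.nondegenerate).symm f := ⟨_, rfl⟩
  have hwf : ∀ w', ω w w' = f w' := fun w' => hw ▸ BilinForm.apply_toDual_symm_apply ..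
  obtain ⟨u, rfl⟩ := hS.surjective w
  have huC : u ∈ C := mem_centralizer_iff.2 fun l hl => by
    refine (hS.eq_zero_iff_commute.1 ?_).symm; rw [hwf]; exact hf ⟨l, hl, rfl⟩
  refine hf0 (LinearMap.ext fun w' => ?_)
  rw [← hwf, (hS.eq_zero_iff u).2 (hCc huC), map_zero]

theorem hasMultiplier_one {φ : Q →* Q} (hφ : φ ζ = ζ) {a : W ≃ₗ[ZMod r] W}
    (ha : ∀ x, a (q x) = q (φ x)) : HasMultiplier ω a 1 := by
  intro w w'; obtain ⟨x, rfl⟩ := hS.surjective w; obtain ⟨y, rfl⟩ := hS.surjective w'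
  rw [Units.val_one, one_mul, ha, ha]; refine hS.pow_injective ?_
  rw [← hS.commutator, ← map_commutatorElement, hS.commutator, _root_.map_pow, hφ]

/-- If the form is not zero, some nontrivial commutator shows that `φ` maps `ζ` to a power of
itself, and the exponent is the multiplier. -/
theorem exists_hasMultiplier {φ : Q →* Q} (hφ : Injective φ) {a : W ≃ₗ[ZMod r] W}
    (ha : ∀ x, a (q x) = q (φ x)) : ∃ μ, HasMultiplier ω a μ := by
  by_cases h0 : ∀ x y, ω (q x) (q y) = 0
  · refine ⟨1, fun w w' => ?_⟩; obtain ⟨x, rfl⟩ := hS.surjective w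
    obtain ⟨y, rfl⟩ := hS.surjective w'; rw [ha, ha, h0, h0, mul_zero]
  push Not at h0
  obtain ⟨x₀, y₀, h0⟩ := h0
  have hmul : ∀ a b : ZMod r, ζ ^ (a * b).val = (ζ ^ a.val) ^ b.val := fun a b => by
    have h := pow_mod_orderOf ζ (a.val * b.val); rw [hS.orderOf_eq] at h
    rw [ZMod.val_mul, h, pow_mul]
  have hφω : ∀ x y, φ (ζ ^ (ω (q x) (q y)).val) = ζ ^ (ω (a (q x)) (a (q y))).val := fun x y => by
    rw [← hS.commutator, ha, ha, ← hS.commutator, map_commutatorElement]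
  obtain ⟨k, hk⟩ : ∃ k : ZMod r, φ ζ = ζ ^ k.val := by
    refine ⟨ω (a (q x₀)) (a (q y₀)) * (ω (q x₀) (q y₀))⁻¹, ?_⟩
    rw [hmul, ← hφω, ← _root_.map_pow, ← hmul, mul_inv_cancel₀ h0, ZMod.val_one, pow_one]
  have hk0 : k ≠ 0 := by
    rintro rfl; rw [ZMod.val_zero, pow_zero, ← _root_.map_one φ] at hk
    have h1 := hS.orderOf_eq; rw [hφ hk, orderOf_one] at h1
    exact (Fact.out : r.Prime).one_lt.ne h1
  refine ⟨Units.mk0 k hk0, fun w w' => ?_⟩; obtain ⟨x, rfl⟩ := hS.surjective w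
  obtain ⟨y, rfl⟩ := hS.surjective w'; refine hS.pow_injective ?_
  rw [← hφω, _root_.map_pow, hk, Units.val_mk0, hmul]

end IsSymplecticQuotient

end SymplecticQuotient

/-! ### Lifting isometries, and maximality of the induced isometry group -/

section Stable

variable {K : Type*} {V : Type*} [Field K] [AddCommGroup V] [Module K V]

/-- The action of a semilinear transformation on a stable linear group. -/
def StableUnder.mulAut {Λ : Subgroup (semiAut K V)} {X : Subgroup (GL K V)} (hX : StableUnder Λ X) :
    Λ →* MulAut X where
  toFun g :=
    { toFun := fun y => ⟨semiAut.conjGL (g : semiAut K V) y, hX g g.2 y y.2⟩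
      invFun := fun y => ⟨semiAut.conjGL (g⁻¹ : semiAut K V) y, hX _ (inv_mem g.2) y y.2⟩
      left_inv := fun y => Subtype.ext (by simp)
      right_inv := fun y => Subtype.ext (by simp)
      map_mul' := fun y z => Subtype.ext (map_mul _ _ _) }
  map_one' := by
    ext y; simp
  map_mul' g h := by
    ext y; simp

theorem StableUnder.coe_mulAut {Λ : Subgroup (semiAut K V)} {X : Subgroup (GL K V)}
    (hX : StableUnder Λ X) (g : Λ) (x : X) : (hX.mulAut g x : GL K V) = semiAut.conjGL
    (g : semiAut K V) x := rfl

end Stable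

section InducedAction

variable {Q G : Type*} [Group Q] [Group G] {r : ℕ} {W : Type*} [AddCommGroup W] [Module (ZMod r) W]

/-- The group of automorphisms of the symplectic space induced by a group of automorphisms. -/
def inducedAction (q : Q → W) (Φ : G →* MulAut Q) (T : Subgroup G) : Subgroup (W ≃ₗ[ZMod r] W) where
  carrier := {a | ∃ g ∈ T, ∀ x, a (q x) = q (Φ g x)}
  one_mem' := ⟨1, one_mem _, fun x => by simp⟩
  mul_mem' := by
    rintro a b ⟨g, hg, ha⟩ ⟨h, hh, hb⟩; refine ⟨g * h, mul_mem hg hh, fun x => ?_⟩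
    rw [LinearEquiv.mul_apply, hb, ha, map_mul, MulAut.mul_apply]
  inv_mem' := by
    rintro a ⟨g, hg, ha⟩; refine ⟨g⁻¹, inv_mem hg, fun x => ?_⟩
    have h1 : q x = a (q (Φ g⁻¹ x)) := by rw [ha, ← MulAut.mul_apply, ← map_mul]; simp
    rw [h1, ← LinearEquiv.mul_apply, inv_mul_cancel]; rfl

end InducedAction

namespace IsCoprimeSemilinear

variable {K : Type*} {V : Type v} [Field K] [Finite K] [AddCommGroup V] [Module K V]
  [FiniteDimensional K V] [Nontrivial V] {Λ : Subgroup (semiAut K V)} (hΛ : IsCoprimeSemilinear Λ)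
  {P : Subgroup (GL K V)} (hP : StableUnder Λ P) (hle : P ≤ linearPart Λ) {r : ℕ} [Fact r.Prime]
  {W : Type v} [AddCommGroup W] [Module (ZMod r) W] {q : P → W} {ζ : P} {ω : BilinForm (ZMod r) W}
  (hS : IsSymplecticQuotient q ζ ω)

theorem coprime_ringChar_iff {m : ℕ} : m.Coprime (ringChar K) ↔ m.Coprime (Nat.card K) := by
  have : Fintype K := Fintype.ofFinite K
  obtain ⟨n, hp, hn⟩ := FiniteField.card K (ringChar K)
  rw [Nat.card_eq_fintype_card, hn, Nat.coprime_pow_right_iff n.pos]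

include hΛ hP in
theorem mem_center_iff_coe {x : P} : x ∈ center P ↔ (x : GL K V) ∈ center (GL K V) := by
  rw [hΛ.center_eq hP, mem_subgroupOf]

include hΛ hP hle hS in
/-- Isometries in a stable coprime group, compatible with the power map, are induced by the linear
part. -/
theorem mem_inducedAction_of_lift {Y : Subgroup (W ≃ₗ[ZMod r] W)}
    (hYc : (Nat.card Y).Coprime (ringChar K))
    (hYA : ∀ a ∈ inducedAction q hP.mulAut ⊤, ∀ y ∈ Y, a * y * a⁻¹ ∈ Y) {y : W ≃ₗ[ZMod r] W}
    (hy : y ∈ Y) (hiso : HasMultiplier ω y 1)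
    (hpow : ∀ x x', q x' = y (q x) → ∃ z ∈ center P, x' ^ r * z ^ r = x ^ r) : y ∈ inducedAction q
    hP.mulAut (semiAut.ofGL.range.subgroupOf Λ) := by
  have hCiff := fun x : P => hΛ.mem_center_iff_coe hP (x := x)
  have hcop := hΛ.coprime_of_le hle
  have hcomm : ∀ x ∈ P, ∀ y ∈ P, ⁅x, y⁆ ∈ center (GL K V) :=
    fun x hx y hy => (hCiff _).1 (hS.commutator_mem_center ⟨x, hx⟩ ⟨y, hy⟩)
  have hC : ∀ x ∈ P, (∀ y ∈ P, y * x = x * y) → x ∈ center (GL K V) :=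
    fun x hx h => (hCiff ⟨x, hx⟩).1 (mem_center_iff.2 fun y => Subtype.ext (h y y.2))
  have hY1 : ∀ y ∈ Y, y ^ Nat.card Y = 1 := fun y hy =>
    congrArg Subtype.val (pow_card_eq_one' (x := (⟨y, hy⟩ : Y)))
  -- `R u y` means that `u` lies in the algebra spanned by `P` and induces `y` on the symplectic
  -- space. The lifts of elements of `Y` form a stable group, to which `le_linearPart` will apply.
  let R : GL K V → (W ≃ₗ[ZMod r] W) → Prop := fun u y =>
    (u : End K V) ∈ groupAlg P ∧ ∀ x : P, ∃ h : u * x * u⁻¹ ∈ P, q ⟨_, h⟩ = y (q x)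
  have hR1 : R 1 1 := ⟨one_mem _, fun x => ⟨by simp, congrArg q (Subtype.ext (by simp))⟩⟩
  have hRmul : ∀ u y v y', R u y → R v y' → R (u * v) (y * y') := by
    rintro u y v y' ⟨hu, huy⟩ ⟨hv, hvy'⟩; refine ⟨mul_mem hu hv, fun x => ?_⟩
    obtain ⟨h1, h2⟩ := hvy' x; obtain ⟨h3, h4⟩ := huy ⟨_, h1⟩
    have h5 : u * (v * x * v⁻¹) * u⁻¹ = u * v * x * (u * v)⁻¹ := by group
    refine ⟨h5 ▸ h3, ?_⟩; rw [LinearEquiv.mul_apply, ← h2, ← h4]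
    exact congrArg q (Subtype.ext h5.symm)
  have hRpow : ∀ u y, R u y → ∀ n : ℕ, R (u ^ n) (y ^ n) := by
    intro u y h n; induction n with
    | zero => simpa using hR1
    | succ n ih => rw [pow_succ, pow_succ]; exact hRmul _ _ _ _ ih h
  let S : Set (GL K V) := {u | ∃ y ∈ Y, R u y}
  have hS1 : 1 ∈ S := ⟨1, one_mem _, hR1⟩
  have hSmul : ∀ u ∈ S, ∀ v ∈ S, u * v ∈ S := by
    rintro u ⟨y, hy, huy⟩ v ⟨y', hy', hvy'⟩
    exact ⟨y * y', mul_mem hy hy', hRmul _ _ _ _ huy hvy'⟩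
  let X : Subgroup (GL K V) :=
    { carrier := S
      one_mem' := hS1
      mul_mem' := fun hx hy => hSmul _ hx _ hy
      inv_mem' := fun hx => inv_mem_of_forall_mul_mem S hS1 hSmul hx }
  have hXst : StableUnder Λ X := by
    rintro g hg u ⟨y, hy, hu, huy⟩
    obtain ⟨a, ha⟩ := hS.exists_linearEquiv (hP.mulAut ⟨g, hg⟩)
    have haA : a ∈ inducedAction q hP.mulAut ⊤ := ⟨_, mem_top _, ha⟩
    have ha' : ∀ x, a⁻¹ (q x) = q (hP.mulAut ⟨g, hg⟩⁻¹ x) := by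
      intro x
      have h1 : q x = a (q (hP.mulAut ⟨g, hg⟩⁻¹ x)) := by
        rw [ha, ← MulAut.mul_apply, ← map_mul]; simp
      rw [h1, ← LinearEquiv.mul_apply, inv_mul_cancel]; rfl
    refine ⟨a * y * a⁻¹, hYA a haA y hy,
      hP.conjGL_mem_unitsSubgroup hg (mem_unitsSubgroup.2 hu), fun x => ?_⟩
    obtain ⟨h1, h2⟩ := huy (hP.mulAut ⟨g, hg⟩⁻¹ x)
    have h3 : (hP.mulAut ⟨g, hg⟩ ⟨_, h1⟩ : GL K V) =
        semiAut.conjGL g u * x * (semiAut.conjGL g u)⁻¹ := by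
      have h4 : semiAut.conjGL g (hP.mulAut ⟨g, hg⟩⁻¹ x : GL K V) = x := by
        rw [StableUnder.coe_mulAut]; simp
      rw [StableUnder.coe_mulAut]; change semiAut.conjGL g (u * _ * u⁻¹) = _
      rw [map_mul, map_mul, h4, map_inv]
    refine ⟨h3 ▸ (hP.mulAut ⟨g, hg⟩ ⟨_, h1⟩).2, ?_⟩
    rw [LinearEquiv.mul_apply, LinearEquiv.mul_apply, ha', ← h2, ha]
    exact congrArg q (Subtype.ext h3.symm)
  have hXle : X ≤ linearPart Λ := by
    refine hΛ.le_linearPart (m := Nat.card Y * r) hXst ?_ ?_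
    · refine Nat.Coprime.mul_left (coprime_ringChar_iff.1 hYc) ?_
      refine Nat.Coprime.coprime_dvd_left ?_ hcop; rw [← hS.orderOf_eq]
      exact orderOf_dvd_natCard ζ
    -- The power `v` of `u` with exponent `|Y|` acts trivially on `W`, so it conjugates each `x ∈ P`
    -- to `x z` with `z` scalar. Comparing `r`-th powers gives `z ^ r = 1`, so `v ^ r` centralises
    -- `P` and is a scalar.
    · rintro u ⟨y, hy, huy⟩; obtain ⟨hv, hvy⟩ := hRpow u y huy (Nat.card Y)
      rw [hY1 y hy] at hvy; obtain ⟨v, hv'⟩ : ∃ v, v = u ^ Nat.card Y := ⟨_, rfl⟩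
      rw [← hv'] at hv hvy; rw [pow_mul, ← hv']
      obtain ⟨c, hc⟩ := hΛ.exists_smul_one_of_center hP (a := (v ^ r : GL K V))
        (pow_mem hv r) fun x hx => by
          obtain ⟨h1, h2⟩ := hvy ⟨x, hx⟩; have h3 := (hCiff _).1 (hS.eq_iff.1 h2.symm)
          obtain ⟨z, hz⟩ : ∃ z, z = x⁻¹ * (v * x * v⁻¹) := ⟨_, rfl⟩
          change x⁻¹ * (v * x * v⁻¹) ∈ _ at h3; rw [← hz] at h3
          have hxz : v * x * v⁻¹ = x * z := by rw [hz, mul_inv_cancel_left]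
          have hzc := mem_center_iff.1 h3
          have hn : ∀ n : ℕ, v ^ n * x * (v ^ n)⁻¹ = x * z ^ n := by
            intro n; induction n with
            | zero => simp
            | succ n ih =>
              calc v ^ (n + 1) * x * (v ^ (n + 1))⁻¹ = v * (v ^ n * x * (v ^ n)⁻¹) * v⁻¹ := by
                    rw [pow_succ']; group
                _ = v * x * v⁻¹ * (v * z ^ n * v⁻¹) := by
                    rw [ih]; group
                _ = x * z ^ (n + 1) := by
                    rw [hxz, mem_center_iff.1 (pow_mem h3 n) v, mul_inv_cancel_right, mul_assoc,
                      pow_succ']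
          have hzr : z ^ r = 1 := by
            have hxr := (hCiff _).1 (hS.pow_mem_center ⟨x, hx⟩); change x ^ r ∈ _ at hxr
            have h4 : (v * x * v⁻¹) ^ r = x ^ r := by
              rw [conj_pow, mem_center_iff.1 hxr v, mul_inv_cancel_right]
            have hcxz : Commute x z := hzc x; rw [hxz, hcxz.mul_pow] at h4
            exact mul_eq_left.1 h4
          have h4 := hn r; rw [hzr, mul_one, mul_inv_eq_iff_eq_mul] at h4
          rw [← Units.val_mul, ← Units.val_mul, h4]
      exact mem_center_of_eq_smul_one hc
  -- The given isometry first lifts to an endomorphism of `P` fixing the centre, and that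
  -- endomorphism is conjugation by a unit of the algebra.
  obtain ⟨φ, hφ, hφq⟩ := hS.exists_hom (y := (y : W →ₗ[ZMod r] W))
    (fun a b => by simpa using hiso a b) hpow
  obtain ⟨n, θ, hθ, hr⟩ := hΛ.exists_algHom hP hle
  obtain ⟨u, hu, hux⟩ := exists_unit_mul_eq hcop hcomm hC hθ hr (φ := φ)
    (fun x hx => hφ x ((hCiff x).2 hx)) fun x hx => by
      rw [← hCiff, ← hS.eq_zero_iff] at hx ⊢; rw [hφq] at hx; exact y.map_eq_zero_iff.1 hx
  have hux' : ∀ x : P, u * x * u⁻¹ = φ x := fun x => by rw [hux, mul_inv_cancel_right]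
  have huX : u ∈ X := ⟨y, hy, hu, fun x => ⟨(hux' x).symm ▸ (φ x).2, by
    rw [← LinearEquiv.coe_coe, ← hφq]; exact congrArg q (Subtype.ext (hux' x))⟩⟩
  refine ⟨⟨semiAut.ofGL u, hXle huX⟩, ⟨u, rfl⟩, fun x => ?_⟩
  rw [← LinearEquiv.coe_coe, ← hφq]; refine congrArg q (Subtype.ext ?_)
  rw [StableUnder.coe_mulAut, semiAut.conjGL_ofGL, ← hux']

include hΛ hP hle hS

/-- Powers in a stable group of class two. -/
theorem exists_pow_mul_pow_eq (hr2 : r ≠ 2) (x : P) : ∃ z ∈ center P, x ^ r = z ^ r := by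
  have hfinW : Finite W := Finite.of_surjective q hS.surjective
  -- Applied to the `r`-th powers of central elements: for odd `r` the power map is multiplicative,
  -- because `r` divides `r.choose 2`.
  have hcyc := hΛ.isCyclic_center_subgroup hP; let T : Subgroup P :=
    { carrier := {y | ∃ z ∈ center P, y = z ^ r}
      one_mem' := ⟨1, one_mem _, (one_pow r).symm⟩
      mul_mem' := by
        rintro _ _ ⟨z, hz, rfl⟩ ⟨z', hz', rfl⟩
        have h1 : Commute z z' := mem_center_iff.1 hz' z
        exact ⟨z * z', mul_mem hz hz', (h1.mul_pow r).symm⟩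
      inv_mem' := by
        rintro _ ⟨z, hz, rfl⟩; exact ⟨z⁻¹, inv_mem hz, (inv_pow z r).symm⟩ }
  refine hS.pow_mem (hΛ.charAbelianCentral hP) hcyc (T := T) ?_ ?_ (fun z hz => ⟨z, hz, rfl⟩) ?_ x
  · rw [characteristic_iff_le_comap]; rintro φ _ ⟨z, hz, rfl⟩
    exact ⟨φ z, characteristic_iff_le_comap.1 (inferInstance : (center P).Characteristic) φ hz,
      map_pow φ z r⟩
  · rintro _ ⟨z, hz, rfl⟩; exact pow_mem hz r
  · intro x y; refine ⟨1, one_mem _, ?_⟩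
    rw [mul_pow_eq_of_commutator_mem_center (hS.commutator_mem_center y x), mul_one]
    have hr : r.Prime := Fact.out
    have h1 : r ∣ r.choose 2 := hr.dvd_choose_self two_ne_zero
      (lt_of_le_of_ne hr.two_le (Ne.symm hr2))
    obtain ⟨m, hm⟩ := h1; rw [hm, pow_mul, hS.commutator_pow, one_pow, mul_one]

/-- Up to squares, the squares in a stable group of class two are preserved by automorphisms. -/
theorem exists_automorphism_sq_eq (hr2 : r = 2) (φ : P ≃* P) (x : P) : ∃ z ∈ center P, φ x ^ r = x ^
    r * z ^ r := by
  subst hr2; have hcyc := hΛ.isCyclic_center_subgroup hP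
  have hc : ∀ z ∈ center P, φ z ∈ center P := fun z hz =>
    characteristic_iff_le_comap.1 (inferInstance : (center P).Characteristic) φ hz
  let φc : center P →* center P :=
    { toFun := fun z => ⟨φ z, hc z z.2⟩
      map_one' := Subtype.ext (map_one φ)
      map_mul' := fun a b => Subtype.ext (map_mul φ _ _) }
  -- An automorphism raises central elements to a fixed power `m`, which is odd because `ζ` has
  -- order two and is not killed. So `φ(x) ^ 2 = (x ^ 2) ^ m` differs from `x ^ 2` by the square of
  -- a central element.
  obtain ⟨m, hm⟩ := MonoidHom.map_cyclic φc
  have hm' : ∀ z ∈ center P, φ z = z ^ m := fun z hz => congrArg Subtype.val (hm ⟨z, hz⟩)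
  have hodd : Odd m := by
    by_contra hev; rw [Int.not_odd_iff_even] at hev; obtain ⟨k, rfl⟩ := hev
    have h1 := hm' ζ hS.mem_center
    have h2 : ζ ^ 2 = 1 := by
      have h := pow_orderOf_eq_one ζ; rwa [hS.orderOf_eq] at h
    rw [← two_mul, zpow_mul, zpow_ofNat, h2, one_zpow] at h1
    have h3 : ζ = 1 := φ.injective (h1.trans (map_one φ).symm); have h4 := hS.orderOf_eq
    rw [h3, orderOf_one] at h4; exact absurd h4 (by norm_num)
  obtain ⟨k, rfl⟩ := hodd; refine ⟨(x ^ 2) ^ k, zpow_mem (hS.pow_mem_center x) k, ?_⟩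
  rw [← map_pow, hm' _ (hS.pow_mem_center x), zpow_add, zpow_one, mul_comm, zpow_mul, zpow_ofNat,
    ← zpow_natCast, ← zpow_natCast, ← zpow_mul, ← zpow_mul, ← zpow_add, ← zpow_add,
    add_comm]

/-- The maximality of `Λ` is transferred through `mem_inducedAction_of_lift`. For odd `r` the
compatibility with powers is automatic up to the centre. For `r = 2` it holds for maps induced by
automorphisms, and all multipliers are trivial, so the whole group `A` lifts. An isotropic stable
subspace corresponds to a stable abelian group, which is scalar. -/
theorem isCoprimeSymplectic : IsCoprimeSymplectic ω (inducedAction q hP.mulAut ⊤)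
      (inducedAction q hP.mulAut (semiAut.ofGL.range.subgroupOf Λ)) (ringChar K) := by
  have hfinW : Finite W := Finite.of_surjective q hS.surjective
  have hfinE : Finite (W ≃ₗ[ZMod r] W) := DFunLike.finite _
  have hCiff := fun x : P => hΛ.mem_center_iff_coe hP (x := x)
  have hA : ((Nat.card (inducedAction q hP.mulAut ⊤ : Subgroup (W ≃ₗ[ZMod r] W)))).Coprime
      (ringChar K) := by
    refine card_coprime_of_forall_pow_eq_one (m := Nat.card Λ) ?_
      (coprime_ringChar_iff.2 hΛ.coprime)
    rintro ⟨a, g, -, ha⟩; refine Subtype.ext (hS.linearEquiv_ext fun x => ?_)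
    have h1 : ∀ n : ℕ, ∀ x, (a ^ n) (q x) = q (hP.mulAut (g ^ n) x) := by
      intro n; induction n with
      | zero => intro x; simp
      | succ n ih =>
        intro x
        rw [pow_succ, LinearEquiv.mul_apply, ha, ih, pow_succ, map_mul, MulAut.mul_apply]
    change (a ^ Nat.card Λ) (q x) = q x; rw [h1, pow_card_eq_one']; simp
  have hmono : inducedAction q hP.mulAut (semiAut.ofGL.range.subgroupOf Λ) ≤
      (inducedAction q hP.mulAut ⊤ : Subgroup (W ≃ₗ[ZMod r] W)) :=
    fun a ⟨g, _, ha⟩ => ⟨g, mem_top _, ha⟩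
  have hsim : ∀ a ∈ (inducedAction q hP.mulAut ⊤ : Subgroup (W ≃ₗ[ZMod r] W)),
      ∃ μ, HasMultiplier ω a μ := by
    rintro a ⟨g, -, ha⟩
    exact hS.exists_hasMultiplier (φ := (hP.mulAut g).toMonoidHom) (hP.mulAut g).injective ha
  refine ⟨CharP.char_is_prime K _, hS.alternating, hS.eq_zero_of_forall, hmono, ?_, ?_, hsim, hA,
    ?_, ?_, ?_⟩
  · rintro a ⟨g, -, ha⟩ b ⟨h, ⟨x, hx⟩, hb⟩; refine ⟨g * h * g⁻¹, ?_, ?_⟩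
    · refine ⟨semiAut.conjGL g x, ?_⟩; rw [semiAut.ofGL_conjGL, hx]; rfl
    · intro x
      have h1 : q x = a (q (hP.mulAut g⁻¹ x)) := by rw [ha, ← MulAut.mul_apply, ← map_mul]; simp
      have h2 : a⁻¹ (q x) = q (hP.mulAut g⁻¹ x) := by
        rw [h1, ← LinearEquiv.mul_apply, inv_mul_cancel]; rfl
      rw [LinearEquiv.mul_apply, LinearEquiv.mul_apply, h2, hb, ha, map_mul, map_mul,
        MulAut.mul_apply, MulAut.mul_apply]
  · rintro b ⟨h, ⟨y, hy⟩, hb⟩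
    refine hS.hasMultiplier_one (φ := (hP.mulAut h).toMonoidHom) (Subtype.ext ?_) hb
    change semiAut.conjGL (h : semiAut K V) (ζ : GL K V) = ζ
    replace hy : semiAut.ofGL y = (h : semiAut K V) := hy
    rw [← hy, semiAut.conjGL_ofGL, mem_center_iff.1 ((hCiff ζ).1 hS.mem_center) y,
      mul_inv_cancel_right]
  · intro U hU hiso; let X : Subgroup P :=
      { carrier := {x | q x ∈ U}
        one_mem' := by
          change q 1 ∈ U; rw [hS.map_one]; exact zero_mem _
        mul_mem' := by
          rintro a b (ha : _ ∈ U) (hb : _ ∈ U); change _ ∈ U; rw [hS.map_mul]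
          exact add_mem ha hb
        inv_mem' := by
          rintro a (ha : _ ∈ U); change _ ∈ U; rw [hS.map_inv]; exact neg_mem ha }
    have h1 : X.map P.subtype ≤ center (GL K V) := by
      refine hΛ.mem_center_of_abelian ?_ ?_
      · rintro g hg _ ⟨x, hx, rfl⟩
        obtain ⟨a, ha⟩ := hS.exists_linearEquiv (hP.mulAut ⟨g, hg⟩)
        refine ⟨hP.mulAut ⟨g, hg⟩ x, ?_, rfl⟩; change q _ ∈ U; rw [← ha]
        exact hU a ⟨_, mem_top _, ha⟩ _ hx
      · rintro _ ⟨x, hx, rfl⟩ _ ⟨y, hy, rfl⟩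
        exact congrArg Subtype.val (hS.eq_zero_iff_commute.1 (hiso _ hx _ hy))
    rw [Submodule.eq_bot_iff]; intro w hw; obtain ⟨x, rfl⟩ := hS.surjective w
    rw [hS.eq_zero_iff, hCiff]; exact h1 ⟨x, hw, rfl⟩
  · intro hr2 Y hY hYc hYA y hy
    refine hΛ.mem_inducedAction_of_lift hP hle hS hYc hYA hy (hY y hy) fun x x' _ => ?_
    obtain ⟨z, hz, hxz⟩ := hΛ.exists_pow_mul_pow_eq hP hle hS hr2 x
    obtain ⟨z', hz', hxz'⟩ := hΛ.exists_pow_mul_pow_eq hP hle hS hr2 x'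
    have h1 : Commute z'⁻¹ z := mem_center_iff.1 hz _
    refine ⟨z'⁻¹ * z, mul_mem (inv_mem hz') hz, ?_⟩
    rw [hxz, hxz', h1.mul_pow, inv_pow, mul_inv_cancel_left]
  · intro hr2 a ha; refine hΛ.mem_inducedAction_of_lift hP hle hS hA
      (fun b hb y hy => mul_mem (mul_mem hb hy) (inv_mem hb)) ha ?_ ?_
    · obtain ⟨μ, hμ⟩ := hsim a ha; subst hr2; have : μ = 1 := Subsingleton.elim _ _
      rwa [this] at hμ
    · intro x x' hxx'; obtain ⟨g, -, hg⟩ := ha; rw [hg] at hxx'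
      obtain ⟨z, hz, hφ⟩ := hΛ.exists_automorphism_sq_eq hP hle hS hr2 (hP.mulAut g) x
      obtain ⟨z', hz', rfl⟩ : ∃ z' ∈ center P, x' = hP.mulAut g x * z' :=
        ⟨_, hS.eq_iff.1 hxx'.symm, (mul_inv_cancel_left _ _).symm⟩
      have h1 : Commute (hP.mulAut g x) z' := mem_center_iff.1 hz' _
      have h2 : Commute z⁻¹ z'⁻¹ := mem_center_iff.1 (inv_mem hz') _
      refine ⟨z⁻¹ * z'⁻¹, mul_mem (inv_mem hz) (inv_mem hz'), ?_⟩
      rw [h1.mul_pow, hφ, h2.mul_pow, inv_pow, inv_pow]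
      have h3 : z' ^ r * (z ^ r)⁻¹ = (z ^ r)⁻¹ * z' ^ r := (mem_center_iff.1 (pow_mem hz' r) _).symm
      calc x ^ r * z ^ r * z' ^ r * ((z ^ r)⁻¹ * (z' ^ r)⁻¹)
          = x ^ r * z ^ r * (z' ^ r * (z ^ r)⁻¹) * (z' ^ r)⁻¹ := by group
        _ = x ^ r := by
          rw [h3]; group

end IsCoprimeSemilinear

/-! ### Commutators of distinct minimal normal subgroups -/

section MinimalNormal

variable {Q : Type*} [Group Q]

theorem IsMinimalAboveCenter.inf_eq_center {M M' : Subgroup Q} (hM : IsMinimalAboveCenter M)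
    (hM' : IsMinimalAboveCenter M') (hne : M ≠ M') : M ⊓ M' = center Q := by
  by_contra h; have hMn := hM.1.1; have hMn' := hM'.1.1
  have hlt : center Q < M ⊓ M' := lt_of_le_of_ne (le_inf hM.1.2.le hM'.1.2.le) (Ne.symm h)
  have h1 : M ≤ M ⊓ M' := hM.2 ⟨inferInstance, hlt⟩ inf_le_left
  have h2 : M' ≤ M ⊓ M' := hM'.2 ⟨inferInstance, hlt⟩ inf_le_right
  exact hne (le_antisymm (h1.trans inf_le_right) (h2.trans inf_le_left))

theorem IsMinimalAboveCenter.commutator_le_center_of_ne {M M' : Subgroup Q}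
    (hM : IsMinimalAboveCenter M) (hM' : IsMinimalAboveCenter M') (hne : M ≠ M') : ⁅M, M'⁆ ≤ center
    Q := by
  have hMn := hM.1.1; have hMn' := hM'.1.1; rw [← hM.inf_eq_center hM' hne]
  exact commutator_le_inf M M'

/-- A minimal normal subgroup which is nonabelian modulo the centre commutes with the others. -/
theorem IsMinimalAboveCenter.commutator_eq_bot {M M' : Subgroup Q} (hM : IsMinimalAboveCenter M)
    (hM' : IsMinimalAboveCenter M') (hne : M ≠ M') (h : ¬ ⁅M, M⁆ ≤ center Q) : ⁅M, M'⁆ = ⊥ := by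
  have hMn := hM.1.1; have hMn' := hM'.1.1
  -- `[M, M']` lies in `M ∩ M'`, which is the centre. The three subgroups lemma shows that `M'`
  -- commutes with `[M, M]`, and by minimality `M` is the centre times `[M, M]`.
  have h1 : ⁅⁅M, M'⁆, M⁆ = ⊥ := by
    rw [commutator_eq_bot_iff_le_centralizer]
    exact (hM.commutator_le_center_of_ne hM' hne).trans (center_le_centralizer _)
  have h2 : ⁅⁅M, M⁆, M'⁆ = ⊥ := by
    apply commutator_commutator_eq_bot_of_rotate h1; rw [commutator_comm M' M]; exact h1
  have h3 : M = center Q ⊔ ⁅M, M⁆ := by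
    refine le_antisymm ?_ (sup_le hM.1.2.le (commutator_le_left M M))
    refine hM.2 ⟨inferInstance, lt_of_le_of_ne le_sup_left fun h4 => h ?_⟩
      (sup_le hM.1.2.le (commutator_le_left M M))
    rw [h4]; exact le_sup_right
  rw [h3, commutator_eq_bot_iff_le_centralizer]
  refine sup_le (center_le_centralizer _) ?_; rwa [← commutator_eq_bot_iff_le_centralizer]

/-- The minimal normal subgroups which are elementary abelian `r`-groups modulo the centre. -/
def IsElementaryAboveCenter (r : ℕ) (M : Subgroup Q) : Prop :=
  IsMinimalAboveCenter M ∧ ⁅M, M⁆ ≤ center Q ∧ ∀ x ∈ M, x ^ r ∈ center Q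

/-- The subgroup generated by the centre and the minimal normal subgroups which are elementary
abelian `r`-groups modulo the centre. -/
def elementarySocle (r : ℕ) (Q : Type*) [Group Q] : Subgroup Q :=
  center Q ⊔ sSup {M | IsElementaryAboveCenter r M}

theorem IsElementaryAboveCenter.le_elementarySocle {r : ℕ} {M : Subgroup Q}
    (hM : IsElementaryAboveCenter r M) : M ≤ elementarySocle r Q :=
  le_sup_of_le_right (le_sSup hM)

theorem IsElementaryAboveCenter.map {r : ℕ} {M : Subgroup Q} (hM : IsElementaryAboveCenter r M)
    (φ : Q ≃* Q) : IsElementaryAboveCenter r (M.map φ.toMonoidHom) := by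
  have hc : (center Q).map φ.toMonoidHom = center Q := characteristic_iff_map_eq.1 inferInstance φ
  refine ⟨hM.1.map φ, ?_, ?_⟩
  · rw [← map_commutator, ← hc]; exact Subgroup.map_mono hM.2.1
  · rintro _ ⟨x, hx, rfl⟩; rw [← map_pow, ← hc]; exact mem_map_of_mem _ (hM.2.2 x hx)

theorem elementarySocle_characteristic (r : ℕ) : (elementarySocle r Q).Characteristic := by
  rw [characteristic_iff_map_le]; intro φ
  rw [elementarySocle, Subgroup.map_sup, sSup_eq_iSup', Subgroup.map_iSup]
  refine sup_le (le_sup_of_le_left ?_) (le_sup_of_le_right (iSup_le fun M => ?_))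
  · exact (characteristic_iff_map_le.1 inferInstance) φ
  · exact le_iSup_of_le ⟨_, M.2.map φ⟩ le_rfl

/-- Commuting modulo the centre is membership in a centraliser of the quotient, so it can be checked
on the generating subgroups: distinct ones intersect in the centre, and each is abelian modulo the
centre. -/
theorem commutator_elementarySocle_le (r : ℕ) : ⁅elementarySocle r Q, elementarySocle r Q⁆ ≤ center
    Q := by
  let X : Subgroup Q → Subgroup Q := fun A =>
    (centralizer (A.map (QuotientGroup.mk' (center Q)) : Set (Q ⧸ center Q))).comap
      (QuotientGroup.mk' (center Q))
  have hX : ∀ A B : Subgroup Q, A ≤ X B ↔ ⁅A, B⁆ ≤ center Q := by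
    intro A B
    rw [← map_le_iff_le_comap, ← commutator_eq_bot_iff_le_centralizer, ← map_commutator,
      Subgroup.map_eq_bot_iff, QuotientGroup.ker_mk']
  have hcomm : ∀ A B : Subgroup Q, A ≤ X B → B ≤ X A := fun A B h => by
    rw [hX] at h ⊢; rwa [commutator_comm]
  have hcX : ∀ A, center Q ≤ X A := fun A => by
    rw [hX]; refine commutator_le.2 fun x hx y _ => ?_
    rw [commutatorElement_eq_one_iff_mul_comm.2 (mem_center_iff.1 hx y).symm]
    exact one_mem _
  have h1 : ∀ M, IsElementaryAboveCenter r M → elementarySocle r Q ≤ X M := by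
    refine fun M hM => sup_le (hcX _) (sSup_le fun M' hM' => ?_); rw [hX]
    by_cases hne : M' = M
    · rw [hne]; exact hM.2.1
    · exact hM'.1.commutator_le_center_of_ne hM.1 hne
  rw [← hX]; exact sup_le (hcX _) (sSup_le fun M hM => hcomm _ _ (h1 M hM))

theorem pow_mem_center_of_mem_elementarySocle {r : ℕ} {x : Q} (hx : x ∈ elementarySocle r Q) : x ^ r
    ∈ center Q := by
  have hcomm : ∀ x ∈ elementarySocle r Q, ∀ y ∈ elementarySocle r Q, ⁅x, y⁆ ∈ center Q :=
    fun x hx y hy => commutator_elementarySocle_le r (commutator_mem_commutator hx hy)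
  let X : Subgroup Q :=
    { carrier := {x | x ∈ elementarySocle r Q ∧ x ^ r ∈ center Q}
      one_mem' := ⟨one_mem _, by rw [one_pow]; exact one_mem _⟩
      mul_mem' := by
        rintro a b ⟨ha, ha'⟩ ⟨hb, hb'⟩; refine ⟨mul_mem ha hb, ?_⟩
        rw [mul_pow_eq_of_commutator_mem_center (hcomm b hb a ha)]
        exact mul_mem (mul_mem ha' hb') (pow_mem (hcomm b hb a ha) _)
      inv_mem' := by
        rintro a ⟨ha, ha'⟩; refine ⟨inv_mem ha, ?_⟩; rw [inv_pow]; exact inv_mem ha' }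
  have h1 : elementarySocle r Q ≤ X := by
    refine sup_le (fun z hz => ⟨le_sup_left (a := center Q) hz, pow_mem hz r⟩)
      (sSup_le fun M hM y hy => ⟨hM.le_elementarySocle hy, hM.2.2 y hy⟩)
  exact (h1 hx).2

end MinimalNormal

/-! ### Minimal normal subgroups, irreducible subspaces, and commuting -/

section Translation

variable {Γ : Type*} [Group Γ] {H C : Subgroup Γ}

/-- The theorem speaks of subgroups of the ambient linear group, the group theory of subgroups of
`H`; this passes between the two. -/
theorem isMinimalNormalAbove_iff (hCH : C ≤ H) (hc : center H = C.subgroupOf H) {L : Subgroup Γ} :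
    IsMinimalNormalAbove H C L ↔ ∃ M : Subgroup H, IsMinimalAboveCenter M ∧ L = M.map H.subtype :=
      by
  have hcm : (center H).map H.subtype = C := by rw [hc, subgroupOf_map_subtype, inf_eq_left.2 hCH]
  have key : ∀ M : Subgroup H, (C < M.map H.subtype ∧ M.map H.subtype ≤ H ∧
      NormalisedBy H (M.map H.subtype)) ↔ (M.Normal ∧ center H < M) := by
    intro M
    have hlt : C < M.map H.subtype ↔ center H < M := by
      rw [← hcm]; exact map_lt_map_iff_of_injective H.subtype_injective
    rw [hlt]; constructor
    · rintro ⟨h1, -, h3⟩; refine ⟨⟨fun x hx g => ?_⟩, h1⟩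
      obtain ⟨y, hy, hyx⟩ := h3 g g.2 x ⟨x, hx, rfl⟩
      rwa [show g * x * g⁻¹ = y from Subtype.ext hyx.symm]
    · rintro ⟨h1, h2⟩; refine ⟨h2, map_subtype_le M, ?_⟩; rintro g hg _ ⟨x, hx, rfl⟩
      exact ⟨⟨g, hg⟩ * x * ⟨g, hg⟩⁻¹, h1.conj_mem x hx _, rfl⟩
  constructor
  · intro hL
    have hLe : (L.subgroupOf H).map H.subtype = L := by
      rw [subgroupOf_map_subtype, inf_eq_left.2 hL.1.2.1]
    refine ⟨L.subgroupOf H, ⟨(key _).1 (hLe.symm ▸ hL.1), fun M hM hML => ?_⟩, hLe.symm⟩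
    have h1 : M.map H.subtype ≤ L := hLe ▸ Subgroup.map_mono hML
    have h2 := hL.2 ((key M).2 hM) h1; rw [← map_subtype_le_map_subtype, hLe]; exact h2
  · rintro ⟨M, hM, rfl⟩; refine ⟨(key M).2 hM.1, fun L hL hLM => ?_⟩
    have hLe : (L.subgroupOf H).map H.subtype = L := by
      rw [subgroupOf_map_subtype, inf_eq_left.2 hL.2.1]
    rw [← hLe] at hL hLM ⊢
    exact map_subtype_le_map_subtype.2 (hM.2 ((key _).1 hL) (map_subtype_le_map_subtype.1 hLM))

end Translation

namespace IsSymplecticQuotient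

variable {Q : Type*} [Group Q] {r : ℕ} [Fact r.Prime] {W : Type*} [AddCommGroup W]
  [Module (ZMod r) W] {q : Q → W} {ζ : Q} {ω : BilinForm (ZMod r) W}
  (hS : IsSymplecticQuotient q ζ ω)

/-- The subspace corresponding to a subgroup. -/
def image (L : Subgroup Q) : Submodule (ZMod r) W :=
  AddSubgroup.toZModSubmodule r
    { carrier := q '' L
      zero_mem' := ⟨1, one_mem _, hS.map_one⟩
      add_mem' := by
        rintro _ _ ⟨x, hx, rfl⟩ ⟨y, hy, rfl⟩; exact ⟨x * y, mul_mem hx hy, hS.map_mul x y⟩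
      neg_mem' := by
        rintro _ ⟨x, hx, rfl⟩; exact ⟨x⁻¹, inv_mem hx, hS.map_inv x⟩ }

theorem mem_image {L : Subgroup Q} {w : W} : w ∈ hS.image L ↔ ∃ x ∈ L, q x = w := Iff.rfl

theorem apply_mem_image_iff {L : Subgroup Q} (hL : center Q ≤ L) {x : Q} : q x ∈ hS.image L ↔ x ∈ L
    := by
  refine ⟨?_, fun hx => hS.mem_image.2 ⟨x, hx, rfl⟩⟩; intro h
  obtain ⟨y, hy, hyx⟩ := hS.mem_image.1 h; have h1 := mul_mem hy (hL (hS.eq_iff.1 hyx))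
  rwa [mul_inv_cancel_left] at h1

/-- The subgroup corresponding to a subspace. -/
def preimage (U : Submodule (ZMod r) W) : Subgroup Q where
  carrier := {x | q x ∈ U}
  one_mem' := by
    change q 1 ∈ U; rw [hS.map_one]; exact zero_mem _
  mul_mem' := by
    rintro a b (ha : _ ∈ U) (hb : _ ∈ U); change _ ∈ U; rw [hS.map_mul]
    exact add_mem ha hb
  inv_mem' := by
    rintro a (ha : _ ∈ U); change _ ∈ U; rw [hS.map_inv]; exact neg_mem ha

theorem mem_preimage {U : Submodule (ZMod r) W} {x : Q} : x ∈ hS.preimage U ↔ q x ∈ U := Iff.rfl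

theorem center_le_preimage (U : Submodule (ZMod r) W) : center Q ≤ hS.preimage U := fun x hx => by
  rw [mem_preimage, (hS.eq_zero_iff x).2 hx]; exact zero_mem U

end IsSymplecticQuotient

namespace IsCoprimeSemilinear

variable {K : Type*} {V : Type v} [Field K] [Finite K] [AddCommGroup V] [Module K V]
  [FiniteDimensional K V] [Nontrivial V] {Λ : Subgroup (semiAut K V)} (hΛ : IsCoprimeSemilinear Λ)
  {P : Subgroup (GL K V)} (hP : StableUnder Λ P) (hle : P ≤ linearPart Λ) {r : ℕ} [Fact r.Prime]
  {W : Type v} [AddCommGroup W] [Module (ZMod r) W] {q : P → W} {ζ : P} {ω : BilinForm (ZMod r) W}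
  (hS : IsSymplecticQuotient q ζ ω)

include hΛ hle in
/-- Minimal normal subgroups above the centre correspond to irreducible subspaces. -/
theorem isIrreducibleFor_image {M : Subgroup (linearPart Λ)} (hM : IsMinimalAboveCenter M)
    (hMP : M.map (linearPart Λ).subtype ≤ P) : IsIrreducibleFor
    (inducedAction q hP.mulAut (semiAut.ofGL.range.subgroupOf Λ))
      (hS.image ((M.map (linearPart Λ).subtype).subgroupOf P)) := by
  have hH := stableUnder_linearPart (Λ := Λ)
  have hcP : ∀ {x : P}, x ∈ center P ↔ (x : GL K V) ∈ center (GL K V) := hΛ.mem_center_iff_coe hP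
  have hcH : ∀ {x : linearPart Λ}, x ∈ center (linearPart Λ) ↔ (x : GL K V) ∈ center (GL K V) :=
    hΛ.mem_center_iff_coe hH
  let L := (M.map (linearPart Λ).subtype).subgroupOf P
  have hmem : ∀ x : P, x ∈ L ↔ (⟨x, hle x.2⟩ : linearPart Λ) ∈ M := by
    intro x; constructor
    · rintro ⟨y, hy, hyx⟩
      rwa [show (⟨x, hle x.2⟩ : linearPart Λ) = y from Subtype.ext hyx.symm]
    · exact fun h => ⟨_, h, rfl⟩
  have hcL : center P ≤ L := fun x hx => (hmem x).2 (hM.1.2.le (hcH.2 (hcP.1 hx)))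
  -- conjugation by an element of the linear part
  have hconj : ∀ h : linearPart Λ, ∃ b ∈ (inducedAction q hP.mulAut
      (semiAut.ofGL.range.subgroupOf Λ) : Subgroup (W ≃ₗ[ZMod r] W)), ∀ x x' : P, (x' : GL K V) =
        h * x * (h : GL K V)⁻¹ → b (q x) = q x' := by
    intro h; obtain ⟨b, hb⟩ := hS.exists_linearEquiv (hP.mulAut ⟨semiAut.ofGL h, h.2⟩)
    refine ⟨b, ⟨⟨semiAut.ofGL h, h.2⟩, ⟨h, rfl⟩, hb⟩, fun x x' hx => ?_⟩; rw [hb]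
    refine congrArg q (Subtype.ext ?_)
    rw [StableUnder.coe_mulAut, semiAut.conjGL_ofGL, hx]
  refine ⟨?_, ?_, ?_⟩
  · intro h0; obtain ⟨x, hx, hxc⟩ := SetLike.exists_of_lt hM.1.2
    have hxP := hMP (mem_map_of_mem (linearPart Λ).subtype hx)
    have h1 : q ⟨x, hxP⟩ ∈ hS.image L := (hS.apply_mem_image_iff hcL).2 ((hmem _).2 hx)
    rw [h0, Submodule.mem_bot, hS.eq_zero_iff, hcP] at h1; exact hxc (hcH.2 h1)
  · rintro b ⟨g, ⟨y, hy⟩, hb⟩ u hu; obtain ⟨x, hx, rfl⟩ := hS.mem_image.1 hu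
    replace hy : semiAut.ofGL y = (g : semiAut K V) := hy; rw [hb]
    refine hS.mem_image.2 ⟨_, (hmem _).2 ?_, rfl⟩
    have hyH : y ∈ linearPart Λ := by
      rw [mem_linearPart, hy]; exact g.2
    have h1 := hM.1.1.conj_mem _ ((hmem x).1 hx) ⟨y, hyH⟩; convert h1 using 1
    refine Subtype.ext ?_; change semiAut.conjGL (g : semiAut K V) x = y * x * y⁻¹
    rw [← hy, semiAut.conjGL_ofGL]
  · intro U' hU' hst
    let M' : Subgroup (linearPart Λ) := ((hS.preimage U').map P.subtype).subgroupOf (linearPart Λ)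
    have hM' : ∀ (x : P), (⟨x, hle x.2⟩ : linearPart Λ) ∈ M' ↔ q x ∈ U' := by
      intro x; constructor
      · rintro ⟨y, hy, hyx⟩; rwa [show x = y from Subtype.ext hyx.symm]
      · exact fun h => ⟨x, h, rfl⟩
    have hMM : M' ≤ M := by
      rintro x ⟨y, hy, hyx⟩
      have h1 := (hmem y).1 ((hS.apply_mem_image_iff hcL).1 (hU' hy))
      rwa [show x = ⟨y, hle y.2⟩ from Subtype.ext hyx.symm]
    have hMn : M'.Normal := by
      refine ⟨fun x hx h => ?_⟩; obtain ⟨y, hy, hyx⟩ := id hx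
      obtain ⟨b, hb, hbq⟩ := hconj h
      have h2 := hMP ⟨_, hM.1.1.conj_mem _ (hMM hx) h, rfl⟩
      have h1 := hbq y ⟨_, h2⟩ (by rw [show (y : GL K V) = x from hyx]; rfl)
      refine ⟨⟨_, h2⟩, ?_, rfl⟩; change q _ ∈ U'; rw [← h1]; exact hst b hb _ hy
    have hMc : center (linearPart Λ) ≤ M' := by
      intro x hx; have h1 := hMP (mem_map_of_mem (linearPart Λ).subtype (hM.1.2.le hx))
      exact ⟨⟨x, h1⟩, hS.center_le_preimage U' (hcP.2 (hcH.1 hx)), rfl⟩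
    rcases eq_or_lt_of_le hMc with h | h
    · left; rw [Submodule.eq_bot_iff]; intro w hw; obtain ⟨x, rfl⟩ := hS.surjective w
      have h1 := (hM' x).2 hw; rw [← h, hcH] at h1; exact (hS.eq_zero_iff x).2 (hcP.2 h1)
    · right; refine le_antisymm hU' fun w hw => ?_
      obtain ⟨x, hx, rfl⟩ := hS.mem_image.1 hw
      exact (hM' x).1 (hM.2 ⟨hMn, h⟩ hMM ((hmem x).1 hx))

include hΛ in
/-- Distinct minimal normal subgroups of the linear part above the centre commute. -/
theorem commutator_minimalNormal_eq_bot {M M' : Subgroup (linearPart Λ)}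
    (hM : IsMinimalAboveCenter M) (hM' : IsMinimalAboveCenter M') (hne : M ≠ M') : ⁅M, M'⁆ = ⊥ := by
  by_cases h : ⁅M, M⁆ ≤ center (linearPart Λ); swap
  · exact hM.commutator_eq_bot hM' hne h
  by_cases h' : ⁅M', M'⁆ ≤ center (linearPart Λ); swap
  · rw [commutator_comm]; exact hM'.commutator_eq_bot hM hne.symm h'
  obtain ⟨r, hr, hrM⟩ := hM.exists_prime (quotient_comm_iff.2 h)
  obtain ⟨r', hr', hrM'⟩ := hM'.exists_prime (quotient_comm_iff.2 h')
  have hcc : ∀ x ∈ M, ∀ y ∈ M', ⁅x, y⁆ ∈ center (linearPart Λ) := fun x hx y hy =>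
    hM.commutator_le_center_of_ne hM' hne (commutator_mem_commutator hx hy)
  rw [_root_.eq_bot_iff, commutator_le]; intro x hx y hy; rw [mem_bot]
  -- For different primes the central commutator has order dividing both, so it is trivial.
  by_cases hrr : r = r'; swap
  · have h1 : ⁅x, y⁆ ^ r = 1 := by
      rw [← commutatorElement_pow_left (hcc x hx y hy), commutatorElement_eq_one_iff_mul_comm]
      exact (mem_center_iff.1 (hrM x hx) y).symm
    have h2 : ⁅x, y⁆ ^ r' = 1 := by
      rw [← commutatorElement_pow_right (hcc x hx y hy), commutatorElement_eq_one_iff_mul_comm]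
      exact mem_center_iff.1 (hrM' y hy) x
    have h3 := Nat.dvd_gcd (orderOf_dvd_of_pow_eq_one h1) (orderOf_dvd_of_pow_eq_one h2)
    rw [((Nat.coprime_primes hr hr').2 hrr : Nat.gcd r r' = 1), Nat.dvd_one, orderOf_eq_one_iff] at h3
    exact h3
  subst hrr; have : Fact r.Prime := ⟨hr⟩
  -- `M` and `M'` need not be stable under `Λ`, but the group generated by all minimal normal
  -- subgroups of the same type is characteristic in `H` and therefore stable.
  let P := (elementarySocle r (linearPart Λ)).map (linearPart Λ).subtype
  have hle : P ≤ linearPart Λ := map_subtype_le _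
  have hP : StableUnder Λ P := stableUnder_linearPart.map_subtype (elementarySocle_characteristic r)
  have hcP : ∀ {x : P}, x ∈ center P ↔ (x : GL K V) ∈ center (GL K V) := hΛ.mem_center_iff_coe hP
  have hcH : ∀ {x : linearPart Λ}, x ∈ center (linearPart Λ) ↔ (x : GL K V) ∈ center (GL K V) :=
    hΛ.mem_center_iff_coe stableUnder_linearPart
  have hME : IsElementaryAboveCenter r M := ⟨hM, h, hrM⟩
  have hME' : IsElementaryAboveCenter r M' := ⟨hM', h', hrM'⟩
  have hMP : M.map (linearPart Λ).subtype ≤ P := Subgroup.map_mono hME.le_elementarySocle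
  have hMP' : M'.map (linearPart Λ).subtype ≤ P := Subgroup.map_mono hME'.le_elementarySocle
  let x' : P := ⟨x, hMP ⟨x, hx, rfl⟩⟩
  let y' : P := ⟨y, hMP' ⟨y, hy, rfl⟩⟩
  have hxy : ⁅x', y'⁆ = 1 → ⁅x, y⁆ = 1 := fun h => by
    rw [commutatorElement_eq_one_iff_mul_comm] at h ⊢
    have h1 : (x : GL K V) * y = y * x := congrArg Subtype.val h; exact Subtype.ext h1
  -- A nontrivial commutator makes `P` nonabelian and so provides the symplectic space. There the
  -- two images are distinct and irreducible, hence orthogonal, which means that the subgroups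
  -- commute.
  by_contra hna
  have hcommP : ∀ a b : P, ⁅a, b⁆ ∈ center P := by
    rintro ⟨_, a, ha, rfl⟩ ⟨_, b, hb, rfl⟩
    exact hcP.2 (hcH.1 (commutator_elementarySocle_le r (commutator_mem_commutator ha hb)))
  have hpowP : ∀ a : P, a ^ r ∈ center P := by
    rintro ⟨_, a, ha, rfl⟩; exact hcP.2 (hcH.1 (pow_mem_center_of_mem_elementarySocle ha))
  obtain ⟨W, _, _, q, ζ, ω, hS⟩ := exists_isSymplecticQuotient hr hcommP hpowP
    (hΛ.isCyclic_center_subgroup hP) ⟨x', y', fun h => hna (hxy h)⟩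
  have : Finite W := Finite.of_surjective q hS.surjective
  have hsymp := hΛ.isCoprimeSymplectic hP hle hS
  have hcL : ∀ {L : Subgroup (linearPart Λ)}, IsMinimalAboveCenter L →
      center P ≤ (L.map (linearPart Λ).subtype).subgroupOf P := by
    intro L hL z hz; exact ⟨⟨z, hle z.2⟩, hL.1.2.le (hcH.2 (hcP.1 hz)), rfl⟩
  have key := hsymp.le_orthogonal (hΛ.isIrreducibleFor_image hP hle hS hM hMP)
    (hΛ.isIrreducibleFor_image hP hle hS hM' hMP') (fun he => hne ?_)
  · have h1 : ω (q x') (q y') = 0 :=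
      key (hS.mem_image.2 ⟨y', ⟨y, hy, rfl⟩, rfl⟩) _ (hS.mem_image.2 ⟨x', ⟨x, hx, rfl⟩, rfl⟩)
    exact hna (hxy (commutatorElement_eq_one_iff_mul_comm.2 (hS.eq_zero_iff_commute.1 h1)))
  · have h2 : (M.map (linearPart Λ).subtype).subgroupOf P =
        (M'.map (linearPart Λ).subtype).subgroupOf P := by
      ext z; rw [← hS.apply_mem_image_iff (hcL hM), he, hS.apply_mem_image_iff (hcL hM')]
    rw [subgroupOf_inj, inf_eq_left.2 hMP, inf_eq_left.2 hMP'] at h2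
    exact Subgroup.map_injective (linearPart Λ).subtype_injective h2

end IsCoprimeSemilinear

/-! ### Tensor decompositions given by commuting linear groups -/

namespace TensorDecomposition

variable {K : Type} {V : Type v} [Field K] [AddCommGroup V] [Module K V] {n : ℕ}
  (D : TensorDecomposition K V (Fin n))

/-- The embedding of `GL(W i)` in `GL(V)` by the action on the `i`-th tensor factor. -/
noncomputable def emb (i : Fin n) : GL K (D.W i) →* GL K V :=
  D.act.comp (MonoidHom.mulSingle (fun i => GL K (D.W i)) i)

theorem factor_eq_map (i : Fin n) (A : Subgroup (GL K (D.W i))) : D.factor i A = A.map (D.emb i) :=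
    rfl

theorem emb_apply (i : Fin n) (u : GL K (D.W i)) : D.emb i u = D.act (Pi.mulSingle i u) := rfl

theorem tensor_eq_iSup (A : ∀ i, Subgroup (GL K (D.W i))) : D.tensor A = ⨆ i, D.factor i (A i) := by
  apply le_antisymm
  · rw [tensor, map_le_iff_le_comap, pi_le_iff]; intro i
    rw [← map_le_iff_le_comap, Subgroup.map_map]
    exact le_iSup (fun i => D.factor i (A i)) i
  · refine iSup_le fun i => ?_; rintro _ ⟨u, hu, rfl⟩
    have h1 := (mulSingle_mem_pi (H := A) (I := Set.univ) i u).2 fun _ => hu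
    exact ⟨_, h1, rfl⟩

theorem act_mem_of_emb_mem {X : Subgroup (GL K V)} {u : ∀ i, GL K (D.W i)}
    (h : ∀ i, D.emb i (u i) ∈ X) : D.act u ∈ X := by
  have h1 : u ∈ X.comap D.act := pi_mem_of_mulSingle_mem u h; exact h1

theorem act_conj_emb (u : ∀ i, GL K (D.W i)) (i : Fin n) (x : GL K (D.W i)) : D.act u * D.emb i x *
    (D.act u)⁻¹ = D.emb i (u i * x * (u i)⁻¹) := by
  rw [emb_apply, emb_apply, ← map_inv, ← map_mul, ← map_mul]; congr 1; ext1 j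
  by_cases hj : j = i
  · subst hj; simp
  · simp [Pi.mulSingle_eq_of_ne hj]

theorem emb_commute {i j : Fin n} (hij : i ≠ j) (x : GL K (D.W i)) (y : GL K (D.W j)) : D.emb i x *
    D.emb j y = D.emb j y * D.emb i x := by
  rw [emb_apply, emb_apply, ← map_mul, ← map_mul]; congr 1
  exact Pi.mulSingle_commute (f := fun i => GL K (D.W i)) hij x y

/-- The tensor decomposition `D` is the one given by the groups `M i`: the factor `End (W i)` is
the algebra generated by `M i`. -/
structure IsRealisedBy (M : Fin n → Subgroup (GL K V)) : Prop where
  nontrivial : ∀ i, Nontrivial (D.W i)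
  exists_algHom : ∀ i, ∃ η : End K (D.W i) →ₐ[K] End K V,
    Injective η ∧ η.range = groupAlg (M i) ∧ ∀ u, (D.emb i u : End K V) = η u

namespace IsRealisedBy

variable {D} {M : Fin n → Subgroup (GL K V)} (hD : D.IsRealisedBy M)

include hD

theorem emb_injective (i : Fin n) : Injective (D.emb i) := by
  obtain ⟨η, hη, -, h⟩ := hD.exists_algHom i; intro x y hxy; refine Units.ext (hη ?_)
  rw [← h, ← h, hxy]

/-- By finiteness the inverse of `x` also lies in the algebra spanned by `M i`, so the preimage of
`x` in `End (W i)` is invertible. -/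
theorem exists_emb_eq [Finite K] [FiniteDimensional K V] {i : Fin n} {x : GL K V}
    (hx : (x : End K V) ∈ groupAlg (M i)) : ∃ u, D.emb i u = x := by
  obtain ⟨η, hη, hr, h⟩ := hD.exists_algHom i
  have hx' : ((x⁻¹ : GL K V) : End K V) ∈ groupAlg (M i) :=
    inv_mem (s := unitsSubgroup (groupAlg (M i))) hx
  rw [← hr] at hx hx'; obtain ⟨f, hf⟩ := hx; obtain ⟨g, hg⟩ := hx'
  replace hf : η f = x := hf; replace hg : η g = ((x⁻¹ : GL K V) : End K V) := hg
  refine ⟨⟨f, g, hη ?_, hη ?_⟩, Units.ext ?_⟩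
  · rw [map_mul, hf, hg, map_one, Units.mul_inv]
  · rw [map_mul, hf, hg, map_one, Units.inv_mul]
  · rw [h]; exact hf

theorem map_comap_emb [Finite K] [FiniteDimensional K V] {i : Fin n} {X : Subgroup (GL K V)}
    (hX : X ≤ M i) : D.factor i (X.comap (D.emb i)) = X := by
  rw [factor_eq_map, Subgroup.map_comap_eq, inf_eq_right]; intro x hx
  exact hD.exists_emb_eq (coe_mem_groupAlg (hX hx))

theorem groupAlg_comap_emb [Finite K] [FiniteDimensional K V] (i : Fin n) : groupAlg
    ((M i).comap (D.emb i)) = ⊤ := by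
  obtain ⟨η, hη, hr, h⟩ := hD.exists_algHom i; rw [_root_.eq_top_iff]; intro f _
  have key : ∀ a ∈ groupAlg (M i), ∃ g ∈ groupAlg ((M i).comap (D.emb i)), η g = a := by
    intro a ha; refine groupAlg_induction
      (p := fun a => ∃ g ∈ groupAlg ((M i).comap (D.emb i)), η g = a) ?_ ?_ ?_ ?_ ha
    · intro x hx; obtain ⟨u, hu⟩ := hD.exists_emb_eq (coe_mem_groupAlg hx)
      refine ⟨u, coe_mem_groupAlg ?_, by rw [← h, hu]⟩
      rw [mem_comap, hu]; exact hx
    · exact ⟨0, zero_mem _, map_zero _⟩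
    · rintro _ _ ⟨g, hg, rfl⟩ ⟨g', hg', rfl⟩
      exact ⟨g + g', add_mem hg hg', map_add _ _ _⟩
    · rintro c _ ⟨g, hg, rfl⟩; exact ⟨c • g, Subalgebra.smul_mem _ hg c, map_smul _ _ _⟩
  obtain ⟨g, hg, hgf⟩ := key (η f) (hr ▸ ⟨f, rfl⟩); rwa [← hη hgf]

/-- An automorphism of `M i` by conjugation is realised on the `i`-th factor. -/
theorem exists_emb_conj [FiniteDimensional K V] (i : Fin n) (h : GL K V)
    (hn : (M i).map (MulAut.conj h).toMonoidHom = M i) : ∃ a : GL K (D.W i), ∀ u, h * D.emb i u *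
      h⁻¹ = D.emb i (a * u * a⁻¹) := by
  obtain ⟨η, hη, hr, he⟩ := hD.exists_algHom i; have := hD.nontrivial i
  let c : End K V →ₐ[K] End K V :=
    { toFun := fun f => (h : End K V) * f * (h⁻¹ : GL K V)
      map_one' := by rw [mul_one, Units.mul_inv]
      map_mul' := fun f g => by simp [mul_assoc]
      map_zero' := by simp
      map_add' := fun f g => by rw [mul_add, add_mul]
      commutes' := fun r => by
        rw [Algebra.algebraMap_eq_smul_one, mul_smul_comm, mul_one, smul_mul_assoc, Units.mul_inv] }
  have hc : Injective c := fun f g hfg => by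
    have h1 : (h : End K V) * f * (h⁻¹ : GL K V) = h * g * (h⁻¹ : GL K V) := hfg
    rwa [Units.mul_left_inj, Units.mul_right_inj] at h1
  have hcr : (c.comp η).range = η.range := by
    rw [AlgHom.range_comp, hr, groupAlg, AlgHom.map_adjoin]; congr 1
    conv_rhs => rw [← hn]
    ext f; constructor
    · rintro ⟨_, ⟨x, hx, rfl⟩, rfl⟩; exact ⟨_, ⟨x, hx, rfl⟩, rfl⟩
    · rintro ⟨_, ⟨x, hx, rfl⟩, rfl⟩; exact ⟨_, ⟨x, hx, rfl⟩, rfl⟩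
  obtain ⟨T, hT⟩ := exists_linearEquiv_of_range_eq (c.comp η) η (hc.comp hη) hη hcr
  refine ⟨.ofLinearEquiv T, fun u => Units.ext ?_⟩
  rw [he, Units.val_mul, Units.val_mul, he]; exact hT u

end IsRealisedBy

end TensorDecomposition

theorem exists_isRealisedBy {K : Type} {V : Type v} [Field K] [Finite K] [AddCommGroup V]
    [Module K V] [FiniteDimensional K V] [Nontrivial V] {n : ℕ} {M : Fin n → Subgroup (GL K V)}
    (hM : ∀ i, (Nat.card (M i)).Coprime (Nat.card K))
    (hcomm : ∀ i j, i ≠ j → ∀ x ∈ M i, ∀ y ∈ M j, x * y = y * x) (htop : groupAlg (⨆ i, M i) = ⊤) :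
    ∃ D : TensorDecomposition K V (Fin n), D.IsRealisedBy M := by
  obtain ⟨D, η, hn, hi, hr, hc, ha⟩ := exists_tensorDecomposition_of_commute hM hcomm htop
  refine ⟨D, hn, fun i => ⟨η i, hi i, hr i, fun u => ?_⟩⟩
  rw [D.emb_apply, ha, ← tensorOp_mulSingle (θ := η) i (u : End K (D.W i))]; congr 1
  ext1 j; by_cases hj : j = i
  · subst hj; simp
  · simp [Pi.mulSingle_eq_of_ne hj]

section GroupAlgebra

variable {K : Type*} {V : Type*} [Field K] [AddCommGroup V] [Module K V]

/-- The recurring test for scalars: it is enough to commute with groups that together span `End V`.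
-/
theorem mem_center_of_commute_iSup {ι : Sort*} {M : ι → Subgroup (GL K V)}
    (htop : groupAlg (⨆ i, M i) = ⊤) {x : GL K V} (h : ∀ i, ∀ m ∈ M i, m * x = x * m) : x ∈ center
    (GL K V) := by
  have h1 : ⨆ i, M i ≤ centralizer {x} :=
    iSup_le fun i m hm => mem_centralizer_singleton_iff.2 (h i m hm)
  exact mem_center_of_commute_groupAlg htop fun y hy => mem_centralizer_singleton_iff.1 (h1 hy)

theorem groupAlg_eq_top_of_le_center_sup [Finite K] [FiniteDimensional K V] [Nontrivial V]
    {X Y : Subgroup (GL K V)} (hX : groupAlg X = ⊤) (hXY : X ≤ center (GL K V) ⊔ Y) : groupAlg Y = ⊤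
    := by
  rw [_root_.eq_top_iff, ← hX]
  have h1 : X ≤ unitsSubgroup (groupAlg Y) := by
    refine hXY.trans (sup_le (fun z hz => ?_) fun y hy => coe_mem_groupAlg hy)
    obtain ⟨c, hc⟩ := GeneralLinearGroup.exists_smul_one hz
    rw [mem_unitsSubgroup, hc, ← Algebra.algebraMap_eq_smul_one]
    exact Subalgebra.algebraMap_mem _ (c : K)
  refine Algebra.adjoin_le ?_; rintro _ ⟨x, hx, rfl⟩; exact h1 hx

end GroupAlgebra

/-! ### Decomposing the linear part along its minimal normal subgroups -/

namespace IsCoprimeSemilinear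

variable {K : Type} {V : Type v} [Field K] [Finite K] [AddCommGroup V] [Module K V]
  [FiniteDimensional K V] [Nontrivial V] {Λ : Subgroup (semiAut K V)} (hΛ : IsCoprimeSemilinear Λ)
  {t : ℕ} {L : Fin t → Subgroup (linearPart Λ)} (hL : Set.range L = {M | IsMinimalAboveCenter M})

include hL in
theorem socleAboveCenter_eq : socleAboveCenter (linearPart Λ) = center (linearPart Λ) ⊔ ⨆ i, L i := by
  rw [socleAboveCenter, ← hL, sSup_range]

include hΛ

theorem map_center : (center (linearPart Λ)).map (linearPart Λ).subtype = center (GL K V) := by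
  rw [hΛ.center_eq stableUnder_linearPart, subgroupOf_map_subtype,
    inf_eq_left.2 hΛ.center_le_linearPart]

/-- The centraliser of the socle in the linear part is the centre, so `groupAlg_eq_top` applies. -/
theorem groupAlg_socle_eq_top : groupAlg
    ((socleAboveCenter (linearPart Λ)).map (linearPart Λ).subtype) = ⊤ := by
  refine hΛ.groupAlg_eq_top (stableUnder_linearPart.map_subtype inferInstance)
    (map_subtype_le _) fun x hx hc => ?_
  rw [← hΛ.map_center,
    ← centralizer_socleAboveCenter (hΛ.charAbelianCentral stableUnder_linearPart)]
  exact ⟨⟨x, hx⟩, mem_centralizer_iff.2 fun y hy => Subtype.ext (hc y ⟨y, hy, rfl⟩), rfl⟩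

include hL

theorem map_socleAboveCenter : (socleAboveCenter (linearPart Λ)).map (linearPart Λ).subtype = center
    (GL K V) ⊔ ⨆ i, (L i).map (linearPart Λ).subtype := by
  rw [socleAboveCenter_eq hL, Subgroup.map_sup, hΛ.map_center, Subgroup.map_iSup]

theorem groupAlg_iSup_eq_top : groupAlg (⨆ i, (L i).map (linearPart Λ).subtype) = ⊤ :=
  groupAlg_eq_top_of_le_center_sup hΛ.groupAlg_socle_eq_top (hΛ.map_socleAboveCenter hL).le

/-- An element which acts on every minimal normal subgroup above the centre as some element of the
linear part belongs to the linear part. -/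
theorem mem_linearPart_of_forall_conj_eq {x : GL K V}
    (hx : ∀ i, ∃ h ∈ linearPart Λ, ∀ m ∈ (L i).map (linearPart Λ).subtype, x * m * x⁻¹ = h * m *
      h⁻¹) : x ∈ linearPart Λ := by
  have hmin : ∀ i, IsMinimalAboveCenter (L i) := fun i => hL.le ⟨i, rfl⟩
  have hnorm : ∀ i, ∀ h ∈ linearPart Λ, ∀ m ∈ (L i).map (linearPart Λ).subtype,
      h * m * h⁻¹ ∈ (L i).map (linearPart Λ).subtype := by
    rintro i h hh _ ⟨m, hm, rfl⟩; exact ⟨_, (hmin i).1.1.conj_mem m hm ⟨h, hh⟩, rfl⟩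
  -- The element `h` may depend on `i`. Such `x` form a group, stable because `Λ` permutes the
  -- minimal normal subgroups, and its exponent modulo scalars divides `|H|`.
  let S : Set (GL K V) := {x | ∀ i, ∃ h ∈ linearPart Λ,
    ∀ m ∈ (L i).map (linearPart Λ).subtype, x * m * x⁻¹ = h * m * h⁻¹}
  have h1 : 1 ∈ S := fun i => ⟨1, one_mem _, fun m _ => rfl⟩
  have hmul : ∀ x ∈ S, ∀ y ∈ S, x * y ∈ S := by
    intro x hx y hy i; obtain ⟨h, hh, hxh⟩ := hx i; obtain ⟨h', hh', hyh⟩ := hy i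
    refine ⟨h * h', mul_mem hh hh', fun m hm => ?_⟩
    calc x * y * m * (x * y)⁻¹ = x * (y * m * y⁻¹) * x⁻¹ := by group
      _ = h * (h' * m * h'⁻¹) * h⁻¹ := by rw [hyh m hm, hxh _ (hnorm i h' hh' m hm)]
      _ = _ := by group
  let X : Subgroup (GL K V) :=
    { carrier := S
      one_mem' := h1
      mul_mem' := fun hx hy => hmul _ hx _ hy
      inv_mem' := fun hx => inv_mem_of_forall_mul_mem S h1 hmul hx }
  refine hΛ.le_linearPart (X := X) ?_ hΛ.coprime_linearPart ?_ hx
  · intro g hg x hx i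
    let φ : linearPart Λ ≃* linearPart Λ := stableUnder_linearPart.mulAut ⟨g, hg⟩
    obtain ⟨j, hj⟩ := hL.ge ((hmin i).map φ.symm); obtain ⟨h, hh, hxh⟩ := hx j
    refine ⟨semiAut.conjGL g h, conjGL_mem_linearPart hg hh, ?_⟩; rintro _ ⟨m, hm, rfl⟩
    have h2 := hxh (φ.symm m) (mem_map_of_mem _ (hj ▸ mem_map_of_mem _ hm))
    have h3 : semiAut.conjGL g (φ.symm m : GL K V) = m :=
      congrArg Subtype.val (φ.apply_symm_apply m)
    have h4 := congrArg (semiAut.conjGL g) h2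
    rw [map_mul, map_mul, map_mul, map_mul, h3, map_inv, map_inv] at h4; exact h4
  · intro x hx
    refine mem_center_of_commute_iSup (hΛ.groupAlg_iSup_eq_top hL) fun i m hm => ?_
    obtain ⟨h, hh, hxh⟩ := hx i
    have hpow : ∀ n : ℕ, ∀ m ∈ (L i).map (linearPart Λ).subtype,
        x ^ n * m * (x ^ n)⁻¹ = h ^ n * m * (h ^ n)⁻¹ := by
      intro n; induction n with
      | zero => intro m _; simp
      | succ n ih =>
        intro m hm
        calc x ^ (n + 1) * m * (x ^ (n + 1))⁻¹ = x ^ n * (x * m * x⁻¹) * (x ^ n)⁻¹ := by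
              rw [pow_succ]; group
          _ = h ^ n * (h * m * h⁻¹) * (h ^ n)⁻¹ := by rw [hxh m hm, ih _ (hnorm i h hh m hm)]
          _ = _ := by rw [pow_succ]; group
    have h2 : h ^ Nat.card (linearPart Λ) = 1 :=
      congrArg Subtype.val (pow_card_eq_one' (x := (⟨h, hh⟩ : linearPart Λ)))
    have h3 := hpow (Nat.card (linearPart Λ)) m hm
    rw [h2, one_mul, inv_one, mul_one, mul_inv_eq_iff_eq_mul] at h3; exact h3.symm

/-- The tensor decomposition of `V` given by the minimal normal subgroups above the centre, and the
corresponding decomposition of the elements of the linear part. -/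
theorem exists_tensorDecomposition (hinj : Injective L) : ∃ D : TensorDecomposition K V (Fin t),
      D.IsRealisedBy (fun i => (L i).map (linearPart Λ).subtype) ∧ ∀ h ∈ linearPart Λ, ∃ z ∈ center
      (GL K V), ∃ u, (∀ i, D.emb i (u i) ∈ linearPart Λ) ∧ h = z * D.act u := by
  have hmin : ∀ i, IsMinimalAboveCenter (L i) := fun i => hL.le ⟨i, rfl⟩
  obtain ⟨D, hD⟩ := exists_isRealisedBy (fun i => hΛ.coprime_of_le (map_subtype_le (L i))) (by
      rintro i j hij _ ⟨x, hx, rfl⟩ _ ⟨y, hy, rfl⟩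
      have h1 := commutator_mem_commutator hx hy
      rw [hΛ.commutator_minimalNormal_eq_bot (hmin i) (hmin j) (hinj.ne hij), mem_bot,
        commutatorElement_eq_one_iff_mul_comm] at h1
      exact congrArg Subtype.val h1) (hΛ.groupAlg_iSup_eq_top hL)
  refine ⟨D, hD, fun h hh => ?_⟩
  have hex : ∀ i, ∃ a : GL K (D.W i), ∀ u, h * D.emb i u * h⁻¹ = D.emb i (a * u * a⁻¹) := by
    refine fun i => hD.exists_emb_conj i h (le_antisymm ?_ ?_)
    · rintro _ ⟨_, ⟨m, hm, rfl⟩, rfl⟩; exact ⟨_, (hmin i).1.1.conj_mem m hm ⟨h, hh⟩, rfl⟩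
    · rintro _ ⟨m, hm, rfl⟩
      refine ⟨_, ⟨_, (hmin i).1.1.conj_mem m hm ⟨h, hh⟩⁻¹, rfl⟩, ?_⟩
      change h * (h⁻¹ * m * h⁻¹⁻¹) * h⁻¹ = m; group
  choose u hu using hex
  have hemb : ∀ i, ∀ m ∈ (L i).map (linearPart Λ).subtype, ∃ x, D.emb i x = m :=
    fun i m hm => hD.exists_emb_eq (coe_mem_groupAlg hm)
  refine ⟨h * (D.act u)⁻¹, ?_, u, fun i => ?_, by group⟩
  -- The quotient of `h` by the tensor product of its components `u i` centralises all the minimal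
  -- normal subgroups.
  · refine mem_center_of_commute_iSup (hΛ.groupAlg_iSup_eq_top hL) fun i m hm => ?_
    obtain ⟨x, rfl⟩ := hemb i m hm; have h1 := hu i ((u i)⁻¹ * x * u i)
    have h2 := D.act_conj_emb u i ((u i)⁻¹ * x * u i)
    rw [← h2, mul_inv_eq_iff_eq_mul] at h1
    have h3 : D.act u * D.emb i ((u i)⁻¹ * x * u i) * (D.act u)⁻¹ = D.emb i x := by
      rw [h2]; congr 1; group
    have h4 : D.emb i ((u i)⁻¹ * x * u i) = (D.act u)⁻¹ * D.emb i x * D.act u := by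
      rw [← h3]; group
    rw [h3, h4] at h1
    calc D.emb i x * (h * (D.act u)⁻¹) = (D.emb i x * h) * (D.act u)⁻¹ := by group
      _ = _ := by rw [← h1]; group
  -- A single component acts on its own minimal normal subgroup as `h` does, and trivially on the
  -- others.
  · refine hΛ.mem_linearPart_of_forall_conj_eq hL fun j => ?_; by_cases hij : i = j
    · subst hij; refine ⟨h, hh, fun m hm => ?_⟩; obtain ⟨x, rfl⟩ := hemb i m hm
      rw [hu, map_mul, map_mul, map_inv]
    · refine ⟨1, one_mem _, fun m hm => ?_⟩; obtain ⟨x, rfl⟩ := hemb j m hm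
      rw [D.emb_commute hij, mul_inv_cancel_right, one_mul, inv_one, mul_one]

end IsCoprimeSemilinear

/-! ### Extraspecial groups and the abelian case -/

section Extraspecial

/-- A nonabelian group of class two whose centre has prime order `r` and contains the `r`-th powers
is extraspecial. -/
theorem isExtraspecial_of_class_two {R : Type*} [Group R] [Finite R] {r : ℕ} (hr : r.Prime)
    (hc : Nat.card (center R) = r) (hcomm : ∀ x y : R, ⁅x, y⁆ ∈ center R)
    (hpow : ∀ x : R, x ^ r ∈ center R) (hna : ∃ x y : R, ⁅x, y⁆ ≠ 1) : IsExtraspecial r R := by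
  have hcr : ∀ z ∈ center R, z ^ r = 1 := fun z hz => by
    have h1 := pow_card_eq_one' (x := (⟨z, hz⟩ : center R)); rw [hc] at h1
    exact congrArg Subtype.val h1
  have hcom : _root_.commutator R = center R := by
    have hle : _root_.commutator R ≤ center R := by
      rw [_root_.commutator_def, commutator_le]; exact fun x _ y _ => hcomm x y
    obtain ⟨x, y, hxy⟩ := hna
    have h1 : Nat.card (_root_.commutator R) ∣ r := hc ▸ Subgroup.card_dvd_of_le hle
    refine Subgroup.eq_of_le_of_card_ge hle ?_
    rw [hc, ((Nat.dvd_prime hr).1 h1).resolve_left fun h2 => hxy ?_]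
    rw [Subgroup.card_eq_one] at h2
    have h3 : ⁅x, y⁆ ∈ _root_.commutator R := commutator_mem_commutator (mem_top x) (mem_top y)
    rwa [h2, mem_bot] at h3
  have hnormal : ∀ X : Subgroup R, center R ≤ X → X.Normal := fun X hX =>
    ⟨fun x hx g => by
      have h1 := mul_mem (hX (hcomm g x)) hx
      rwa [commutatorElement_def, inv_mul_cancel_right] at h1⟩
  refine ⟨inferInstance, fun x => ⟨2, ?_⟩, hc, hcom, le_antisymm ?_ ?_⟩
  · rw [sq, pow_mul, hcr _ (hpow x)]
  · intro x hx; by_contra hxc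
    -- For a noncentral `x`, choose `X` maximal among subgroups containing the centre but not `x`.
    -- It turns out to be a maximal subgroup, so `x` is not in the Frattini subgroup.
    obtain ⟨X, -, hX⟩ := (Set.toFinite {X : Subgroup R | center R ≤ X ∧ x ∉ X}).exists_le_maximal
      (show center R ∈ {X : Subgroup R | center R ≤ X ∧ x ∉ X} from ⟨le_rfl, hxc⟩)
    have hgt : ∀ Y, X < Y → x ∈ Y := fun Y hY => by
      by_contra h; exact not_le_of_gt hY (hX.2 ⟨hX.1.1.trans hY.le, h⟩ hY.le)
    have htop : ∀ g, g ∈ X ⊔ zpowers x := by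
      intro g; by_cases hg : g ∈ X
      · exact le_sup_left (a := X) hg
      have hXn := hnormal X hX.1.1
      have h1 := hgt (X ⊔ zpowers g) (lt_of_le_of_ne le_sup_left fun h => hg (by
        rw [h]; exact le_sup_right (a := X) (mem_zpowers g)))
      obtain ⟨y, hy, _, ⟨k, rfl⟩, hyk⟩ := mem_sup_of_normal_left.1 h1
      have hgr : g ^ (r : ℤ) ∈ X := by
        rw [zpow_natCast]; exact hX.1.1 (hpow g)
      have hgk : g ^ k ∈ X ⊔ zpowers x := by
        have h2 : g ^ k = y⁻¹ * x := by rw [← hyk, inv_mul_cancel_left]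
        rw [h2]
        exact mul_mem (le_sup_left (a := X) (inv_mem hy)) (le_sup_right (a := X) (mem_zpowers x))
      -- `x` is an element of `X` times `g ^ k`, and `g ^ r ∈ X`; if `r` divided `k`, `x` would lie
      -- in `X`. So `g` can be recovered from `g ^ r` and `g ^ k`.
      have hkr : IsCoprime (r : ℤ) k := by
        rw [Prime.coprime_iff_not_dvd (Nat.prime_iff_prime_int.1 hr)]; rintro ⟨m, rfl⟩
        refine hX.1.2 (hyk ▸ mul_mem hy ?_); change g ^ ((r : ℤ) * m) ∈ X; rw [zpow_mul]
        exact zpow_mem hgr m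
      obtain ⟨a, b, hab⟩ := hkr
      have h3 : g = (g ^ (r : ℤ)) ^ a * (g ^ k) ^ b := by
        rw [← zpow_mul, ← zpow_mul, ← zpow_add, mul_comm _ a, mul_comm k, hab, zpow_one]
      rw [h3]; exact mul_mem (zpow_mem (le_sup_left (a := X) hgr) a) (zpow_mem hgk b)
    refine hX.1.2 (frattini_le_coatom (K := X) ⟨fun h => hX.1.2 (h ▸ mem_top x), fun Y hY => ?_⟩ hx)
    rw [_root_.eq_top_iff]; intro g _
    exact (sup_le hY.le (zpowers_le.2 (hgt Y hY)) : X ⊔ zpowers x ≤ Y) (htop g)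
  · refine le_iInf₂ fun X (hX : IsCoatom X) => ?_; by_contra h
    -- If a maximal subgroup missed part of the centre, the group would be that subgroup times the
    -- centre. Then all commutators, and so the centre itself, would lie in the subgroup.
    have h1 : X ⊔ center R = ⊤ := hX.2 _ (left_lt_sup.2 h)
    have h2 : ∀ g : R, ∃ x ∈ X, ∃ z ∈ center R, x * z = g := fun g =>
      mem_sup_of_normal_right.1 (h1 ▸ mem_top g)
    refine h (hcom ▸ ?_); rw [_root_.commutator_def, commutator_le]; intro g _ g' _
    obtain ⟨x, hx, z, hz, rfl⟩ := h2 g; obtain ⟨x', hx', z', hz', rfl⟩ := h2 g'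
    have e1 : ∀ y : R, ⁅z, y⁆ = 1 := fun y =>
      commutatorElement_eq_one_iff_mul_comm.2 (mem_center_iff.1 hz y).symm
    have e2 : ∀ y : R, ⁅y, z'⁆ = 1 := fun y =>
      commutatorElement_eq_one_iff_mul_comm.2 (mem_center_iff.1 hz' y)
    rw [commutatorElement_mul_left (hcomm _ _), e1, mul_one,
      commutatorElement_mul_right (hcomm _ _), e2, mul_one, commutatorElement_def]
    exact mul_mem (mul_mem (mul_mem hx hx') (inv_mem hx)) (inv_mem hx')

/-- An extraspecial supplement of the centre. -/
theorem exists_isExtraspecial {E : Type u} [Group E] [Finite E] {r : ℕ} (hr : r.Prime)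
    (hcomm : ∀ x y : E, ⁅x, y⁆ ∈ center E) (hpow : ∀ x : E, x ^ r ∈ center E)
    (hcyc : IsCyclic (center E)) (hna : ∃ x y : E, ⁅x, y⁆ ≠ 1)
    (hpow' : ∀ x : E, ∃ z ∈ center E, ((x * z) ^ r) ^ r = 1) : ∃ R : Subgroup E, R ⊔ center E = ⊤ ∧
    IsExtraspecial r R ∧ Nat.card R = r * Nat.card (E ⧸ center E) := by
  obtain ⟨ζ, hζc, hζr, hζ⟩ : ∃ ζ ∈ center E, orderOf ζ = r ∧ ∀ x y : E, ⁅x, y⁆ ∈ zpowers ζ := by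
    obtain ⟨W, _, _, q, ζ, ω, hS⟩ := exists_isSymplecticQuotient hr hcomm hpow hcyc hna
    refine ⟨ζ, hS.mem_center, hS.orderOf_eq, fun x y => ?_⟩; rw [hS.commutator]
    exact pow_mem (mem_zpowers ζ) _
  -- `R` is a complement to the centre modulo the subgroup of order `r`. By `hpow'` each element can
  -- be corrected by a central one so that its `r`-th power has exponent `r`, hence lies in that
  -- subgroup.
  obtain ⟨R, hζR, hRY, hsup⟩ := exists_complement_modulo hr (zpowers_le.2 hζc) hζ fun x => by
    obtain ⟨z, hz, hxz⟩ := hpow' x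
    exact ⟨z, hz, mem_zpowers_of_pow_eq_one hcyc hr.pos hζc hζr (hpow _) hxz⟩
  have hcR : center R = (center E).subgroupOf R := by
    ext x; rw [mem_subgroupOf]
    refine ⟨fun hx => ?_, fun hx => mem_center_iff.2 fun y => Subtype.ext (mem_center_iff.1 hx y)⟩
    have h1 : R ⊔ center E ≤ centralizer {(x : E)} := by
      refine sup_le (fun y hy => ?_) fun y hy => ?_
      · rw [mem_centralizer_singleton_iff]
        exact congrArg Subtype.val (mem_center_iff.1 hx ⟨y, hy⟩)
      · rw [mem_centralizer_singleton_iff]; exact (mem_center_iff.1 hy x).symm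
    rw [hsup] at h1
    exact mem_center_iff.2 fun y => mem_centralizer_singleton_iff.1 (h1 (mem_top y))
  have hcard : Nat.card (center R) = r := by
    rw [hcR, ← inf_subgroupOf_right, inf_comm, hRY,
      Nat.card_congr (subgroupOfEquivOfLe hζR).toEquiv, Nat.card_zpowers, hζr]
  refine ⟨R, hsup, isExtraspecial_of_class_two hr hcard (fun x y => ?_) (fun x => ?_) ?_, ?_⟩
  · rw [hcR, mem_subgroupOf]; exact hcomm x y
  · rw [hcR, mem_subgroupOf]; exact hpow x
  · by_contra! h; obtain ⟨x, y, hxy⟩ := hna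
    have h2 : ∀ g : E, ∃ x ∈ R, ∃ z ∈ center E, x * z = g := fun g =>
      mem_sup_of_normal_right.1 (hsup ▸ mem_top g)
    obtain ⟨a, ha, z, hz, rfl⟩ := h2 x; obtain ⟨b, hb, z', hz', rfl⟩ := h2 y
    refine hxy ?_
    rw [commutatorElement_mul_left (hcomm _ _), commutatorElement_mul_right (hcomm _ _),
      commutatorElement_eq_one_iff_mul_comm.2 (mem_center_iff.1 hz _).symm,
      commutatorElement_eq_one_iff_mul_comm.2 (mem_center_iff.1 hz' a), mul_one, mul_one]
    exact congrArg Subtype.val (h ⟨a, ha⟩ ⟨b, hb⟩)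
  · rw [← Subgroup.index_eq_card, ← relIndex_top_right, ← hsup, relIndex_sup_right, relIndex,
      ← hcR, ← hcard, Subgroup.card_mul_index]

end Extraspecial

theorem IsExtraspecial.of_mulEquiv {X Y : Type*} [Group X] [Group Y] {r : ℕ} (e : X ≃* Y)
    (h : IsExtraspecial r X) : IsExtraspecial r Y := by
  obtain ⟨h1, h2, h3, h4, h5⟩ := h
  have hc : (center X).map e.toMonoidHom = center Y := by
    ext y; refine ⟨?_, fun hy => ⟨e.symm y, ?_, e.apply_symm_apply y⟩⟩
    · rintro ⟨x, hx, rfl⟩; exact (centerCongr e ⟨x, hx⟩).2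
    · exact (centerCongr e.symm ⟨y, hy⟩).2
  refine ⟨Finite.of_equiv X e.toEquiv, h2.of_equiv e, ?_, ?_, ?_⟩
  · rw [← h3, Nat.card_congr (centerCongr e).toEquiv]
  · rw [← hc, ← h4, _root_.map_commutator_eq, MonoidHom.range_eq_top.2 e.surjective]; rfl
  · rw [← hc, ← h5]; exact (OrderIso.map_radical e.mapSubgroup).symm

namespace IsSymplecticQuotient

/-- An application of `pow_mem` to the central elements which some `r`-th power of a central element
corrects to exponent `r`. The error term of the power map is a power of a commutator and has
exponent `r`, so it belongs to this subgroup, also for `r = 2`. -/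
theorem exists_pow_pow_eq_one {Q : Type*} [Group Q] {r : ℕ} {W : Type*} [AddCommGroup W]
    [Module (ZMod r) W] {q : Q → W} {ζ : Q} {ω : BilinForm (ZMod r) W}
    (hS : IsSymplecticQuotient q ζ ω) [Fact r.Prime] [Finite W] (hQ : CharAbelianCentral Q)
    (hcyc : IsCyclic (center Q)) (x : Q) : ∃ z ∈ center Q, ((x * z) ^ r) ^ r = 1 := by
  have hcz : ∀ {z}, z ∈ center Q → ∀ y, Commute y z := fun hz y => mem_center_iff.1 hz y
  let T : Subgroup Q :=
    { carrier := {t | t ∈ center Q ∧ ∃ z ∈ center Q, (t * z ^ r) ^ r = 1}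
      one_mem' := ⟨one_mem _, 1, one_mem _, by simp⟩
      mul_mem' := by
        rintro a b ⟨ha, z, hz, haz⟩ ⟨hb, w, hw, hbw⟩
        refine ⟨mul_mem ha hb, z * w, mul_mem hz hw, ?_⟩
        have h1 : a * b * (z * w) ^ r = a * z ^ r * (b * w ^ r) := by
          rw [(hcz hw z).mul_pow, mul_assoc a, mul_assoc a, ← mul_assoc b, ← mul_assoc (z ^ r),
            hcz hb (z ^ r)]
        rw [h1, (hcz (mul_mem hb (Subgroup.pow_mem _ hw r)) _).mul_pow, haz, hbw, one_mul]
      inv_mem' := by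
        rintro a ⟨ha, z, hz, haz⟩; refine ⟨inv_mem ha, z⁻¹, inv_mem hz, ?_⟩
        rw [inv_pow, ← mul_inv_rev, inv_pow, (hcz ha _).eq, haz, inv_one] }
  have hT : T.Characteristic := by
    rw [characteristic_iff_le_comap]; rintro φ a ⟨ha, z, hz, haz⟩
    have hφ : ∀ {z}, z ∈ center Q → φ z ∈ center Q := fun hz => (centerCongr φ ⟨_, hz⟩).2
    refine ⟨hφ ha, φ z, hφ hz, ?_⟩; have h := congrArg φ haz; simpa using h
  obtain ⟨hx, z, hz, h⟩ := hS.pow_mem hQ hcyc hT (fun _ h => h.1)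
    (fun z hz => ⟨Subgroup.pow_mem _ hz r, z⁻¹, inv_mem hz, by rw [inv_pow, mul_inv_cancel, one_pow]⟩)
    (fun x y => ⟨⁅y, x⁆ ^ r.choose 2, ⟨Subgroup.pow_mem _ (hS.commutator_mem_center y x) _, 1, one_mem _, by
      rw [one_pow, mul_one, ← pow_mul, mul_comm, pow_mul, hS.commutator_pow, one_pow]⟩,
      mul_pow_eq_of_commutator_mem_center (hS.commutator_mem_center y x) r⟩) x
  exact ⟨z, hz, by rw [(hcz hz x).mul_pow, h]⟩

end IsSymplecticQuotient

namespace IsCoprimeSemilinear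

variable {K : Type} {V : Type v} [Field K] [Finite K] [AddCommGroup V] [Module K V]
  [FiniteDimensional K V] [Nontrivial V] {Λ : Subgroup (semiAut K V)} (hΛ : IsCoprimeSemilinear Λ)

include hΛ

/-- The computation takes place in the stable group generated by all minimal normal subgroups of the
type of `M`, because `M` itself need not be stable. -/
theorem exists_pow_pow_eq_one {r : ℕ} (hr : r.Prime) {M : Subgroup (linearPart Λ)}
    (hM : IsElementaryAboveCenter r M) {x : GL K V} (hx : x ∈ M.map (linearPart Λ).subtype) : ∃ z ∈
    center (GL K V), ((x * z) ^ r) ^ r = 1 := by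
  have : Fact r.Prime := ⟨hr⟩
  let P := (elementarySocle r (linearPart Λ)).map (linearPart Λ).subtype
  have hP : StableUnder Λ P := stableUnder_linearPart.map_subtype (elementarySocle_characteristic r)
  have hcP : ∀ {x : P}, x ∈ center P ↔ (x : GL K V) ∈ center (GL K V) := hΛ.mem_center_iff_coe hP
  have hcH : ∀ {x : linearPart Λ}, x ∈ center (linearPart Λ) ↔ (x : GL K V) ∈ center (GL K V) :=
    hΛ.mem_center_iff_coe stableUnder_linearPart
  have hMP : M.map (linearPart Λ).subtype ≤ P := Subgroup.map_mono hM.le_elementarySocle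
  have hcommP : ∀ a b : P, ⁅a, b⁆ ∈ center P := by
    rintro ⟨_, a, ha, rfl⟩ ⟨_, b, hb, rfl⟩
    exact hcP.2 (hcH.1 (commutator_elementarySocle_le r (commutator_mem_commutator ha hb)))
  have hpowP : ∀ a : P, a ^ r ∈ center P := by
    rintro ⟨_, a, ha, rfl⟩; exact hcP.2 (hcH.1 (pow_mem_center_of_mem_elementarySocle ha))
  have hna : ∃ x y : P, ⁅x, y⁆ ≠ 1 := by
    by_contra! h
    refine not_le_of_gt hM.1.1.2 fun m hm => hcH.2 (hcP.1 (?_ : ⟨m, hMP ⟨m, hm, rfl⟩⟩ ∈ _))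
    exact mem_center_iff.2 fun y => commutatorElement_eq_one_iff_mul_comm.1 (h y _)
  obtain ⟨W, _, _, q, ζ, ω, hS⟩ := exists_isSymplecticQuotient hr hcommP hpowP
    (hΛ.isCyclic_center_subgroup hP) hna
  have : Finite W := Finite.of_surjective q hS.surjective
  obtain ⟨z, hz, h⟩ := hS.exists_pow_pow_eq_one (hΛ.charAbelianCentral hP)
    (hΛ.isCyclic_center_subgroup hP) ⟨x, hMP hx⟩
  exact ⟨z, hcP.1 hz, congrArg Subtype.val h⟩

variable {t : ℕ} {L : Fin t → Subgroup (linearPart Λ)}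
  (hL : Set.range L = {M | IsMinimalAboveCenter M}) (hinj : Injective L)

include hL hinj

/-- A central element of one minimal normal subgroup commutes with all the others too, and together
they span `End V`. -/
theorem center_map_minimalNormal (i : Fin t) : center ((L i).map (linearPart Λ).subtype) =
      (center (GL K V)).subgroupOf _ := by
  have hmin : ∀ i, IsMinimalAboveCenter (L i) := fun i => hL.le ⟨i, rfl⟩; ext x
  rw [mem_subgroupOf]
  refine ⟨fun hx => ?_, fun hx => mem_center_iff.2 fun y => Subtype.ext (mem_center_iff.1 hx y)⟩
  refine mem_center_of_commute_iSup (hΛ.groupAlg_iSup_eq_top hL) fun j m hm => ?_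
  by_cases hij : i = j
  · subst hij; exact congrArg Subtype.val (mem_center_iff.1 hx ⟨m, hm⟩)
  · obtain ⟨m, hm, rfl⟩ := hm; obtain ⟨x, x', hx', rfl⟩ := x
    have h1 := commutator_mem_commutator hm hx'
    rw [hΛ.commutator_minimalNormal_eq_bot (hmin j) (hmin i) (hinj.ne (Ne.symm hij)), mem_bot,
      commutatorElement_eq_one_iff_mul_comm] at h1
    exact congrArg Subtype.val h1

/-- The minimal normal subgroups which are abelian modulo the centre. -/
theorem exists_isExtraspecial_minimalNormal {D : TensorDecomposition K V (Fin t)}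
    (hD : D.IsRealisedBy (fun i => (L i).map (linearPart Λ).subtype)) {i : Fin t}
    {M C : Subgroup (GL K V)} (hM : M = (L i).map (linearPart Λ).subtype) (hC : C = center (GL K V))
    (hab : ⁅M, M⁆ ≤ C) : ∃ (r l : ℕ) (R : Subgroup (GL K V)), r.Prime ∧ R ≤ M ∧ M = C ⊔ R ∧
      IsExtraspecial r R ∧ Nat.card R = r ^ (2 * l + 1) ∧ Nat.card (M ⧸ C.subgroupOf M) = r ^
      (2 * l) ∧ Module.finrank K (D.W i) = r ^ l := by
  have hmin : IsMinimalAboveCenter (L i) := hL.le ⟨i, rfl⟩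
  have hcH : ∀ {x : linearPart Λ}, x ∈ center (linearPart Λ) ↔ (x : GL K V) ∈ center (GL K V) :=
    hΛ.mem_center_iff_coe stableUnder_linearPart
  have hcM : center M = C.subgroupOf M := by
    subst hM hC; exact hΛ.center_map_minimalNormal hL hinj i
  have hML : ∀ {x}, x ∈ L i → (x : GL K V) ∈ M := fun hx => by
    rw [hM]; exact ⟨_, hx, rfl⟩
  have hab' : ⁅L i, L i⁆ ≤ center (linearPart Λ) := by
    rw [commutator_le]; intro x hx y hy; rw [hcH, ← hC]
    exact hab (commutator_mem_commutator (hML hx) (hML hy))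
  obtain ⟨r, hr, hpow⟩ := hmin.exists_prime (quotient_comm_iff.2 hab')
  have hcC : ∀ {x : M}, x ∈ center M ↔ (x : GL K V) ∈ C := by
    intro x; rw [hcM, mem_subgroupOf]
  have hCM : C ≤ M := by
    rw [hC, ← hΛ.map_center, hM]; exact Subgroup.map_mono hmin.1.2.le
  have hcomm : ∀ x y : M, ⁅x, y⁆ ∈ center M := fun x y =>
    hcC.2 (hab (commutator_mem_commutator x.2 y.2))
  have hpowM : ∀ x : M, x ^ r ∈ center M := by
    rintro ⟨x, hx⟩; obtain ⟨x, hx', rfl⟩ := hM.le hx; refine hcC.2 ?_; rw [hC]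
    exact hcH.1 (hpow x hx')
  have hcyc : IsCyclic (center M) := by
    rw [hC] at hcM; exact isCyclic_center_of_eq hcM
  obtain ⟨R, hsup, hR, hcard⟩ := exists_isExtraspecial hr hcomm hpowM hcyc (by
    by_contra! h
    refine not_le_of_gt hmin.1.2 fun m hm => hcH.2 (hC ▸ hcC.1 (?_ : ⟨m, hML hm⟩ ∈ _))
    exact mem_center_iff.2 fun y => commutatorElement_eq_one_iff_mul_comm.1 (h y _)) (by
    rintro ⟨x, hx⟩
    obtain ⟨z, hz, h⟩ := hΛ.exists_pow_pow_eq_one hr ⟨hmin, hab', hpow⟩ (hM ▸ hx)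
    exact ⟨⟨z, hCM (hC ▸ hz)⟩, hcC.2 (hC ▸ hz), Subtype.ext h⟩)
  -- Representatives of the cosets of the centre are linearly independent and span the algebra of
  -- `M`, which is isomorphic to `End (W i)`.
  have hdim : Nat.card (M ⧸ center M) = Module.finrank K (D.W i) * Module.finrank K (D.W i) := by
    let s : M ⧸ center M → GL K V := fun a => (a.out : M)
    have hs : LinearIndependent K fun a => (s a : End K V) := by
      refine linearIndependent_of_class_two (X := M) ?_ (fun x hx y hy => ?_) (fun x hx h => ?_)
        (fun a => a.out.2) fun a b hab => ?_
      · rw [hM]; exact hΛ.coprime_of_le (map_subtype_le _)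
      · rw [← hC]; exact hcC.1 (hcomm ⟨x, hx⟩ ⟨y, hy⟩)
      · rw [← hC]
        exact hcC.1 (show ⟨x, hx⟩ ∈ center M from mem_center_iff.2 fun y => Subtype.ext (h y y.2))
      · rw [← hC] at hab
        rw [← QuotientGroup.out_eq' a, ← QuotientGroup.out_eq' b, QuotientGroup.eq]
        exact hcC.2 hab
    have hspan : Submodule.span K (Set.range fun a => (s a : End K V)) =
        Subalgebra.toSubmodule (groupAlg M) := by
      rw [groupAlg_toSubmodule]
      refine le_antisymm (Submodule.span_mono ?_) (Submodule.span_le.2 ?_)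
      · rintro _ ⟨a, rfl⟩; exact ⟨s a, a.out.2, rfl⟩
      · rintro _ ⟨x, hx, rfl⟩
        have h1 : ((⟨x, hx⟩ : M) : M ⧸ center M).out⁻¹ * ⟨x, hx⟩ ∈ center M := by
          rw [← QuotientGroup.eq, QuotientGroup.out_eq']
        have h2 := hcC.1 h1; rw [hC] at h2
        obtain ⟨c, hc⟩ := GeneralLinearGroup.exists_smul_one h2
        have h3 : (x : End K V) = (c : K) • (s ((⟨x, hx⟩ : M) : M ⧸ center M) : End K V) := by
          rw [← mul_one (s _ : End K V), ← mul_smul_comm, ← hc, ← Units.val_mul]; congr 1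
          change x = _ * (_⁻¹ * x); rw [mul_inv_cancel_left]
        change (x : End K V) ∈ _; rw [h3]
        exact Submodule.smul_mem _ _ (Submodule.subset_span ⟨_, rfl⟩)
    obtain ⟨η, hη, hr, -⟩ := hD.exists_algHom i
    have : Fintype (M ⧸ center M) := Fintype.ofFinite _
    rw [Nat.card_eq_fintype_card, ← finrank_span_eq_card hs, hspan, hM, ← hr,
      ← Module.finrank_linearMap K K]
    exact (LinearEquiv.ofInjective η.toLinearMap hη).finrank_eq.symm
  have : Fact r.Prime := ⟨hr⟩
  have hq : IsPGroup r (M ⧸ center M) := by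
    intro a; induction a using QuotientGroup.induction_on with | H x => ?_
    exact ⟨1, by rw [pow_one, ← QuotientGroup.mk_pow, (QuotientGroup.eq_one_iff _).2 (hpowM x)]⟩
  obtain ⟨m, hm⟩ := IsPGroup.iff_card.1 hq
  obtain ⟨l, -, hl⟩ := (Nat.dvd_prime_pow hr).1 (Dvd.intro _ (hdim.symm.trans hm))
  have hml : Nat.card (M ⧸ center M) = r ^ (2 * l) := by rw [hdim, hl, ← pow_add, two_mul]
  refine ⟨r, l, R.map M.subtype, hr, map_subtype_le R, ?_,
    hR.of_mulEquiv (R.equivMapOfInjective _ M.subtype_injective), ?_, hcM ▸ hml, hl⟩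
  · have h1 := congrArg (Subgroup.map M.subtype) hsup
    rw [Subgroup.map_sup, hcM, subgroupOf_map_subtype, inf_eq_left.2 hCM, ← MonoidHom.range_eq_map,
      range_subtype, sup_comm] at h1
    exact h1.symm
  · rw [Nat.card_congr (R.equivMapOfInjective _ M.subtype_injective).symm.toEquiv, hcard, hml,
      pow_succ, mul_comm]

end IsCoprimeSemilinear

/-! ### Permuting tensor factors -/

namespace TensorDecomposition

variable {K : Type} {V : Type v} [Field K] [AddCommGroup V] [Module K V] {n : ℕ}
  (D : TensorDecomposition K V (Fin n))

theorem act_apply_tprod (u : ∀ i, GL K (D.W i)) (w : ∀ i, D.W i) : (D.act u : V →ₗ[K] V)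
    (D.equiv.symm (PiTensorProduct.tprod K w)) = D.equiv.symm
      (PiTensorProduct.tprod K fun j => (u j : D.W j →ₗ[K] D.W j) (w j)) := by
  have h1 : (D.act u : V →ₗ[K] V) (D.equiv.symm (PiTensorProduct.tprod K w)) =
      D.equiv.symm (PiTensorProduct.map (fun i => (u i : D.W i →ₗ[K] D.W i))
        (D.equiv (D.equiv.symm (PiTensorProduct.tprod K w)))) := rfl
  rw [h1, LinearEquiv.apply_symm_apply, PiTensorProduct.map_tprod]

theorem ext_tprod {f g : End K V} (h : ∀ w : ∀ i, D.W i, f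
    (D.equiv.symm (PiTensorProduct.tprod K w)) = g (D.equiv.symm (PiTensorProduct.tprod K w))) : f =
    g := by
  have h1 : f ∘ₗ D.equiv.symm.toLinearMap = g ∘ₗ D.equiv.symm.toLinearMap :=
    PiTensorProduct.ext (MultilinearMap.ext h)
  refine LinearMap.ext fun v => ?_; have h2 := LinearMap.congr_fun h1 (D.equiv v)
  simpa using h2

namespace IsRealisedBy

variable {D} {M : Fin n → Subgroup (GL K V)} (hD : D.IsRealisedBy M)

include hD

theorem emb_mem_center_iff [Finite K] [FiniteDimensional K V] {i : Fin n} {u : GL K (D.W i)} : D.emb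
    i u ∈ center (GL K V) ↔ u ∈ center (GL K (D.W i)) := by
  constructor
  · intro h; refine mem_center_iff.2 fun y => hD.emb_injective i ?_; rw [map_mul, map_mul]
    exact mem_center_iff.1 h _
  · intro h; have := hD.nontrivial i; obtain ⟨η, -, -, he⟩ := hD.exists_algHom i
    obtain ⟨c, hc⟩ := GeneralLinearGroup.exists_smul_one h
    refine mem_center_iff.2 fun y => Units.ext ?_
    rw [Units.val_mul, Units.val_mul, he, hc, map_smul, map_one, mul_smul_comm, smul_mul_assoc,
      mul_one, one_mul]

/-- A transformation which permutes the groups `M i` permutes the tensor factors. -/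
theorem permutes [Finite K] [FiniteDimensional K V] [NeZero n] (htop : groupAlg (⨆ i, M i) = ⊤)
    {h : GL K V} {π : Equiv.Perm (Fin n)}
    (hπ : ∀ j, (M j).map (MulAut.conj h).toMonoidHom = M (π j)) : D.Permutes π h := by
  choose η hη hr he using hD.exists_algHom
  have hnt := hD.nontrivial; have hex : ∀ j, ∃ T : D.W (π⁻¹ j) ≃ₗ[K] D.W j, ∀ x,
      h * D.emb (π⁻¹ j) x * h⁻¹ = D.emb j (LinearMap.GeneralLinearGroup.congrLinearEquiv T x) := by
    intro j; let c : End K V ≃ₐ[K] End K V := h.toLinearEquiv.conjAlgEquiv K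
    have hcr : (c.toAlgHom.comp (η (π⁻¹ j))).range = (η j).range := by
      have h1 := hπ (π⁻¹ j)
      rw [← Equiv.Perm.mul_apply, mul_inv_cancel, Equiv.Perm.one_apply] at h1
      rw [AlgHom.range_comp, hr, hr, groupAlg, AlgHom.map_adjoin, ← h1, groupAlg]; congr 1
      ext f; constructor
      · rintro ⟨_, ⟨x, hx, rfl⟩, rfl⟩; exact ⟨_, ⟨x, hx, rfl⟩, rfl⟩
      · rintro ⟨_, ⟨x, hx, rfl⟩, rfl⟩; exact ⟨_, ⟨x, hx, rfl⟩, rfl⟩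
    obtain ⟨T, hT⟩ := exists_linearEquiv_of_range_eq (c.toAlgHom.comp (η (π⁻¹ j))) (η j)
      (c.injective.comp (hη _)) (hη j) hcr
    refine ⟨T, fun u => Units.ext ?_⟩; rw [he, Units.val_mul, Units.val_mul, he]
    exact hT u
  choose T hT using hex
  -- The map `e` permutes the tensor factors and applies the isomorphisms `T` supplied by
  -- Skolem–Noether. It induces the same conjugation as `h` on every factor, so the two differ by a
  -- scalar.
  let e : V ≃ₗ[K] V := ((D.equiv.trans (PiTensorProduct.reindex K D.W π)).trans
    (PiTensorProduct.congr (t := D.W) T)).trans D.equiv.symm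
  have hew : ∀ w : ∀ i, D.W i, e (D.equiv.symm (PiTensorProduct.tprod K w)) =
      D.equiv.symm (PiTensorProduct.tprod K fun j => T j (w (π⁻¹ j))) := by
    intro w
    change D.equiv.symm (PiTensorProduct.congr (t := D.W) T (PiTensorProduct.reindex K D.W π
      (D.equiv (D.equiv.symm (PiTensorProduct.tprod K w))))) = _
    rw [LinearEquiv.apply_symm_apply, PiTensorProduct.reindex_tprod]; congr 1
    exact PiTensorProduct.congr_tprod T _
  let g := LinearMap.GeneralLinearGroup.ofLinearEquiv e
  have hact : ∀ u : ∀ i, GL K (D.W i), g * D.act u =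
      D.act (fun j => LinearMap.GeneralLinearGroup.congrLinearEquiv (T j) (u (π⁻¹ j))) * g := by
    intro u; refine Units.ext (D.ext_tprod fun w => ?_)
    change e ((D.act u : V →ₗ[K] V) (D.equiv.symm (PiTensorProduct.tprod K w))) =
      (D.act _ : V →ₗ[K] V) (e (D.equiv.symm (PiTensorProduct.tprod K w)))
    rw [act_apply_tprod, hew, hew, act_apply_tprod]; congr 2; ext1 j
    change _ = T j ((u (π⁻¹ j) : D.W _ →ₗ[K] D.W _) ((T j).symm (T j (w (π⁻¹ j)))))
    rw [LinearEquiv.symm_apply_apply]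
  have hg : ∀ i x, g * D.emb i x * g⁻¹ = h * D.emb i x * h⁻¹ := by
    intro i x; obtain ⟨j, rfl⟩ : ∃ j, π⁻¹ j = i := ⟨π i, π.symm_apply_apply i⟩
    rw [hT, D.emb_apply, hact, mul_inv_cancel_right, emb_apply]; congr 1; ext1 j'
    by_cases hj : j' = j
    · subst hj; simp
    · rw [Pi.mulSingle_eq_of_ne hj, Pi.mulSingle_eq_of_ne (π⁻¹.injective.ne hj), map_one]
  have hz : g⁻¹ * h ∈ center (GL K V) := by
    refine mem_center_of_commute_iSup htop fun i m hm => ?_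
    obtain ⟨x, rfl⟩ := hD.exists_emb_eq (coe_mem_groupAlg hm); have h1 := hg i x
    rw [mul_inv_eq_iff_eq_mul] at h1
    calc D.emb i x * (g⁻¹ * h) = g⁻¹ * (g * D.emb i x) * g⁻¹ * h := by group
      _ = g⁻¹ * h * D.emb i x := by rw [h1]; group
  have : Nontrivial V := by
    obtain ⟨x, y, hxy⟩ := exists_pair_ne (End K (D.W 0)); by_contra hV
    have := not_nontrivial_iff_subsingleton.1 hV
    exact hxy (hη 0 (LinearMap.ext fun v => Subsingleton.elim _ _))
  obtain ⟨c, hc⟩ := GeneralLinearGroup.exists_smul_one hz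
  have hh : ∀ v, (h : V →ₗ[K] V) v = (c : K) • e v := by
    intro v; have h1 : h = g * (g⁻¹ * h) := by group
    have h2 : (h : End K V) = g * ((g⁻¹ * h : GL K V) : End K V) := by rw [← Units.val_mul, ← h1]
    rw [hc, mul_smul_comm, mul_one] at h2; exact LinearMap.congr_fun h2 v
  -- The remaining scalar is absorbed into the isomorphism of one factor, which requires at least
  -- one factor.
  refine ⟨Function.update T 0 ((LinearEquiv.smulOfUnit c).trans (T 0)), fun w => ?_⟩
  rw [hh, hew, map_smul, LinearEquiv.apply_symm_apply]
  rw [← Function.update_eq_self 0 fun j => T j (w (π⁻¹ j)), ← MultilinearMap.map_update_smul]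
  congr 1; ext1 j; by_cases hj : j = 0
  · subst hj; rw [Function.update_self, Function.update_self]
    exact (map_smul (T 0) (c : K) _).symm
  · rw [Function.update_of_ne hj, Function.update_of_ne hj]

end IsRealisedBy

end TensorDecomposition

/-! ### The nonabelian case -/

section NonabelianFactor

variable {K : Type} {W : Type v} [Field K] [Finite K] [AddCommGroup W] [Module K W]
  [FiniteDimensional K W] [Nontrivial W]

/-- A family of distinct subgroups which are permuted by conjugation. -/
theorem exists_perm_of_conj {Γ : Type*} [Group Γ] {s : ℕ} {P : Fin s → Subgroup Γ}
    (hP : Injective P) {H : Subgroup Γ}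
    (h : ∀ g ∈ H, ∀ j, ∃ j', (P j).map (MulAut.conj g).toMonoidHom = P j') : ∃ π : H →* Equiv.Perm
    (Fin s), ∀ (g : H) j, (P j).map (MulAut.conj (g : Γ)).toMonoidHom = P (π g j) := by
  choose p hp using fun (g : H) j => h g g.2 j
  refine ⟨MonoidHom.toHomPerm
    { toFun := p
      map_one' := funext fun j => hP ?_
      map_mul' := fun g g' => funext fun j => hP ?_ }, fun g j => hp g j⟩
  · rw [← hp]; change (P j).map (MulAut.conj (1 : Γ)).toMonoidHom = P j; rw [map_one]
    exact Subgroup.map_id _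
  · rw [← hp]
    change (P j).map (MulAut.conj ((g : Γ) * g')).toMonoidHom = P (p g (p g' j))
    rw [← hp, ← hp, Subgroup.map_map, map_mul]; rfl

/-- Isomorphic groups have isomorphic derived groups. -/
theorem nonempty_commutator_mulEquiv {X Y : Type*} [Group X] [Group Y] (e : X ≃* Y) : Nonempty
    (_root_.commutator X ≃* _root_.commutator Y) := by
  have h : (_root_.commutator X).map e.toMonoidHom = _root_.commutator Y := by
    rw [_root_.map_commutator_eq, MonoidHom.range_eq_top.2 e.surjective]; rfl
  exact ⟨((_root_.commutator X).equivMapOfInjective e.toMonoidHom e.injective).trans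
    (MulEquiv.subgroupCongr h)⟩

/-- A linear group which is a direct power of a nonabelian simple group modulo the scalars. -/
theorem exists_tensorDecomposition_of_pi {N H Z : Subgroup (GL K W)}
    (hcop : (Nat.card N).Coprime (Nat.card K)) (htop : groupAlg N = ⊤) (hZ : Z = center (GL K W))
    (hN : IsMinimalNormalAbove H Z N) {s : ℕ} {T : Type} [Group T] (hTs : IsSimpleGroup T)
    (hT : ¬ ∀ x y : T, x * y = y * x) {f : N →* (Fin s → T)} (hf : Surjective f)
    (hker : f.ker = Z.subgroupOf N) : ∃ (E : TensorDecomposition K W (Fin s))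
      (S P : ∀ j, Subgroup (GL K (E.W j))),
      (∀ j, IsQuasisimple (S j) ∧ IsAbsolutelyIrreducible (S j)) ∧ (∀ j j', Nonempty (S j ≃* S j'))
      ∧ (∀ j, P j = S j ⊔ Subgroup.center (GL K (E.W j))) ∧ N = E.tensor P ∧ ∃ π : H →* Equiv.Perm
      (Fin s), (∀ h : H, E.Permutes (π h) h ∧ ∀ j, (E.factor j (P j)).map
            (MulAut.conj (h : GL K W)).toMonoidHom = E.factor (π h j) (P (π h j))) ∧ ∀ j j', ∃ h :
        H, π h j = j' := by
  obtain ⟨⟨hZN, hNH, hnorm⟩, hmin⟩ := hN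
  have hZc : ∀ {x}, x ∈ Z → ∀ y, y * x = x * y := fun hx => mem_center_iff.1 (hZ ▸ hx)
  have hkerc : f.ker ≤ center N := fun x hx => mem_center_iff.2 fun y => by
    rw [hker] at hx; exact Subtype.ext (hZc hx y)
  -- The preimages of the simple factors commute pairwise and generate `N`, so they span `End W` and
  -- provide the tensor decomposition.
  let Q : Fin s → Subgroup (GL K W) := fun j => (factorSubgroup f j).map N.subtype
  have hQN : ∀ j, Q j ≤ N := fun j => map_subtype_le _
  have hkerm : f.ker.map N.subtype = Z := by rw [hker, subgroupOf_map_subtype, inf_eq_left.2 hZN.le]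
  have hZQ : ∀ j, Z < Q j := fun j => by
    rw [← hkerm]
    exact (map_lt_map_iff_of_injective N.subtype_injective).2 (ker_lt_factorSubgroup hf j)
  have hQinj : Injective Q := fun i j hij =>
    eq_of_factorSubgroup_le hf (Subgroup.map_injective N.subtype_injective hij).le
  -- For `s = 0` the group `N` would be its own scalar subgroup.
  have hs : NeZero s := ⟨by
    rintro rfl; refine not_le_of_gt hZN fun x hx => ?_
    have h1 : (⟨x, hx⟩ : N) ∈ f.ker := Subsingleton.elim _ _; rwa [hker] at h1⟩
  have hQcomm : ∀ i j, i ≠ j → ∀ x ∈ Q i, ∀ y ∈ Q j, x * y = y * x := by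
    rintro i j hij _ ⟨x, hx, rfl⟩ _ ⟨y, hy, rfl⟩
    have h1 := commutator_mem_commutator hx hy
    rw [commutator_factorSubgroup_eq_bot hf hkerc hT hij, mem_bot,
      commutatorElement_eq_one_iff_mul_comm] at h1
    exact congrArg Subtype.val h1
  have hsup : N = ⨆ j, Q j := by
    refine le_antisymm ?_ (iSup_le hQN)
    have h1 := congrArg (Subgroup.map N.subtype) (ker_sup_iSup_factorSubgroup hf)
    rw [Subgroup.map_sup, Subgroup.map_iSup, hkerm, ← MonoidHom.range_eq_map, range_subtype] at h1
    rw [← h1]; exact sup_le ((hZQ 0).le.trans (le_iSup Q 0)) le_rfl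
  have hQtop : groupAlg (⨆ j, Q j) = ⊤ := hsup ▸ htop
  obtain ⟨E, hE⟩ := exists_isRealisedBy
    (fun j => Nat.Coprime.coprime_dvd_left (Subgroup.card_dvd_of_le (hQN j)) hcop) hQcomm hQtop
  have hnt := hE.nontrivial
  let P : ∀ j, Subgroup (GL K (E.W j)) := fun j => (Q j).comap (E.emb j)
  have hPQ : ∀ j, E.factor j (P j) = Q j := fun j => hE.map_comap_emb le_rfl
  let e : ∀ j, P j ≃* factorSubgroup f j := fun j =>
    ((P j).equivMapOfInjective (E.emb j) (hE.emb_injective j)).trans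
      ((MulEquiv.subgroupCongr (hPQ j)).trans
        ((factorSubgroup f j).equivMapOfInjective N.subtype N.subtype_injective).symm)
  let g : ∀ j, P j →* T := fun j => (factorHom f j).comp (e j).toMonoidHom
  have hg : ∀ j, Surjective (g j) := fun j => (factorHom_surjective hf j).comp (e j).surjective
  have hgk : ∀ j, (g j).ker ≤ center (P j) := fun j x hx => by
    have h1 : e j x ∈ center (factorSubgroup f j) := ker_factorHom_le_center hkerc j hx
    have h2 := (centerCongr (e j).symm ⟨_, h1⟩).2
    change (e j).symm (e j x) ∈ center (P j) at h2; rwa [MulEquiv.symm_apply_apply] at h2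
  -- The quasisimple group is the derived group of `P j`, which is a central extension of `T`.
  let S : ∀ j, Subgroup (GL K (E.W j)) := fun j => (_root_.commutator (P j)).map (P j).subtype
  let eS : ∀ j, _root_.commutator (P j) ≃* S j := fun j =>
    (_root_.commutator (P j)).equivMapOfInjective (P j).subtype (P j).subtype_injective
  have hPtop : ∀ j, groupAlg (P j) = ⊤ := fun j => hE.groupAlg_comap_emb j
  have hPc : ∀ j, (center (P j)).map (P j).subtype ≤ center (GL K (E.W j)) := by
    rintro j _ ⟨x, hx, rfl⟩; exact mem_center_of_commute_groupAlg (hPtop j) fun y hy =>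
      congrArg Subtype.val (mem_center_iff.1 hx ⟨y, hy⟩)
  have hPS : ∀ j, P j = S j ⊔ center (GL K (E.W j)) := by
    intro j; refine le_antisymm ?_ (sup_le (map_subtype_le _) fun x hx => ?_)
    · have h1 := congrArg (Subgroup.map (P j).subtype) (center_sup_commutator (hg j) (hgk j) hT)
      rw [Subgroup.map_sup, ← MonoidHom.range_eq_map, range_subtype] at h1; rw [sup_comm]
      exact h1.ge.trans (sup_le_sup_right (hPc j) _)
    · refine (hZQ j).le ?_; rw [hZ]; exact hE.emb_mem_center_iff.2 hx
  have hconj : ∀ h ∈ H, ∀ j, ∃ j', (Q j).map (MulAut.conj h).toMonoidHom = Q j' := by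
    intro h hh j; let φ : N ≃* N :=
      { toFun := fun x => ⟨h * x * h⁻¹, hnorm h hh x x.2⟩
        invFun := fun x => ⟨h⁻¹ * x * h, by simpa using hnorm h⁻¹ (inv_mem hh) x x.2⟩
        left_inv := fun x => Subtype.ext (by simp [mul_assoc])
        right_inv := fun x => Subtype.ext (by simp [mul_assoc])
        map_mul' := fun x y => Subtype.ext (by simp [mul_assoc]) }
    have hφ : f.ker.map φ.toMonoidHom = f.ker := by
      have hφ' : ∀ x ∈ f.ker, φ x = x := fun x hx => Subtype.ext (by
        rw [hker] at hx; change h * x * h⁻¹ = x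
        rw [show h * (x : GL K W) = x * h from hZc hx h, mul_inv_cancel_right])
      ext x; refine ⟨?_, fun hx => ⟨x, hx, hφ' x hx⟩⟩; rintro ⟨x, hx, rfl⟩; change φ x ∈ _
      rwa [hφ' x hx]
    obtain ⟨j', hj'⟩ := exists_map_factorSubgroup_eq hf hT φ hφ j; refine ⟨j', ?_⟩
    change _ = (factorSubgroup f j').map N.subtype
    rw [← hj', Subgroup.map_map, Subgroup.map_map]; rfl
  obtain ⟨π, hπ⟩ := exists_perm_of_conj hQinj hconj
  have htrans : ∀ j j', ∃ h : H, π h j = j' := by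
    -- The join of an orbit is normalised by `H` and hence contains `N` by minimality. A factor
    -- outside the orbit would commute with this join, so it would be scalar.
    intro j j'; by_contra! hne; let X := ⨆ h : H, Q (π h j)
    have hjX : Q j ≤ X := by
      refine le_iSup_of_le 1 ?_; rw [map_one]; rfl
    have hNX : N ≤ X := by
      refine hmin ⟨(hZQ j).trans_le hjX, (iSup_le fun _ => hQN _).trans hNH, ?_⟩
        (iSup_le fun _ => hQN _)
      intro h hh x hx
      have h1 : X.map (MulAut.conj h).toMonoidHom ≤ X := by
        rw [Subgroup.map_iSup]; refine iSup_le fun k => le_iSup_of_le (⟨h, hh⟩ * k) ?_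
        rw [map_mul]; exact (hπ ⟨h, hh⟩ (π k j)).le
      exact h1 ⟨x, hx, rfl⟩
    refine not_le_of_gt (hZQ j') fun x hx => ?_; rw [hZ]
    have h2 : N ≤ centralizer {x} := by
      refine hNX.trans (iSup_le fun h y hy => ?_)
      exact mem_centralizer_singleton_iff.2 (hQcomm _ _ (hne h) y hy x hx)
    exact mem_center_of_commute_groupAlg htop fun y hy => mem_centralizer_singleton_iff.1 (h2 hy)
  refine ⟨E, S, P, fun j => ⟨(isQuasisimple_commutator (hg j) (hgk j) hT).of_mulEquiv (eS j), ?_⟩,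
    fun j j' => ?_, hPS, ?_, π, fun h => ⟨hE.permutes hQtop (hπ h), fun j => ?_⟩, htrans⟩
  · refine isAbsolutelyIrreducible_of_groupAlg_eq_top
      (groupAlg_eq_top_of_le_center_sup (hPtop j) ?_)
    rw [sup_comm, ← hPS]
  · obtain ⟨h, hh⟩ := htrans j j'
    have h1 : P j ≃* P j' := (((P j).equivMapOfInjective (E.emb j) (hE.emb_injective j)).trans
      (MulEquiv.subgroupCongr (hPQ j))).trans
      ((((Q j).equivMapOfInjective _ (MulAut.conj (h : GL K W)).injective).trans
        (MulEquiv.subgroupCongr ((hπ h j).trans (hh ▸ rfl)))).trans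
      (((P j').equivMapOfInjective (E.emb j') (hE.emb_injective j')).trans
      (MulEquiv.subgroupCongr (hPQ j'))).symm)
    obtain ⟨k⟩ := nonempty_commutator_mulEquiv h1
    exact ⟨((eS j).symm.trans k).trans (eS j')⟩
  · rw [E.tensor_eq_iSup, iSup_congr hPQ, ← hsup]
  · rw [hPQ, hPQ]; exact hπ h j

end NonabelianFactor

/-! ### Restriction to a tensor factor and assembly of the theorem -/

theorem exists_normal_generalisedFitting_eq {Q : Type*} [Group Q] [Finite Q]
    (hQ : CharAbelianCentral Q) (hcyc : IsCyclic (center Q)) {Z : Subgroup Q} (hZ : Z = center Q) :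
    ∃ _ : Z.Normal, generalisedFitting Q = (socle (Q ⧸ Z)).comap (QuotientGroup.mk' Z) := by
  subst hZ
  exact ⟨inferInstance, by
    rw [generalisedFitting_eq_socleAboveCenter hQ hcyc, socle_comap_eq_socleAboveCenter]⟩

namespace TensorDecomposition.IsRealisedBy

variable {K : Type} {V : Type v} [Field K] [Finite K] [AddCommGroup V] [Module K V]
  [FiniteDimensional K V] {n : ℕ} {D : TensorDecomposition K V (Fin n)}
  {M : Fin n → Subgroup (GL K V)} (hD : D.IsRealisedBy M)

include hD

/-- The minimal normal subgroups above the centre remain minimal on their tensor factors. -/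
theorem isMinimalNormalAbove_comap {H C : Subgroup (GL K V)} (hC : C = center (GL K V))
    (hH : ∀ h ∈ H, ∃ z ∈ center (GL K V), ∃ u, (∀ i, D.emb i (u i) ∈ H) ∧ h = z * D.act
      u) {i : Fin n} (hM : IsMinimalNormalAbove H C (M i)) : IsMinimalNormalAbove
    (H.comap (D.emb i)) (center (GL K (D.W i))) ((M i).comap (D.emb i)) := by
  obtain ⟨⟨hCM, hMH, hn⟩, hmin⟩ := hM
  have hc : ∀ {u}, u ∈ center (GL K (D.W i)) ↔ D.emb i u ∈ C := by
    intro u; rw [hC, hD.emb_mem_center_iff]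
  have hlt : ∀ X ≤ (M i).comap (D.emb i), (center _ < X ↔ C < X.map (D.emb i)) := by
    intro X hX
    have h1 : (center _).map (D.emb i) = C := by
      refine le_antisymm ?_ fun x hx => ?_
      · rintro _ ⟨u, hu, rfl⟩; exact hc.1 hu
      · obtain ⟨u, rfl⟩ := hD.exists_emb_eq (coe_mem_groupAlg (hCM.le hx))
        exact ⟨u, hc.2 hx, rfl⟩
    rw [← h1, map_lt_map_iff_of_injective (hD.emb_injective i)]
  refine ⟨⟨?_, comap_mono hMH, fun g hg x hx => ?_⟩, fun X ⟨hX, hXH, hXn⟩ hXM => ?_⟩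
  · rw [hlt _ le_rfl, ← D.factor_eq_map, hD.map_comap_emb le_rfl]; exact hCM
  · rw [mem_comap, map_mul, map_mul, map_inv]; exact hn _ hg _ hx
  · have h1 : M i ≤ X.map (D.emb i) := by
      refine hmin ⟨(hlt X hXM).1 hX, (map_le_iff_le_comap.2 hXH), ?_⟩ (map_le_iff_le_comap.2 hXM)
      rintro h hh _ ⟨x, hx, rfl⟩; obtain ⟨z, hz, u, hu, rfl⟩ := hH h hh
      refine ⟨u i * x * (u i)⁻¹, hXn _ (hu i) _ hx, ?_⟩; rw [← D.act_conj_emb]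
      have h2 := mem_center_iff.1 hz (D.act u * D.emb i x * (D.act u)⁻¹)
      rw [mul_inv_rev, ← mul_assoc, mul_assoc z, mul_assoc z, ← h2, mul_inv_cancel_right]
    intro u hu; obtain ⟨x, hx, hxu⟩ := h1 hu; rwa [← hD.emb_injective i hxu]

/-- The homomorphism induced on a tensor factor. -/
theorem exists_hom_comap {C : Subgroup (GL K V)} (hC : C = center (GL K V)) {i : Fin n} {Y : Type*}
    [Group Y] [(C.subgroupOf (M i)).Normal] (e : (M i ⧸ C.subgroupOf (M i)) ≃* Y) : ∃ f :
    (M i).comap (D.emb i) →* Y, Surjective f ∧ f.ker = (center (GL K (D.W i))).subgroupOf _ := by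
  refine ⟨(e.toMonoidHom.comp (QuotientGroup.mk' _)).comp ((D.emb i).subgroupComap (M i)), ?_, ?_⟩
  · refine (e.surjective.comp (QuotientGroup.mk'_surjective _)).comp ?_; rintro ⟨x, hx⟩
    obtain ⟨u, rfl⟩ := hD.exists_emb_eq (coe_mem_groupAlg hx); exact ⟨⟨u, hx⟩, rfl⟩
  · ext x; rw [mem_subgroupOf, ← hD.emb_mem_center_iff, ← hC, MonoidHom.mem_ker]
    change e (QuotientGroup.mk' _ ((D.emb i).subgroupComap (M i) x)) = 1 ↔ _
    rw [map_eq_one_iff e e.injective]; exact QuotientGroup.eq_one_iff _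

end TensorDecomposition.IsRealisedBy

theorem quotient_subgroupOf_map_comm_or_pi {Γ : Type*} [Group Γ] {H C M : Subgroup Γ} [Finite H]
    (hc : center H = C.subgroupOf H) [(C.subgroupOf M).Normal] {L : Subgroup H}
    (hL : IsMinimalAboveCenter L) (hM : M = L.map H.subtype) :
    (∀ x y : M ⧸ C.subgroupOf M, x * y = y * x) ∨ ∃ (s : ℕ) (T : Type)
      (_ : Group T), IsSimpleGroup T ∧ (¬ ∀ x y : T, x * y = y * x) ∧ Nonempty
        ((M ⧸ C.subgroupOf M) ≃* (Fin s → T)) := by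
  let e : L ≃* M := (L.equivMapOfInjective H.subtype H.subtype_injective).trans
    (MulEquiv.subgroupCongr hM.symm)
  have he : ((center H).subgroupOf L).map e.toMonoidHom = C.subgroupOf M := by
    rw [hc]; ext x; constructor
    · rintro ⟨y, hy, rfl⟩; exact hy
    · intro hx; refine ⟨e.symm x, ?_, e.apply_symm_apply x⟩
      have h1 : ((e.symm x : L) : Γ) = e (e.symm x) := rfl
      change ((e.symm x : L) : Γ) ∈ C; rw [h1, e.apply_symm_apply]; exact hx
  let k : (L ⧸ (center H).subgroupOf L) ≃* (M ⧸ C.subgroupOf M) := QuotientGroup.congr _ _ e he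
  rcases hL.comm_or_pi with h | ⟨s, T, hTg, hT, hna, ⟨k'⟩⟩
  · left; intro x y; have h1 := congrArg k (h (k.symm x) (k.symm y))
    rwa [map_mul, map_mul, k.apply_symm_apply, k.apply_symm_apply] at h1
  · exact Or.inr ⟨s, T, hTg, hT, hna, ⟨k.symm.trans k'⟩⟩

theorem theorem4p1 {F : Type u} {V : Type v} [Field F] [Finite F] [AddCommGroup V] [Module F V]
    [FiniteDimensional F V] (G : Subgroup (LinearMap.GeneralLinearGroup F V))
    (hprim : IsPrimitiveLinear G)
    (hmax : Maximal (fun L : Subgroup (LinearMap.GeneralLinearGroup F V) => IsCoprimeLinear L) G) :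
    -- (1) the unique maximal abelian subgroup normalised by `G`
    ∃ Z : Subgroup (LinearMap.GeneralLinearGroup F V), Maximal (IsAbelianNormalisedBy G) Z ∧
      (∀ Z', Maximal (IsAbelianNormalisedBy G) Z' → Z' = Z) ∧
      Z ≤ G ∧
      -- (2) `Z` is cyclic, and `Z ∪ {0}` is a field `K` with `q ^ k` elements
      IsCyclic Z ∧
      ∃ k : ℕ, k ∣ Module.finrank F V ∧
      ∃ (K : Type) (_ : Field K) (_ : Algebra F K) (_ : Module K V) (_ : IsScalarTower F K V),
        Nat.card K = Nat.card F ^ k ∧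
        Set.range (fun a : K => (Algebra.lsmul F F V a : Module.End F V)) =
          insert 0 ((fun z : LinearMap.GeneralLinearGroup F V => (z : Module.End F V)) '' Z) ∧
        -- (3) the unique and maximal vector space structure for which `G` is semilinear
        Module.finrank K V = Module.finrank F V / k ∧
        G ≤ semilinearGroup F K V ∧
        (∀ (L : Type) [Field L] [Algebra F L] [Module L V] [IsScalarTower F L V],
          G ≤ semilinearGroup F L V → ∃ j : L →ₐ[F] K, (∀ (a : L) (v : V), j a • v = a • v) ∧
              (Nat.card L = Nat.card F ^ k → Function.Bijective j)) ∧
        -- (4) the subgroup `G ∩ GL(d, q ^ k)`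
        Z ≤ G ⊓ (restrictGL F K V).range ∧
        G ⊓ (restrictGL F K V).range = G ⊓ Subgroup.centralizer Z ∧
        NormalisedBy G (G ⊓ (restrictGL F K V).range) ∧
        Z = (Subgroup.center (LinearMap.GeneralLinearGroup K V)).map (restrictGL F K V) ∧
        (∀ z : LinearMap.GeneralLinearGroup F V,
          z ∈ Z ↔ ∃ a : Kˣ, ∀ v : V, (z : V →ₗ[F] V) v = (a : K) • v) ∧
        (∃ σ : G →* (K ≃ₐ[F] K), (∀ (g : G) (a : K) (v : V),
            ((g : LinearMap.GeneralLinearGroup F V) : V →ₗ[F] V) (a • v) =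
              σ g a • ((g : LinearMap.GeneralLinearGroup F V) : V →ₗ[F] V) v) ∧
          σ.ker = (G ⊓ (restrictGL F K V).range).subgroupOf G) ∧
        -- from here on, `H` and the scalar group `C` (that is, `Z`) are subgroups of `GL(d, q ^ k)`
        ∃ H C N : Subgroup (LinearMap.GeneralLinearGroup K V), H = G.comap (restrictGL F K V) ∧
          C = Subgroup.center (LinearMap.GeneralLinearGroup K V) ∧
          N = (generalisedFitting H).map H.subtype ∧
          -- (5) `N / Z` is the socle of `H / Z`, and `N` is absolutely irreducible
          (∃ _ : (C.subgroupOf H).Normal, generalisedFitting H =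
              (socle (H ⧸ C.subgroupOf H)).comap (QuotientGroup.mk' (C.subgroupOf H))) ∧
          IsAbsolutelyIrreducible N ∧
          -- (6) the minimal normal subgroups of `H` above `Z`
          ∃ (t : ℕ) (M : Fin t → Subgroup (LinearMap.GeneralLinearGroup K V)),
            Function.Injective M ∧
            Set.range M = {L | IsMinimalNormalAbove H C L} ∧
            ∃ (D : TensorDecomposition K V (Fin t))
              (N' H' : ∀ i, Subgroup (LinearMap.GeneralLinearGroup K (D.W i))),
              (∀ i, IsAbsolutelyIrreducible (N' i) ∧ D.factor i (N' i) = M i ∧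
                N' i ≤ H' i ∧ NormalisedBy (H' i) (N' i)) ∧
              N = C ⊔ D.tensor N' ∧
              H = C ⊔ D.tensor H' ∧
              ∀ i, ∃ _ : (C.subgroupOf (M i)).Normal,
                ((∀ x y : M i ⧸ C.subgroupOf (M i), x * y = y * x) ∨
                  ∃ (s : ℕ) (T : Type) (_ : Group T), IsSimpleGroup T ∧
                    (¬ ∀ x y : T, x * y = y * x) ∧
                    Nonempty ((M i ⧸ C.subgroupOf (M i)) ≃* (Fin s → T))) ∧
                -- (7) the abelian case
                ((∀ x y : M i ⧸ C.subgroupOf (M i), x * y = y * x) →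
                  ∃ (r l : ℕ) (R : Subgroup (LinearMap.GeneralLinearGroup K V)),
                    r.Prime ∧ R ≤ M i ∧ M i = C ⊔ R ∧ IsExtraspecial r R ∧
                    Nat.card R = r ^ (2 * l + 1) ∧
                    Nat.card (M i ⧸ C.subgroupOf (M i)) = r ^ (2 * l) ∧
                    Module.finrank K (D.W i) = r ^ l) ∧
                -- (8) the non-abelian case
                (∀ (s : ℕ) (T : Type) [Group T], IsSimpleGroup T → (¬ ∀ x y : T, x * y = y * x) →
                  Nonempty ((M i ⧸ C.subgroupOf (M i)) ≃* (Fin s → T)) →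
                  ∃ (E : TensorDecomposition K (D.W i) (Fin s))
                    (S P : ∀ j, Subgroup (LinearMap.GeneralLinearGroup K (E.W j))),
                    (∀ j, IsQuasisimple (S j) ∧ IsAbsolutelyIrreducible (S j)) ∧
                    (∀ j j', Nonempty (S j ≃* S j')) ∧
                    (∀ j, P j = S j ⊔ Subgroup.center (LinearMap.GeneralLinearGroup K (E.W j))) ∧
                    N' i = E.tensor P ∧
                    ∃ π : H' i →* Equiv.Perm (Fin s), (∀ h : H' i, E.Permutes (π h) h ∧
                        ∀ j, (E.factor j (P j)).map
                          (MulAut.conj (h : LinearMap.GeneralLinearGroup K (D.W i))).toMonoidHom =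
                            E.factor (π h j) (P (π h j))) ∧
                      ∀ j j', ∃ h : H' i, π h j = j') := by
  have hV := nontrivial_of_isPrimitiveLinear hprim
  obtain ⟨Ω, hc, hs, hZmax, huniq, hZG, hbig⟩ := exists_maximal_abelian hprim hmax
  obtain ⟨K, hKf, hKa, ⟨ε⟩⟩ := exists_field_algEquiv Ω (isField_of_conjStable hprim hc hs)
  let _ : Module K V := Module.compHom V ((Ω.val.comp ε.toAlgHom : K →ₐ[F] End F V) : K →+* End F V)
  have hsm : ∀ (a : K) (v : V), a • v = (ε a : End F V) v := fun _ _ => rfl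
  have hst : IsScalarTower F K V := ⟨fun r a v => by rw [hsm, hsm, map_smul]; rfl⟩
  have hKfin : Finite K := finite_of_isScalarTower F K V
  have hfd : FiniteDimensional K V := Module.Finite.of_restrictScalars_finite F K V
  have hmemC : ∀ x : End F V, x ∈ Ω ↔ ∃ a : K, ∀ v, x v = a • v := by
    intro x; constructor
    · intro hx; exact ⟨ε.symm ⟨x, hx⟩, fun v => by rw [hsm, AlgEquiv.apply_symm_apply]⟩
    · rintro ⟨a, ha⟩; have : x = ε a := LinearMap.ext ha; rw [this]; exact (ε a).2
  have hmemZ : ∀ z : GL F V,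
      z ∈ unitsSubgroup Ω ↔ ∃ a : Kˣ, ∀ v : V, (z : V →ₗ[F] V) v = (a : K) • v := by
    intro z; rw [mem_unitsSubgroup, hmemC]; constructor
    · rintro ⟨a, ha⟩; refine ⟨Units.mk0 a ?_, ha⟩; rintro rfl
      exact z.ne_zero (LinearMap.ext fun v => by rw [ha, zero_smul]; rfl)
    · rintro ⟨a, ha⟩; exact ⟨a, ha⟩
  have hFK : FiniteDimensional F K := Module.Finite.of_surjective
    (ε.symm.toLinearMap) ε.symm.surjective
  have hmul : Module.finrank F K * Module.finrank K V = Module.finrank F V :=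
    Module.finrank_mul_finrank F K V
  have hcardK : Nat.card K = Nat.card F ^ Module.finrank F K := Module.natCard_eq_pow_finrank
  have hsemi : G ≤ semilinearGroup F K V := by
    intro g hg
    have hconj : ∀ x : Ω, (g : End F V) * x * (↑g⁻¹ : End F V) ∈ Ω := fun x => hs g hg x x.2
    have hconj' : ∀ x : Ω, (↑g⁻¹ : End F V) * x * (g : End F V) ∈ Ω :=
      fun x => by simpa using hs g⁻¹ (G.inv_mem hg) x x.2
    let c : Ω ≃+* Ω :=
      { toFun := fun x => ⟨_, hconj x⟩
        invFun := fun x => ⟨_, hconj' x⟩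
        left_inv := fun x => Subtype.ext (by simp [mul_assoc])
        right_inv := fun x => Subtype.ext (by simp [mul_assoc])
        map_mul' := fun x y => Subtype.ext (by simp [mul_assoc])
        map_add' := fun x y => Subtype.ext (by simp [mul_add, add_mul]) }
    refine ⟨(ε.toRingEquiv.trans c).trans ε.symm.toRingEquiv, fun a v => ?_⟩
    rw [hsm, hsm]
    have : (ε (((ε.toRingEquiv.trans c).trans ε.symm.toRingEquiv) a) : End F V) =
        (g : End F V) * ε a * (↑g⁻¹ : End F V) := by simp [c]
    rw [this]; simp [Module.End.mul_apply, GeneralLinearGroup.inv_apply_apply]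
  have hZrange : unitsSubgroup Ω ≤ (restrictGL F K V).range := by
    intro z hz; obtain ⟨a, ha⟩ := (hmemZ z).1 hz; rw [mem_range_restrictGL_iff]; intro b v
    rw [ha, ha, smul_smul, smul_smul, mul_comm]
  have hunitex : ∀ a : K, a ≠ 0 → ∃ z ∈ unitsSubgroup Ω, ∀ v, (z : V →ₗ[F] V) v = a • v := by
    intro a ha; refine ⟨.ofLinearEquiv
      ((LinearEquiv.smulOfUnit (M := V) (Units.mk0 a ha)).restrictScalars F), ?_, fun v => rfl⟩
    rw [hmemZ]; exact ⟨Units.mk0 a ha, fun v => rfl⟩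
  -- Every commutative `G`-stable algebra lies in the largest one, which acts as `K`.
  have hmain : IsCoprimeSemilinear (semilinearImage F K G) :=
    isCoprimeSemilinear_semilinearImage hprim hmax hsemi fun Ω' hc' hs' x hx =>
      (hmemC x).1 (hbig Ω' hc' hs' hx)
  refine ⟨unitsSubgroup Ω, hZmax, huniq, hZG, ?_, Module.finrank F K, Dvd.intro _ hmul, K, hKf,
    hKa, _, hst, hcardK, ?_, ?_, hsemi, ?_, le_inf hZG hZrange, ?_, ?_, ?_, hmemZ, ?_, ?_⟩
  · let f : unitsSubgroup Ω →* Kˣ := Units.map ε.symm.toMonoidHom |>.comp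
      { toFun := fun z => ⟨⟨(z : GL F V).val, z.2⟩,
            ⟨((z⁻¹ : unitsSubgroup Ω) : GL F V).val, (z⁻¹).2⟩,
            Subtype.ext (by simp), Subtype.ext (by simp)⟩
        map_one' := rfl
        map_mul' := fun _ _ => rfl }
    refine isCyclic_of_injective f fun z w hzw => ?_; have h1 := congrArg Units.val hzw
    have h2 := ε.symm.injective h1
    exact Subtype.ext (Units.ext (congrArg Subtype.val h2))
  · ext x; simp only [Set.mem_range, Set.mem_insert_iff, Set.mem_image, SetLike.mem_coe]
    constructor
    · rintro ⟨a, rfl⟩; by_cases ha : a = 0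
      · left; rw [ha, map_zero]
      · right; obtain ⟨z, hz, h⟩ := hunitex a ha; exact ⟨z, hz, LinearMap.ext h⟩
    · rintro (rfl | ⟨z, hz, rfl⟩)
      · exact ⟨0, map_zero _⟩
      · obtain ⟨a, ha⟩ := (hmemZ z).1 hz; exact ⟨a, LinearMap.ext fun v => (ha v).symm⟩
  · rw [← hmul, Nat.mul_div_cancel_left _ Module.finrank_pos]
  · intro L _ _ _ _ hGL; have hLfin : Finite L := finite_of_isScalarTower F L V
    have hL : ∀ a : L, ∃ b : K, ∀ v : V, a • v = b • v := by
      intro a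
      -- Semilinearity makes the image of `L` stable under conjugation by `G`, so it lies in the
      -- largest commutative stable algebra.
      have hle : (Algebra.lsmul F F V : L →ₐ[F] End F V).range ≤ Ω := by
        apply hbig
        · rintro _ ⟨a, rfl⟩ _ ⟨b, rfl⟩
          change Algebra.lsmul F F V a * Algebra.lsmul F F V b =
            Algebra.lsmul F F V b * Algebra.lsmul F F V a
          rw [← map_mul, mul_comm, map_mul]
        · rintro g hg _ ⟨a, rfl⟩; obtain ⟨σ, hσ⟩ := hGL hg
          refine ⟨σ a, LinearMap.ext fun v => ?_⟩
          change σ a • v = (g : V →ₗ[F] V) (a • (↑g⁻¹ : V →ₗ[F] V) v)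
          rw [hσ, GeneralLinearGroup.apply_inv_apply]
      obtain ⟨b, hb⟩ := (hmemC _).1 (hle ⟨a, rfl⟩); exact ⟨b, hb⟩
    choose j hj using hL
    obtain ⟨v₀, hv₀⟩ := exists_ne (0 : V); have hinj := smul_left_injective K hv₀
    let J : L →ₐ[F] K :=
      { toFun := j
        map_one' := hinj (by simp only; rw [← hj, one_smul, one_smul])
        map_mul' := fun a b => hinj (by simp only; rw [← hj, mul_smul, mul_smul, hj b, hj a])
        map_zero' := hinj (by simp only; rw [← hj, zero_smul, zero_smul])
        map_add' := fun a b => hinj (by simp only; rw [← hj, add_smul, add_smul, hj b, hj a])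
        commutes' := fun r => hinj (by simp only; rw [← hj, algebraMap_smul, algebraMap_smul]) }
    refine ⟨J, fun a v => (hj a v).symm, fun hcard => ?_⟩
    rw [Nat.bijective_iff_injective_and_card]
    exact ⟨(J : L →+* K).injective, hcard.trans hcardK.symm⟩
  · ext g; rw [Subgroup.mem_inf, Subgroup.mem_inf, and_congr_right_iff]; intro hg
    rw [mem_range_restrictGL_iff, Subgroup.mem_centralizer_iff]; constructor
    · intro h z hz; obtain ⟨a, ha⟩ := (hmemZ z).1 hz; ext v; simp [ha, h]
    · intro h a v; by_cases ha : a = 0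
      · simp [ha]
      · obtain ⟨z, hz, hza⟩ := hunitex a ha
        have := LinearMap.congr_fun (congrArg Units.val (h z hz)) v
        simp only [Units.val_mul, Module.End.mul_apply, hza] at this; exact this.symm
  · rintro g hg x ⟨hx, hx'⟩; refine ⟨G.mul_mem (G.mul_mem hg hx) (G.inv_mem hg), ?_⟩
    obtain ⟨σ, hσ⟩ := hsemi hg; obtain ⟨τ, hτ⟩ := hsemi (G.inv_mem hg)
    replace hx' : x ∈ (restrictGL F K V).range := hx'
    change g * x * g⁻¹ ∈ (restrictGL F K V).range; rw [mem_range_restrictGL_iff] at hx' ⊢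
    intro a v; change (g : V →ₗ[F] V) ((x : V →ₗ[F] V) ((↑g⁻¹ : V →ₗ[F] V) (a • v))) =
      a • (g : V →ₗ[F] V) ((x : V →ₗ[F] V) ((↑g⁻¹ : V →ₗ[F] V) v))
    have h1 : ∀ w, (↑g⁻¹ : V →ₗ[F] V) (a • w) = σ.symm a • (↑g⁻¹ : V →ₗ[F] V) w := by
      intro w
      have h2 : (g : V →ₗ[F] V) (σ.symm a • (↑g⁻¹ : V →ₗ[F] V) w) = a • w := by
        rw [hσ, GeneralLinearGroup.apply_inv_apply, RingEquiv.apply_symm_apply]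
      rw [← h2, GeneralLinearGroup.inv_apply_apply]
    rw [h1, hx', hσ, RingEquiv.apply_symm_apply]
  · ext z; rw [hmemZ]; constructor
    · rintro ⟨a, ha⟩; refine ⟨.ofLinearEquiv (LinearEquiv.smulOfUnit a),
        GeneralLinearGroup.mem_center_iff.2 ⟨a, fun v => rfl⟩, ?_⟩
      ext v; exact (ha v).symm
    · rintro ⟨x, hx, rfl⟩; obtain ⟨a, ha⟩ := GeneralLinearGroup.mem_center_iff.1 hx
      exact ⟨a, ha⟩
  · obtain ⟨σ, hσ⟩ := exists_galoisHom hsemi; refine ⟨σ, hσ, ?_⟩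
    obtain ⟨v₀, hv₀⟩ := exists_ne (0 : V); ext g
    rw [MonoidHom.mem_ker, Subgroup.mem_subgroupOf, Subgroup.mem_inf, mem_range_restrictGL_iff]
    constructor
    · intro h; exact ⟨g.2, fun a v => by rw [hσ, h]; rfl⟩
    · rintro ⟨-, h⟩; ext a
      have h0 : ((g : GL F V) : V →ₗ[F] V) v₀ ≠ 0 := by
        intro h0; apply hv₀
        rw [← GeneralLinearGroup.inv_apply_apply (g : GL F V) v₀, h0, map_zero]
      refine smul_left_injective K h0 ?_; simp only; rw [← hσ, h]; rfl
  · let H := linearPart (semilinearImage F K G)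
    let C := center (GL K V)
    have hst := IsCoprimeSemilinear.stableUnder_linearPart (Λ := semilinearImage F K G)
    have hcH : center H = C.subgroupOf H := hmain.center_eq hst
    have hCH : C ≤ H := hmain.center_le_linearPart
    have hchar := hmain.charAbelianCentral hst
    have hcyc := hmain.isCyclic_center_subgroup hst
    have hgf : generalisedFitting H = socleAboveCenter H :=
      generalisedFitting_eq_socleAboveCenter hchar hcyc
    -- Enumerating the set of minimal normal subgroups itself gives a list without repetition,
    -- possibly empty.
    obtain ⟨t, ⟨e⟩⟩ := Finite.exists_equiv_fin {M : Subgroup H | IsMinimalAboveCenter M}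
    let L : Fin t → Subgroup H := fun i => (e.symm i : Subgroup H)
    have hL : Set.range L = {M | IsMinimalAboveCenter M} := by
      rw [Set.range_comp' Subtype.val, e.symm.range_eq_univ, Set.image_univ, Subtype.range_coe]
    have hinj : Injective L := Subtype.val_injective.comp e.symm.injective
    have hmin : ∀ i, IsMinimalAboveCenter (L i) := fun i => hL.le ⟨i, rfl⟩
    obtain ⟨D, hD, hdec⟩ := hmain.exists_tensorDecomposition hL hinj
    have hnt := hD.nontrivial
    let M : Fin t → Subgroup (GL K V) := fun i => (L i).map H.subtype
    let N' : ∀ i, Subgroup (GL K (D.W i)) := fun i => (M i).comap (D.emb i)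
    -- `H' i` consists of the transformations of the `i`-th factor which lie in `H` when extended
    -- trivially to the other factors; `hdec` says that these components account for all of `H` up
    -- to scalars.
    let H' : ∀ i, Subgroup (GL K (D.W i)) := fun i => H.comap (D.emb i)
    have hMH : ∀ i, M i ≤ H := fun i => map_subtype_le _
    have hMN : ∀ i, D.factor i (N' i) = M i := fun i => hD.map_comap_emb le_rfl
    have hMmin : ∀ i, IsMinimalNormalAbove H C (M i) := fun i =>
      (isMinimalNormalAbove_iff hCH hcH).2 ⟨L i, hmin i, rfl⟩
    have hN'min : ∀ i, IsMinimalNormalAbove (H' i) (center (GL K (D.W i))) (N' i) := fun i =>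
      hD.isMinimalNormalAbove_comap rfl hdec (hMmin i)
    have hN'top : ∀ i, groupAlg (N' i) = ⊤ := fun i => hD.groupAlg_comap_emb i
    have hN : (generalisedFitting H).map H.subtype = C ⊔ ⨆ i, M i := by
      rw [hgf]; exact hmain.map_socleAboveCenter hL
    refine ⟨H, C, _, comap_semilinearImage G, rfl, rfl,
      exists_normal_generalisedFitting_eq hchar hcyc hcH.symm, ?_, t, M,
      (Subgroup.map_injective H.subtype_injective).comp hinj, ?_, D, N', H',
      fun i => ⟨isAbsolutelyIrreducible_of_groupAlg_eq_top (hN'top i), hMN i, (hN'min i).1.2.1,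
        (hN'min i).1.2.2⟩, ?_, ?_, fun i => ?_⟩
    · rw [hgf]
      exact isAbsolutelyIrreducible_of_groupAlg_eq_top hmain.groupAlg_socle_eq_top
    · ext X; rw [Set.mem_setOf_eq, isMinimalNormalAbove_iff hCH hcH]; constructor
      · rintro ⟨i, rfl⟩; exact ⟨L i, hmin i, rfl⟩
      · rintro ⟨Y, hY, rfl⟩; obtain ⟨i, rfl⟩ := hL.ge hY; exact ⟨i, rfl⟩
    · rw [hN, D.tensor_eq_iSup, iSup_congr hMN]
    · refine le_antisymm (fun h hh => ?_) (sup_le hCH ?_)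
      · obtain ⟨z, hz, u, hu, rfl⟩ := hdec h hh
        exact mul_mem_sup hz ⟨u, fun i _ => hu i, rfl⟩
      · rintro _ ⟨u, hu, rfl⟩; exact D.act_mem_of_emb_mem fun i => hu i trivial
    · have hCn : (C.subgroupOf (M i)).Normal := ⟨fun x hx g => by
        rw [mem_subgroupOf] at hx ⊢; exact (inferInstance : C.Normal).conj_mem _ hx g⟩
      refine ⟨hCn, quotient_subgroupOf_map_comm_or_pi hcH (hmin i) rfl, fun hab => ?_,
        fun s T _ hT hna ⟨k⟩ => ?_⟩
      · exact hmain.exists_isExtraspecial_minimalNormal hL hinj hD rfl rfl (quotient_comm_iff.1 hab)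
      · obtain ⟨f, hf, hker⟩ := hD.exists_hom_comap rfl k
        refine exists_tensorDecomposition_of_pi ?_ (hN'top i) rfl (hN'min i) hT hna hf hker
        exact Nat.Coprime.coprime_dvd_left (Subgroup.card_comap_dvd_of_injective _ _
          (hD.emb_injective i)) (hmain.coprime_of_le (hMH i))
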